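/- Let $\mathcal C$ be a small category. Work in the internal language of presheaves over $\mathcal C$, with an interval $\mathbb I$ (end points $0,1$) and an object $\mathbb F$ of cofibrant propositions satisfying the axioms of Orton and Pitts: $\mathbb I$ is connected, $0\neq 1$, $\mathbb I$ has connections, and cofibrant propositions contain $i=0$ and $i=1$ and are closed under $\vee$, dependent conjunction and $\forall (i:\mathbb I)$. Let $\mathcal M$ be a cubical category with families: a category with families $(\mathrm{Con},\mathrm{Subst},\mathrm{Type},\mathrm{Elem})$ internal to presheaves over $\mathcal C$, with dependent products $\Pi$ and dependent sums $\Sigma$ (with $\beta$ and $\eta$ rules), with path types $\mathrm{Path}(A,a_0,a_1)$, whose elements are in bijection with the functions $u:\mathbb I\to \mathrm{Elem}(\Gamma,A)$ with $u\,0=a_0$ and $u\,1=a_1$, and with a filling operation, extending every partial section $\Pi(i:\mathbb I).\,[\phi]\vee(i=b)\to \mathrm{Elem}(\Gamma,A\,i)$ ($A:\mathbb I\to\mathrm{Type}(\Gamma)$, $\phi:\mathbb F$, $b\in\{0,1\}$) to a total one; all operations are stable under substitution (further type formers play no role). We assume that the sets $\mathrm{Subst}(\Delta,\Gamma)$ and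 $\mathrm{Elem}(\Gamma,A)$ are small. Write $|\Gamma|=\mathrm{Subst}(1,\Gamma)$, and $|A|\,\rho=\mathrm{Elem}(1,A\rho)$ for $A:\mathrm{Type}(\Gamma)$ and $\rho:|\Gamma|$; for $f:\mathrm{Elem}(\Gamma,A\to B)$ let $\langle f\rangle\,\rho:|A|\,\rho\to|B|\,\rho$, $\langle f\rangle\,\rho\,a=\mathrm{app}(f\rho,a)$. The sconing $\mathcal M^*$ is the following category with families. A context $(\Gamma,\Gamma')$ is a context $\Gamma$ of $\mathcal M$ with a family $\Gamma'$ of small sets over $|\Gamma|$; a substitution $(\Delta,\Delta')\to(\Gamma,\Gamma')$ is a substitution $\sigma:\Delta\to\Gamma$ with functions $\Delta'\nu\to\Gamma'(\sigma\nu)$ for $\nu:|\Delta|$. A type $(A,A')$ over $(\Gamma,\Gamma')$ is a type $A:\mathrm{Type}(\Gamma)$ with a family $A'\rho\rho'a$ of small sets ($\rho:|\Gamma|$, $\rho':\Gamma'\rho$, $a:|A|\,\rho$) that carries a filling structure, and an element $(a,a')$ of it is an element $a:\mathrm{Elem}(\Gamma,A)$ with $a'\rho\rho':A'\rho\rho'(a\rho)$.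 The type formers of $\mathcal M^*$ are those of $\mathcal M$ on first components and the corresponding products, sums and sets of paths on second components; in particular an element of $(A,A')\to(B,B')$ is a pair $(f,f')$ with $f:\mathrm{Elem}(\Gamma,A\to B)$ and $f'\rho\rho'a:A'\rho\rho'a\to B'\rho\rho'(\langle f\rangle\,\rho\,a)$. For a function $f$ of $\mathcal M$ or of $\mathcal M^*$ let $\mathrm{isEquiv}(f)$, respectively $\mathrm{isEquiv}^*(f)$, be the type of pairs of a homotopy left inverse and a homotopy right inverse of $f$, formed with the type formers of $\mathcal M$, respectively $\mathcal M^*$. For a function $h:X\to Y$ of sets in the internal language, $\mathrm{isEquiv}(h)$ is likewise the set of pairs of a left and a right inverse of $h$ up to homotopies, where a homotopy is a family of functions on $\mathbb I$ with the given end points. **Lemma.** For $(f,f'):\mathrm{Elem}((\Gamma,\Gamma'),(A,A')\to(B,B'))$ in $\mathcal M^*$ the following are logically equivalent, that is, there are maps between any two of them in both directions: 1. $\mathrm{Elem}((\Gamma,\Gamma'),\mathrm{isEquiv}^*(f,f'))$, 2. $\mathrm{Elem}(\Gamma,\mathrm{isEquiv}(f))\times\Pi(\rho:|\Gamma|)(\rho':\Gamma'\rho).\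 \mathrm{isEquiv}(\Sigma_{\langle f\rangle\rho}f'\rho\rho')$, where $\Sigma_{\langle f\rangle\rho}f'\rho\rho':\Sigma(a:|A|\,\rho).A'\rho\rho'a\to\Sigma(b:|B|\,\rho).B'\rho\rho'b$ sends $(a,a')$ to $(\langle f\rangle\,\rho\,a,\ f'\rho\rho'a\,a')$, 3. $\mathrm{Elem}(\Gamma,\mathrm{isEquiv}(f))\times\Pi(\rho:|\Gamma|)(\rho':\Gamma'\rho)(a:|A|\,\rho).\ \mathrm{isEquiv}(f'\rho\rho'a)$. The logical equivalences are natural in $(\Gamma,\Gamma')$: the maps can be chosen, for all contexts, types and functions simultaneously, so that they commute with all substitutions of $\mathcal M^*$ (including restriction along the maps of $\mathcal C$). -/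

import Mathlib

set_option linter.unusedVariables false
set_option linter.checkUnivs false

open CategoryTheory Opposite
universe u v w w' z

namespace Sconing

section Presheaves
variable {E : Type w} [Category.{v} E]

/-- restriction in a presheaf -/
abbrev res (T : Eᵒᵖ ⥤ Type w') {X Y : E} (f : Y ⟶ X) (t : T.obj (op X)) : T.obj (op Y) :=
  T.map f.op t

theorem res_id (T : Eᵒᵖ ⥤ Type w') {X : E} (t : T.obj (op X)) : res T (𝟙 X) t = t := by
  simp [res]

theorem res_res (T : Eᵒᵖ ⥤ Type w') {X Y Z : E} (f : Y ⟶ X) (g : Z ⟶ Y) (t : T.obj (op X)) :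
    res T g (res T f t) = res T (g ≫ f) t := by
  simp [res]

theorem res_trans {T : Eᵒᵖ ⥤ Type w'} {X Y Z : E} {f : Y ⟶ X} {g : Z ⟶ Y} {t : T.obj (op X)}
    {s : T.obj (op Y)} {r : T.obj (op Z)} (h : res T f t = s) (k : res T g s = r) :
    res T (g ≫ f) t = r := by rw [← k, ← h, res_res]

/-- A presheaf from plain functions. -/
def mkPsh (obj : E → Type w') (r : ∀ {X Y : E}, (Y ⟶ X) → obj X → obj Y)
    (r_id : ∀ {X : E} (t : obj X), r (𝟙 X) t = t)
    (r_comp : ∀ {X Y Z : E} (f : Y ⟶ X) (g : Z ⟶ Y) (t : obj X), r g (r f t) = r (g ≫ f) t) :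
    Eᵒᵖ ⥤ Type w' where
  obj X := obj X.unop
  map f := TypeCat.ofHom (r f.unop)
  map_id X := by ext t; exact r_id t
  map_comp f g := by ext t; exact (r_comp f.unop g.unop t).symm

/-- application of a map of presheaves -/
abbrev ap {S T : Eᵒᵖ ⥤ Type w'} (α : S ⟶ T) {X : E} (s : S.obj (op X)) : T.obj (op X) :=
  α.app (op X) s

theorem ap_res {S T : Eᵒᵖ ⥤ Type w'} (α : S ⟶ T) {X Y : E} (f : Y ⟶ X) (s : S.obj (op X)) :
    ap α (res S f s) = res T f (ap α s) := NatTrans.naturality_apply α f.op s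

/-- A map of presheaves from natural plain functions. -/
def mkHom {S T : Eᵒᵖ ⥤ Type w'} (a : ∀ {X : E}, S.obj (op X) → T.obj (op X))
    (nat : ∀ {X Y : E} (f : Y ⟶ X) (s : S.obj (op X)), a (res S f s) = res T f (a s)) : S ⟶ T where
  app X := TypeCat.ofHom (a (X := X.unop))
  naturality X Y f := by ext s; exact nat f.unop s

theorem psh_hom_ext {S T : Eᵒᵖ ⥤ Type w'} {α β : S ⟶ T}
    (h : ∀ {X : E} (s : S.obj (op X)), ap α s = ap β s) : α = β := by
  ext X s; exact h s

/-- A family of types over the presheaf `T`, that is, a presheaf on its category of elements. The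
index of a restriction is kept flexible, so that families have strict pullbacks. -/
structure Fam (T : Eᵒᵖ ⥤ Type w') where
  obj : ∀ {X : E}, T.obj (op X) → Type z
  map : ∀ {X Y : E} (f : Y ⟶ X) {t : T.obj (op X)} {s : T.obj (op Y)},
    res T f t = s → obj t → obj s
  map_id : ∀ {X : E} {t : T.obj (op X)} (h : res T (𝟙 X) t = t) (x : obj t), map (𝟙 X) h x = x
  map_comp : ∀ {X Y Z : E} (f : Y ⟶ X) (g : Z ⟶ Y) {t : T.obj (op X)} {s : T.obj (op Y)}
    {r : T.obj (op Z)} (h : res T f t = s) (k : res T g s = r)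
    (l : res T (g ≫ f) t = r) (x : obj t), map g k (map f h x) = map (g ≫ f) l x

namespace Fam
variable {S T R : Eᵒᵖ ⥤ Type w'}

theorem pull_aux (α : S ⟶ T) {X Y : E} {f : Y ⟶ X} {t : S.obj (op X)} {s : S.obj (op Y)}
    (h : res S f t = s) : res T f (ap α t) = ap α s := by rw [← h, ap_res]

/-- pullback of a family -/
def pull (α : S ⟶ T) (F : Fam.{v, w, w', z} T) : Fam.{v, w, w', z} S where
  obj s := F.obj (ap α s)
  map := fun {_ _} f {_ _} h x => F.map f (pull_aux α h) x
  map_id := fun {_ _} _ x => F.map_id _ x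
  map_comp := fun {_ _ _} f g {_ _ _} _ _ _ x => F.map_comp f g _ _ _ x

theorem pull_id (F : Fam.{v, w, w', z} T) : F.pull (𝟙 T) = F := rfl
theorem pull_pull (α : R ⟶ S) (β : S ⟶ T) (F : Fam.{v, w, w', z} T) :
  (F.pull β).pull α = F.pull (α ≫ β) := rfl

theorem map_map (F : Fam.{v, w, w', z} T) {X Y Z : E} {f : Y ⟶ X} {g : Z ⟶ Y} {t : T.obj (op X)}
    {s : T.obj (op Y)} {r : T.obj (op Z)} (h : res T f t = s) (k : res T g s = r) (x : F.obj t) :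
    F.map g k (F.map f h x) = F.map (g ≫ f) (res_trans h k) x := F.map_comp f g h k _ x

theorem map_eq (F : Fam.{v, w, w', z} T) {X Y : E} {f f' : Y ⟶ X} (e : f = f') {t : T.obj (op X)}
    {s : T.obj (op Y)} (h : res T f t = s) (h' : res T f' t = s) (x : F.obj t) :
    F.map f h x = F.map f' h' x := by subst e; rfl

theorem map_heq (F : Fam.{v, w, w', z} T) {X Y : E} {f f' : Y ⟶ X} {t t' : T.obj (op X)} {s s' : T.obj (op Y)}
    (hf : f = f') (h : res T f t = s) (h' : res T f' t' = s')
    {x : F.obj t} {x' : F.obj t'} (ht : t = t') (hx : HEq x x') : HEq (F.map f h x) (F.map f' h' x') := by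
  subst hf ht hx h h'; rfl

theorem map_heq'' (F : Fam.{v, w, w', z} T) {X Y : E} (f : Y ⟶ X) {t : T.obj (op X)}
    {s s' : T.obj (op Y)} (h : res T f t = s) (h' : res T f t = s') (x : F.obj t) :
    HEq (F.map f h x) (F.map f h' x) := by subst h h'; rfl

theorem map_id_heq (F : Fam.{v, w, w', z} T) {X : E} {t s : T.obj (op X)}
    (h : res T (𝟙 X) t = s) (x : F.obj t) : HEq (F.map (𝟙 X) h x) x := by
  obtain rfl : t = s := by rw [← h, res_id]
  rw [F.map_id]

/-- the total space `Σ (t : T). F t` -/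
def tot (F : Fam.{v, w, w', w'} T) : Eᵒᵖ ⥤ Type w' :=
  mkPsh (fun X => Σ t : T.obj (op X), F.obj t) (fun f t => ⟨res T f t.1, F.map f rfl t.2⟩)
   (fun {X} t => by
     refine Sigma.ext (res_id T _) ?_
     exact F.map_id_heq _ _)
   (fun f g t => by
     refine Sigma.ext (res_res T _ _ _) ?_
     dsimp only
     rw [F.map_comp f g rfl rfl (res_res T _ _ _).symm]
     exact F.map_heq rfl _ _ rfl HEq.rfl)
end Fam
end Presheaves

/-! ## Cubical base -/

/-- A predicate on a presheaf `I` at stage `X`, that is, a map `yX × I ⟶ Ω`. -/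
structure StagePred {C : Type u} [SmallCategory C] (I : Cᵒᵖ ⥤ Type u) (X : C) where
  holds : ∀ {Y : C}, (Y ⟶ X) → I.obj (op Y) → Prop
  mono : ∀ {Y Z : C} (f : Y ⟶ X) (i : I.obj (op Y)) (g : Z ⟶ Y),
    holds f i → holds (g ≫ f) (res I g i)

namespace StagePred
variable {C : Type u} [SmallCategory C] {I : Cᵒᵖ ⥤ Type u} {X : C} (φ : StagePred I X)

/-- the truth value `φ i`, for `i` at a later stage -/
def val {Y : C} (f : Y ⟶ X) (i : I.obj (op Y)) : Sieve Y where
  arrows _ g := φ.holds (g ≫ f) (res I g i)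
  downward_closed {Z W g} h k := by
    have := φ.mono (g ≫ f) (res I g i) k h
    rwa [res_res, ← Category.assoc] at this

/-- the truth value `∀ i : I, φ i` -/
def all : Sieve X where
  arrows Y f := ∀ {Z : C} (g : Z ⟶ Y) (i : I.obj (op Z)), φ.holds (g ≫ f) i
  downward_closed {Y Z f} h k := fun g i => by
    have := h (g ≫ k) i
    rwa [Category.assoc] at this

end StagePred

/-- the truth value `i = e` -/
def eqSieve {C : Type u} [SmallCategory C] {I : Cᵒᵖ ⥤ Type u} {X : C} (i j : I.obj (op X)) :
    Sieve X where
  arrows Y f := res I f i = res I f j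
  downward_closed {Y Z f} h k := by
    rw [← res_res, ← res_res, h]

/-- An interval `I` with end points `pt false = 0` and `pt true = 1`, and cofibrant propositions `Cof`,
satisfying the axioms of Orton and Pitts: the interval is connected, has distinct end points and
connections, and cofibrant propositions contain the equations `i = 0`, `i = 1` and are closed
under disjunction, dependent conjunction, and universal quantification over `I`; all of this in the
internal language of presheaves over `C`. -/
structure CubeBase (C : Type u) [SmallCategory C] where
  I : Cᵒᵖ ⥤ Type u
  pt : Bool → ∀ X : C, I.obj (op X)
  pt_res : ∀ (b : Bool) {X Y : C} (f : Y ⟶ X), res I f (pt b X) = pt b Y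
  Cof : ∀ X : C, Set (Sieve X)
  Cof_pullback : ∀ {X Y : C} (f : Y ⟶ X) (φ : Sieve X), φ ∈ Cof X → φ.pullback f ∈ Cof Y
  connected : ∀ {X : C} (φ : StagePred I X),
    (∀ {Y : C} (f : Y ⟶ X) (i : I.obj (op Y)), φ.holds f i ∨
      ∀ {Z : C} (g : Z ⟶ Y), ¬ φ.holds (g ≫ f) (res I g i)) →
    (∀ {Y : C} (f : Y ⟶ X) (i : I.obj (op Y)), φ.holds f i) ∨
      ∀ {Y : C} (f : Y ⟶ X) (i : I.obj (op Y)), ¬ φ.holds f i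
  pt_ne : ∀ X : C, pt false X ≠ pt true X
  meet : ∀ {X : C}, I.obj (op X) → I.obj (op X) → I.obj (op X)
  meet_res : ∀ {X Y : C} (f : Y ⟶ X) (i j : I.obj (op X)),
    res I f (meet i j) = meet (res I f i) (res I f j)
  zero_meet : ∀ {X : C} (i : I.obj (op X)), meet (pt false X) i = pt false X
  meet_zero : ∀ {X : C} (i : I.obj (op X)), meet i (pt false X) = pt false X
  one_meet : ∀ {X : C} (i : I.obj (op X)), meet (pt true X) i = i
  meet_one : ∀ {X : C} (i : I.obj (op X)), meet i (pt true X) = i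
  join : ∀ {X : C}, I.obj (op X) → I.obj (op X) → I.obj (op X)
  join_res : ∀ {X Y : C} (f : Y ⟶ X) (i j : I.obj (op X)),
    res I f (join i j) = join (res I f i) (res I f j)
  zero_join : ∀ {X : C} (i : I.obj (op X)), join (pt false X) i = i
  join_zero : ∀ {X : C} (i : I.obj (op X)), join i (pt false X) = i
  one_join : ∀ {X : C} (i : I.obj (op X)), join (pt true X) i = pt true X
  join_one : ∀ {X : C} (i : I.obj (op X)), join i (pt true X) = pt true X
  Cof_eq : ∀ {X : C} (i : I.obj (op X)) (b : Bool), eqSieve i (pt b X) ∈ Cof X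
  Cof_or : ∀ {X : C} (φ ψ : Sieve X), φ ∈ Cof X → ψ ∈ Cof X → φ ⊔ ψ ∈ Cof X
  Cof_and : ∀ {X : C} (φ ψ : Sieve X), φ ∈ Cof X →
    (∀ {Y : C} (f : Y ⟶ X), φ.arrows f → ψ.pullback f ∈ Cof Y) → φ ⊓ ψ ∈ Cof X
  Cof_all : ∀ {X : C} (φ : StagePred I X),
    (∀ {Y : C} (f : Y ⟶ X) (i : I.obj (op Y)), φ.val f i ∈ Cof Y) → φ.all ∈ Cof X

/-! ## Categories with families internal to presheaves over `C` -/

/-- A category with terminal object, internal to presheaves over `C`: an internal category is a family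
of categories indexed by the objects of `C` with restriction functors, and it is given here by its
total category, whose objects are the pairs of a stage `X` and a context at stage `X`, and whose maps
`(Y, Δ) ⟶ (X, Γ)` over `f : Y ⟶ X` are the substitutions from `Δ` to the restriction of `Γ` along `f`.
The restrictions are only asked to exist up to isomorphism (`exists_lift`). The
context `unitCon X` is terminal at stage `X`, and the terminal contexts are stable under restriction. -/
structure Contexts (C : Type u) [SmallCategory C] where
  Con : C → Type w
  cat : Category.{u} (Σ X : C, Con X)
  base : ∀ {Δ Γ : Σ X : C, Con X}, (Δ ⟶ Γ) → (Δ.1 ⟶ Γ.1)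
  base_id : ∀ Γ : Σ X : C, Con X, base (𝟙 Γ) = 𝟙 Γ.1
  base_comp : ∀ {Θ Δ Γ : Σ X : C, Con X} (τ : Θ ⟶ Δ) (σ : Δ ⟶ Γ),
    base (τ ≫ σ) = base τ ≫ base σ
  exists_lift : ∀ (Γ : Σ X : C, Con X) {Y : C} (f : Y ⟶ Γ.1),
    ∃ (Γf : Con Y) (l : (⟨Y, Γf⟩ : Σ X : C, Con X) ⟶ Γ), base l = f ∧
      ∀ (Δ : Σ X : C, Con X) (τ : Δ ⟶ Γ) (g : Δ.1 ⟶ Y), base τ = g ≫ f →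
        ∃! τ' : Δ ⟶ ⟨Y, Γf⟩, base τ' = g ∧ τ' ≫ l = τ
  unitCon : ∀ X : C, Con X
  toUnit : ∀ (Δ : Σ X : C, Con X) {X : C} (f : Δ.1 ⟶ X), Δ ⟶ ⟨X, unitCon X⟩
  base_toUnit : ∀ (Δ : Σ X : C, Con X) {X : C} (f : Δ.1 ⟶ X), base (toUnit Δ f) = f
  toUnit_uniq : ∀ {Δ : Σ X : C, Con X} {X : C} (τ : Δ ⟶ ⟨X, unitCon X⟩), toUnit Δ (base τ) = τ

namespace Contexts
variable {C : Type u} [SmallCategory C]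

abbrev Ctx (K : Contexts.{u, w} C) := Σ X : C, K.Con X

instance (K : Contexts.{u, w} C) : Category.{u} K.Ctx := K.cat

abbrev mk' (K : Contexts.{u, w} C) {X : C} (Γ : K.Con X) : K.Ctx := ⟨X, Γ⟩

end Contexts

/-- A category with families internal to presheaves over `C`: presheaves of types and of elements on
the total category of contexts, and context extensions within each stage, with projections `p`, `q`
and their universal property. -/
structure Cwf (C : Type u) [SmallCategory C] extends Contexts.{u, w} C where
  Ty : (toContexts.Ctx)ᵒᵖ ⥤ Type w'
  Tm : Fam.{u, max u w, w', u} Ty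
  ext : ∀ (Γ : toContexts.Ctx), Ty.obj (op Γ) → Con Γ.1
  p : ∀ {Γ : toContexts.Ctx} (A : Ty.obj (op Γ)), toContexts.mk' (ext Γ A) ⟶ Γ
  base_p : ∀ {Γ : toContexts.Ctx} (A : Ty.obj (op Γ)), base (p A) = 𝟙 Γ.1
  q : ∀ {Γ : toContexts.Ctx} (A : Ty.obj (op Γ)), Tm.obj (res Ty (p A) A)
  pair : ∀ {Δ Γ : toContexts.Ctx} (σ : Δ ⟶ Γ) {A : Ty.obj (op Γ)} {A' : Ty.obj (op Δ)},
    res Ty σ A = A' → Tm.obj A' → (Δ ⟶ toContexts.mk' (ext Γ A))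
  pair_p : ∀ {Δ Γ : toContexts.Ctx} (σ : Δ ⟶ Γ) {A : Ty.obj (op Γ)} {A' : Ty.obj (op Δ)}
    (h : res Ty σ A = A') (a : Tm.obj A'), pair σ h a ≫ p A = σ
  pair_q : ∀ {Δ Γ : toContexts.Ctx} (σ : Δ ⟶ Γ) {A : Ty.obj (op Γ)} {A' : Ty.obj (op Δ)}
    (h : res Ty σ A = A') (a : Tm.obj A') (h' : res Ty (pair σ h a) (res Ty (p A) A) = A'),
    Tm.map (pair σ h a) h' (q A) = a
  pair_uniq : ∀ {Δ Γ : toContexts.Ctx} {A : Ty.obj (op Γ)} (τ : Δ ⟶ toContexts.mk' (ext Γ A))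
    {A' : Ty.obj (op Δ)} (h : res Ty τ (res Ty (p A) A) = A') (h' : res Ty (τ ≫ p A) A = A'),
    pair (τ ≫ p A) h' (Tm.map τ h (q A)) = τ

namespace Cwf
variable {C : Type u} [SmallCategory C] (K : Cwf.{u, w, w'} C)

abbrev Ctx : Type (max u w) := K.toContexts.Ctx
abbrev TyAt (Γ : K.Ctx) : Type w' := K.Ty.obj (op Γ)

abbrev extend (Γ : K.Ctx) (A : K.TyAt Γ) : K.Ctx := K.mk' (K.ext Γ A)

variable {K}
/-- `A[σ]` -/
abbrev sub {Δ Γ : K.Ctx} (A : K.TyAt Γ) (σ : Δ ⟶ Γ) : K.TyAt Δ := res K.Ty σ A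

theorem sub_sub {Θ Δ Γ : K.Ctx} (A : K.TyAt Γ) (σ : Δ ⟶ Γ) (τ : Θ ⟶ Δ) :
    sub (sub A σ) τ = sub A (τ ≫ σ) := res_res _ _ _ _

theorem sub_trans {Θ Δ Γ : K.Ctx} {A : K.TyAt Γ} {σ : Δ ⟶ Γ} {τ : Θ ⟶ Δ} {A' : K.TyAt Δ}
    {A'' : K.TyAt Θ} (h : sub A σ = A') (h' : sub A' τ = A'') : sub A (τ ≫ σ) = A'' := by
  subst h h'; exact (sub_sub _ _ _).symm

theorem sub_eq {Θ Δ Γ Δ' : K.Ctx} {A : K.TyAt Γ} {σ : Δ ⟶ Γ} {τ : Θ ⟶ Δ} {σ' : Δ' ⟶ Γ}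
    {τ' : Θ ⟶ Δ'} {A' : K.TyAt Δ} {A'' : K.TyAt Δ'} (e : τ ≫ σ = τ' ≫ σ') (h : sub A σ = A')
    (h' : sub A σ' = A'') : sub A' τ = sub A'' τ' := by
  subst h h'; rw [sub_sub, sub_sub, e]

/-- `σ⁺`, with flexible domain -/
def lift {Δ Γ : K.Ctx} (σ : Δ ⟶ Γ) {A : K.TyAt Γ} {A' : K.TyAt Δ} (h : sub A σ = A') :
    K.extend Δ A' ⟶ K.extend Γ A :=
  K.pair (A := A) (A' := sub A' (K.p A')) (K.p A' ≫ σ) (by rw [← h, sub, sub, res_res]) (K.q A')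

/-- `[a]` -/
def inst {Γ : K.Ctx} {A : K.TyAt Γ} (a : K.Tm.obj A) : Γ ⟶ K.extend Γ A :=
  K.pair (𝟙 Γ) (res_id _ _) a


theorem pair_congr {Δ Γ : K.Ctx} {σ σ' : Δ ⟶ Γ} (e : σ = σ') {A : K.TyAt Γ} {A' : K.TyAt Δ}
    (u : sub A σ = A') (u' : sub A σ' = A') (a : K.Tm.obj A') : K.pair σ u a = K.pair σ' u' a := by
  subst e; rfl

theorem hom_ext {Δ Γ : K.Ctx} {A : K.TyAt Γ} {τ τ' : Δ ⟶ K.extend Γ A}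
    (hp : τ ≫ K.p A = τ' ≫ K.p A) {A' : K.TyAt Δ} (h : sub (sub A (K.p A)) τ = A')
    (h' : sub (sub A (K.p A)) τ' = A') (hq : K.Tm.map τ h (K.q A) = K.Tm.map τ' h' (K.q A)) :
    τ = τ' := by
  have e : sub A (τ ≫ K.p A) = A' := by rw [← h, sub, sub, sub, res_res]
  have e' : sub A (τ' ≫ K.p A) = A' := by rw [← h', sub, sub, sub, res_res]
  rw [← K.pair_uniq τ h e, ← K.pair_uniq τ' h' e']
  rw [hq]
  exact pair_congr hp _ _ _

theorem comp_pair {Θ Δ Γ : K.Ctx} (τ : Θ ⟶ Δ) (σ : Δ ⟶ Γ) {A : K.TyAt Γ} {A' : K.TyAt Δ}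
    {A'' : K.TyAt Θ} (h : sub A σ = A') (h' : sub A' τ = A'') (a : K.Tm.obj A') :
    τ ≫ K.pair σ h a
      = K.pair (τ ≫ σ) (sub_trans h h') (K.Tm.map τ h' a) := by
  have e : sub (sub A (K.p A)) (τ ≫ K.pair σ h a) = A'' := by
    rw [sub_sub, Category.assoc, K.pair_p]; exact sub_trans h h'
  have e2 : sub (sub A (K.p A)) (K.pair (τ ≫ σ) (sub_trans h h') (K.Tm.map τ h' a)) = A'' := by
    rw [sub_sub, K.pair_p]; exact sub_trans h h'
  refine hom_ext (by rw [Category.assoc, K.pair_p, K.pair_p]) e e2 ?_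
  rw [K.pair_q]
  have e3 : sub (sub A (K.p A)) (K.pair σ h a) = A' := by
    rw [sub_sub, K.pair_p]; exact h
  rw [← K.Tm.map_comp _ _ e3 h', K.pair_q]

theorem lift_p {Δ Γ : K.Ctx} (σ : Δ ⟶ Γ) {A : K.TyAt Γ} {A' : K.TyAt Δ} (h : sub A σ = A') :
    lift σ h ≫ K.p A = K.p A' ≫ σ := K.pair_p _ _ _

theorem lift_q {Δ Γ : K.Ctx} (σ : Δ ⟶ Γ) {A : K.TyAt Γ} {A' : K.TyAt Δ} (h : sub A σ = A')
    (h' : sub (sub A (K.p A)) (lift σ h) = sub A' (K.p A')) :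
    K.Tm.map (lift σ h) h' (K.q A) = K.q A' := K.pair_q _ _ _ _

theorem inst_p {Γ : K.Ctx} {A : K.TyAt Γ} (a : K.Tm.obj A) : inst a ≫ K.p A = 𝟙 Γ :=
  K.pair_p _ _ _

theorem pair_lift {Θ Δ Γ : K.Ctx} (τ : Θ ⟶ Δ) (σ : Δ ⟶ Γ) {A : K.TyAt Γ} {A' : K.TyAt Δ}
    {A'' : K.TyAt Θ} (h : sub A σ = A') (h' : sub A' τ = A'') (a : K.Tm.obj A'') :
    K.pair τ h' a ≫ lift σ h = K.pair (τ ≫ σ) (sub_trans h h') a := by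
  have e : sub (sub A' (K.p A')) (K.pair τ h' a) = A'' := by
    rw [sub, sub, res_res, K.pair_p]; exact h'
  rw [lift, comp_pair _ _ _ e, K.pair_q]
  exact pair_congr (by rw [← Category.assoc, K.pair_p]) _ _ _

theorem comp_inst {Δ Γ : K.Ctx} (σ : Δ ⟶ Γ) {A : K.TyAt Γ} {A' : K.TyAt Δ} (h : sub A σ = A')
    (a : K.Tm.obj A) : σ ≫ inst a = inst (K.Tm.map σ h a) ≫ lift σ h := by
  rw [inst, inst, comp_pair _ _ _ h, pair_lift]
  exact pair_congr (by simp) _ _ _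

theorem inst_sub {Δ Γ : K.Ctx} (σ : Δ ⟶ Γ) {A : K.TyAt Γ} {A' : K.TyAt Δ} (h : sub A σ = A')
    (B : K.TyAt (K.extend Γ A)) (a : K.Tm.obj A) :
    sub (sub B (inst a)) σ = sub (sub B (lift σ h)) (inst (K.Tm.map σ h a)) := by
  rw [sub, sub, sub, sub, res_res, res_res, comp_inst σ h]

end Cwf

variable {C : Type u} [SmallCategory C]

section Lines
variable (P : CubeBase C) {K : Cwf.{u, w, w'} C}
open Cwf

/-- An element of `I → Type(Γ)`. -/
structure TyLine (Γ : K.Ctx) where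
  ty : ∀ {Δ : K.Ctx}, (Δ ⟶ Γ) → P.I.obj (op Δ.1) → K.TyAt Δ
  nat : ∀ {Δ Θ : K.Ctx} (σ : Δ ⟶ Γ) (τ : Θ ⟶ Δ) (i : P.I.obj (op Δ.1)),
    sub (ty σ i) τ = ty (τ ≫ σ) (res P.I (K.base τ) i)

variable {P}

/-- An element of `Π (i : I). Elem(Γ, L i)`. -/
structure TmLine {Γ : K.Ctx} (L : TyLine P Γ) where
  tm : ∀ {Δ : K.Ctx} (σ : Δ ⟶ Γ) (i : P.I.obj (op Δ.1)), K.Tm.obj (L.ty σ i)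
  nat : ∀ {Δ Θ : K.Ctx} (σ : Δ ⟶ Γ) (τ : Θ ⟶ Δ) (i : P.I.obj (op Δ.1)),
    K.Tm.map τ (L.nat σ τ i) (tm σ i) = tm (τ ≫ σ) (res P.I (K.base τ) i)

variable (P)

/-- the constant line at `A` -/
def constLine {Γ : K.Ctx} (A : K.TyAt Γ) : TyLine P Γ where
  ty σ _ := sub A σ
  nat σ τ _ := res_res _ σ τ A

end Lines

/-- Dependent products, dependent sums (both with computation and uniqueness rules, so that
elements of `Pi A B` are the elements of `B` over `Γ.A`, and elements of `Sig A B` are pairs), and path types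
(whose elements are the lines `Π (i : I). Elem(Γ, A)` with given end points), all stable under substitution. -/
structure TypeFormers (P : CubeBase C) (K : Cwf.{u, w, w'} C) where
  Pi : ∀ {Γ : K.Ctx} (A : K.TyAt Γ), K.TyAt (K.extend Γ A) → K.TyAt Γ
  Pi_sub : ∀ {Δ Γ : K.Ctx} (σ : Δ ⟶ Γ) (A : K.TyAt Γ) (B : K.TyAt (K.extend Γ A)),
    Cwf.sub (Pi A B) σ = Pi (Cwf.sub A σ) (Cwf.sub B (Cwf.lift σ rfl))
  unlam : ∀ {Γ : K.Ctx} {A : K.TyAt Γ} {B : K.TyAt (K.extend Γ A)},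
    K.Tm.obj (Pi A B) ≃ K.Tm.obj B
  unlam_sub : ∀ {Δ Γ : K.Ctx} (σ : Δ ⟶ Γ) {A : K.TyAt Γ} {B : K.TyAt (K.extend Γ A)}
    (c : K.Tm.obj (Pi A B)),
    unlam (K.Tm.map σ (Pi_sub σ A B) c) = K.Tm.map (Cwf.lift σ rfl) rfl (unlam c)
  Sig : ∀ {Γ : K.Ctx} (A : K.TyAt Γ), K.TyAt (K.extend Γ A) → K.TyAt Γ
  Sig_sub : ∀ {Δ Γ : K.Ctx} (σ : Δ ⟶ Γ) (A : K.TyAt Γ) (B : K.TyAt (K.extend Γ A)),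
    Cwf.sub (Sig A B) σ = Sig (Cwf.sub A σ) (Cwf.sub B (Cwf.lift σ rfl))
  unpair : ∀ {Γ : K.Ctx} {A : K.TyAt Γ} {B : K.TyAt (K.extend Γ A)},
    K.Tm.obj (Sig A B) ≃ Σ a : K.Tm.obj A, K.Tm.obj (Cwf.sub B (Cwf.inst a))
  unpair_sub : ∀ {Δ Γ : K.Ctx} (σ : Δ ⟶ Γ) {A : K.TyAt Γ} {B : K.TyAt (K.extend Γ A)}
    (c : K.Tm.obj (Sig A B)),
    unpair (K.Tm.map σ (Sig_sub σ A B) c) = ⟨K.Tm.map σ rfl (unpair c).1,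
      K.Tm.map σ (Cwf.inst_sub σ rfl B (unpair c).1) (unpair c).2⟩
  Path : ∀ {Γ : K.Ctx} (A : K.TyAt Γ), K.Tm.obj A → K.Tm.obj A → K.TyAt Γ
  Path_sub : ∀ {Δ Γ : K.Ctx} (σ : Δ ⟶ Γ) (A : K.TyAt Γ) (a₀ a₁ : K.Tm.obj A),
    Cwf.sub (Path A a₀ a₁) σ = Path (Cwf.sub A σ) (K.Tm.map σ rfl a₀) (K.Tm.map σ rfl a₁)
  papp : ∀ {Γ : K.Ctx} {A : K.TyAt Γ} {a₀ a₁ : K.Tm.obj A},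
    K.Tm.obj (Path A a₀ a₁) → P.I.obj (op Γ.1) → K.Tm.obj A
  papp_sub : ∀ {Δ Γ : K.Ctx} (σ : Δ ⟶ Γ) {A : K.TyAt Γ} {a₀ a₁ : K.Tm.obj A}
    (c : K.Tm.obj (Path A a₀ a₁)) (i : P.I.obj (op Γ.1)),
    papp (K.Tm.map σ (Path_sub σ A a₀ a₁) c) (res P.I (K.base σ) i) = K.Tm.map σ rfl (papp c i)
  papp_zero : ∀ {Γ : K.Ctx} {A : K.TyAt Γ} {a₀ a₁ : K.Tm.obj A} (c : K.Tm.obj (Path A a₀ a₁)),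
    papp c (P.pt false Γ.1) = a₀
  papp_one : ∀ {Γ : K.Ctx} {A : K.TyAt Γ} {a₀ a₁ : K.Tm.obj A} (c : K.Tm.obj (Path A a₀ a₁)),
    papp c (P.pt true Γ.1) = a₁
  pabs : ∀ {Γ : K.Ctx} {A : K.TyAt Γ} {a₀ a₁ : K.Tm.obj A} (l : TmLine (constLine P A)),
    (∀ {Δ : K.Ctx} (σ : Δ ⟶ Γ), l.tm σ (P.pt false Δ.1) = K.Tm.map σ rfl a₀) →
    (∀ {Δ : K.Ctx} (σ : Δ ⟶ Γ), l.tm σ (P.pt true Δ.1) = K.Tm.map σ rfl a₁) →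
    ∃! c : K.Tm.obj (Path A a₀ a₁), ∀ {Δ : K.Ctx} (σ : Δ ⟶ Γ) (i : P.I.obj (op Δ.1)),
      papp (K.Tm.map σ (Path_sub σ A a₀ a₁) c) i = l.tm σ i

namespace TypeFormers
open Cwf
variable {P : CubeBase C} {K : Cwf.{u, w, w'} C} (F : TypeFormers P K)

/-- `A → B` -/
abbrev arr {Γ : K.Ctx} (A B : K.TyAt Γ) : K.TyAt Γ := F.Pi A (sub B (K.p A))

theorem Pi_sub' {Δ Γ : K.Ctx} (σ : Δ ⟶ Γ) {A : K.TyAt Γ} {B : K.TyAt (K.extend Γ A)}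
    {A' : K.TyAt Δ} {B' : K.TyAt (K.extend Δ A')} (hA : sub A σ = A')
    (hB : sub B (lift σ hA) = B') : sub (F.Pi A B) σ = F.Pi A' B' := by
  subst hA hB; exact F.Pi_sub σ A B

theorem Sig_sub' {Δ Γ : K.Ctx} (σ : Δ ⟶ Γ) {A : K.TyAt Γ} {B : K.TyAt (K.extend Γ A)}
    {A' : K.TyAt Δ} {B' : K.TyAt (K.extend Δ A')} (hA : sub A σ = A')
    (hB : sub B (lift σ hA) = B') : sub (F.Sig A B) σ = F.Sig A' B' := by
  subst hA hB; exact F.Sig_sub σ A B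

theorem Path_sub' {Δ Γ : K.Ctx} (σ : Δ ⟶ Γ) {A : K.TyAt Γ} {a₀ a₁ : K.Tm.obj A}
    {A' : K.TyAt Δ} {b₀ b₁ : K.Tm.obj A'} (hA : sub A σ = A')
    (h₀ : K.Tm.map σ hA a₀ = b₀) (h₁ : K.Tm.map σ hA a₁ = b₁) :
    sub (F.Path A a₀ a₁) σ = F.Path A' b₀ b₁ := by
  subst hA h₀ h₁; exact F.Path_sub σ A a₀ a₁

theorem unlam_sub' {Δ Γ : K.Ctx} (σ : Δ ⟶ Γ) {A : K.TyAt Γ} {B : K.TyAt (K.extend Γ A)}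
    {A' : K.TyAt Δ} {B' : K.TyAt (K.extend Δ A')} (hA : sub A σ = A')
    (hB : sub B (lift σ hA) = B') (h : sub (F.Pi A B) σ = F.Pi A' B') (c : K.Tm.obj (F.Pi A B)) :
    F.unlam (K.Tm.map σ h c) = K.Tm.map (lift σ hA) hB (F.unlam c) := by
  subst hA hB; exact F.unlam_sub σ c

theorem arr_aux {Δ Γ : K.Ctx} (σ : Δ ⟶ Γ) {A B : K.TyAt Γ} {A' B' : K.TyAt Δ}
    (hA : sub A σ = A') (hB : sub B σ = B') :
    sub (sub B (K.p A)) (lift σ hA) = sub B' (K.p A') := by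
  rw [← hB, sub, sub, sub, sub, res_res, res_res, lift_p]

theorem arr_sub {Δ Γ : K.Ctx} (σ : Δ ⟶ Γ) {A B : K.TyAt Γ} {A' B' : K.TyAt Δ}
    (hA : sub A σ = A') (hB : sub B σ = B') : sub (F.arr A B) σ = F.arr A' B' :=
  F.Pi_sub' σ hA (arr_aux σ hA hB)

theorem comp_aux {Γ : K.Ctx} {A B D : K.TyAt Γ} (b : K.Tm.obj (sub B (K.p A))) :
    sub (sub D (K.p B)) (K.pair (K.p A) rfl b) = sub D (K.p A) := by
  rw [sub, sub, res_res, K.pair_p]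

/-- `g ∘ f` -/
def comp {Γ : K.Ctx} {A B D : K.TyAt Γ} (g : K.Tm.obj (F.arr B D)) (f : K.Tm.obj (F.arr A B)) :
    K.Tm.obj (F.arr A D) :=
  F.unlam.symm (K.Tm.map (K.pair (K.p A) rfl (F.unlam f)) (comp_aux _) (F.unlam g))

/-- `Π (a : A). Path A (h a) a` -/
def htpyId {Γ : K.Ctx} {A : K.TyAt Γ} (h : K.Tm.obj (F.arr A A)) : K.TyAt Γ :=
  F.Pi A (F.Path (sub A (K.p A)) (F.unlam h) (K.q A))

/-- Homotopy left inverses, `Σ (g : B → A). Π (a : A). Path A (g (f a)) a`. -/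
def LInv {Γ : K.Ctx} {A B : K.TyAt Γ} (f : K.Tm.obj (F.arr A B)) : K.TyAt Γ :=
  F.Sig (F.arr B A) (F.htpyId (F.comp
    (K.Tm.map (𝟙 _) (by rw [res_id]; exact F.arr_sub _ rfl rfl) (K.q (F.arr B A)))
    (K.Tm.map (K.p (F.arr B A)) (F.arr_sub _ rfl rfl) f)))

/-- Homotopy right inverses, `Σ (g : B → A). Π (b : B). Path B (f (g b)) b`. -/
def RInv {Γ : K.Ctx} {A B : K.TyAt Γ} (f : K.Tm.obj (F.arr A B)) : K.TyAt Γ :=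
  F.Sig (F.arr B A) (F.htpyId (F.comp
    (K.Tm.map (K.p (F.arr B A)) (F.arr_sub _ rfl rfl) f)
    (K.Tm.map (𝟙 _) (by rw [res_id]; exact F.arr_sub _ rfl rfl) (K.q (F.arr B A)))))

/-- `f` is an equivalence: it has a homotopy left inverse and a homotopy right inverse. -/
def isEquiv {Γ : K.Ctx} {A B : K.TyAt Γ} (f : K.Tm.obj (F.arr A B)) : K.TyAt Γ :=
  F.Sig (F.LInv f) (sub (F.RInv f) (K.p (F.LInv f)))

theorem unlam_arr_sub {Δ Γ : K.Ctx} (σ : Δ ⟶ Γ) {A B : K.TyAt Γ} {A' B' : K.TyAt Δ}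
    (hA : sub A σ = A') (hB : sub B σ = B') (h : sub (F.arr A B) σ = F.arr A' B')
    (f : K.Tm.obj (F.arr A B)) : F.unlam (K.Tm.map σ h f)
      = K.Tm.map (lift σ hA) (arr_aux σ hA hB) (F.unlam f) :=
  F.unlam_sub' σ hA (arr_aux σ hA hB) h f

theorem comp_sub {Δ Γ : K.Ctx} (σ : Δ ⟶ Γ) {A B D : K.TyAt Γ} {A' B' D' : K.TyAt Δ}
    (hA : sub A σ = A') (hB : sub B σ = B') (hD : sub D σ = D')
    (g : K.Tm.obj (F.arr B D)) (f : K.Tm.obj (F.arr A B)) (h₁ : sub (F.arr A D) σ = F.arr A' D')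
    (h₂ : sub (F.arr B D) σ = F.arr B' D') (h₃ : sub (F.arr A B) σ = F.arr A' B') :
    K.Tm.map σ h₁ (F.comp g f) = F.comp (K.Tm.map σ h₂ g) (K.Tm.map σ h₃ f) := by
  subst hA hB hD
  apply F.unlam.injective
  rw [F.unlam_arr_sub σ rfl rfl, comp, comp, Equiv.apply_symm_apply, Equiv.apply_symm_apply,
    F.unlam_arr_sub σ rfl rfl h₂ g]
  have e : lift σ rfl ≫ K.pair (K.p A) rfl (F.unlam f)
      = K.pair (K.p (sub A σ)) rfl (F.unlam (K.Tm.map σ h₃ f)) ≫ lift σ (A := B) rfl := by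
    rw [F.unlam_arr_sub σ rfl rfl, comp_pair _ _ _ (arr_aux σ rfl rfl), pair_lift]
    congr 1
    exact lift_p _ _
  rw [K.Tm.map_map, K.Tm.map_map]
  exact K.Tm.map_eq e _ _ _

theorem htpyId_sub {Δ Γ : K.Ctx} (σ : Δ ⟶ Γ) {A : K.TyAt Γ} {A' : K.TyAt Δ}
    (hA : sub A σ = A') (h : K.Tm.obj (F.arr A A)) {h' : K.Tm.obj (F.arr A' A')}
    (e : sub (F.arr A A) σ = F.arr A' A') (hh : K.Tm.map σ e h = h') :
    sub (F.htpyId h) σ = F.htpyId h' := by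
  subst hh
  refine F.Pi_sub' σ hA (F.Path_sub' _ (arr_aux σ hA hA) ?_ ?_)
  · rw [F.unlam_arr_sub σ hA hA]
  · exact lift_q _ _ _

theorem LInv_sub {Δ Γ : K.Ctx} (σ : Δ ⟶ Γ) {A B : K.TyAt Γ} {A' B' : K.TyAt Δ}
    (hA : sub A σ = A') (hB : sub B σ = B') (f : K.Tm.obj (F.arr A B))
    {f' : K.Tm.obj (F.arr A' B')} (e : sub (F.arr A B) σ = F.arr A' B')
    (hf : K.Tm.map σ e f = f') : sub (F.LInv f) σ = F.LInv f' := by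
  subst hf
  have hl := F.arr_sub σ hB hA
  have eA := arr_aux (A := F.arr B A) (B := A) σ hl hA
  have eB := arr_aux (A := F.arr B A) (B := B) σ hl hB
  refine F.Sig_sub' σ hl (F.htpyId_sub _ eA _ (F.arr_sub _ eA eA) ?_)
  rw [F.comp_sub _ eA eB eA _ _ _ (F.arr_sub _ eB eA) (F.arr_sub _ eA eB)]
  congr 1
  · rw [K.Tm.map_map, ← lift_q σ hl (sub_eq (lift_p σ hl) rfl hl), K.Tm.map_map]
    exact K.Tm.map_eq (by simp) _ _ _
  · rw [K.Tm.map_map, K.Tm.map_map]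
    exact K.Tm.map_eq (lift_p _ _) _ _ _

theorem RInv_sub {Δ Γ : K.Ctx} (σ : Δ ⟶ Γ) {A B : K.TyAt Γ} {A' B' : K.TyAt Δ}
    (hA : sub A σ = A') (hB : sub B σ = B') (f : K.Tm.obj (F.arr A B))
    {f' : K.Tm.obj (F.arr A' B')} (e : sub (F.arr A B) σ = F.arr A' B')
    (hf : K.Tm.map σ e f = f') : sub (F.RInv f) σ = F.RInv f' := by
  subst hf
  have hl := F.arr_sub σ hB hA
  have eA := arr_aux (A := F.arr B A) (B := A) σ hl hA
  have eB := arr_aux (A := F.arr B A) (B := B) σ hl hB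
  refine F.Sig_sub' σ hl (F.htpyId_sub _ eB _ (F.arr_sub _ eB eB) ?_)
  rw [F.comp_sub _ eB eA eB _ _ _ (F.arr_sub _ eA eB) (F.arr_sub _ eB eA)]
  congr 1
  · rw [K.Tm.map_map, K.Tm.map_map]
    exact K.Tm.map_eq (lift_p _ _) _ _ _
  · rw [K.Tm.map_map, ← lift_q σ hl (sub_eq (lift_p σ hl) rfl hl), K.Tm.map_map]
    exact K.Tm.map_eq (by simp) _ _ _

theorem isEquiv_sub {Δ Γ : K.Ctx} (σ : Δ ⟶ Γ) {A B : K.TyAt Γ} {A' B' : K.TyAt Δ}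
    (hA : sub A σ = A') (hB : sub B σ = B') (f : K.Tm.obj (F.arr A B))
    {f' : K.Tm.obj (F.arr A' B')} (e : sub (F.arr A B) σ = F.arr A' B')
    (hf : K.Tm.map σ e f = f') : sub (F.isEquiv f) σ = F.isEquiv f' :=
  F.Sig_sub' σ (F.LInv_sub σ hA hB f e hf) (sub_eq (lift_p _ _) rfl (F.RInv_sub σ hA hB f e hf))

end TypeFormers

/-! ## The sconing -/

namespace Cwf
variable (K : Cwf.{u, w, w'} C)

abbrev unit (X : C) : K.Ctx := ⟨X, K.unitCon X⟩

def unitMap {X Y : C} (f : Y ⟶ X) : K.unit Y ⟶ K.unit X := K.toUnit (K.unit Y) f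

variable {K}
theorem unit_hom_ext {Δ : K.Ctx} {X : C} {τ τ' : Δ ⟶ K.unit X} (h : K.base τ = K.base τ') :
    τ = τ' := by rw [← K.toUnit_uniq τ, h, K.toUnit_uniq τ']

variable (K)
theorem base_unitMap {X Y : C} (f : Y ⟶ X) : K.base (K.unitMap f) = f := K.base_toUnit _ _

theorem unitMap_id (X : C) : K.unitMap (𝟙 X) = 𝟙 (K.unit X) :=
  unit_hom_ext (by rw [base_unitMap, K.base_id])

theorem unitMap_comp {X Y Z : C} (f : Y ⟶ X) (g : Z ⟶ Y) :
    K.unitMap (g ≫ f) = K.unitMap g ≫ K.unitMap f :=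
  unit_hom_ext (by rw [base_unitMap, K.base_comp, base_unitMap, base_unitMap])

/-- the global sections `|Γ|`, with value at stage `Y` the substitutions from the terminal context at
stage `Y` to `Γ` -/
def pts (Γ : K.Ctx) : Cᵒᵖ ⥤ Type u :=
  mkPsh (fun Y => (K.unit Y ⟶ Γ)) (fun f ρ => K.unitMap f ≫ ρ)
    (fun ρ => by rw [unitMap_id]; exact Category.id_comp ρ)
    (fun f g ρ => by rw [unitMap_comp, Category.assoc])
end Cwf

namespace Scone
open Cwf
variable (K : Cwf.{u, w, w'} C)

/-- A context `(Γ, Γ')` of the sconing: a context `Γ` of `M` together with a family `Γ'` of types indexed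
by `|Γ|`, represented by the total space `pred` of the pairs `(ρ, ρ')` and its projection to `|Γ|`. -/
structure Con (X : C) where
  ctx : K.Con X
  pred : Cᵒᵖ ⥤ Type u
  proj : pred ⟶ K.pts ⟨X, ctx⟩

abbrev Ctx := Σ X : C, Con.{u, w, w'} K X

variable {K}

/-- the context of `M` underlying a context of the sconing -/
abbrev under (Γ : Ctx K) : K.Ctx := ⟨Γ.1, Γ.2.ctx⟩
/-- the component `ρ` of `(ρ, ρ')` -/
abbrev pr (Γ : Ctx K) {Y : C} (g : Γ.2.pred.obj (op Y)) : K.unit Y ⟶ under Γ := ap Γ.2.proj g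

theorem pr_res (Γ : Ctx K) {X Y : C} (f : Y ⟶ X) (g : Γ.2.pred.obj (op X)) :
  pr Γ (res Γ.2.pred f g) = K.unitMap f ≫ pr Γ g := ap_res Γ.2.proj f g

/-- A substitution: a substitution of `M` together with a map of families over it. -/
@[ext]
structure Hom (Δ Γ : Ctx K) where
  sub : under Δ ⟶ under Γ
  map : Δ.2.pred ⟶ Γ.2.pred
  comm : ∀ {Y : C} (d : Δ.2.pred.obj (op Y)), pr Γ (ap map d) = pr Δ d ≫ sub

instance : Category.{u} (Ctx K) where
  Hom := Hom
  id Γ := ⟨𝟙 _, 𝟙 _, fun d => (Category.comp_id _).symm⟩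
  comp τ σ := ⟨τ.sub ≫ σ.sub, τ.map ≫ σ.map, fun d => by
    refine (σ.comm (ap τ.map d)).trans ?_
    rw [τ.comm, Category.assoc]⟩
  id_comp f := Hom.ext (Category.id_comp _) (Category.id_comp _)
  comp_id f := Hom.ext (Category.comp_id _) (Category.comp_id _)
  assoc f g h := Hom.ext (Category.assoc _ _ _) (Category.assoc _ _ _)

theorem hom_ext {Δ Γ : Ctx K} {τ τ' : Δ ⟶ Γ} (h : τ.sub = τ'.sub)
    (h' : ∀ {Y : C} (d : Δ.2.pred.obj (op Y)), ap τ.map d = ap τ'.map d) : τ = τ' :=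
  Hom.ext h (psh_hom_ext h')

variable (K) in
def contexts : Contexts.{u, max w (u+1)} C where
  Con := Con K
  cat := inferInstance
  base σ := K.base σ.sub
  base_id Γ := K.base_id _
  base_comp τ σ := K.base_comp _ _
  exists_lift Γ {Y} f := by
    obtain ⟨Γf, l, hl, H⟩ := K.exists_lift (under Γ) f
    let G : Cᵒᵖ ⥤ Type u := mkPsh
      (fun Z => {x : (K.unit Z ⟶ (⟨Y, Γf⟩ : K.Ctx)) × Γ.2.pred.obj (op Z) // pr Γ x.2 = x.1 ≫ l})
      (fun k x => ⟨(K.unitMap k ≫ x.1.1, res _ k x.1.2), by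
        rw [pr_res, x.2, Category.assoc]⟩)
      (fun x => Subtype.ext (Prod.ext (by simp [unitMap_id]) (res_id _ _)))
      (fun k k' x => Subtype.ext (Prod.ext (by simp [unitMap_comp]) (res_res _ _ _ _)))
    refine ⟨⟨Γf, G, mkHom (fun x => x.1.1) (fun _ _ => rfl)⟩,
      ⟨l, mkHom (fun x => x.1.2) (fun _ _ => rfl), fun d => d.2⟩, hl, ?_⟩
    intro Δ τ g hg
    obtain ⟨τ', ⟨h1, h2⟩, hu⟩ := H (under Δ) τ.sub g hg
    refine ⟨⟨τ', mkHom (fun d => ⟨(pr Δ d ≫ τ', ap τ.map d), ?_⟩) ?_, ?_⟩, ⟨h1, ?_⟩, ?_⟩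
    · rw [Category.assoc, h2]; exact τ.comm d
    · intro X Z k d
      refine Subtype.ext (Prod.ext ?_ (ap_res _ _ _))
      show pr Δ (res _ k d) ≫ τ' = K.unitMap k ≫ (pr Δ d ≫ τ')
      rw [pr_res, Category.assoc]
    · intro Z d; rfl
    · exact hom_ext h2 (fun d => rfl)
    · rintro σ ⟨e1, e2⟩
      have es : σ.sub = τ' := hu σ.sub ⟨e1, congrArg Hom.sub e2⟩
      refine hom_ext es (fun d => Subtype.ext (Prod.ext ?_ ?_))
      · have := σ.comm d
        rw [es] at this
        exact this
      · exact congrArg (fun κ : Hom Δ Γ => ap κ.map d) e2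
  unitCon X := ⟨K.unitCon X, K.pts (K.unit X), 𝟙 _⟩
  toUnit Δ {X} f := ⟨K.toUnit _ f,
    mkHom (fun d => pr Δ d ≫ K.toUnit (under Δ) f) (fun k d => by
      rw [pr_res, Category.assoc]; rfl), fun d => rfl⟩
  base_toUnit Δ {X} f := K.base_toUnit (under Δ) f
  toUnit_uniq {Δ X} τ := by
    refine hom_ext (K.toUnit_uniq τ.sub) (fun {Y} d => ?_)
    exact (congrArg (pr Δ d ≫ ·) (K.toUnit_uniq τ.sub)).trans (τ.comm d).symm


/-! types -/

/-- A type `A` of `M` in context `Γ`. The field `cl` is a redundant name for the closed types `A ρ`, which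
makes substitution strict for the families over `|A|`. -/
structure Closed (Γ : Ctx K) where
  ty : K.TyAt (under Γ)
  cl : ∀ {Y : C}, Γ.2.pred.obj (op Y) → K.TyAt (K.unit Y)
  cl_eq : ∀ {Y : C} (g : Γ.2.pred.obj (op Y)), Cwf.sub ty (pr Γ g) = cl g

namespace Closed
variable {Γ Δ : Ctx K} (A : Closed Γ)

theorem cl_res {X Y : C} (f : Y ⟶ X) (g : Γ.2.pred.obj (op X)) :
    Cwf.sub (A.cl g) (K.unitMap f) = A.cl (res _ f g) := by
  rw [← A.cl_eq, ← A.cl_eq, Cwf.sub_sub, pr_res]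

/-- the triples `(ρ, ρ', a)` with `a : |A| ρ = Elem(1, A ρ)` -/
def secs : Cᵒᵖ ⥤ Type u :=
  mkPsh (fun Y => Σ g : Γ.2.pred.obj (op Y), K.Tm.obj (A.cl g))
    (fun f s => ⟨res _ f s.1, K.Tm.map (K.unitMap f) (A.cl_res f s.1) s.2⟩)
    (fun {X} s => Sigma.ext (res_id _ _) (by
      refine HEq.trans (K.Tm.map_heq (K.unitMap_id X) _ (res_id _ _) rfl HEq.rfl) ?_
      exact heq_of_eq (K.Tm.map_id _ _)))
    (fun f g s => Sigma.ext (res_res _ _ _ _) (by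
      dsimp only
      rw [K.Tm.map_map]
      exact K.Tm.map_heq (K.unitMap_comp f g).symm _ _ rfl HEq.rfl))

/-- the element `a ρ` of `|A| ρ` -/
def ev (a : K.Tm.obj A.ty) {Y : C} (g : Γ.2.pred.obj (op Y)) : K.Tm.obj (A.cl g) :=
  K.Tm.map (pr Γ g) (A.cl_eq g) a

def elem {Y : C} (g : Γ.2.pred.obj (op Y)) (a : K.Tm.obj (A.cl g)) : A.secs.obj (op Y) := ⟨g, a⟩

theorem res_elem {X Y : C} (f : Y ⟶ X) {g : Γ.2.pred.obj (op X)} {a : K.Tm.obj (A.cl g)}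
    {g' : Γ.2.pred.obj (op Y)} {a' : K.Tm.obj (A.cl g')} (hg : res _ f g = g')
    (ha : K.Tm.map (K.unitMap f) (by rw [← hg]; exact A.cl_res f g) a = a') :
    res A.secs f (A.elem g a) = A.elem g' a' := by
  subst hg ha; rfl

theorem ev_res (a : K.Tm.obj A.ty) {X Y : C} (f : Y ⟶ X) (g : Γ.2.pred.obj (op X)) :
    K.Tm.map (K.unitMap f) (A.cl_res f g) (A.ev a g) = A.ev a (res _ f g) := by
  rw [ev, ev, K.Tm.map_map]
  exact K.Tm.map_eq (pr_res Γ f g).symm _ _ _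

def pullback (σ : Δ ⟶ Γ) : Closed Δ where
  ty := Cwf.sub A.ty σ.sub
  cl d := A.cl (ap σ.map d)
  cl_eq d := by rw [Cwf.sub_sub, ← A.cl_eq, σ.comm]

def secsMap (σ : Δ ⟶ Γ) : (A.pullback σ).secs ⟶ A.secs :=
  mkHom (fun s => ⟨ap σ.map s.1, s.2⟩) (fun f s => Sigma.ext (ap_res _ _ _) (by
    exact K.Tm.map_heq rfl _ _ rfl HEq.rfl))

theorem ev_pullback (σ : Δ ⟶ Γ) (a : K.Tm.obj A.ty) {t : K.TyAt (under Δ)}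
    (e : Cwf.sub A.ty σ.sub = t) {Y : C}
    (d : Δ.2.pred.obj (op Y)) (h : Cwf.sub t (pr Δ d) = A.cl (ap σ.map d)) :
    K.Tm.map (pr Δ d) h (K.Tm.map σ.sub e a) = A.ev a (ap σ.map d) := by
  rw [Closed.ev, K.Tm.map_map]
  exact K.Tm.map_eq (σ.comm d).symm _ _ _

end Closed

/-- A (raw) type `(A, A')` of the sconing: a type `A` of `M` in context `Γ` together with a family
`A' ρ ρ' a` for `a : |A| ρ`. -/
structure Ty (Γ : Ctx K) extends Closed Γ where
  fam : Fam.{u, u, u, u} toClosed.secs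

namespace Ty
variable {Γ Δ Θ : Ctx K}

def pullback (A : Ty Γ) (σ : Δ ⟶ Γ) : Ty Δ where
  toClosed := A.toClosed.pullback σ
  fam := A.fam.pull (A.secsMap σ)

theorem mk_congr {t t' : K.TyAt (under Γ)} (h : t = t')
    (cl : ∀ {Y : C}, Γ.2.pred.obj (op Y) → K.TyAt (K.unit Y))
    (e : ∀ {Y : C} (g : Γ.2.pred.obj (op Y)), Cwf.sub t (pr Γ g) = cl g)
    (e' : ∀ {Y : C} (g : Γ.2.pred.obj (op Y)), Cwf.sub t' (pr Γ g) = cl g)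
    (F : Fam.{u, u, u, u} (Closed.mk t cl e).secs) :
    Ty.mk ⟨t, cl, e⟩ F = Ty.mk ⟨t', cl, e'⟩ F := by subst h; rfl

theorem pullback_id (A : Ty Γ) : A.pullback (𝟙 Γ) = A :=
  mk_congr (res_id _ _) A.cl (A.toClosed.pullback (𝟙 Γ)).cl_eq A.cl_eq A.fam

theorem pullback_comp (A : Ty Γ) (σ : Δ ⟶ Γ) (τ : Θ ⟶ Δ) :
    (A.pullback σ).pullback τ = A.pullback (τ ≫ σ) :=
  mk_congr (res_res _ _ _ _) (A.pullback (τ ≫ σ)).cl ((A.toClosed.pullback σ).pullback τ).cl_eq (A.pullback (τ ≫ σ)).cl_eq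
    (A.pullback (τ ≫ σ)).fam

end Ty

variable (K) in
def tyPsh : (Ctx K)ᵒᵖ ⥤ Type (max w' (u+1)) :=
  mkPsh (fun Γ => Ty Γ) (fun σ A => A.pullback σ) (fun A => A.pullback_id)
    (fun σ τ A => A.pullback_comp σ τ)

/-- An element `(a, a')`: an element `a` of `A` together with `a' ρ ρ' : A' ρ ρ' (a ρ)`, naturally. -/
structure Tm {Γ : Ctx K} (A : Ty Γ) where
  tm : K.Tm.obj A.ty
  sec : ∀ {Y : C} (g : Γ.2.pred.obj (op Y)), A.fam.obj (A.elem g (A.ev tm g))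
  nat : ∀ {X Y : C} (f : Y ⟶ X) (g : Γ.2.pred.obj (op X)),
    A.fam.map f (A.res_elem f rfl (A.ev_res tm f g)) (sec g) = sec (res _ f g)

namespace Tm
variable {Γ Δ Θ : Ctx K}

theorem ext {A : Ty Γ} {x y : Tm A} (h : x.tm = y.tm)
    (h' : ∀ {Y : C} (g : Γ.2.pred.obj (op Y)), HEq (x.sec g) (y.sec g)) : x = y := by
  obtain ⟨t, s, n⟩ := x
  obtain ⟨t', s', n'⟩ := y
  obtain rfl : t = t' := h
  obtain rfl : @s = @s' := by
    funext Y g; exact eq_of_heq (h' g)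
  rfl

theorem sec_heq {A : Ty Γ} (x : Tm A) {Y : C} {g g' : Γ.2.pred.obj (op Y)} (h : g = g') :
  HEq (x.sec g) (x.sec g') := by subst h; rfl

theorem map_aux {A : Ty Γ} (σ : Δ ⟶ Γ) {B : Ty Δ} (h : A.pullback σ = B) (x : Tm A) {Y : C}
    (d : Δ.2.pred.obj (op Y)) :
    A.fam.obj (A.elem (ap σ.map d) (A.ev x.tm (ap σ.map d)))
      = B.fam.obj (B.elem d (B.ev (K.Tm.map σ.sub (congrArg (fun T : Ty Δ => T.ty) h) x.tm) d)) := by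
  subst h
  exact congrArg (fun a => A.fam.obj (A.elem (ap σ.map d) a)) (A.ev_pullback σ x.tm rfl d _).symm

def map {A : Ty Γ} (σ : Δ ⟶ Γ) {B : Ty Δ} (h : A.pullback σ = B) (x : Tm A) : Tm B where
  tm := K.Tm.map σ.sub (congrArg (fun T : Ty Δ => T.ty) h) x.tm
  sec d := cast (map_aux σ h x d) (x.sec (ap σ.map d))
  nat f d := by
    subst h
    refine eq_of_heq (HEq.trans (A.fam.map_heq rfl _ (A.res_elem f rfl (A.ev_res x.tm f _)) ?_
      (cast_heq _ _)) ?_)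
    · exact congrArg (A.elem (ap σ.map d)) (A.ev_pullback σ x.tm rfl d _)
    · rw [x.nat]
      exact (x.sec_heq (ap_res _ _ _).symm).trans (cast_heq _ _).symm

theorem map_sec {A : Ty Γ} (σ : Δ ⟶ Γ) {B : Ty Δ} (h : A.pullback σ = B) (x : Tm A) {Y : C}
    (d : Δ.2.pred.obj (op Y)) : HEq ((x.map σ h).sec d) (x.sec (ap σ.map d)) := cast_heq _ _

end Tm

variable (K) in
def tmFam : Fam.{u, max (u + 1) w, max w' (u+1), u} (tyPsh K) where
  obj A := Tm A
  map := fun {_ _} σ {_ _} h x => Tm.map σ h x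
  map_id := fun {_ _} h x => Tm.ext (K.Tm.map_id _ _) (fun g => Tm.map_sec _ h x g)
  map_comp := fun {_ _ _} σ τ {_ _ _} h k l x => Tm.ext (K.Tm.map_map _ _ _) (fun g =>
    (Tm.map_sec τ k (x.map σ h) g).trans ((Tm.map_sec σ h x _).trans (Tm.map_sec (τ ≫ σ) l x g).symm))


/-! context extension -/

variable {Γ Δ Θ : Ctx K}

abbrev Ty.total (A : Ty Γ) : Cᵒᵖ ⥤ Type u := A.fam.tot

/-- the element `(ρ, a)` of `|Γ.A|` -/
def Closed.proj (A : Closed Γ) : A.secs ⟶ K.pts (K.extend (under Γ) A.ty) :=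
  mkHom (fun s => K.pair (pr Γ s.1) (A.cl_eq s.1) s.2) (fun f s => by
    refine (Cwf.pair_congr (pr_res Γ f s.1) _ (by rw [← pr_res]; exact A.cl_eq _) _).trans ?_
    exact (Cwf.comp_pair _ _ _ _ _).symm)

def Ty.fstMap (A : Ty Γ) : A.total ⟶ A.secs := mkHom Sigma.fst (fun _ _ => rfl)

def extCon (Γ : Ctx K) (A : Ty Γ) : Con K Γ.1 where
  ctx := K.ext (under Γ) A.ty
  pred := A.total
  proj := A.fstMap ≫ A.proj

abbrev extend (Γ : Ctx K) (A : Ty Γ) : Ctx K := ⟨Γ.1, extCon Γ A⟩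

def p (A : Ty Γ) : extend Γ A ⟶ Γ where
  sub := K.p A.ty
  map := mkHom (fun t => t.1.1) (fun _ _ => rfl)
  comm t := (K.pair_p _ _ _).symm

theorem q_aux (A : Ty Γ) {Y : C} (t : A.total.obj (op Y)) :
    K.Tm.map (pr (extend Γ A) t) ((A.pullback (p A)).cl_eq t) (K.q A.ty) = t.1.2 :=
  K.pair_q _ _ _ _

def q (A : Ty Γ) : Tm (A.pullback (p A)) where
  tm := K.q A.ty
  sec t := cast (congrArg (fun a => A.fam.obj (A.elem t.1.1 a)) (q_aux A t).symm) t.2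
  nat f t := by
    refine eq_of_heq (HEq.trans (A.fam.map_heq rfl _ rfl ?_ (cast_heq _ _)) ?_)
    · exact congrArg (A.elem t.1.1) (q_aux A t)
    · exact (cast_heq _ _).symm

theorem q_sec (A : Ty Γ) {Y : C} (t : A.total.obj (op Y)) : HEq ((q A).sec t) t.2 := cast_heq _ _

theorem pair_aux (σ : Δ ⟶ Γ) {A : Ty Γ} {B : Ty Δ} (h : A.pullback σ = B) {Y : C}
    (d : Δ.2.pred.obj (op Y)) : Cwf.sub B.ty (pr Δ d) = A.cl (ap σ.map d) := by
  subst h; exact (A.pullback σ).cl_eq d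

theorem pair_aux' (σ : Δ ⟶ Γ) {A : Ty Γ} {B : Ty Δ} (h : A.pullback σ = B) (b : K.Tm.obj B.ty)
    {Y : C} (d : Δ.2.pred.obj (op Y)) : B.fam.obj (B.elem d (B.ev b d))
      = A.fam.obj (A.elem (ap σ.map d) (K.Tm.map (pr Δ d) (pair_aux σ h d) b)) := by
  subst h; rfl

def pair (σ : Δ ⟶ Γ) {A : Ty Γ} {B : Ty Δ} (h : A.pullback σ = B) (b : Tm B) :
    Δ ⟶ extend Γ A where
  sub := K.pair σ.sub (congrArg (fun T : Ty Δ => T.ty) h) b.tm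
  map := mkHom (fun d => ⟨A.elem (ap σ.map d) (K.Tm.map (pr Δ d) (pair_aux σ h d) b.tm),
    cast (pair_aux' σ h b.tm d) (b.sec d)⟩) (fun f d => by
      subst h
      refine Sigma.ext
        (A.res_elem f (ap_res _ _ _).symm ((A.pullback σ).ev_res b.tm f d)).symm ?_
      refine (heq_of_eq (b.nat f d).symm).trans ?_
      exact A.fam.map_heq rfl _ _ rfl HEq.rfl)
  comm d := by
    subst h
    exact (Cwf.pair_congr (σ.comm d) _ _ _).trans (Cwf.comp_pair _ _ _ _ _).symm

theorem pair_p (σ : Δ ⟶ Γ) {A : Ty Γ} {B : Ty Δ} (h : A.pullback σ = B) (b : Tm B) :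
    pair σ h b ≫ p A = σ := by
  subst h; exact hom_ext (K.pair_p _ _ _) (fun d => rfl)

theorem pair_q (σ : Δ ⟶ Γ) {A : Ty Γ} {B : Ty Δ} (h : A.pullback σ = B) (b : Tm B)
    (h' : (A.pullback (p A)).pullback (pair σ h b) = B) : (q A).map (pair σ h b) h' = b := by
  subst h
  exact Tm.ext (K.pair_q _ _ _ _)
    (fun d => (Tm.map_sec (pair σ rfl b) h' (q A) d).trans (q_sec A _))

theorem pair_uniq {A : Ty Γ} (τ : Δ ⟶ extend Γ A) {B : Ty Δ}
    (h : (A.pullback (p A)).pullback τ = B) (h' : A.pullback (τ ≫ p A) = B) :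
    pair (τ ≫ p A) h' ((q A).map τ h) = τ := by
  subst h'
  refine hom_ext (K.pair_uniq _ _ _) (fun d => ?_)
  refine Sigma.ext (Sigma.ext rfl (heq_of_eq ?_))
    ((Tm.map_sec τ h (q A) d).trans (q_sec A _))
  refine Eq.trans ?_ (q_aux A (ap τ.map d))
  refine (K.Tm.map_map _ _ _).trans ?_
  exact K.Tm.map_eq (τ.comm d).symm _ _ _

variable (K) in
/-- the category with families of the sconing -/
def cwf : Cwf.{u, max w (u+1), max w' (u+1)} C where
  toContexts := contexts K
  Ty := tyPsh K
  Tm := tmFam K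
  ext := fun Γ A => extCon Γ A
  p := fun {_} A => p A
  base_p := fun {_} A => K.base_p A.ty
  q := fun {_} A => q A
  pair := fun {_ _} σ {_ _} h b => pair σ h b
  pair_p := fun {_ _} σ {_ _} h b => pair_p σ h b
  pair_q := fun {_ _} σ {_ _} h b h' => pair_q σ h b h'
  pair_uniq := fun {_ _ _} τ {_} h h' => pair_uniq τ h h'


theorem Ty.ext' {A A' : Ty Γ} (h : A.ty = A'.ty)
    (ho : ∀ {Y : C} (g : Γ.2.pred.obj (op Y)) (c : K.Tm.obj (A.cl g)) (c' : K.Tm.obj (A'.cl g)),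
      HEq c c' → A.fam.obj (A.elem g c) = A'.fam.obj (A'.elem g c'))
    (hm : ∀ {X Y : C} (f : Y ⟶ X) {s : A.secs.obj (op X)} {r : A.secs.obj (op Y)}
      {s' : A'.secs.obj (op X)} {r' : A'.secs.obj (op Y)} (e : res A.secs f s = r)
      (e' : res A'.secs f s' = r'), s.1 = s'.1 → HEq s.2 s'.2 →
      ∀ (x : A.fam.obj s) (x' : A'.fam.obj s'), HEq x x' →
      HEq (A.fam.map f e x) (A'.fam.map f e' x')) : A = A' := by
  obtain ⟨⟨ty, cl, ce⟩, ⟨fo, fm, _, _⟩⟩ := A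
  obtain ⟨⟨ty', cl', ce'⟩, ⟨fo', fm', _, _⟩⟩ := A'
  obtain rfl : ty = ty' := h
  obtain rfl : @cl = @cl' := by
    funext Y g; exact (ce g).symm.trans (ce' g)
  obtain rfl : @fo = @fo' := by
    funext Y s; exact ho s.1 s.2 s.2 HEq.rfl
  obtain rfl : @fm = @fm' := by
    funext X Y f s r e x
    exact eq_of_heq (hm f e e rfl HEq.rfl x x HEq.rfl)
  rfl

/-- The base change of context extensions, with an explicit underlying map. -/
def lift' (σ : Δ ⟶ Γ) (A : Ty Γ) : extend Δ (A.pullback σ) ⟶ extend Γ A where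
  sub := Cwf.lift σ.sub rfl
  map := mkHom (fun t => ⟨A.elem (ap σ.map t.1.1) t.1.2, t.2⟩) (fun f t => by
    refine Sigma.ext ?_ ?_
    · exact (ap_res (A.secsMap σ) f t.1)
    · exact A.fam.map_heq rfl _ _ rfl HEq.rfl)
  comm t := by
    refine Eq.symm ((Cwf.pair_lift _ _ _ _ _).trans ?_)
    exact Cwf.pair_congr (σ.comm _).symm _ _ _

theorem lift_eq (σ : Δ ⟶ Γ) (A : Ty Γ) :
    Cwf.lift (K := cwf K) σ (A := A) (A' := A.pullback σ) rfl = lift' σ A := by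
  refine hom_ext rfl (fun t => ?_)
  refine Sigma.ext (congrArg (A.elem (ap σ.map t.1.1)) (q_aux (A.pullback σ) t)) ?_
  exact q_sec (A.pullback σ) t

/-! ### Dependent products -/

/-- `a ↦ iapp(c, a)` with flexible types -/
def kapp {P : CubeBase C} (F : TypeFormers P K) {Θ : K.Ctx} {T : K.TyAt Θ} {A : K.TyAt Θ}
    {B : K.TyAt (K.extend Θ A)} {R : K.TyAt Θ} (h : T = F.Pi A B) (c : K.Tm.obj T)
    (a : K.Tm.obj A) (hR : Cwf.sub B (Cwf.inst a) = R) : K.Tm.obj R :=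
  K.Tm.map (Cwf.inst a) hR (F.unlam (cast (congrArg (fun T => K.Tm.obj T) h) c))

section
variable {P : CubeBase C} (F : TypeFormers P K)

theorem kapp_heq {Θ : K.Ctx} {T T' : K.TyAt Θ} {A A' : K.TyAt Θ}
    {B : K.TyAt (K.extend Θ A)} {B' : K.TyAt (K.extend Θ A')} {R R' : K.TyAt Θ}
    (h : T = F.Pi A B) (h' : T' = F.Pi A' B') {c : K.Tm.obj T} {c' : K.Tm.obj T'}
    {a : K.Tm.obj A} {a' : K.Tm.obj A'} (hR : Cwf.sub B (Cwf.inst a) = R)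
    (hR' : Cwf.sub B' (Cwf.inst a') = R') (eA : A = A') (eB : HEq B B')
    (ec : HEq c c') (ea : HEq a a') : HEq (kapp F h c a hR) (kapp F h' c' a' hR') := by
  subst eA
  obtain rfl := eq_of_heq eB
  obtain rfl := eq_of_heq ea
  subst h h' hR hR'
  obtain rfl := eq_of_heq ec
  rfl

theorem kapp_sub {Ξ Θ : K.Ctx} (τ : Ξ ⟶ Θ) {T : K.TyAt Θ} {A : K.TyAt Θ}
    {B : K.TyAt (K.extend Θ A)} {R : K.TyAt Θ} (h : T = F.Pi A B) (c : K.Tm.obj T)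
    (a : K.Tm.obj A) (hR : Cwf.sub B (Cwf.inst a) = R)
    {T' : K.TyAt Ξ} {A' : K.TyAt Ξ} {B' : K.TyAt (K.extend Ξ A')} {R' : K.TyAt Ξ}
    (h' : T' = F.Pi A' B') (eT : Cwf.sub T τ = T') (eA : Cwf.sub A τ = A')
    (eB : Cwf.sub B (Cwf.lift τ eA) = B')
    (hR' : Cwf.sub B' (Cwf.inst (K.Tm.map τ eA a)) = R') (eR : Cwf.sub R τ = R') :
    K.Tm.map τ eR (kapp F h c a hR) = kapp F h' (K.Tm.map τ eT c) (K.Tm.map τ eA a) hR' := by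
  subst h hR eA eB eT eR
  have e1 := F.unlam_sub' τ rfl rfl (F.Pi_sub _ _ _) c
  have e2 : cast (congrArg (fun T => K.Tm.obj T) h') (K.Tm.map τ rfl c)
      = K.Tm.map τ (F.Pi_sub _ _ _) c :=
    eq_of_heq ((cast_heq _ _).trans (K.Tm.map_heq'' _ _ _ _))
  rw [kapp, kapp, e2, e1, cast_eq, K.Tm.map_map, K.Tm.map_map]
  exact K.Tm.map_eq (Cwf.comp_inst τ rfl a) _ _ _

variable (A : Ty Γ) (B : Ty (extend Γ A))

/-- the type `B` of the model `M` in context `1.A(ρ)` -/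
abbrev clB {Y : C} (g : Γ.2.pred.obj (op Y)) : K.TyAt (K.extend (K.unit Y) (A.cl g)) :=
  Cwf.sub B.ty (Cwf.lift (pr Γ g) (A.cl_eq g))

/-- The element `(ρ, a), (ρ', a')` of the extended context. -/
abbrev tot {Y : C} (g : Γ.2.pred.obj (op Y)) (a : K.Tm.obj (A.cl g))
    (x : A.fam.obj (A.elem g a)) : A.total.obj (op Y) := ⟨A.elem g a, x⟩

theorem clB_inst {Y : C} (g : Γ.2.pred.obj (op Y)) (a : K.Tm.obj (A.cl g))
    (x : A.fam.obj (A.elem g a)) : Cwf.sub (clB A B g) (Cwf.inst a) = B.cl (tot A g a x) := by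
  refine Eq.trans ?_ (B.cl_eq (tot A g a x))
  refine (Cwf.sub_sub B.ty _ _).trans ?_
  refine congrArg (fun σ => Cwf.sub B.ty σ) ?_
  exact (Cwf.pair_lift _ _ _ _ _).trans (Cwf.pair_congr (Category.id_comp _) _ _ _)

theorem cl_res' {Z W : C} (k : W ⟶ Z) {g : Γ.2.pred.obj (op Z)} {g' : Γ.2.pred.obj (op W)}
    (h : res _ k g = g') : Cwf.sub (A.cl g) (K.unitMap k) = A.cl g' := by
  subst h; exact A.cl_res k g

theorem res_tot {Z W : C} (k : W ⟶ Z) {g : Γ.2.pred.obj (op Z)} {g' : Γ.2.pred.obj (op W)}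
    (h : res _ k g = g') {a : K.Tm.obj (A.cl g)} {a' : K.Tm.obj (A.cl g')}
    (ha : K.Tm.map (K.unitMap k) (cl_res' A k h) a = a') {x : A.fam.obj (A.elem g a)}
    {x' : A.fam.obj (A.elem g' a')} (hx : A.fam.map k (A.res_elem k h ha) x = x') :
    res A.total k (tot A g a x) = tot A g' a' x' := by
  subst h ha hx; rfl

/-- Data for the fibre of a dependent product: the restrictions of `ρ'`, and the function `iapp`. -/
@[ext]
structure PiData (Y : C) where
  γ : ∀ {Z : C}, (Z ⟶ Y) → Γ.2.pred.obj (op Z)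
  hγ : ∀ {Z W : C} (f : Z ⟶ Y) (k : W ⟶ Z) (f' : W ⟶ Y), k ≫ f = f' → res _ k (γ f) = γ f'
  ω : ∀ {Z : C} (f : Z ⟶ Y) (a : K.Tm.obj (A.cl (γ f))) (x : A.fam.obj (A.elem (γ f) a)),
    K.Tm.obj (B.cl (tot A (γ f) a x))
  hω : ∀ {Z W : C} (f : Z ⟶ Y) (k : W ⟶ Z) (f' : W ⟶ Y) (e : k ≫ f = f'),
    ∀ (a : K.Tm.obj (A.cl (γ f))) (x : A.fam.obj (A.elem (γ f) a))
      (a' : K.Tm.obj (A.cl (γ f'))) (x' : A.fam.obj (A.elem (γ f') a'))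
      (ha : K.Tm.map (K.unitMap k) (cl_res' A k (hγ f k f' e)) a = a'),
      A.fam.map k (A.res_elem k (hγ f k f' e) ha) x = x' →
    res B.secs k (B.elem (tot A (γ f) a x) (ω f a x)) = B.elem (tot A (γ f') a' x') (ω f' a' x')

variable {A B}
/-- Natural families of elements of `B' (ρ, a) (ρ', a') (iapp(c, a))` -/
def PiFib {Y : C} (D : PiData A B Y) : Type u :=
  {y : ∀ {Z : C} (f : Z ⟶ Y) (a : K.Tm.obj (A.cl (D.γ f))) (x : A.fam.obj (A.elem (D.γ f) a)),
      B.fam.obj (B.elem (tot A (D.γ f) a x) (D.ω f a x)) //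
    ∀ {Z W : C} (f : Z ⟶ Y) (k : W ⟶ Z) (f' : W ⟶ Y) (e : k ≫ f = f')
      (a : K.Tm.obj (A.cl (D.γ f))) (x : A.fam.obj (A.elem (D.γ f) a))
      (a' : K.Tm.obj (A.cl (D.γ f'))) (x' : A.fam.obj (A.elem (D.γ f') a'))
      (ha : K.Tm.map (K.unitMap k) (cl_res' A k (D.hγ f k f' e)) a = a')
      (hx : A.fam.map k (A.res_elem k (D.hγ f k f' e) ha) x = x'),
      B.fam.map k (D.hω f k f' e a x a' x' ha hx) (y f a x) = y f' a' x'}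

theorem tot_heq {Y : C} {g g' : Γ.2.pred.obj (op Y)} {a : K.Tm.obj (A.cl g)} {a' : K.Tm.obj (A.cl g')}
    {x : A.fam.obj (A.elem g a)} {x' : A.fam.obj (A.elem g' a')} (h : tot A g a x = tot A g' a' x') :
    g = g' ∧ HEq a a' ∧ HEq x x' := by
  have h1 := congrArg Sigma.fst h
  have h2 : g = g' := congrArg Sigma.fst h1
  have h3 : HEq a a' := (Sigma.mk.inj_iff.1 h1).2
  exact ⟨h2, h3, (Sigma.mk.inj_iff.1 h).2⟩

namespace PiFib

/-- function application -/
def at' {Y : C} {D : PiData A B Y} (y : PiFib D) {Z : C} (f : Z ⟶ Y) (a : K.Tm.obj (A.cl (D.γ f)))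
    (x : A.fam.obj (A.elem (D.γ f) a)) : B.fam.obj (B.elem (tot A (D.γ f) a x) (D.ω f a x)) :=
  y.1 f a x

theorem ext {Y : C} {D : PiData A B Y} {y y' : PiFib D} (h : ∀ {Z : C} (f : Z ⟶ Y)
    (a : K.Tm.obj (A.cl (D.γ f))) (x : A.fam.obj (A.elem (D.γ f) a)), y.at' f a x = y'.at' f a x) :
    y = y' := by
  apply Subtype.ext
  funext Z f a x
  exact h f a x

theorem at_heq {Y : C} {D D' : PiData A B Y} (hD : D = D') {y : PiFib D} {y' : PiFib D'}
    (hy : HEq y y') {Z : C} {f f' : Z ⟶ Y} (hf : f = f') {a : K.Tm.obj (A.cl (D.γ f))}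
    {a' : K.Tm.obj (A.cl (D'.γ f'))} (ha : HEq a a')
    {x : A.fam.obj (A.elem (D.γ f) a)} {x' : A.fam.obj (A.elem (D'.γ f') a')} (hx : HEq x x') :
    HEq (y.at' f a x) (y'.at' f' a' x') := by
  subst hD hf
  obtain rfl := eq_of_heq hy
  obtain rfl := eq_of_heq ha
  obtain rfl := eq_of_heq hx
  rfl

end PiFib

theorem PiData.ω_heq {Y : C} (D : PiData A B Y) {Z : C} {f f' : Z ⟶ Y} (hf : f = f')
    {a : K.Tm.obj (A.cl (D.γ f))}
    {a' : K.Tm.obj (A.cl (D.γ f'))} (ha : HEq a a')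
    {x : A.fam.obj (A.elem (D.γ f) a)} {x' : A.fam.obj (A.elem (D.γ f') a')} (hx : HEq x x') :
    HEq (D.ω f a x) (D.ω f' a' x') := by
  subst hf
  obtain rfl := eq_of_heq ha
  obtain rfl := eq_of_heq hx
  rfl

theorem PiData.ext' {Y : C} {D D' : PiData A B Y} (h : ∀ {Z : C} (f : Z ⟶ Y), D.γ f = D'.γ f)
    (h' : ∀ {Z : C} (f : Z ⟶ Y) (a : K.Tm.obj (A.cl (D.γ f))) (a' : K.Tm.obj (A.cl (D'.γ f)))
     (x : A.fam.obj (A.elem (D.γ f) a)) (x' : A.fam.obj (A.elem (D'.γ f) a')), HEq a a' → HEq x x' →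
     HEq (D.ω f a x) (D'.ω f a' x')) : D = D' := by
  obtain ⟨γ, hγ, ω, hω⟩ := D
  obtain ⟨γ', hγ', ω', hω'⟩ := D'
  obtain rfl : @γ = @γ' := by funext Z f; exact h f
  obtain rfl : @ω = @ω' := by
    funext Z f a x; exact eq_of_heq (h' f a a x x HEq.rfl HEq.rfl)
  rfl

theorem B_elem_congr {Y : C} {t t' : A.total.obj (op Y)} (h : t = t') {b : K.Tm.obj (B.cl t)}
    {b' : K.Tm.obj (B.cl t')} (hb : HEq b b') : B.elem t b = B.elem t' b' := by
  subst h; rw [eq_of_heq hb]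

theorem tot_congr {Y : C} {g g' : Γ.2.pred.obj (op Y)} (hg : g = g') {a : K.Tm.obj (A.cl g)}
    {a' : K.Tm.obj (A.cl g')} (ha : HEq a a')
    {x : A.fam.obj (A.elem g a)} {x' : A.fam.obj (A.elem g' a')} (hx : HEq x x') :
    tot A g a x = tot A g' a' x' := by
  subst hg
  obtain rfl := eq_of_heq ha
  obtain rfl := eq_of_heq hx
  rfl

/-- restriction of the data along `k` -/
def PiData.pre {X Y : C} (k : Y ⟶ X) (D : PiData A B X) : PiData A B Y where
  γ f := D.γ (f ≫ k)
  hγ f l f' e := D.hγ _ _ _ (by rw [← e, Category.assoc])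
  ω f a x := D.ω (f ≫ k) a x
  hω f l f' e := D.hω _ _ _ (by rw [← e, Category.assoc])

def PiFib.pre {X Y : C} (k : Y ⟶ X) {D : PiData A B X} (y : PiFib D) : PiFib (D.pre k) :=
  ⟨fun f a x => y.1 (f ≫ k) a x, fun f l f' e => y.2 _ _ _ (by rw [← e, Category.assoc])⟩

theorem PiFib.pre_heq {X Y : C} (k : Y ⟶ X) {D D' : PiData A B X} (h : D = D') {y : PiFib D}
    {y' : PiFib D'} (hy : HEq y y') : HEq (y.pre k) (y'.pre k) := by
  subst h
  obtain rfl := eq_of_heq hy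
  rfl

theorem PiFib.cast_at {Y : C} {D D' : PiData A B Y} (hD : D = D') (y : PiFib D)
    {Z : C} (f : Z ⟶ Y) {a : K.Tm.obj (A.cl (D.γ f))}
    {a' : K.Tm.obj (A.cl (D'.γ f))} (ha : HEq a a')
    {x : A.fam.obj (A.elem (D.γ f) a)} {x' : A.fam.obj (A.elem (D'.γ f) a')} (hx : HEq x x') :
    HEq ((cast (congrArg PiFib hD) y).at' f a' x') (y.at' f a x) :=
  PiFib.at_heq hD.symm (cast_heq _ _) rfl ha.symm hx.symm

theorem PiFib.heq {Y : C} {D D' : PiData A B Y} (hD : D = D') {y : PiFib D} {y' : PiFib D'}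
    (h : ∀ {Z : C} (f : Z ⟶ Y) (a : K.Tm.obj (A.cl (D.γ f))) (a' : K.Tm.obj (A.cl (D'.γ f)))
      (x : A.fam.obj (A.elem (D.γ f) a)) (x' : A.fam.obj (A.elem (D'.γ f) a')), HEq a a' →
      HEq x x' → HEq (y.at' f a x) (y'.at' f a' x')) : HEq y y' := by
  subst hD
  exact heq_of_eq (PiFib.ext fun f a x => eq_of_heq (h f a a x x HEq.rfl HEq.rfl))

/-! the family -/

variable (A B)
abbrev piTy : K.TyAt (under Γ) := F.Pi A.ty B.ty

def piClosed : Closed Γ where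
  ty := F.Pi A.ty B.ty
  cl g := Cwf.sub (F.Pi A.ty B.ty) (pr Γ g)
  cl_eq _ := rfl

theorem piClosed_cl {Y : C} (g : Γ.2.pred.obj (op Y)) :
    (piClosed F A B).cl g = F.Pi (A.cl g) (clB A B g) := F.Pi_sub' _ _ rfl

/-- `iapp(c, a)` for `c` in the dependent product over `ρ'` -/
def piApp {Y : C} (s : (piClosed F A B).secs.obj (op Y)) (a : K.Tm.obj (A.cl s.1))
    (x : A.fam.obj (A.elem s.1 a)) : K.Tm.obj (B.cl (tot A s.1 a x)) :=
  kapp F (piClosed_cl F A B s.1) s.2 a (clB_inst A B s.1 a x)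

theorem piApp_heq {Y : C} {s s' : (piClosed F A B).secs.obj (op Y)} (hs : s = s')
    {a : K.Tm.obj (A.cl s.1)} {a' : K.Tm.obj (A.cl s'.1)} (ha : HEq a a')
    {x : A.fam.obj (A.elem s.1 a)} {x' : A.fam.obj (A.elem s'.1 a')} (hx : HEq x x') :
    HEq (piApp F A B s a x) (piApp F A B s' a' x') := by
  subst hs
  obtain rfl := eq_of_heq ha
  obtain rfl := eq_of_heq hx
  rfl

theorem piApp_res {X Y : C} (k : Y ⟶ X) (s : (piClosed F A B).secs.obj (op X))
    (s' : (piClosed F A B).secs.obj (op Y)) (hs : res _ k s = s') (a : K.Tm.obj (A.cl s.1))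
    (x : A.fam.obj (A.elem s.1 a)) (a' : K.Tm.obj (A.cl s'.1)) (x' : A.fam.obj (A.elem s'.1 a'))
    (h : res A.total k (tot A s.1 a x) = tot A s'.1 a' x') :
    res B.secs k (B.elem (tot A s.1 a x) (piApp F A B s a x))
      = B.elem (tot A s'.1 a' x') (piApp F A B s' a' x') := by
  subst hs
  refine B_elem_congr h ?_
  obtain ⟨-, ha, hx⟩ := tot_heq h
  have e : Cwf.sub (clB A B s.1) (Cwf.lift (K.unitMap k) (A.cl_res k s.1))
      = clB A B (res Γ.2.pred k s.1) := by
    refine (Cwf.sub_sub B.ty _ _).trans ?_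
    refine congrArg (fun σ => Cwf.sub B.ty σ) ?_
    refine (Cwf.pair_lift _ _ _ _ _).trans ?_
    exact Cwf.pair_congr ((Category.assoc _ _ _).trans
      (congrArg (fun τ => K.p _ ≫ τ) (pr_res Γ k s.1).symm)) _ _ _
  have h1 := kapp_sub F (K.unitMap k) (piClosed_cl F A B s.1) s.2 a (clB_inst A B s.1 a x)
    (piClosed_cl F A B (res Γ.2.pred k s.1)) ((piClosed F A B).cl_res k s.1) (A.cl_res k s.1) e
    (clB_inst A B _ _ (A.fam.map k rfl x)) (B.cl_res k (tot A s.1 a x))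
  refine (heq_of_eq h1).trans ?_
  exact piApp_heq F A B (s := res _ k s) rfl ha hx

def piData {Y : C} (s : (piClosed F A B).secs.obj (op Y)) : PiData A B Y where
  γ f := (res (piClosed F A B).secs f s).1
  hγ f k f' e := by subst e; exact congrArg Sigma.fst (res_res _ f k s)
  ω f a x := piApp F A B (res _ f s) a x
  hω f k f' e a x a' x' ha hx :=
    piApp_res F A B k _ _ (by subst e; exact res_res _ _ _ _) a x a' x'
      (res_tot A k (by subst e; exact congrArg Sigma.fst (res_res _ f k s)) ha hx)

theorem piData_res {X Y : C} (k : Y ⟶ X) {s : (piClosed F A B).secs.obj (op X)}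
    {s' : (piClosed F A B).secs.obj (op Y)} (hs : res _ k s = s') :
    (piData F A B s).pre k = piData F A B s' := by
  subst hs
  exact PiData.ext' (fun f => congrArg Sigma.fst (res_res _ k f s).symm)
    (fun f a a' x x' ha hx => piApp_heq F A B (res_res _ k f s).symm ha hx)

theorem piMap_heq {X Y : C} (k : Y ⟶ X) {s : (piClosed F A B).secs.obj (op X)}
    {s' : (piClosed F A B).secs.obj (op Y)} (hs : res _ k s = s') (y : PiFib (piData F A B s)) :
    HEq (cast (congrArg PiFib (piData_res F A B k hs)) (y.pre k)) (y.pre k) := cast_heq _ _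

def pi : Ty Γ where
  toClosed := piClosed F A B
  fam := {
    obj := fun s => PiFib (piData F A B s)
    map := fun {_ _} k {_ _} h y => cast (congrArg PiFib (piData_res F A B k h)) (y.pre k)
    map_id := fun {X t} h y => eq_of_heq ((cast_heq _ _).trans
      (PiFib.heq (piData_res F A B (𝟙 X) h) fun f a a' x x' ha hx =>
        PiFib.at_heq (D := piData F A B t) (y := y) rfl HEq.rfl (Category.comp_id f) ha hx))
    map_comp := fun {X Y Z} f g {t s r} h k l y => eq_of_heq (by
      refine (cast_heq _ _).trans (HEq.trans ?_ (cast_heq _ _).symm)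
      refine (PiFib.pre_heq g (piData_res F A B f h).symm (cast_heq _ _)).trans ?_
      refine PiFib.heq ?_ fun f' a a' x x' ha hx =>
        PiFib.at_heq (D := piData F A B t) (y := y) rfl HEq.rfl (Category.assoc _ _ _) ha hx
      rw [piData_res F A B f h, piData_res F A B g k, piData_res F A B (g ≫ f) l]) }
end

section
variable {P : CubeBase C} (F : TypeFormers P K) {A : Ty Γ} {B : Ty (extend Γ A)}

/-- base change of data -/
def PiData.base (σ : Δ ⟶ Γ) {Y : C} (D : PiData (A.pullback σ) (B.pullback (lift' σ A)) Y) :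
    PiData A B Y where
  γ f := ap σ.map (D.γ f)
  hγ f k f' e := by rw [← ap_res, D.hγ f k f' e]
  ω f a x := D.ω f a x
  hω f k f' e a x a' x' ha hx :=
    (ap_res (B.secsMap (lift' σ A)) k _).symm.trans <|
      congrArg (ap (B.secsMap (lift' σ A))) (D.hω f k f' e a x a' x' ha hx)

theorem PiFib_base (σ : Δ ⟶ Γ) {Y : C} (D : PiData (A.pullback σ) (B.pullback (lift' σ A)) Y) :
    PiFib (D.base σ) = PiFib D := rfl

theorem clB_lift (σ : Δ ⟶ Γ) (A : Ty Γ) (B : Ty (extend Γ A)) {Y : C} (d : Δ.2.pred.obj (op Y)) :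
    clB (A.pullback σ) (B.pullback (lift' σ A)) d = clB A B (ap σ.map d) := by
  refine (Cwf.sub_sub B.ty _ _).trans ?_
  refine congrArg (fun τ => Cwf.sub B.ty τ) ?_
  refine (Cwf.pair_lift _ _ rfl _ _).trans ?_
  exact Cwf.pair_congr ((Category.assoc _ _ _).trans
    (congrArg (fun τ => K.p _ ≫ τ) (σ.comm d).symm)) _ _ _

/-- The fibres of dependent products at elements of `M` which agree. -/
theorem piData_base (σ : Δ ⟶ Γ) {Y : C} (s : (piClosed F A B).secs.obj (op Y))
    (s' : (piClosed F (A.pullback σ) (B.pullback (lift' σ A))).secs.obj (op Y))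
    (h : s.1 = ap σ.map s'.1) (h' : HEq s.2 s'.2) :
    piData F A B s = (piData F (A.pullback σ) (B.pullback (lift' σ A)) s').base σ := by
  have key : ∀ {Z : C} (f : Z ⟶ Y), res Γ.2.pred f s.1 = ap σ.map (res Δ.2.pred f s'.1) := by
    intro Z f; rw [h, ap_res]
  refine PiData.ext' (fun f => key f) (fun f a a' x x' ha hx => ?_)
  refine kapp_heq F (piClosed_cl F A B _) (piClosed_cl F (A.pullback σ) (B.pullback (lift' σ A)) _)
    (clB_inst A B _ a x) (clB_inst (A.pullback σ) (B.pullback (lift' σ A)) _ a' x') ?_ ?_ ?_ ha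
  · exact congrArg (fun g => A.cl g) (key f)
  · refine HEq.trans (b := clB A B (ap σ.map (res Δ.2.pred f s'.1))) ?_ (heq_of_eq (clB_lift σ A B _).symm)
    rw [← key f]; rfl
  · refine K.Tm.map_heq rfl _ _ ?_ h'
    refine Eq.trans (b := Cwf.sub (F.Pi A.ty B.ty) (pr Γ s.1)) rfl ?_
    rw [h, σ.comm, ← Cwf.sub_sub]
    exact congrArg (fun T => Cwf.sub T (pr Δ s'.1)) (F.Pi_sub σ.sub A.ty B.ty)

theorem pi_pullback (σ : Δ ⟶ Γ) (A : Ty Γ) (B : Ty (extend Γ A)) :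
    (pi F A B).pullback σ = pi F (A.pullback σ) (B.pullback (lift' σ A)) := by
  refine Ty.ext' (F.Pi_sub σ.sub A.ty B.ty) ?_ ?_
  · intro Y d c c' hc
    exact congrArg PiFib (piData_base F σ (A := A) (B := B) ⟨ap σ.map d, c⟩ ⟨d, c'⟩ rfl hc)
  · intro X Y f s r s' r' e e' h h' x x' hx
    refine (cast_heq _ _).trans (HEq.trans ?_ (cast_heq _ _).symm)
    exact PiFib.pre_heq f (piData_base F σ (A := A) (B := B) (ap (Closed.secsMap _ σ) s) s' (congrArg (ap σ.map) h) h') hx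


/-- `iapp(f ρ, a) = (unlam f)(ρ, a)` -/
theorem piApp_ev (w : K.Tm.obj (F.Pi A.ty B.ty)) {Y : C} (g : Γ.2.pred.obj (op Y))
    (a : K.Tm.obj (A.cl g)) (x : A.fam.obj (A.elem g a)) :
    piApp F A B ⟨g, (piClosed F A B).ev w g⟩ a x = B.ev (F.unlam w) (tot A g a x) := by
  have e1 := F.unlam_sub' (pr Γ g) (A.cl_eq g) rfl (piClosed_cl F A B g) w
  have e2 : cast (congrArg (fun T => K.Tm.obj T) (piClosed_cl F A B g)) ((piClosed F A B).ev w g)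
      = K.Tm.map (pr Γ g) (piClosed_cl F A B g) w :=
    eq_of_heq ((cast_heq _ _).trans (K.Tm.map_heq'' _ _ _ _))
  refine Eq.trans (congrArg (K.Tm.map (Cwf.inst a) (clB_inst A B g a x))
    ((congrArg F.unlam e2).trans e1)) ?_
  refine (K.Tm.map_map _ _ _).trans ?_
  refine K.Tm.map_eq ?_ _ _ _
  exact (Cwf.pair_lift _ _ (A.cl_eq g) _ _).trans (Cwf.pair_congr (Category.id_comp _) _ _ _)

variable (A B) in
abbrev piEv (w : K.Tm.obj (F.Pi A.ty B.ty)) {Y : C} (g : Γ.2.pred.obj (op Y)) :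
    (piClosed F A B).secs.obj (op Y) := (piClosed F A B).elem g ((piClosed F A B).ev w g)

theorem piEv_res (w : K.Tm.obj (F.Pi A.ty B.ty)) {X Y : C} (k : Y ⟶ X)
    (g : Γ.2.pred.obj (op X)) :
    res _ k (piEv F A B w g) = piEv F A B w (res _ k g) :=
  (piClosed F A B).res_elem k rfl ((piClosed F A B).ev_res w k g)

theorem piData_ev_ω (w : K.Tm.obj (F.Pi A.ty B.ty)) {X Y : C} (k : Y ⟶ X)
    (g : Γ.2.pred.obj (op X)) (a : K.Tm.obj (A.cl (res _ k g)))
    (x : A.fam.obj (A.elem (res _ k g) a)) :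
    (piData F A B (piEv F A B w g)).ω k a x = B.ev (F.unlam w) (tot A (res _ k g) a x) := by
  rw [← piApp_ev]
  exact eq_of_heq (piApp_heq F A B (piEv_res F w k g) HEq.rfl HEq.rfl)

/-- the second component of an element of the dependent product, applied -/
def unlamSec (w : Tm (pi F A B)) {Y : C} (t : A.total.obj (op Y)) :
    B.fam.obj (B.elem t (B.ev (F.unlam w.tm) t)) :=
  B.fam.map (𝟙 Y) ((res_id B.secs _).trans (B_elem_congr (res_id A.total t)
      ((heq_of_eq (piData_ev_ω F w.tm (𝟙 Y) t.1.1 _ _)).trans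
        (congr_arg_heq (fun t => B.ev (F.unlam w.tm) t) (res_id A.total t)))))
    ((w.sec t.1.1).at' (𝟙 Y) (K.Tm.map (K.unitMap (𝟙 Y)) (A.cl_res _ _) t.1.2)
      (A.fam.map (𝟙 Y) rfl t.2))

theorem unlamSec_heq (w : Tm (pi F A B)) {X Y : C} (k : Y ⟶ X) (g : Γ.2.pred.obj (op X))
    (t : A.total.obj (op Y)) (a : K.Tm.obj (A.cl ((piData F A B (piEv F A B w.tm g)).γ k)))
    (x : A.fam.obj (A.elem _ a)) (h : tot A _ a x = t) :
    HEq (unlamSec F w t) ((w.sec g).at' k a x) := by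
  subst h
  refine (B.fam.map_id_heq _ _).trans ?_
  have e := w.nat k g
  have e' : HEq (w.sec (res _ k g)) ((w.sec g).pre k) := (heq_of_eq e.symm).trans (cast_heq _ _)
  obtain ⟨-, ha, hx⟩ := tot_heq (res_id A.total (tot A _ a x))
  refine (PiFib.at_heq (D := piData F A B (piEv F A B w.tm (res _ k g)))
    (y := w.sec (res _ k g)) (y' := (w.sec g).pre k)
    (piData_res F A B k (piEv_res F w.tm k g)).symm e' rfl
    (a' := cast (by
      exact congrArg (fun f => K.Tm.obj (A.cl ((piData F A B (piEv F A B w.tm g)).γ f)))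
        (Category.id_comp k).symm) a) (ha.trans (cast_heq _ _).symm)
    (x' := cast (by
      refine congrArg (fun s : A.secs.obj (op Y) => A.fam.obj s) ?_
      exact Sigma.ext (congrArg (piData F A B (piEv F A B w.tm g)).γ (Category.id_comp k).symm)
        (cast_heq _ _).symm) x) (hx.trans (cast_heq _ _).symm)).trans ?_
  exact PiFib.at_heq (D := piData F A B (piEv F A B w.tm g)) (y := w.sec g) rfl HEq.rfl
    (Category.id_comp k) (cast_heq _ _) (cast_heq _ _)

theorem unlamSec_congr (w : Tm (pi F A B)) {Y : C} {t t' : A.total.obj (op Y)} (h : t = t') :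
    HEq (unlamSec F w t) (unlamSec F w t') := by subst h; rfl

def unlam (w : Tm (pi F A B)) : Tm B where
  tm := F.unlam w.tm
  sec t := unlamSec F w t
  nat {X Y} f t := by
    have h := res_id A.total t
    obtain ⟨-, ha, hx⟩ := tot_heq h
    have e := (w.sec t.1.1).2 (𝟙 X) f (f ≫ 𝟙 X) rfl
      (K.Tm.map (K.unitMap (𝟙 X)) (A.cl_res _ _) t.1.2) (A.fam.map (𝟙 X) rfl t.2) _ _ rfl rfl
    refine eq_of_heq ((B.fam.map_heq rfl _ _ ?_ (B.fam.map_id_heq _ _)).trans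
      ((heq_of_eq e).trans (unlamSec_heq F w (f ≫ 𝟙 X) t.1.1 _ _ _ ?_).symm))
    · exact B_elem_congr h.symm ((congr_arg_heq (fun t => B.ev (F.unlam w.tm) t) h.symm).trans
        (heq_of_eq (piData_ev_ω F w.tm (𝟙 X) t.1.1 _ _).symm))
    · refine (res_tot A f ((piData F A B (piEv F A B w.tm t.1.1)).hγ (𝟙 X) f _ rfl) rfl rfl).symm.trans ?_
      exact congrArg (res A.total f) h

theorem lam_aux (v : K.Tm.obj B.ty) {X Y : C} (k : Y ⟶ X) (g : Γ.2.pred.obj (op X))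
    (a : K.Tm.obj (A.cl (res _ k g))) (x : A.fam.obj (A.elem (res _ k g) a)) :
    B.ev v (tot A (res _ k g) a x) = (piData F A B (piEv F A B (F.unlam.symm v) g)).ω k a x :=
  (congrArg (fun v => B.ev v (tot A (res _ k g) a x)) ((F.unlam (A := A.ty) (B := B.ty)).apply_symm_apply v).symm).trans
    (piData_ev_ω F (F.unlam.symm v) k g a x).symm

def lam (v : Tm B) : Tm (pi F A B) where
  tm := F.unlam.symm v.tm
  sec {Y} g := ⟨fun f a x => cast (congrArg
      (fun b => B.fam.obj (B.elem (tot A (res _ f g) a x) b)) (lam_aux F v.tm f g a x)) (v.sec (tot A (res _ f g) a x)),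
    fun {Z W} f k f' e a x a' x' ha hx => by
      subst e
      have h := res_tot A k (res_res Γ.2.pred f k g) ha hx
      refine eq_of_heq ((B.fam.map_heq rfl _ _ ?_ (cast_heq _ _)).trans
        ((heq_of_eq (v.nat k _)).trans
        ((v.sec_heq h).trans (cast_heq _ _).symm)))
      exact congrArg (B.elem _) (lam_aux F v.tm f g a x).symm⟩
  nat {X Y} f g := by
    refine eq_of_heq ((cast_heq _ _).trans ?_)
    refine PiFib.heq ?_ (fun k a a' x x' ha hx => ?_)
    · exact piData_res F A B f (piEv_res F (F.unlam.symm v.tm) f g)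
    · refine (cast_heq _ _).trans (HEq.trans (v.sec_heq ?_) (cast_heq _ _).symm)
      exact tot_congr (res_res _ _ _ _).symm ha hx

theorem lam_at (v : Tm B) {Y Z : C} (g : Γ.2.pred.obj (op Y)) (f : Z ⟶ Y)
    (a : K.Tm.obj (A.cl (res _ f g))) (x : A.fam.obj (A.elem _ a)) :
    HEq (((lam F v).sec g).at' f a x) (v.sec (tot A (res _ f g) a x)) := cast_heq _ _

def unlamEquiv : Tm (pi F A B) ≃ Tm B where
  toFun := unlam F
  invFun := lam F
  left_inv w := by
    refine Tm.ext (F.unlam.symm_apply_apply _) (fun g => ?_)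
    refine PiFib.heq ?_ (fun f a a' x x' ha hx => ?_)
    · exact congrArg (fun w => piData F A B (piEv F A B w g)) (F.unlam.symm_apply_apply w.tm)
    · refine (cast_heq _ _).trans (unlamSec_heq F w f g _ a' x' ?_)
      exact tot_congr rfl ha.symm hx.symm
  right_inv v := by
    refine Tm.ext (F.unlam.apply_symm_apply _) (fun {Y} t => ?_)
    have h := res_id A.total t
    refine (unlamSec_heq F (lam F v) (𝟙 Y) t.1.1 t _ _ h).trans ?_
    exact (cast_heq _ _).trans (v.sec_heq h)

theorem unlam_map (σ : Δ ⟶ Γ) (w : Tm (pi F A B)) :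
    unlam F (w.map σ (pi_pullback F σ A B)) = (unlam F w).map (lift' σ A) rfl := by
  refine Tm.ext (F.unlam_sub σ.sub w.tm) (fun {Y} t => ?_)
  refine HEq.trans ?_ (Tm.map_sec (lift' σ A) rfl (unlam F w) t).symm
  refine HEq.trans ?_ (unlamSec_heq F w (𝟙 Y) (ap σ.map t.1.1) _ _ _
    (res_id A.total (ap (lift' σ A).map t))).symm
  refine (B.fam.map_id_heq _ _).trans ?_
  refine PiFib.at_heq (D := (piData F (A.pullback σ) (B.pullback (lift' σ A)) _).base σ)
    (y := ((w.map σ (pi_pullback F σ A B)).sec t.1.1))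
    (D' := piData F A B (piEv F A B w.tm (ap σ.map t.1.1))) (y' := w.sec (ap σ.map t.1.1))
    ?_ (Tm.map_sec _ _ _ _) rfl ?_ ?_
  · refine (piData_base F σ _ _ rfl ?_).symm
    refine HEq.trans ?_ (heq_of_eq (K.Tm.map_map _ _ _).symm)
    exact K.Tm.map_heq (σ.comm t.1.1) _ _ rfl HEq.rfl
  · exact K.Tm.map_heq rfl _ _ rfl HEq.rfl
  · exact A.fam.map_heq rfl _ _ rfl HEq.rfl
end

/-! ### Dependent sums -/

section
variable {P : CubeBase C} (F : TypeFormers P K)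

/-- first projection, with flexible types -/
def kfst {Θ : K.Ctx} {T : K.TyAt Θ} {A : K.TyAt Θ} {B : K.TyAt (K.extend Θ A)}
    (h : T = F.Sig A B) (c : K.Tm.obj T) : K.Tm.obj A :=
  (F.unpair (cast (congrArg (fun T => K.Tm.obj T) h) c)).1

/-- second projection, with flexible types -/
def ksnd {Θ : K.Ctx} {T : K.TyAt Θ} {A : K.TyAt Θ} {B : K.TyAt (K.extend Θ A)} {R : K.TyAt Θ}
    (h : T = F.Sig A B) (c : K.Tm.obj T) (hR : Cwf.sub B (Cwf.inst (kfst F h c)) = R) :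
    K.Tm.obj R :=
  cast (congrArg (fun T => K.Tm.obj T) hR) (F.unpair (cast (congrArg (fun T => K.Tm.obj T) h) c)).2

theorem kfst_heq {Θ : K.Ctx} {T T' : K.TyAt Θ} {A A' : K.TyAt Θ}
    {B : K.TyAt (K.extend Θ A)} {B' : K.TyAt (K.extend Θ A')}
    (h : T = F.Sig A B) (h' : T' = F.Sig A' B') {c : K.Tm.obj T} {c' : K.Tm.obj T'}
    (eA : A = A') (eB : HEq B B') (ec : HEq c c') : HEq (kfst F h c) (kfst F h' c') := by
  subst eA
  obtain rfl := eq_of_heq eB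
  subst h h'
  obtain rfl := eq_of_heq ec
  rfl

theorem ksnd_heq {Θ : K.Ctx} {T T' : K.TyAt Θ} {A A' : K.TyAt Θ}
    {B : K.TyAt (K.extend Θ A)} {B' : K.TyAt (K.extend Θ A')} {R R' : K.TyAt Θ}
    (h : T = F.Sig A B) (h' : T' = F.Sig A' B') {c : K.Tm.obj T} {c' : K.Tm.obj T'}
    (hR : Cwf.sub B (Cwf.inst (kfst F h c)) = R) (hR' : Cwf.sub B' (Cwf.inst (kfst F h' c')) = R')
    (eA : A = A') (eB : HEq B B') (ec : HEq c c') : HEq (ksnd F h c hR) (ksnd F h' c' hR') := by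
  subst eA
  obtain rfl := eq_of_heq eB
  subst h h'
  obtain rfl := eq_of_heq ec
  subst hR hR'
  rfl

theorem unpair_sub' {Ξ Θ : K.Ctx} (τ : Ξ ⟶ Θ) {A : K.TyAt Θ} {B : K.TyAt (K.extend Θ A)}
    (c : K.Tm.obj (F.Sig A B)) {A' : K.TyAt Ξ} {B' : K.TyAt (K.extend Ξ A')} {R : K.TyAt Ξ}
    (eA : Cwf.sub A τ = A') (eB : Cwf.sub B (Cwf.lift τ eA) = B')
    (h : Cwf.sub (F.Sig A B) τ = F.Sig A' B') (eR : Cwf.sub (Cwf.sub B (Cwf.inst (F.unpair c).1)) τ = R) :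
    (F.unpair (K.Tm.map τ h c)).1 = K.Tm.map τ eA (F.unpair c).1 ∧
    HEq (F.unpair (K.Tm.map τ h c)).2 (K.Tm.map τ eR (F.unpair c).2) := by
  subst eA eB
  have e := F.unpair_sub τ c
  have e1 := congrArg Sigma.fst e
  refine ⟨e1, ?_⟩
  have e2 := (Sigma.mk.inj_iff.1 e).2
  refine e2.trans ?_
  exact K.Tm.map_heq'' _ _ _ _

theorem kfst_sub {Ξ Θ : K.Ctx} (τ : Ξ ⟶ Θ) {T : K.TyAt Θ} {A : K.TyAt Θ}
    {B : K.TyAt (K.extend Θ A)} (h : T = F.Sig A B) (c : K.Tm.obj T)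
    {T' : K.TyAt Ξ} {A' : K.TyAt Ξ} {B' : K.TyAt (K.extend Ξ A')}
    (h' : T' = F.Sig A' B') (eT : Cwf.sub T τ = T') (eA : Cwf.sub A τ = A')
    (eB : Cwf.sub B (Cwf.lift τ eA) = B') :
    K.Tm.map τ eA (kfst F h c) = kfst F h' (K.Tm.map τ eT c) := by
  subst h eA eB eT
  have e1 := (unpair_sub' F τ c rfl rfl (F.Sig_sub _ _ _) rfl).1
  have e2 : cast (congrArg (fun T => K.Tm.obj T) h') (K.Tm.map τ rfl c)
      = K.Tm.map τ (F.Sig_sub _ _ _) c :=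
    eq_of_heq ((cast_heq _ _).trans (K.Tm.map_heq'' _ _ _ _))
  rw [kfst, kfst, e2, e1, cast_eq]

theorem ksnd_sub {Ξ Θ : K.Ctx} (τ : Ξ ⟶ Θ) {T : K.TyAt Θ} {A : K.TyAt Θ}
    {B : K.TyAt (K.extend Θ A)} {R : K.TyAt Θ} (h : T = F.Sig A B) (c : K.Tm.obj T)
    (hR : Cwf.sub B (Cwf.inst (kfst F h c)) = R)
    {T' : K.TyAt Ξ} {A' : K.TyAt Ξ} {B' : K.TyAt (K.extend Ξ A')} {R' : K.TyAt Ξ}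
    (h' : T' = F.Sig A' B') (eT : Cwf.sub T τ = T') (eA : Cwf.sub A τ = A')
    (eB : Cwf.sub B (Cwf.lift τ eA) = B')
    (hR' : Cwf.sub B' (Cwf.inst (kfst F h' (K.Tm.map τ eT c))) = R') (eR : Cwf.sub R τ = R') :
    K.Tm.map τ eR (ksnd F h c hR) = ksnd F h' (K.Tm.map τ eT c) hR' := by
  subst h eA eB eT hR eR
  have e1 := (unpair_sub' F τ c rfl rfl (F.Sig_sub _ _ _) rfl).2
  have e2 : cast (congrArg (fun T => K.Tm.obj T) h') (K.Tm.map τ rfl c)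
      = K.Tm.map τ (F.Sig_sub _ _ _) c :=
    eq_of_heq ((cast_heq _ _).trans (K.Tm.map_heq'' _ _ _ _))
  refine eq_of_heq (e1.symm.trans (HEq.trans ?_ (cast_heq _ _).symm))
  exact congr_arg_heq (fun c => (F.unpair c).2) e2.symm

variable (A : Ty Γ) (B : Ty (extend Γ A))

/-- Data for the fibre of a dependent sum: `ρ'` and the two projections of an element of `M`. -/
structure SigData (Y : C) where
  g : Γ.2.pred.obj (op Y)
  a : K.Tm.obj (A.cl g)
  b : ∀ x : A.fam.obj (A.elem g a), K.Tm.obj (B.cl (tot A g a x))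

variable {A B}
/-- Pairs of an element of `A' ρ ρ' a` and one of `B' (ρ, a) (ρ', a') b` -/
def SigFib {Y : C} (D : SigData A B Y) : Type u :=
  Σ x : A.fam.obj (A.elem D.g D.a), B.fam.obj (B.elem (tot A D.g D.a x) (D.b x))

theorem SigData.ext' {Y : C} {D D' : SigData A B Y} (h : D.g = D'.g) (ha : HEq D.a D'.a)
    (hb : ∀ x x', HEq x x' → HEq (D.b x) (D'.b x')) : D = D' := by
  obtain ⟨g, a, b⟩ := D
  obtain ⟨g', a', b'⟩ := D'
  obtain rfl : g = g' := h
  obtain rfl : a = a' := eq_of_heq ha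
  obtain rfl : @b = @b' := by funext x; exact eq_of_heq (hb x x HEq.rfl)
  rfl

theorem SigFib.heq {Y : C} {D D' : SigData A B Y} (h : D = D') {y : SigFib D} {y' : SigFib D'}
    (h1 : HEq y.1 y'.1) (h2 : HEq y.2 y'.2) : HEq y y' := by
  subst h; exact heq_of_eq (Sigma.ext (eq_of_heq h1) h2)

theorem SigData.elem_congr {Y : C} {D D' : SigData A B Y} (h : D = D')
    {x : A.fam.obj (A.elem D.g D.a)} {x' : A.fam.obj (A.elem D'.g D'.a)} (hx : HEq x x') :
    B.elem (tot A D.g D.a x) (D.b x) = B.elem (tot A D'.g D'.a x') (D'.b x') := by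
  subst h; obtain rfl := eq_of_heq hx; rfl

theorem SigFib.heq_parts {Y : C} {D D' : SigData A B Y} (h : D = D') {y : SigFib D} {y' : SigFib D'}
    (h1 : HEq y y') : HEq y.1 y'.1 ∧ HEq y.2 y'.2 := by
  subst h; obtain rfl := eq_of_heq h1; exact ⟨HEq.rfl, HEq.rfl⟩

variable (A B)

def sigClosed : Closed Γ where
  ty := F.Sig A.ty B.ty
  cl g := Cwf.sub (F.Sig A.ty B.ty) (pr Γ g)
  cl_eq _ := rfl

theorem sigClosed_cl {Y : C} (g : Γ.2.pred.obj (op Y)) :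
    (sigClosed F A B).cl g = F.Sig (A.cl g) (clB A B g) := F.Sig_sub' _ _ rfl

def sigFst {Y : C} (s : (sigClosed F A B).secs.obj (op Y)) : K.Tm.obj (A.cl s.1) :=
  kfst F (sigClosed_cl F A B s.1) s.2

def sigSnd {Y : C} (s : (sigClosed F A B).secs.obj (op Y))
    (x : A.fam.obj (A.elem s.1 (sigFst F A B s))) : K.Tm.obj (B.cl (tot A s.1 (sigFst F A B s) x)) :=
  ksnd F (sigClosed_cl F A B s.1) s.2 (clB_inst A B s.1 _ x)

abbrev sigData {Y : C} (s : (sigClosed F A B).secs.obj (op Y)) : SigData A B Y :=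
  ⟨s.1, sigFst F A B s, sigSnd F A B s⟩

theorem clB_res {X Y : C} (k : Y ⟶ X) (g : Γ.2.pred.obj (op X)) :
    Cwf.sub (clB A B g) (Cwf.lift (K.unitMap k) (A.cl_res k g)) = clB A B (res Γ.2.pred k g) := by
  refine (Cwf.sub_sub B.ty _ _).trans ?_
  refine congrArg (fun σ => Cwf.sub B.ty σ) ?_
  refine (Cwf.pair_lift _ _ _ _ _).trans ?_
  exact Cwf.pair_congr ((Category.assoc _ _ _).trans
    (congrArg (fun τ => K.p _ ≫ τ) (pr_res Γ k g).symm)) _ _ _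

theorem sigFst_res {X Y : C} (k : Y ⟶ X) {s : (sigClosed F A B).secs.obj (op X)}
    {s' : (sigClosed F A B).secs.obj (op Y)} (h : res _ k s = s') :
    res A.secs k (A.elem s.1 (sigFst F A B s)) = A.elem s'.1 (sigFst F A B s') := by
  subst h
  exact A.res_elem k rfl (kfst_sub F (K.unitMap k) (sigClosed_cl F A B s.1) s.2
    (sigClosed_cl F A B _) ((sigClosed F A B).cl_res k s.1) (A.cl_res k s.1) (clB_res A B k s.1))

theorem sigSnd_res {X Y : C} (k : Y ⟶ X) {s : (sigClosed F A B).secs.obj (op X)}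
    {s' : (sigClosed F A B).secs.obj (op Y)} (h : res _ k s = s')
    (x : A.fam.obj (A.elem s.1 (sigFst F A B s))) :
    res B.secs k (B.elem (tot A s.1 (sigFst F A B s) x) (sigSnd F A B s x))
      = B.elem (tot A s'.1 (sigFst F A B s') (A.fam.map k (sigFst_res F A B k h) x))
        (sigSnd F A B s' _) := by
  subst h
  have e : res A.total k (tot A s.1 (sigFst F A B s) x) = tot A _ (sigFst F A B (res _ k s))
      (A.fam.map k (sigFst_res F A B k rfl) x) :=
    Sigma.ext (sigFst_res F A B k rfl) (A.fam.map_heq'' _ _ _ _)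
  refine B.res_elem k e ?_
  refine (K.Tm.map_eq rfl _ _ _).trans (ksnd_sub F (K.unitMap k) (sigClosed_cl F A B s.1) s.2 _
    (sigClosed_cl F A B _) ((sigClosed F A B).cl_res k s.1) (A.cl_res k s.1) (clB_res A B k s.1)
    (clB_inst A B _ _ _) ((B.cl_res k _).trans (congrArg (fun t => B.cl t) e)))

def sig : Ty Γ where
  toClosed := sigClosed F A B
  fam := {
    obj := fun s => SigFib (sigData F A B s)
    map := fun {_ _} k {_ _} h y => ⟨A.fam.map k (sigFst_res F A B k h) y.1,
      B.fam.map k (sigSnd_res F A B k h y.1) y.2⟩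
    map_id := fun {X t} h y => Sigma.ext (A.fam.map_id _ _) (B.fam.map_id_heq _ _)
    map_comp := fun {X Y Z} f g {t s r} h k l y => Sigma.ext (A.fam.map_comp _ _ _ _ _ _) (by
      refine (heq_of_eq (B.fam.map_map _ _ _)).trans ?_
      exact B.fam.map_heq'' _ _ _ _) }

variable {A B}

/-- base change of data -/
def SigData.base (σ : Δ ⟶ Γ) {Y : C} (D : SigData (A.pullback σ) (B.pullback (lift' σ A)) Y) :
    SigData A B Y := ⟨ap σ.map D.g, D.a, D.b⟩

theorem sigData_base (σ : Δ ⟶ Γ) {Y : C} (s : (sigClosed F A B).secs.obj (op Y))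
    (s' : (sigClosed F (A.pullback σ) (B.pullback (lift' σ A))).secs.obj (op Y))
    (h : s.1 = ap σ.map s'.1) (h' : HEq s.2 s'.2) :
    sigData F A B s = (sigData F (A.pullback σ) (B.pullback (lift' σ A)) s').base σ := by
  have e1 : A.cl s.1 = A.cl (ap σ.map s'.1) := congrArg (fun g => A.cl g) h
  have e2 : HEq (clB A B s.1) (clB (A.pullback σ) (B.pullback (lift' σ A)) s'.1) := by
    refine HEq.trans (b := clB A B (ap σ.map s'.1)) ?_ (heq_of_eq (clB_lift σ A B _).symm)
    rw [h]
  exact SigData.ext' h (kfst_heq F (sigClosed_cl F A B _)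
    (sigClosed_cl F (A.pullback σ) (B.pullback (lift' σ A)) _) e1 e2 h')
    (fun x x' hx => ksnd_heq F (sigClosed_cl F A B _)
    (sigClosed_cl F (A.pullback σ) (B.pullback (lift' σ A)) _) (clB_inst A B s.1 _ x)
    (clB_inst (A.pullback σ) (B.pullback (lift' σ A)) s'.1 _ x') e1 e2 h')

theorem sig_pullback (σ : Δ ⟶ Γ) (A : Ty Γ) (B : Ty (extend Γ A)) :
    (sig F A B).pullback σ = sig F (A.pullback σ) (B.pullback (lift' σ A)) := by
  refine Ty.ext' (F.Sig_sub σ.sub A.ty B.ty) ?_ ?_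
  · intro Y d c c' hc
    exact congrArg SigFib (sigData_base F σ (A := A) (B := B) ⟨ap σ.map d, c⟩ ⟨d, c'⟩ rfl hc)
  · intro X Y f s r s' r' e e' h h' x x' hx
    have h1 := sigData_base F σ (A := A) (B := B) (ap (Closed.secsMap _ σ) s) s' (congrArg (ap σ.map) h) h'
    have h2 : r.1 = r'.1 ∧ HEq r.2 r'.2 := by
      subst e e'
      refine ⟨congrArg (res _ f) h, ?_⟩
      refine K.Tm.map_heq rfl _ _ ?_ h'
      refine Eq.trans ?_ (congrArg (sigClosed F (A.pullback σ) (B.pullback (lift' σ A))).cl h)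
      refine (congrArg (Cwf.sub (F.Sig A.ty B.ty)) (σ.comm s.1)).trans ?_
      exact (Cwf.sub_sub _ _ _).symm.trans
        (congrArg (fun T => Cwf.sub T (pr Δ s.1)) (F.Sig_sub σ.sub A.ty B.ty))
    have h3 := sigData_base F σ (A := A) (B := B) (ap (Closed.secsMap _ σ) r) r' (congrArg (ap σ.map) h2.1) h2.2
    obtain ⟨hx1, hx2⟩ := SigFib.heq_parts h1 hx
    have key : A.elem (ap σ.map s.1) (sigFst F A B (ap (Closed.secsMap _ σ) s)) =
      A.elem (ap σ.map s'.1) (sigFst F (A.pullback σ) (B.pullback (lift' σ A)) s') :=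
      congrArg (fun D : SigData A B X => A.elem D.g D.a) h1
    have k1 := A.fam.map_heq (f := f) rfl (sigFst_res F A B f (s' := ap (Closed.secsMap _ σ) r)
       ((ap_res ((sigClosed F A B).secsMap σ) f s).symm.trans
         (congrArg (ap ((sigClosed F A B).secsMap σ)) e))) ((ap_res (A.secsMap σ) f _).symm.trans <| congrArg (ap (A.secsMap σ)) (sigFst_res F (A.pullback σ) (B.pullback (lift' σ A)) f e')) key hx1
    refine SigFib.heq (y' := show SigFib ((sigData F _ _ r').base σ) from _) h3 k1 ?_
    exact B.fam.map_heq rfl _ _ (SigData.elem_congr h1 hx1) hx2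

variable (A B) in
abbrev sigEv (w : K.Tm.obj (F.Sig A.ty B.ty)) {Y : C} (g : Γ.2.pred.obj (op Y)) :
    (sigClosed F A B).secs.obj (op Y) := (sigClosed F A B).elem g ((sigClosed F A B).ev w g)

theorem sig_ev_aux (a : Tm A) {Y : C} (g : Γ.2.pred.obj (op Y)) :
    ap (Cwf.inst (K := cwf K) a).map g = tot A g (A.ev a.tm g) (a.sec g) := by
  refine Sigma.ext rfl ?_
  exact cast_heq (pair_aux' (𝟙 Γ) A.pullback_id a.tm g) (a.sec g)

theorem sig_ev (w : K.Tm.obj (F.Sig A.ty B.ty)) {a : K.Tm.obj A.ty}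
    {b : K.Tm.obj (Cwf.sub B.ty (Cwf.inst a))} (hw : F.unpair w = ⟨a, b⟩) {Y : C}
    (g : Γ.2.pred.obj (op Y)) : sigFst F A B (sigEv F A B w g) = A.ev a g ∧
    ∀ x (R : K.TyAt (K.unit Y)) (hR : Cwf.sub (Cwf.sub B.ty (Cwf.inst a)) (pr Γ g) = R),
      HEq (sigSnd F A B (sigEv F A B w g) x) (K.Tm.map (pr Γ g) hR b) := by
  obtain rfl : a = (F.unpair w).1 := (congrArg Sigma.fst hw).symm
  obtain rfl : b = (F.unpair w).2 := (eq_of_heq (Sigma.mk.inj_iff.1 hw).2).symm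
  have e2 : cast (congrArg (fun T => K.Tm.obj T) (sigClosed_cl F A B g)) ((sigClosed F A B).ev w g)
      = K.Tm.map (pr Γ g) (sigClosed_cl F A B g) w :=
    eq_of_heq ((cast_heq _ _).trans (K.Tm.map_heq'' _ _ _ _))
  have e1 := unpair_sub' F (pr Γ g) w (A.cl_eq g) rfl (sigClosed_cl F A B g) rfl
  refine ⟨(congrArg (fun c => (F.unpair c).1) e2).trans e1.1, fun x R hR => ?_⟩
  refine (cast_heq _ _).trans ((congr_arg_heq (fun c => (F.unpair c).2) e2).trans (e1.2.trans ?_))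
  exact K.Tm.map_heq'' _ _ _ _

theorem sig_elem (w : K.Tm.obj (F.Sig A.ty B.ty)) {a : Tm A}
    {b : Tm (B.pullback (Cwf.inst (K := cwf K) a))} (hw : F.unpair w = ⟨a.tm, b.tm⟩) {Y : C}
    (g : Γ.2.pred.obj (op Y)) (x : A.fam.obj (A.elem g (sigFst F A B (sigEv F A B w g))))
    (hx : HEq x (a.sec g)) :
    B.elem (tot A g (sigFst F A B (sigEv F A B w g)) x) (sigSnd F A B (sigEv F A B w g) x)
      = B.elem (ap (Cwf.inst (K := cwf K) a).map g) ((B.pullback (Cwf.inst (K := cwf K) a)).ev b.tm g) := by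
  refine B_elem_congr ((Sigma.ext ?_ hx : _ = tot A g (A.ev a.tm g) (a.sec g)).trans
    (sig_ev_aux a g).symm) ((sig_ev F w hw g).2 x _ _)
  exact congrArg (A.elem g) (sig_ev F w hw g).1

/-- pairing -/
def sigPair (a : Tm A) (b : Tm (B.pullback (Cwf.inst (K := cwf K) a))) : Tm (sig F A B) where
  tm := F.unpair.symm ⟨a.tm, b.tm⟩
  sec g :=
    have h := sig_ev F (A := A) (B := B) _ (F.unpair.apply_symm_apply ⟨a.tm, b.tm⟩) g
    have h1 := congrArg (fun a => A.fam.obj (A.elem g a)) h.1.symm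
    ⟨cast h1 (a.sec g), cast (congrArg (fun t => B.fam.obj t)
      (sig_elem F _ (F.unpair.apply_symm_apply ⟨a.tm, b.tm⟩) g _ (cast_heq h1 (a.sec g))).symm)
      (b.sec g)⟩
  nat f g := by
    refine Sigma.ext ?_ ?_
    · refine eq_of_heq (HEq.trans ?_ ((heq_of_eq (a.nat f g)).trans (cast_heq _ _).symm))
      refine A.fam.map_heq rfl _ _ ?_ (cast_heq _ _)
      exact congrArg (A.elem g) (sig_ev F _ (F.unpair.apply_symm_apply ⟨a.tm, b.tm⟩) g).1
    · refine HEq.trans ?_ ((heq_of_eq (b.nat f g)).trans (cast_heq _ _).symm)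
      refine B.fam.map_heq rfl _ _ ?_ (cast_heq _ _)
      exact sig_elem F _ (F.unpair.apply_symm_apply ⟨a.tm, b.tm⟩) g _ (cast_heq _ _)

def sigFst' (w : Tm (sig F A B)) : Tm A where
  tm := (F.unpair w.tm).1
  sec g := cast (congrArg (fun a => A.fam.obj (A.elem g a)) (sig_ev F w.tm rfl g).1) (w.sec g).1
  nat f g := by
    have e := (Sigma.mk.inj_iff.1 (w.nat f g)).1
    refine eq_of_heq (HEq.trans ?_ ((heq_of_eq e).trans (cast_heq _ _).symm))
    exact A.fam.map_heq rfl _ _ (congrArg (A.elem g) (sig_ev F w.tm rfl g).1.symm) (cast_heq _ _)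

theorem sig_elem' (w : Tm (sig F A B)) {Y : C} (g : Γ.2.pred.obj (op Y)) :
    B.elem (tot A g (sigFst F A B (sigEv F A B w.tm g)) (w.sec g).1)
        (sigSnd F A B (sigEv F A B w.tm g) (w.sec g).1)
      = B.elem (ap (Cwf.inst (K := cwf K) (sigFst' F w)).map g)
        ((B.pullback (Cwf.inst (K := cwf K) (sigFst' F w))).ev (F.unpair w.tm).2 g) := by
  refine B_elem_congr ((Sigma.ext ?_ (cast_heq _ _).symm :
    _ = tot A g (A.ev (sigFst' F w).tm g) ((sigFst' F w).sec g)).trans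
    (sig_ev_aux _ g).symm) ((sig_ev F w.tm rfl g).2 _ _ _)
  exact congrArg (A.elem g) (sig_ev F w.tm rfl g).1

def sigSnd' (w : Tm (sig F A B)) : Tm (B.pullback (Cwf.inst (K := cwf K) (sigFst' F w))) where
  tm := (F.unpair w.tm).2
  sec g := cast (congrArg (fun t => B.fam.obj t) (sig_elem' F w g)) (w.sec g).2
  nat f g := by
    have e := (Sigma.mk.inj_iff.1 (w.nat f g)).2
    refine eq_of_heq (HEq.trans ?_ (e.trans (cast_heq _ _).symm))
    exact B.fam.map_heq rfl _ _ (sig_elem' F w g).symm (cast_heq _ _)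

theorem sigFst'_sec (w : Tm (sig F A B)) {Y : C} (g : Γ.2.pred.obj (op Y)) :
    HEq ((sigFst' F w).sec g) (w.sec g).1 := cast_heq _ _

theorem sigSnd'_sec (w : Tm (sig F A B)) {Y : C} (g : Γ.2.pred.obj (op Y)) :
    HEq ((sigSnd' F w).sec g) (w.sec g).2 := cast_heq _ _

theorem Tm.heq {A A' : Ty Γ} (h : A = A') {x : Tm A} {y : Tm A'} (h1 : HEq x.tm y.tm)
    (h2 : ∀ {Y : C} (g : Γ.2.pred.obj (op Y)), HEq (x.sec g) (y.sec g)) : HEq x y := by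
  subst h; exact heq_of_eq (Tm.ext (eq_of_heq h1) h2)

def unpairEquiv : Tm (sig F A B) ≃ Σ a : Tm A, Tm (B.pullback (Cwf.inst (K := cwf K) a)) where
  toFun w := ⟨sigFst' F w, sigSnd' F w⟩
  invFun x := sigPair F x.1 x.2
  left_inv w := by
    have e : F.unpair.symm ⟨(sigFst' F w).tm, (sigSnd' F w).tm⟩ = w.tm := F.unpair.symm_apply_apply _
    refine Tm.ext e (fun g => ?_)
    refine SigFib.heq (D := sigData F A B (sigEv F A B _ g)) (D' := sigData F A B (sigEv F A B _ g))
      (congrArg (fun w => sigData F A B (sigEv F A B w g)) e) ?_ ?_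
    · exact (cast_heq _ _).trans (cast_heq _ _)
    · exact (cast_heq _ _).trans (cast_heq _ _)
  right_inv := by
    rintro ⟨a, b⟩
    have e : F.unpair (sigPair F a b).tm = ⟨a.tm, b.tm⟩ := F.unpair.apply_symm_apply _
    have e1 : sigFst' F (sigPair F a b) = a :=
      Tm.ext (congrArg Sigma.fst e) (fun g => (cast_heq _ _).trans (cast_heq _ _))
    refine Sigma.ext e1 ?_
    refine Tm.heq (congrArg (fun a : Tm A => B.pullback (Cwf.inst (K := cwf K) a)) e1) (Sigma.mk.inj_iff.1 e).2 (fun g => ?_)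
    exact (cast_heq _ _).trans (cast_heq _ _)

theorem unpair_map_aux (σ : Δ ⟶ Γ) (a : Tm A) :
    (B.pullback (Cwf.inst (K := cwf K) a)).pullback σ
      = (B.pullback (lift' σ A)).pullback (Cwf.inst (K := cwf K) (a.map σ rfl)) := by
  have := Cwf.inst_sub (K := cwf K) σ (A := A) rfl B a
  exact this.trans (congrArg (fun τ : extend Δ (A.pullback σ) ⟶ extend Γ A =>
    (B.pullback τ).pullback (Cwf.inst (K := cwf K) (a.map σ rfl))) (lift_eq σ A))

theorem unpair_map (σ : Δ ⟶ Γ) (w : Tm (sig F A B)) :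
    unpairEquiv F (w.map σ (sig_pullback F σ A B)) = ⟨(unpairEquiv F w).1.map σ rfl,
      (unpairEquiv F w).2.map σ (unpair_map_aux σ _)⟩ := by
  have e := F.unpair_sub σ.sub w.tm
  have key : ∀ {Y : C} (d : Δ.2.pred.obj (op Y)),
      HEq ((w.map σ (sig_pullback F σ A B)).sec d).1 (w.sec (ap σ.map d)).1 ∧
      HEq ((w.map σ (sig_pullback F σ A B)).sec d).2 (w.sec (ap σ.map d)).2 := by
    intro Y d
    refine SigFib.heq_parts
      (D := (sigData F (A.pullback σ) (B.pullback (lift' σ A)) _).base σ) ?_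
      (Tm.map_sec σ (sig_pullback F σ A B) w d)
    refine (sigData_base F σ _ _ rfl ?_).symm
    refine HEq.trans ?_ (heq_of_eq (K.Tm.map_map _ _ _).symm)
    exact K.Tm.map_heq (σ.comm d) _ _ rfl HEq.rfl
  have e1 : sigFst' F (w.map σ (sig_pullback F σ A B)) = (sigFst' F w).map σ rfl := by
    refine Tm.ext (congrArg Sigma.fst e) (fun d => ?_)
    exact (cast_heq _ _).trans ((key d).1.trans
      ((sigFst'_sec F w _).symm.trans (Tm.map_sec σ rfl (sigFst' F w) d).symm))
  refine Sigma.ext e1 ?_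
  refine Tm.heq (by exact congrArg (fun a => (B.pullback (lift' σ A)).pullback (Cwf.inst (K := cwf K) a)) e1)
    (Sigma.mk.inj_iff.1 e).2 (fun d => ?_)
  exact (cast_heq _ _).trans ((key d).2.trans
    ((sigSnd'_sec F w _).symm.trans (Tm.map_sec σ (unpair_map_aux σ _) (sigSnd' F w) d).symm))
end

/-! ### Paths -/

section
variable {P : CubeBase C} (F : TypeFormers P K)

/-- path application, with flexible types -/
def kpapp {Θ : K.Ctx} {T : K.TyAt Θ} {A : K.TyAt Θ} {a₀ a₁ : K.Tm.obj A}
    (h : T = F.Path A a₀ a₁) (c : K.Tm.obj T) (i : P.I.obj (op Θ.1)) : K.Tm.obj A :=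
  F.papp (cast (congrArg (fun T => K.Tm.obj T) h) c) i

theorem kpapp_heq {Θ : K.Ctx} {T T' : K.TyAt Θ} {A A' : K.TyAt Θ} {a₀ a₁ : K.Tm.obj A}
    {a₀' a₁' : K.Tm.obj A'} (h : T = F.Path A a₀ a₁) (h' : T' = F.Path A' a₀' a₁')
    {c : K.Tm.obj T} {c' : K.Tm.obj T'} {i i' : P.I.obj (op Θ.1)} (eA : A = A') (e₀ : HEq a₀ a₀')
    (e₁ : HEq a₁ a₁') (ec : HEq c c') (ei : i = i') : HEq (kpapp F h c i) (kpapp F h' c' i') := by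
  subst eA ei
  obtain rfl := eq_of_heq e₀
  obtain rfl := eq_of_heq e₁
  subst h h'
  obtain rfl := eq_of_heq ec
  rfl

theorem kpapp_sub {Ξ Θ : K.Ctx} (τ : Ξ ⟶ Θ) {T : K.TyAt Θ} {A : K.TyAt Θ} {a₀ a₁ : K.Tm.obj A}
    (h : T = F.Path A a₀ a₁) (c : K.Tm.obj T) (i : P.I.obj (op Θ.1)) {T' : K.TyAt Ξ}
    {A' : K.TyAt Ξ} {a₀' a₁' : K.Tm.obj A'} (h' : T' = F.Path A' a₀' a₁') (eT : Cwf.sub T τ = T')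
    (eA : Cwf.sub A τ = A') (e₀ : K.Tm.map τ eA a₀ = a₀') (e₁ : K.Tm.map τ eA a₁ = a₁') :
    K.Tm.map τ eA (kpapp F h c i) = kpapp F h' (K.Tm.map τ eT c) (res P.I (K.base τ) i) := by
  subst h eA e₀ e₁ eT
  have e2 : cast (congrArg (fun T => K.Tm.obj T) h') (K.Tm.map τ rfl c)
      = K.Tm.map τ (F.Path_sub _ _ _ _) c :=
    eq_of_heq ((cast_heq _ _).trans (K.Tm.map_heq'' _ _ _ _))
  rw [kpapp, kpapp, e2, F.papp_sub, cast_eq]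

theorem kpapp_pt {Θ : K.Ctx} {T : K.TyAt Θ} {A : K.TyAt Θ} {a : Bool → K.Tm.obj A}
    (h : T = F.Path A (a false) (a true)) (c : K.Tm.obj T) (b : Bool) :
    kpapp F h c (P.pt b Θ.1) = a b := by
  cases b
  · exact F.papp_zero _
  · exact F.papp_one _

variable (P) in
/-- Data for the fibre of a path type: the restrictions of `ρ'`, a path in `M`, and end points. -/
structure PathData (A : Ty Γ) (Y : C) where
  γ : ∀ {Z : C}, (Z ⟶ Y) → Γ.2.pred.obj (op Z)
  hγ : ∀ {Z W : C} (f : Z ⟶ Y) (k : W ⟶ Z) (f' : W ⟶ Y), k ≫ f = f' → res _ k (γ f) = γ f'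
  ω : ∀ {Z : C} (f : Z ⟶ Y) (_i : P.I.obj (op Z)), K.Tm.obj (A.cl (γ f))
  hω : ∀ {Z W : C} (f : Z ⟶ Y) (k : W ⟶ Z) (f' : W ⟶ Y) (_e : k ≫ f = f') (i : P.I.obj (op Z)),
    res A.secs k (A.elem (γ f) (ω f i)) = A.elem (γ f') (ω f' (res _ k i))
  η : ∀ (b : Bool) {Z : C} (f : Z ⟶ Y), A.fam.obj (A.elem (γ f) (ω f (P.pt b Z)))

variable {A : Ty Γ}

/-- Paths over a path `u` of `M`, in `A' ρ ρ' (u i)`, with the given end points -/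
def PathFib {Y : C} (D : PathData P A Y) : Type u :=
  {y : ∀ {Z : C} (f : Z ⟶ Y) (i : P.I.obj (op Z)), A.fam.obj (A.elem (D.γ f) (D.ω f i)) //
    (∀ {Z W : C} (f : Z ⟶ Y) (k : W ⟶ Z) (f' : W ⟶ Y) (e : k ≫ f = f') (i : P.I.obj (op Z)),
      A.fam.map k (D.hω f k f' e i) (y f i) = y f' (res _ k i)) ∧
    ∀ (b : Bool) {Z : C} (f : Z ⟶ Y), y f (P.pt b Z) = D.η b f}

theorem PathData.ext' {Y : C} {D D' : PathData P A Y} (h : ∀ {Z : C} (f : Z ⟶ Y), D.γ f = D'.γ f)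
    (h' : ∀ {Z : C} (f : Z ⟶ Y) (i : P.I.obj (op Z)), HEq (D.ω f i) (D'.ω f i))
    (h'' : ∀ (b : Bool) {Z : C} (f : Z ⟶ Y), HEq (D.η b f) (D'.η b f)) : D = D' := by
  obtain ⟨γ, hγ, ω, hω, η⟩ := D
  obtain ⟨γ', hγ', ω', hω', η'⟩ := D'
  obtain rfl : @γ = @γ' := by funext Z f; exact h f
  obtain rfl : @ω = @ω' := by funext Z f i; exact eq_of_heq (h' f i)
  obtain rfl : @η = @η' := by funext b Z f; exact eq_of_heq (h'' b f)
  rfl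

theorem PathFib.heq {Y : C} {D D' : PathData P A Y} (hD : D = D') {y : PathFib D} {y' : PathFib D'}
    (h : ∀ {Z : C} (f : Z ⟶ Y) (i : P.I.obj (op Z)), HEq (y.1 f i) (y'.1 f i)) : HEq y y' := by
  subst hD
  refine heq_of_eq (Subtype.ext ?_)
  funext Z f i
  exact eq_of_heq (h f i)

theorem PathFib.at_heq {Y : C} {D D' : PathData P A Y} (hD : D = D') {y : PathFib D} {y' : PathFib D'}
    (hy : HEq y y') {Z : C} {f f' : Z ⟶ Y} (hf : f = f') {i i' : P.I.obj (op Z)} (hi : i = i') :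
    HEq (y.1 f i) (y'.1 f' i') := by
  subst hD hf hi
  obtain rfl := eq_of_heq hy
  rfl

/-- restriction of the data along `k` -/
def PathData.pre {X Y : C} (k : Y ⟶ X) (D : PathData P A X) : PathData P A Y where
  γ f := D.γ (f ≫ k)
  hγ f l f' e := D.hγ _ _ _ (by rw [← e, Category.assoc])
  ω f i := D.ω (f ≫ k) i
  hω f l f' e := D.hω _ _ _ (by rw [← e, Category.assoc])
  η b _ f := D.η b (f ≫ k)

def PathFib.pre {X Y : C} (k : Y ⟶ X) {D : PathData P A X} (y : PathFib D) : PathFib (D.pre k) :=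
  ⟨fun f i => y.1 (f ≫ k) i, fun f l f' e => y.2.1 _ _ _ (by rw [← e, Category.assoc]),
    fun b _ f => y.2.2 b (f ≫ k)⟩

theorem PathFib.pre_heq {X Y : C} (k : Y ⟶ X) {D D' : PathData P A X} (h : D = D') {y : PathFib D}
    {y' : PathFib D'} (hy : HEq y y') : HEq (y.pre k) (y'.pre k) := by
  subst h
  obtain rfl := eq_of_heq hy
  rfl

variable (A) (e : Bool → Tm A)

def pathClosed : Closed Γ where
  ty := F.Path A.ty (e false).tm (e true).tm
  cl g := Cwf.sub (F.Path A.ty (e false).tm (e true).tm) (pr Γ g)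
  cl_eq _ := rfl

theorem pathClosed_cl {Y : C} (g : Γ.2.pred.obj (op Y)) : (pathClosed F A e).cl g
    = F.Path (A.cl g) (A.ev (e false).tm g) (A.ev (e true).tm g) :=
  F.Path_sub' _ (A.cl_eq g) rfl rfl

def pathApp {Y : C} (s : (pathClosed F A e).secs.obj (op Y)) (i : P.I.obj (op Y)) :
    K.Tm.obj (A.cl s.1) := kpapp F (pathClosed_cl F A e s.1) s.2 i

theorem pathApp_res {X Y : C} (k : Y ⟶ X) (s : (pathClosed F A e).secs.obj (op X))
    (s' : (pathClosed F A e).secs.obj (op Y)) (h : res _ k s = s') (i : P.I.obj (op X)) :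
    res A.secs k (A.elem s.1 (pathApp F A e s i)) = A.elem s'.1 (pathApp F A e s' (res _ k i)) := by
  subst h
  refine A.res_elem k rfl ?_
  refine (kpapp_sub F (K.unitMap k) (pathClosed_cl F A e s.1) s.2 i (pathClosed_cl F A e _)
    ((pathClosed F A e).cl_res k s.1) (A.cl_res k s.1) (A.ev_res _ _ _) (A.ev_res _ _ _)).trans ?_
  exact congrArg (kpapp F _ _) (congrArg (fun f => res P.I f i) (K.base_unitMap k))

theorem pathApp_pt {Y : C} (s : (pathClosed F A e).secs.obj (op Y)) (b : Bool) :
    pathApp F A e s (P.pt b Y) = A.ev (e b).tm s.1 :=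
  kpapp_pt F (a := fun b => A.ev (e b).tm s.1) (pathClosed_cl F A e s.1) s.2 b

theorem pathApp_congr {Y : C} {s s' : (pathClosed F A e).secs.obj (op Y)} (h : s = s')
    (i : P.I.obj (op Y)) : HEq (pathApp F A e s i) (pathApp F A e s' i) := by subst h; rfl

def pathEnd {Y : C} (s : (pathClosed F A e).secs.obj (op Y)) (b : Bool) :
    A.fam.obj (A.elem s.1 (pathApp F A e s (P.pt b Y))) :=
  cast (congrArg (fun a => A.fam.obj (A.elem s.1 a)) (pathApp_pt F A e s b).symm) ((e b).sec s.1)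

theorem pathEnd_heq {Y : C} (s : (pathClosed F A e).secs.obj (op Y)) (b : Bool) :
    HEq (pathEnd F A e s b) ((e b).sec s.1) := cast_heq _ _

def pathData {Y : C} (s : (pathClosed F A e).secs.obj (op Y)) : PathData P A Y where
  γ f := (res (pathClosed F A e).secs f s).1
  hγ f k f' h := by subst h; exact congrArg Sigma.fst (res_res _ f k s)
  ω f i := pathApp F A e (res _ f s) i
  hω f k f' h i := pathApp_res F A e k _ _ (by subst h; exact res_res _ _ _ _) i
  η b _ f := pathEnd F A e (res _ f s) b

theorem pathData_res {X Y : C} (k : Y ⟶ X) {s : (pathClosed F A e).secs.obj (op X)}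
    {s' : (pathClosed F A e).secs.obj (op Y)} (hs : res _ k s = s') :
    (pathData F A e s).pre k = pathData F A e s' := by
  subst hs
  exact PathData.ext' (fun f => congrArg Sigma.fst (res_res _ k f s).symm)
    (fun f i => pathApp_congr F A e (res_res _ k f s).symm i)
    (fun b Z f => (pathEnd_heq F A e _ b).trans (((e b).sec_heq
      (congrArg Sigma.fst (res_res _ k f s).symm)).trans (pathEnd_heq F A e _ b).symm))

def path : Ty Γ where
  toClosed := pathClosed F A e
  fam := {
    obj := fun s => PathFib (pathData F A e s)
    map := fun {_ _} k {_ _} h y => cast (congrArg PathFib (pathData_res F A e k h)) (y.pre k)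
    map_id := fun {X t} h y => eq_of_heq ((cast_heq _ _).trans
      (PathFib.heq (pathData_res F A e (𝟙 X) h) fun f i =>
        PathFib.at_heq (D := pathData F A e t) (y := y) rfl HEq.rfl (Category.comp_id f) rfl))
    map_comp := fun {X Y Z} f g {t s r} h k l y => eq_of_heq (by
      refine (cast_heq _ _).trans (HEq.trans ?_ (cast_heq _ _).symm)
      refine (PathFib.pre_heq g (pathData_res F A e f h).symm (cast_heq _ _)).trans ?_
      refine PathFib.heq ?_ fun f' i =>
        PathFib.at_heq (D := pathData F A e t) (y := y) rfl HEq.rfl (Category.assoc _ _ _) rfl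
      rw [pathData_res F A e f h, pathData_res F A e g k, pathData_res F A e (g ≫ f) l]) }

variable {A}

def PathData.base (σ : Δ ⟶ Γ) {Y : C} (D : PathData P (A.pullback σ) Y) : PathData P A Y where
  γ f := ap σ.map (D.γ f)
  hγ f k f' e := by rw [← ap_res, D.hγ f k f' e]
  ω f i := D.ω f i
  hω f k f' e i := (ap_res (A.secsMap σ) k _).symm.trans <|
      congrArg (ap (A.secsMap σ)) (D.hω f k f' e i)
  η b _ f := D.η b f

theorem pathData_base (σ : Δ ⟶ Γ) {Y : C} (s : (pathClosed F A e).secs.obj (op Y))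
    (e' : Bool → Tm (A.pullback σ)) (he : ∀ b, (e b).map σ rfl = e' b)
    (s' : (pathClosed F (A.pullback σ) e').secs.obj (op Y))
    (h : s.1 = ap σ.map s'.1) (h' : HEq s.2 s'.2) :
    pathData F A e s = (pathData F (A.pullback σ) e' s').base σ := by
  obtain rfl : (fun b => (e b).map σ rfl) = e' := funext he
  have key : ∀ {Z : C} (f : Z ⟶ Y), res Γ.2.pred f s.1 = ap σ.map (res Δ.2.pred f s'.1) := by
    intro Z f; rw [h, ap_res]
  refine PathData.ext' (fun f => key f) (fun f i => ?_) (fun b Z f => ?_)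
  · have h0 : ∀ b, HEq (A.ev (e b).tm (res Γ.2.pred f s.1))
        ((A.pullback σ).ev ((e b).map σ rfl).tm (res Δ.2.pred f s'.1)) := by
      intro b
      refine HEq.trans ?_ (heq_of_eq (A.ev_pullback σ (e b).tm rfl _ _).symm)
      rw [key f]
      exact HEq.rfl
    refine kpapp_heq F (pathClosed_cl F A e _)
      (pathClosed_cl F (A.pullback σ) (fun b => (e b).map σ rfl) _) ?_ (h0 false) (h0 true) ?_ rfl
    · exact congrArg (fun g => A.cl g) (key f)
    · refine K.Tm.map_heq rfl _ _ ?_ h'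
      refine Eq.trans (b := Cwf.sub (F.Path A.ty (e false).tm (e true).tm) (pr Γ s.1)) rfl ?_
      rw [h, σ.comm, ← Cwf.sub_sub]
      exact congrArg (fun T => Cwf.sub T (pr Δ s'.1)) (F.Path_sub σ.sub A.ty _ _)
  · refine (pathEnd_heq F A e _ b).trans (HEq.trans ?_ (pathEnd_heq F (A.pullback σ)
      (fun b => (e b).map σ rfl) (res _ f s') b).symm)
    refine HEq.trans ?_ (Tm.map_sec σ rfl (e b) _).symm
    exact (e b).sec_heq (key f)

theorem path_pullback (σ : Δ ⟶ Γ) (e : Bool → Tm A) :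
    (path F A e).pullback σ = path F (A.pullback σ) (fun b => (e b).map σ rfl) := by
  refine Ty.ext' (F.Path_sub σ.sub A.ty _ _) ?_ ?_
  · intro Y d c c' hc
    exact congrArg PathFib (pathData_base F e σ ⟨ap σ.map d, c⟩ _ (fun _ => rfl) ⟨d, c'⟩ rfl hc)
  · intro X Y f s r s' r' h1 h2 h h' x x' hx
    refine (cast_heq _ _).trans (HEq.trans ?_ (cast_heq _ _).symm)
    exact PathFib.pre_heq f (pathData_base F e σ (ap (Closed.secsMap _ σ) s) _ (fun _ => rfl) s'
      (congrArg (ap σ.map) h) h') hx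

variable (A) in
abbrev pathEv (e : Bool → Tm A) (w : K.Tm.obj (F.Path A.ty (e false).tm (e true).tm)) {Y : C}
    (g : Γ.2.pred.obj (op Y)) : (pathClosed F A e).secs.obj (op Y) :=
  (pathClosed F A e).elem g ((pathClosed F A e).ev w g)

variable {e}

theorem pathEv_res (w : K.Tm.obj (F.Path A.ty (e false).tm (e true).tm)) {X Y : C} (k : Y ⟶ X)
    (g : Γ.2.pred.obj (op X)) : res _ k (pathEv F A e w g) = pathEv F A e w (res _ k g) :=
  (pathClosed F A e).res_elem k rfl ((pathClosed F A e).ev_res w k g)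

/-- The value of `i : I` at the point `ρ` of a context -/
abbrev ival (P : CubeBase C) {Γ : Ctx K} (i : P.I.obj (op Γ.1)) {Y : C} (g : Γ.2.pred.obj (op Y)) :
    P.I.obj (op Y) := res P.I (K.base (pr Γ g)) i

theorem ival_res {Γ : Ctx K} (i : P.I.obj (op Γ.1)) {X Y : C} (k : Y ⟶ X)
    (g : Γ.2.pred.obj (op X)) : ival P i (res _ k g) = res P.I k (ival P i g) := by
  rw [ival, ival, pr_res, res_res]
  refine congrArg (fun f => res P.I f i) ?_
  rw [K.base_comp, K.base_unitMap]

theorem pathApp_ev (w : K.Tm.obj (F.Path A.ty (e false).tm (e true).tm)) {Y : C}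
    (g : Γ.2.pred.obj (op Y)) (i : P.I.obj (op Γ.1)) :
    pathApp F A e (pathEv F A e w g) (ival P i g) = A.ev (F.papp w i) g :=
  (kpapp_sub F (pr Γ g) rfl w i (pathClosed_cl F A e g) ((pathClosed F A e).cl_eq g)
    (A.cl_eq g) rfl rfl).symm

theorem path_elem (w : K.Tm.obj (F.Path A.ty (e false).tm (e true).tm)) {X Y : C} (k : Y ⟶ X)
    (g : Γ.2.pred.obj (op X)) (i : P.I.obj (op Γ.1)) :
    A.elem (res _ k g) (pathApp F A e (res _ k (pathEv F A e w g)) (ival P i (res _ k g)))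
      = A.elem (res _ k g) (A.ev (F.papp w i) (res _ k g)) := by
  rw [← pathApp_ev]
  exact congrArg (A.elem _) (eq_of_heq (pathApp_congr F A e (pathEv_res F w k g) _))

/-- the second component of a path application -/
def pappSec (w : Tm (path F A e)) (i : P.I.obj (op Γ.1)) {Y : C} (g : Γ.2.pred.obj (op Y)) :
    A.fam.obj (A.elem g (A.ev (F.papp w.tm i) g)) :=
  A.fam.map (𝟙 Y) ((congrArg (res A.secs (𝟙 Y)) (path_elem F w.tm (𝟙 Y) g i)).trans
    ((res_id A.secs _).trans (by rw [res_id Γ.2.pred g])))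
    ((w.sec g).1 (𝟙 Y) (ival P i (res _ (𝟙 Y) g)))

theorem path_sec_res (w : Tm (path F A e)) {X Y Z : C} (k : Y ⟶ X) (f : Z ⟶ Y)
    (g : Γ.2.pred.obj (op X)) {g' : Γ.2.pred.obj (op Y)} (h : res _ k g = g') {l : Z ⟶ X}
    (hl : f ≫ k = l) {i i' : P.I.obj (op Z)} (hi : i = i') :
    HEq ((w.sec g').1 f i) ((w.sec g).1 l i') := by
  subst h hl hi
  have e' : HEq (w.sec (res _ k g)) ((w.sec g).pre k) :=
    (heq_of_eq (w.nat k g).symm).trans (cast_heq _ _)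
  exact PathFib.at_heq (D := pathData F A e (pathEv F A e w.tm (res _ k g)))
    (y := w.sec (res _ k g)) (y' := (w.sec g).pre k)
    (pathData_res F A e k (pathEv_res F w.tm k g)).symm e' rfl rfl

theorem pappSec_heq (w : Tm (path F A e)) (i : P.I.obj (op Γ.1)) {X Y : C} (k : Y ⟶ X)
    (g : Γ.2.pred.obj (op X)) {g' : Γ.2.pred.obj (op Y)} (h : res _ k g = g')
    {j : P.I.obj (op Y)} (hj : ival P i g' = j) :
    HEq (pappSec F w i g') ((w.sec g).1 k j) := by
  subst hj
  refine (A.fam.map_id_heq _ _).trans ?_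
  exact path_sec_res F w k (𝟙 Y) g h (Category.id_comp k)
    (congrArg (fun g => ival P i g) (res_id Γ.2.pred _))

def papp (w : Tm (path F A e)) (i : P.I.obj (op Γ.1)) : Tm A where
  tm := F.papp w.tm i
  sec g := pappSec F w i g
  nat {X Y} f g := by
    have h0 : A.elem g (A.ev (F.papp w.tm i) g)
        = A.elem ((pathData F A e (pathEv F A e w.tm g)).γ (𝟙 X))
          ((pathData F A e (pathEv F A e w.tm g)).ω (𝟙 X) (ival P i (res _ (𝟙 X) g))) :=
      ((path_elem F w.tm (𝟙 X) g i).trans (by rw [res_id Γ.2.pred g])).symm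
    have h1 : HEq (pappSec F w i g) ((w.sec g).1 (𝟙 X) (ival P i (res _ (𝟙 X) g))) :=
      A.fam.map_id_heq _ _
    have h2 := (w.sec g).2.1 (𝟙 X) f f (Category.comp_id f) (ival P i (res _ (𝟙 X) g))
    refine eq_of_heq ((A.fam.map_heq rfl _ _ h0 h1).trans ((heq_of_eq h2).trans
      (pappSec_heq F w i f g rfl ?_).symm))
    rw [← ival_res, res_id Γ.2.pred g]

theorem Tm.sec_of_eq {A : Ty Γ} {x y : Tm A} (h : x = y) {Y : C} (g : Γ.2.pred.obj (op Y)) :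
    HEq (x.sec g) (y.sec g) := by subst h; rfl

theorem papp_pt (w : Tm (path F A e)) (b : Bool) : papp F w (P.pt b Γ.1) = e b := by
  refine Tm.ext ?_ (fun {Y} g => ?_)
  · cases b
    · exact F.papp_zero _
    · exact F.papp_one _
  · refine (pappSec_heq F w _ (𝟙 Y) g (res_id _ g) (P.pt_res b _)).trans ?_
    refine (heq_of_eq ((w.sec g).2.2 b (𝟙 Y))).trans ?_
    exact (pathEnd_heq F A e _ b).trans ((e b).sec_heq (res_id Γ.2.pred g))

theorem path_map_sec (w : Tm (path F A e)) (σ : Δ ⟶ Γ) {e' : Bool → Tm (A.pullback σ)}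
    (he : ∀ b, (e b).map σ rfl = e' b)
    (h : (path F A e).pullback σ = path F (A.pullback σ) e') {Y Z : C} (d : Δ.2.pred.obj (op Y))
    (f : Z ⟶ Y) (i : P.I.obj (op Z)) :
    HEq (((w.map σ h).sec d).1 f i) ((w.sec (ap σ.map d)).1 f i) := by
  refine PathFib.at_heq (D := (pathData F (A.pullback σ) e' _).base σ)
    (y := ((w.map σ h).sec d)) (D' := pathData F A e (pathEv F A e w.tm (ap σ.map d)))
    (y' := w.sec (ap σ.map d)) ?_ (Tm.map_sec _ _ _ _) rfl rfl
  refine (pathData_base F e σ _ e' he _ rfl ?_).symm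
  refine HEq.trans ?_ (heq_of_eq (K.Tm.map_map _ _ _).symm)
  exact K.Tm.map_heq (σ.comm d) _ _ rfl HEq.rfl

theorem papp_map (w : Tm (path F A e)) (σ : Δ ⟶ Γ) {e' : Bool → Tm (A.pullback σ)}
    (he : ∀ b, (e b).map σ rfl = e' b)
    (h : (path F A e).pullback σ = path F (A.pullback σ) e') (i : P.I.obj (op Γ.1)) :
    papp F (w.map σ h) (res P.I (K.base σ.sub) i) = (papp F w i).map σ rfl := by
  refine Tm.ext ?_ (fun {Y} d => ?_)
  · obtain rfl : (fun b => (e b).map σ rfl) = e' := funext he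
    exact F.papp_sub σ.sub w.tm i
  · refine HEq.trans ?_ (Tm.map_sec σ rfl _ d).symm
    have hj : ival P (res P.I (K.base σ.sub) i) d = ival P i (ap σ.map d) := by
      rw [ival, ival, σ.comm, res_res, K.base_comp]
    refine (pappSec_heq (A := A.pullback σ) F (w.map σ h) _ (𝟙 Y) d (res_id _ d) hj).trans ?_
    refine HEq.trans ?_ (pappSec_heq F w i (𝟙 Y) _ (res_id _ _) rfl).symm
    exact path_map_sec F w σ he h d _ _

/-! contexts of `M*` with an empty predicate, and points of contexts -/

variable (K) in
def emptyCtx (Δ : K.Ctx) : Ctx K :=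
  ⟨Δ.1, Δ.2, mkPsh (fun _ => PEmpty) (fun _ x => x) (fun x => x.elim) (fun _ _ x => x.elim),
    mkHom (fun x => PEmpty.elim x) (fun _ x => PEmpty.elim x)⟩

def emptyHom {Δ : K.Ctx} {Γ : Ctx K} (σ : Δ ⟶ under Γ) : emptyCtx K Δ ⟶ Γ where
  sub := σ
  map := mkHom (fun x => PEmpty.elim x) (fun _ x => PEmpty.elim x)
  comm x := PEmpty.elim x

theorem emptyHom_eq {Δ : K.Ctx} {Γ : Ctx K} (τ : emptyCtx K Δ ⟶ Γ) : τ = emptyHom τ.sub :=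
  hom_ext rfl (fun x => PEmpty.elim x)

variable (K) in
def ptCtx (Z : C) : Ctx K :=
  ⟨Z, K.unitCon Z, mkPsh (fun W => (W ⟶ Z)) (fun k f => k ≫ f) (fun f => Category.id_comp f)
    (fun f g t => (Category.assoc _ _ _).symm),
    mkHom (fun f => K.unitMap f) (fun k f => K.unitMap_comp f k)⟩

def ptHom {Z : C} (g : Γ.2.pred.obj (op Z)) : ptCtx K Z ⟶ Γ where
  sub := pr Γ g
  map := mkHom (fun f => res _ f g) (fun k f => (res_res _ _ _ _).symm)
  comm f := pr_res Γ f g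

theorem ptHom_comp {Z : C} (σ : Δ ⟶ Γ) (d : Δ.2.pred.obj (op Z)) :
    ptHom d ≫ σ = ptHom (ap σ.map d) :=
  hom_ext (σ.comm d).symm (fun f => ap_res _ _ _)

variable (l : TmLine (K := cwf K) (constLine P A))

theorem line_congr {σ σ' : Δ ⟶ Γ} (h : σ = σ') {i i' : P.I.obj (op Δ.1)} (hi : i = i') :
    HEq (l.tm σ i) (l.tm σ' i') := by subst h hi; rfl

theorem line_tm_congr {σ σ' : Δ ⟶ Γ} (h : σ = σ') {i i' : P.I.obj (op Δ.1)} (hi : i = i') :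
    HEq (Tm.tm (l.tm σ i)) (Tm.tm (l.tm σ' i')) := by subst h hi; rfl

theorem line_sec_congr {σ σ' : Δ ⟶ Γ} (h : σ = σ') {i i' : P.I.obj (op Δ.1)} (hi : i = i') {Y : C}
    (d : Δ.2.pred.obj (op Y)) :
    HEq (Tm.sec (l.tm σ i) d) (Tm.sec (l.tm σ' i') d) := by subst h hi; rfl

def kline : TmLine (K := K) (constLine P A.ty) where
  tm σ i := Tm.tm (l.tm (emptyHom σ) i)
  nat {Δ Θ} σ τ i := by
    have h := congrArg Tm.tm (l.nat (emptyHom σ) (emptyHom (Γ := emptyCtx K Δ) τ) i)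
    refine h.trans (eq_of_heq (line_tm_congr l ?_ rfl))
    exact emptyHom_eq _

theorem kline_tm (σ : Δ ⟶ Γ) (i : P.I.obj (op Δ.1)) : Tm.tm (l.tm σ i) = (kline l).tm σ.sub i := by
  have h := congrArg Tm.tm (l.nat σ (emptyHom (Γ := Δ) (𝟙 (under Δ))) i)
  refine eq_of_heq (HEq.trans (K.Tm.map_id_heq (Cwf.sub_sub _ _ _) _).symm ((heq_of_eq h).trans ?_))
  refine line_tm_congr l ((emptyHom_eq _).trans (congrArg emptyHom (Category.id_comp σ.sub))) ?_
  exact (congrArg (fun f => res P.I f i) (K.base_id _)).trans (res_id _ _)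

/-- the value in `M` of a line at a point -/
def ptElem {Z : C} (g : Γ.2.pred.obj (op Z)) (i : P.I.obj (op Z)) : A.secs.obj (op Z) :=
  A.elem g (K.Tm.map (𝟙 (K.unit Z)) ((res_id _ _).trans (A.cl_eq g)) ((kline l).tm (pr Γ g) i))

theorem kline_congr {Δ : K.Ctx} {σ σ' : Δ ⟶ under Γ} (h : σ = σ') {i i' : P.I.obj (op Δ.1)}
    (hi : i = i') : HEq ((kline l).tm σ i) ((kline l).tm σ' i') := by subst h hi; rfl

theorem elem_congr {Z : C} {g g' : Γ.2.pred.obj (op Z)} (h : g = g') {a : K.Tm.obj (A.cl g)}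
    {a' : K.Tm.obj (A.cl g')} (ha : HEq a a') : A.elem g a = A.elem g' a' := by
  subst h; rw [eq_of_heq ha]

theorem line_elem (σ : Δ ⟶ Γ) (i : P.I.obj (op Δ.1)) {Y : C} (d : Δ.2.pred.obj (op Y))
    {g : Γ.2.pred.obj (op Y)} (hg : ap σ.map d = g) {j : P.I.obj (op Y)} (hj : ival P i d = j) :
    A.elem (ap σ.map d) ((A.pullback σ).ev (Tm.tm (l.tm σ i)) d) = ptElem l g j := by
  subst hg hj
  refine elem_congr rfl ?_
  refine HEq.trans ?_ (K.Tm.map_id_heq _ _).symm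
  rw [kline_tm]
  refine (K.Tm.map_heq'' (pr Δ d) _ (Cwf.sub_sub _ _ _) _).trans ?_
  refine (heq_of_eq ((kline l).nat σ.sub (pr Δ d) i)).trans ?_
  exact kline_congr l (σ.comm d).symm rfl

theorem ptHom_elem {Z W : C} (g : Γ.2.pred.obj (op Z)) (i : P.I.obj (op Z)) (f : W ⟶ Z) :
    ival P (Γ := ptCtx K Z) i (Y := W) f = res P.I f i :=
  congrArg (fun f => res P.I f i) (K.base_unitMap f)

/-- the value of a line at a point -/
def ptVal {Z : C} (g : Γ.2.pred.obj (op Z)) (i : P.I.obj (op Z)) : A.fam.obj (ptElem l g i) :=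
  cast (congrArg (fun s => A.fam.obj s) (line_elem l (ptHom g) i (𝟙 Z) (res_id Γ.2.pred g)
    ((ptHom_elem g i (𝟙 Z)).trans (res_id P.I i)))) (Tm.sec (l.tm (ptHom g) i) (𝟙 Z))

theorem ptVal_congr {Z : C} {g g' : Γ.2.pred.obj (op Z)} (hg : g = g') {i i' : P.I.obj (op Z)}
    (hi : i = i') : HEq (ptVal l g i) (ptVal l g' i') := by subst hg hi; rfl

theorem ptVal_heq (σ : Δ ⟶ Γ) (i : P.I.obj (op Δ.1)) {Y : C} (d : Δ.2.pred.obj (op Y))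
    {g : Γ.2.pred.obj (op Y)} (hg : ap σ.map d = g) {j : P.I.obj (op Y)} (hj : ival P i d = j) :
    HEq (Tm.sec (l.tm σ i) d) (ptVal l g j) := by
  subst hg hj
  have h := Tm.sec_of_eq (l.nat σ (ptHom d) i) (𝟙 Y)
  refine HEq.trans (HEq.trans ?_ (Tm.map_sec (ptHom d)
    ((constLine (K := cwf K) P A).nat σ (ptHom d) i) (l.tm σ i) (𝟙 Y)).symm)
    (HEq.trans h ?_)
  · exact Tm.sec_heq _ (res_id _ d).symm
  · exact (line_sec_congr l (ptHom_comp σ d) rfl _).trans (cast_heq _ _).symm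

theorem ptElem_res {X Y : C} (k : Y ⟶ X) (g : Γ.2.pred.obj (op X)) (i : P.I.obj (op X)) :
    res A.secs k (ptElem l g i) = ptElem l (res _ k g) (res _ k i) := by
  have h := line_elem l (ptHom g) i (𝟙 X) (res_id Γ.2.pred g)
    ((ptHom_elem g i (𝟙 X)).trans (res_id P.I i))
  rw [← h]
  refine Eq.trans ?_ (line_elem l (ptHom g) i k (g := res _ k g) rfl (ptHom_elem g i k))
  have h1 := (A.pullback (ptHom g)).res_elem k (g := 𝟙 X) (g' := k) (Category.comp_id k)
    (a := (A.pullback (ptHom g)).ev (Tm.tm (l.tm (ptHom g) i)) (𝟙 X))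
    (a' := (A.pullback (ptHom g)).ev (Tm.tm (l.tm (ptHom g) i)) k) (by
      refine eq_of_heq ((K.Tm.map_heq'' _ _ _ _).trans ((heq_of_eq
        ((A.pullback (ptHom g)).ev_res (Tm.tm (l.tm (ptHom g) i)) k (𝟙 X))).trans ?_))
      exact congr_arg_heq (fun f => (A.pullback (ptHom g)).ev (Tm.tm (l.tm (ptHom g) i)) f)
        (Category.comp_id k))
  exact (ap_res (A.secsMap (ptHom g)) k _).symm.trans (congrArg (ap (A.secsMap (ptHom g))) h1)

theorem ptVal_res {X Y : C} (k : Y ⟶ X) (g : Γ.2.pred.obj (op X)) (i : P.I.obj (op X)) :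
    A.fam.map k (ptElem_res l k g i) (ptVal l g i) = ptVal l (res _ k g) (res _ k i) := by
  have h := Tm.nat (l.tm (ptHom g) i) k (𝟙 X)
  refine eq_of_heq (HEq.trans ?_ ((heq_of_eq h).trans ((Tm.sec_heq _ (Category.comp_id k)).trans
    (ptVal_heq l (ptHom g) i k rfl (ptHom_elem g i k)))))
  exact A.fam.map_heq rfl _ _ (line_elem l (ptHom g) i (𝟙 X) (res_id Γ.2.pred g)
    ((ptHom_elem g i (𝟙 X)).trans (res_id P.I i))).symm (cast_heq _ _)

theorem pabs_elem (c : K.Tm.obj (F.Path A.ty (e false).tm (e true).tm))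
    (hc : ∀ {Δ : K.Ctx} (σ : Δ ⟶ under Γ) (i : P.I.obj (op Δ.1)),
      F.papp (K.Tm.map σ (F.Path_sub σ A.ty _ _) c) i = (kline l).tm σ i)
    {Y Z : C} (f : Z ⟶ Y) (g : Γ.2.pred.obj (op Y)) (i : P.I.obj (op Z)) :
    ptElem l (res _ f g) i = A.elem ((pathData F A e (pathEv F A e c g)).γ f)
      ((pathData F A e (pathEv F A e c g)).ω f i) := by
  refine elem_congr rfl ((K.Tm.map_id_heq _ _).trans ?_)
  rw [← hc]
  refine HEq.trans ?_ (pathApp_congr F A e (pathEv_res F c f g) i).symm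
  refine kpapp_heq F rfl (pathClosed_cl F A e _) (A.cl_eq _) (K.Tm.map_heq'' _ _ _ _)
    (K.Tm.map_heq'' _ _ _ _) ?_ rfl
  exact K.Tm.map_heq'' _ _ _ _

theorem pabs (h : ∀ (b : Bool) {Δ : Ctx K} (σ : Δ ⟶ Γ), l.tm σ (P.pt b Δ.1) = (e b).map σ rfl)
    (he : ∀ {Δ : Ctx K} (σ : Δ ⟶ Γ) (e' : Bool → Tm (A.pullback σ)),
      (∀ b, (e b).map σ rfl = e' b) → (path F A e).pullback σ = path F (A.pullback σ) e') :
    ∃! c : Tm (path F A e), ∀ {Δ : Ctx K} (σ : Δ ⟶ Γ) (e' : Bool → Tm (A.pullback σ))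
      (h' : ∀ b, (e b).map σ rfl = e' b) (i : P.I.obj (op Δ.1)),
      papp F (c.map σ (he σ e' h')) i = l.tm σ i := by
  obtain ⟨c, hc, hu⟩ := F.pabs (kline l)
    (fun σ => congrArg Tm.tm (h false (emptyHom σ))) (fun σ => congrArg Tm.tm (h true (emptyHom σ)))
  have hcl : ∀ {Y Z : C} (f : Z ⟶ Y) (g : Γ.2.pred.obj (op Y)) (i : P.I.obj (op Z)),
      ptElem l (res _ f g) i = A.elem ((pathData F A e (pathEv F A e c g)).γ f)
        ((pathData F A e (pathEv F A e c g)).ω f i) :=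
    fun f g i => pabs_elem F l c hc f g i
  let c' : Tm (path F A e) := {
    tm := c
    sec := fun {Y} g => ⟨fun f i => cast (congrArg (fun s => A.fam.obj s) (hcl f g i))
        (ptVal l (res _ f g) i), by
      refine ⟨fun {Z W} f k f' ef i => ?_, fun b {Z} f => ?_⟩
      · subst ef
        refine eq_of_heq ((A.fam.map_heq rfl _ _ (hcl f g i).symm (cast_heq _ _)).trans
          ((heq_of_eq (ptVal_res l k (res _ f g) i)).trans
            ((ptVal_congr l (res_res _ _ _ _) rfl).trans (cast_heq _ _).symm)))
      · refine eq_of_heq ((cast_heq _ _).trans (HEq.trans (cast_heq _ _) (HEq.trans ?_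
          (pathEnd_heq F A e _ b).symm)))
        refine (Tm.sec_of_eq (h b (ptHom (res _ f g))) (𝟙 Z)).trans ?_
        exact (Tm.map_sec _ rfl (e b) _).trans (Tm.sec_heq _ (res_id _ _))⟩
    nat := fun {X Y} k g => by
      refine eq_of_heq ((cast_heq _ _).trans ?_)
      refine PathFib.heq (pathData_res F A e k (pathEv_res F c k g)) (fun f i => ?_)
      exact (cast_heq _ _).trans ((ptVal_congr l (res_res _ _ _ _).symm rfl).trans
        (cast_heq _ _).symm) }
  refine ⟨c', ?_, ?_⟩
  · intro Δ σ e' h' i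
    obtain rfl : (fun b => (e b).map σ rfl) = e' := funext h'
    refine Tm.ext (by
      exact (hc σ.sub i).trans (kline_tm l σ i).symm) (fun {Y} d => ?_)
    refine (pappSec_heq (A := A.pullback σ) F _ i (𝟙 Y) d (res_id _ d) rfl).trans ?_
    refine (path_map_sec F c' σ h' (he σ _ h') d _ _).trans ?_
    refine (cast_heq _ _).trans ?_
    exact (ptVal_heq l σ i d (res_id _ _).symm rfl).symm
  · intro x hx
    have hxt : x.tm = c := by
      refine hu x.tm (fun σ i => ?_)
      exact congrArg Tm.tm (hx (emptyHom σ) _ (fun _ => rfl) i)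
    refine Tm.ext hxt (fun {Y} g => ?_)
    refine PathFib.heq (D := pathData F A e (pathEv F A e x.tm g))
      (D' := pathData F A e (pathEv F A e c g)) (by rw [hxt]) (fun {Z} f i => ?_)
    refine HEq.trans ?_ (cast_heq _ _).symm
    have h1 := Tm.sec_of_eq (hx (ptHom (res _ f g)) _ (fun _ => rfl) i) (𝟙 Z)
    refine HEq.trans (HEq.trans ?_ h1) (cast_heq _ _).symm
    refine HEq.trans ?_ (pappSec_heq (A := A.pullback (ptHom (res _ f g))) F _ i (𝟙 Z) (𝟙 Z)
      (Category.id_comp _) ((ptHom_elem (res _ f g) i (𝟙 Z)).trans (res_id P.I i))).symm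
    refine HEq.trans ?_ (path_map_sec F x (ptHom (res _ f g)) (fun _ => rfl) _ (𝟙 Z) _ _).symm
    exact (path_sec_res F x f (𝟙 Z) g (res_id _ _).symm (Category.id_comp f) rfl).symm
end

/-! ### The type formers of `M*` -/

section
variable {P : CubeBase C} (F : TypeFormers P K)

/-- a pair of end points -/
def ends {A : Ty Γ} (a₀ a₁ : Tm A) : Bool → Tm A
  | false => a₀
  | true => a₁

theorem ends_map {A : Ty Γ} (σ : Δ ⟶ Γ) {B : Ty Δ} (h : A.pullback σ = B) (a₀ a₁ : Tm A)
    (b : Bool) : (ends a₀ a₁ b).map σ h = ends (a₀.map σ h) (a₁.map σ h) b := by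
  cases b <;> rfl

theorem path_ends {A : Ty Γ} (σ : Δ ⟶ Γ) (a₀ a₁ : Tm A) {e' : Bool → Tm (A.pullback σ)}
    (h : ∀ b, (ends a₀ a₁ b).map σ rfl = e' b) :
    (path F A (ends a₀ a₁)).pullback σ = path F (A.pullback σ) e' := by
  obtain rfl : (fun b => (ends a₀ a₁ b).map σ rfl) = e' := funext h
  exact path_pullback F σ _

theorem pi_lift (σ : Δ ⟶ Γ) (A : Ty Γ) (B : Ty (extend Γ A)) :
    (pi F A B).pullback σ = pi F (A.pullback σ) (B.pullback
      (Cwf.lift (K := cwf K) σ (A := A) (A' := A.pullback σ) rfl)) :=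
  (pi_pullback F σ A B).trans (congrArg (fun τ : extend Δ (A.pullback σ) ⟶ extend Γ A =>
    pi F (A.pullback σ) (B.pullback τ)) (lift_eq σ A).symm)

theorem sig_lift (σ : Δ ⟶ Γ) (A : Ty Γ) (B : Ty (extend Γ A)) :
    (sig F A B).pullback σ = sig F (A.pullback σ) (B.pullback
      (Cwf.lift (K := cwf K) σ (A := A) (A' := A.pullback σ) rfl)) :=
  (sig_pullback F σ A B).trans (congrArg (fun τ : extend Δ (A.pullback σ) ⟶ extend Γ A =>
    sig F (A.pullback σ) (B.pullback τ)) (lift_eq σ A).symm)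

theorem unlam_lift {A : Ty Γ} {B : Ty (extend Γ A)} (σ : Δ ⟶ Γ)
    (τ : extend Δ (A.pullback σ) ⟶ extend Γ A) (hτ : τ = lift' σ A)
    (h : (pi F A B).pullback σ = pi F (A.pullback σ) (B.pullback τ)) (c : Tm (pi F A B)) :
    unlamEquiv F (c.map σ h) = (unlamEquiv F c).map τ rfl := by
  subst hτ; exact unlam_map F σ c

theorem unpair_lift {A : Ty Γ} {B : Ty (extend Γ A)} (σ : Δ ⟶ Γ)
    (τ : extend Δ (A.pullback σ) ⟶ extend Γ A) (hτ : τ = lift' σ A)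
    (h : (sig F A B).pullback σ = sig F (A.pullback σ) (B.pullback τ)) (c : Tm (sig F A B))
    (h' : (B.pullback (Cwf.inst (K := cwf K) (unpairEquiv F c).1)).pullback σ
      = (B.pullback τ).pullback
          (Cwf.inst (K := cwf K) ((unpairEquiv F c).1.map σ rfl))) :
    unpairEquiv F (c.map σ h) = ⟨(unpairEquiv F c).1.map σ rfl, (unpairEquiv F c).2.map σ h'⟩ := by
  subst hτ; exact unpair_map F σ c

/-- The type formers of the sconing: the first components are the ones of `M`, the second components
are given by products, sums and paths of families of types over `C`. -/
def formers : TypeFormers P (cwf K) where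
  Pi := fun {_} A B => pi F A B
  Pi_sub := fun {_ _} σ A B => pi_lift F σ A B
  unlam := fun {_ _ _} => unlamEquiv F
  unlam_sub := fun {_ _} σ {A B} c => unlam_lift F σ _ (lift_eq σ _) (pi_lift F σ A B) c
  Sig := fun {_} A B => sig F A B
  Sig_sub := fun {_ _} σ A B => sig_lift F σ A B
  unpair := fun {_ _ _} => unpairEquiv F
  unpair_sub := fun {_ _} σ {A B} c => unpair_lift F σ _ (lift_eq σ _) (sig_lift F σ A B) c
    (Cwf.inst_sub (K := cwf K) σ (A := A) rfl B (unpairEquiv F c).1)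
  Path := fun {_} A a₀ a₁ => path F A (ends a₀ a₁)
  Path_sub := fun {_ _} σ _ a₀ a₁ => path_ends F σ a₀ a₁ (ends_map σ rfl a₀ a₁)
  papp := fun {_ _ _ _} w i => papp F w i
  papp_sub := fun {_ _} σ {_ a₀ a₁} c i => papp_map F c σ (ends_map σ rfl _ _)
    (path_ends F σ a₀ a₁ (ends_map σ rfl a₀ a₁)) i
  papp_zero := fun {_ _ _ _} c => papp_pt F c false
  papp_one := fun {_ _ _ _} c => papp_pt F c true
  pabs := fun {Γ A a₀ a₁} l h₀ h₁ => by
    obtain ⟨c, hc, hu⟩ := pabs F (e := ends a₀ a₁) l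
      (fun b _ σ => match b with | false => h₀ σ | true => h₁ σ)
      (fun σ e' h => path_ends F σ a₀ a₁ h)
    refine ⟨c, fun {Δ} σ i => hc σ _ (ends_map σ rfl a₀ a₁) i, fun x hx => ?_⟩
    refine hu x (fun {Δ} σ e' h i => ?_)
    obtain rfl : e' = ends (a₀.map σ rfl) (a₁.map σ rfl) :=
      funext fun b => (h b).symm.trans (ends_map σ rfl a₀ a₁ b)
    exact hx σ i
end

end Scone

/-! ### Filling -/

section Filling
open Cwf
variable {P : CubeBase C} {K : Cwf.{u, w, w'} C}

theorem TyLine.ty_congr {Γ Δ : K.Ctx} (L : TyLine P Γ) {σ σ' : Δ ⟶ Γ} (h : σ = σ')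
    (i : P.I.obj (op Δ.1)) : L.ty σ i = L.ty σ' i := by subst h; rfl

/-- substitution in a line of types -/
def TyLine.sub {Δ Γ : K.Ctx} (L : TyLine P Γ) (τ : Δ ⟶ Γ) : TyLine P Δ where
  ty σ i := L.ty (σ ≫ τ) i
  nat σ ρ i := (L.nat (σ ≫ τ) ρ i).trans (L.ty_congr (Category.assoc _ _ _).symm _)

/-- substitution in a line of elements -/
def TmLine.sub {Δ Γ : K.Ctx} {L : TyLine P Γ} (l : TmLine L) (τ : Δ ⟶ Γ) : TmLine (L.sub τ) where
  tm σ i := l.tm (σ ≫ τ) i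
  nat {Θ Ξ} σ ρ i := by
    have key : ∀ (κ κ' : Ξ ⟶ Γ), κ = κ' → ∀ j, HEq (l.tm κ j) (l.tm κ' j) := by
      rintro κ _ rfl j; rfl
    exact eq_of_heq ((K.Tm.map_heq'' _ _ _ _).trans ((heq_of_eq (l.nat (σ ≫ τ) ρ i)).trans
      (key _ _ (Category.assoc _ _ _).symm _)))

/-- An element of `Π (i : I). [φ] ∨ (i = b) → Elem(Γ, A i)`. -/
structure PartialLine {Γ : K.Ctx} (L : TyLine P Γ) (φ : Sieve Γ.1) (b : Bool) where
  tm : ∀ {Δ : K.Ctx} (σ : Δ ⟶ Γ) (i : P.I.obj (op Δ.1)),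
    φ.arrows (K.base σ) ∨ i = P.pt b Δ.1 → K.Tm.obj (L.ty σ i)
  nat : ∀ {Δ Θ : K.Ctx} (σ : Δ ⟶ Γ) (τ : Θ ⟶ Δ) (i : P.I.obj (op Δ.1))
    (h : φ.arrows (K.base σ) ∨ i = P.pt b Δ.1)
    (h' : φ.arrows (K.base (τ ≫ σ)) ∨ res P.I (K.base τ) i = P.pt b Θ.1),
    K.Tm.map τ (L.nat σ τ i) (tm σ i h) = tm (τ ≫ σ) (res P.I (K.base τ) i) h'

/-- substitution in a partial line of elements -/
def PartialLine.sub {Δ Γ : K.Ctx} {L : TyLine P Γ} {φ : Sieve Γ.1} {b : Bool}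
    (u : PartialLine L φ b) (τ : Δ ⟶ Γ) : PartialLine (L.sub τ) (φ.pullback (K.base τ)) b where
  tm σ i h := u.tm (σ ≫ τ) i (h.imp_left fun h => by
    rw [K.base_comp]; exact h)
  nat {Θ Ξ} σ ρ i h h' := by
    have key : ∀ (κ κ' : Ξ ⟶ Γ), κ = κ' → ∀ j k k', HEq (u.tm κ j k) (u.tm κ' j k') := by
      rintro κ _ rfl j _ _; rfl
    have h₂ : φ.arrows (K.base (ρ ≫ σ ≫ τ)) ∨ res P.I (K.base ρ) i = P.pt b Ξ.1 := by
      refine h'.imp_left fun h => ?_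
      rw [← Category.assoc, K.base_comp]; exact h
    exact eq_of_heq ((K.Tm.map_heq'' _ _ _ _).trans ((heq_of_eq (u.nat (σ ≫ τ) ρ i _ h₂)).trans
      (key _ _ (Category.assoc _ _ _).symm _ _ _)))

/-- A filling operation for elements of types, stable under substitution. -/
structure Filling (P : CubeBase C) (K : Cwf.{u, w, w'} C) where
  fill : ∀ {Γ : K.Ctx} (L : TyLine P Γ) (φ : Sieve Γ.1), φ ∈ P.Cof Γ.1 → ∀ (b : Bool),
    PartialLine L φ b → TmLine L
  fill_extends : ∀ {Γ : K.Ctx} (L : TyLine P Γ) (φ : Sieve Γ.1) (hφ : φ ∈ P.Cof Γ.1) (b : Bool)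
    (u : PartialLine L φ b) {Δ : K.Ctx} (σ : Δ ⟶ Γ) (i : P.I.obj (op Δ.1))
    (h : φ.arrows (K.base σ) ∨ i = P.pt b Δ.1), (fill L φ hφ b u).tm σ i = u.tm σ i h
  fill_sub : ∀ {Δ Γ : K.Ctx} (τ : Δ ⟶ Γ) (L : TyLine P Γ) (φ : Sieve Γ.1) (hφ : φ ∈ P.Cof Γ.1)
    (b : Bool) (u : PartialLine L φ b), (fill L φ hφ b u).sub τ
      = fill (L.sub τ) (φ.pullback (K.base τ)) (P.Cof_pullback _ _ hφ) b (u.sub τ)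

end Filling

/-- A cubical category with families, with the operations relevant to equivalences. -/
structure CubicalCwf (P : CubeBase C) where
  toCwf : Cwf.{u, w, w'} C
  formers : TypeFormers P toCwf
  filling : Filling P toCwf

section FamFilling
variable (P : CubeBase C) {S T : Cᵒᵖ ⥤ Type u}

/-- An element of `I → T` at stage `Z`. -/
structure Line (T : Cᵒᵖ ⥤ Type u) (Z : C) where
  pt : ∀ {Y : C}, (Y ⟶ Z) → P.I.obj (op Y) → T.obj (op Y)
  nat : ∀ {X Y : C} (f : X ⟶ Z) (g : Y ⟶ X) (i : P.I.obj (op X)),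
    res T g (pt f i) = pt (g ≫ f) (res P.I g i)

variable {P}

theorem Line.pt_congr {Y Z : C} (y : Line P T Z) {f f' : Y ⟶ Z} (h : f = f')
    (i : P.I.obj (op Y)) : y.pt f i = y.pt f' i := by subst h; rfl

def Line.pre {W Z : C} (y : Line P T Z) (k : W ⟶ Z) : Line P T W where
  pt f i := y.pt (f ≫ k) i
  nat f g i := (y.nat (f ≫ k) g i).trans (y.pt_congr (Category.assoc _ _ _).symm _)

def Line.map {Z : C} (y : Line P S Z) (α : S ⟶ T) : Line P T Z where
  pt f i := ap α (y.pt f i)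
  nat f g i := (ap_res α g _).symm.trans (congrArg (ap α) (y.nat f g i))

/-- An element of `Π (i : I). F (y i)` at stage `Z`. -/
structure LineSec (F : Fam.{u, u, u, u} T) {Z : C} (y : Line P T Z) where
  val : ∀ {Y : C} (f : Y ⟶ Z) (i : P.I.obj (op Y)), F.obj (y.pt f i)
  nat : ∀ {X Y : C} (f : X ⟶ Z) (g : Y ⟶ X) (i : P.I.obj (op X)),
    F.map g (y.nat f g i) (val f i) = val (g ≫ f) (res P.I g i)

/-- An element of `Π (i : I). [φ] ∨ (i = b) → F (y i)` at stage `Z`. -/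
structure PartialLineSec (F : Fam.{u, u, u, u} T) {Z : C} (y : Line P T Z) (φ : Sieve Z)
    (b : Bool) where
  val : ∀ {Y : C} (f : Y ⟶ Z) (i : P.I.obj (op Y)), φ.arrows f ∨ i = P.pt b Y → F.obj (y.pt f i)
  nat : ∀ {X Y : C} (f : X ⟶ Z) (g : Y ⟶ X) (i : P.I.obj (op X)) (h : φ.arrows f ∨ i = P.pt b X)
    (h' : φ.arrows (g ≫ f) ∨ res P.I g i = P.pt b Y),
    F.map g (y.nat f g i) (val f i h) = val (g ≫ f) (res P.I g i) h'

def LineSec.pre {F : Fam.{u, u, u, u} T} {W Z : C} {y : Line P T Z} (s : LineSec F y)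
    (k : W ⟶ Z) : LineSec F (y.pre k) where
  val f i := s.val (f ≫ k) i
  nat {X Y} f g i := by
    have key : ∀ (l l' : Y ⟶ Z), l = l' → ∀ j, HEq (s.val l j) (s.val l' j) := by
      rintro l _ rfl j; rfl
    exact eq_of_heq ((F.map_heq'' _ _ _ _).trans ((heq_of_eq (s.nat (f ≫ k) g i)).trans
      (key _ _ (Category.assoc _ _ _).symm _)))

def PartialLineSec.pre {F : Fam.{u, u, u, u} T} {W Z : C} {y : Line P T Z} {φ : Sieve Z} {b : Bool}
    (s : PartialLineSec F y φ b) (k : W ⟶ Z) : PartialLineSec F (y.pre k) (φ.pullback k) b where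
  val f i h := s.val (f ≫ k) i h
  nat {X Y} f g i h h' := by
    have key : ∀ (l l' : Y ⟶ Z), l = l' → ∀ j m m', HEq (s.val l j m) (s.val l' j m') := by
      rintro l _ rfl j _ _; rfl
    have h₂ : φ.arrows (g ≫ f ≫ k) ∨ res P.I g i = P.pt b Y := by
      refine h'.imp_left fun h => ?_
      rw [← Category.assoc]; exact h
    exact eq_of_heq ((F.map_heq'' _ _ _ _).trans ((heq_of_eq (s.nat (f ≫ k) g i h h₂)).trans
      (key _ _ (Category.assoc _ _ _).symm _ _ _)))

variable (P) in
/-- A filling structure on the family `F`: a global element of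
`Π (y : I → T). hasFill (F ∘ y)`. -/
structure FillStr (F : Fam.{u, u, u, u} T) where
  fill : ∀ {Z : C} (y : Line P T Z) (φ : Sieve Z), φ ∈ P.Cof Z → ∀ (b : Bool),
    PartialLineSec F y φ b → LineSec F y
  fill_extends : ∀ {Z : C} (y : Line P T Z) (φ : Sieve Z) (hφ : φ ∈ P.Cof Z) (b : Bool)
    (u : PartialLineSec F y φ b) {Y : C} (f : Y ⟶ Z) (i : P.I.obj (op Y))
    (h : φ.arrows f ∨ i = P.pt b Y), (fill y φ hφ b u).val f i = u.val f i h
  fill_pre : ∀ {W Z : C} (k : W ⟶ Z) (y : Line P T Z) (φ : Sieve Z) (hφ : φ ∈ P.Cof Z)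
    (b : Bool) (u : PartialLineSec F y φ b),
    (fill y φ hφ b u).pre k = fill (y.pre k) (φ.pullback k) (P.Cof_pullback _ _ hφ) b (u.pre k)

/-- Closure of filling structures under substitution. -/
def FillStr.pull {F : Fam.{u, u, u, u} T} (s : FillStr P F) (α : S ⟶ T) :
    FillStr P (F.pull α) where
  fill y φ hφ b u :=
    let r := s.fill (y.map α) φ hφ b ⟨fun f i h => u.val f i h, fun f g i h h' => u.nat f g i h h'⟩
    ⟨fun f i => r.val f i, fun f g i => r.nat f g i⟩
  fill_extends y φ hφ b u _ f i h := s.fill_extends (y.map α) φ hφ b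
    ⟨fun f i h => u.val f i h, fun f g i h h' => u.nat f g i h h'⟩ f i h
  fill_pre k y φ hφ b u := by
    have h := s.fill_pre k (y.map α) φ hφ b
      ⟨fun f i h => u.val f i h, fun f g i h h' => u.nat f g i h h'⟩
    exact congrArg (fun r : LineSec F ((y.map α).pre k) =>
      (⟨fun f i => r.val f i, fun f g i => r.nat f g i⟩ : LineSec (F.pull α) (y.pre k))) h

/-! ### Equivalences between families over a presheaf -/

/-- A global element of `Π (t : T). dom t → cod t`. -/
structure FamMap (T : Cᵒᵖ ⥤ Type u) where
  dom : Fam.{u, u, u, u} T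
  cod : Fam.{u, u, u, u} T
  fn : ∀ {X : C} (t : T.obj (op X)), dom.obj t → cod.obj t
  nat : ∀ {X Y : C} (f : Y ⟶ X) {t : T.obj (op X)} {s : T.obj (op Y)} (h : res T f t = s)
    (x : dom.obj t), cod.map f h (fn t x) = fn s (dom.map f h x)

def FamMap.pull (φ : FamMap T) (α : S ⟶ T) : FamMap S where
  dom := φ.dom.pull α
  cod := φ.cod.pull α
  fn s x := φ.fn (ap α s) x
  nat f _ _ h x := φ.nat f _ x

variable (P) in
/-- A global element of `Π (t : T). isEquiv (φ t)`: a left and a right homotopy inverse. -/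
structure FamEquiv (φ : FamMap T) where
  linv : ∀ {X : C} (t : T.obj (op X)), φ.cod.obj t → φ.dom.obj t
  linv_nat : ∀ {X Y : C} (f : Y ⟶ X) {t : T.obj (op X)} {s : T.obj (op Y)} (h : res T f t = s)
    (y : φ.cod.obj t), φ.dom.map f h (linv t y) = linv s (φ.cod.map f h y)
  lhtpy : ∀ {X : C} (t : T.obj (op X)), φ.dom.obj t → P.I.obj (op X) → φ.dom.obj t
  lhtpy_nat : ∀ {X Y : C} (f : Y ⟶ X) {t : T.obj (op X)} {s : T.obj (op Y)} (h : res T f t = s)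
    (x : φ.dom.obj t) (i : P.I.obj (op X)),
    φ.dom.map f h (lhtpy t x i) = lhtpy s (φ.dom.map f h x) (res P.I f i)
  lhtpy_zero : ∀ {X : C} (t : T.obj (op X)) (x : φ.dom.obj t),
    lhtpy t x (P.pt false X) = linv t (φ.fn t x)
  lhtpy_one : ∀ {X : C} (t : T.obj (op X)) (x : φ.dom.obj t), lhtpy t x (P.pt true X) = x
  rinv : ∀ {X : C} (t : T.obj (op X)), φ.cod.obj t → φ.dom.obj t
  rinv_nat : ∀ {X Y : C} (f : Y ⟶ X) {t : T.obj (op X)} {s : T.obj (op Y)} (h : res T f t = s)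
    (y : φ.cod.obj t), φ.dom.map f h (rinv t y) = rinv s (φ.cod.map f h y)
  rhtpy : ∀ {X : C} (t : T.obj (op X)), φ.cod.obj t → P.I.obj (op X) → φ.cod.obj t
  rhtpy_nat : ∀ {X Y : C} (f : Y ⟶ X) {t : T.obj (op X)} {s : T.obj (op Y)} (h : res T f t = s)
    (y : φ.cod.obj t) (i : P.I.obj (op X)),
    φ.cod.map f h (rhtpy t y i) = rhtpy s (φ.cod.map f h y) (res P.I f i)
  rhtpy_zero : ∀ {X : C} (t : T.obj (op X)) (y : φ.cod.obj t),
    rhtpy t y (P.pt false X) = φ.fn t (rinv t y)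
  rhtpy_one : ∀ {X : C} (t : T.obj (op X)) (y : φ.cod.obj t), rhtpy t y (P.pt true X) = y

def FamEquiv.pull {φ : FamMap T} (e : FamEquiv P φ) (α : S ⟶ T) : FamEquiv P (φ.pull α) where
  linv s y := e.linv (ap α s) y
  linv_nat f _ _ h y := e.linv_nat f _ y
  lhtpy s x i := e.lhtpy (ap α s) x i
  lhtpy_nat f _ _ h x i := e.lhtpy_nat f _ x i
  lhtpy_zero s x := e.lhtpy_zero _ x
  lhtpy_one s x := e.lhtpy_one _ x
  rinv s y := e.rinv (ap α s) y
  rinv_nat f _ _ h y := e.rinv_nat f _ y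
  rhtpy s y i := e.rhtpy (ap α s) y i
  rhtpy_nat f _ _ h y i := e.rhtpy_nat f _ y i
  rhtpy_zero s y := e.rhtpy_zero _ y
  rhtpy_one s y := e.rhtpy_one _ y

end FamFilling

/-! ### The three statements -/

namespace Scone
open Cwf

/-- A type of the sconing: a family together with its proof of fibrancy. -/
structure FibTy (P : CubeBase C) {K : Cwf.{u, w, w'} C} (Γ : Ctx K) where
  ty : Ty Γ
  fib : FillStr P ty.fam

variable {K : Cwf.{u, w, w'} C} {Γ Δ Θ : Ctx K} {P : CubeBase C}

def FibTy.pullback (A : FibTy P Γ) (σ : Δ ⟶ Γ) : FibTy P Δ where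
  ty := A.ty.pullback σ
  fib := A.fib.pull (A.ty.secsMap σ)

variable (F : TypeFormers P K)

/-- `A → B` in the sconing -/
abbrev arrow (A B : Ty Γ) : Ty Γ := TypeFormers.arr (formers F) (K := cwf K) A B

variable {F}

/-- `efun f ρ a = iapp (f ρ, a)`, that is `iapp (f p, q)` at `(ρ, a)` -/
def efun {A B : Ty Γ} (f : Tm (arrow F A B)) {Y : C} (g : Γ.2.pred.obj (op Y))
    (a : K.Tm.obj (A.cl g)) : K.Tm.obj (B.cl g) :=
  K.Tm.map (K.pair (pr Γ g) (A.cl_eq g) a)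
    ((Cwf.sub_sub B.ty (K.p A.ty) (K.pair (pr Γ g) (A.cl_eq g) a)).trans
      ((congrArg (Cwf.sub B.ty) (K.pair_p _ _ _)).trans (B.cl_eq g)))
    (F.unlam (A := A.ty) (B := Cwf.sub B.ty (K.p A.ty)) f.tm)

/-- the second component `f' ρ ρ' a : A' ρ ρ' a → B' ρ ρ' (efun f ρ a)` -/
def efun' {A B : Ty Γ} (f : Tm (arrow F A B)) {Y : C} (g : Γ.2.pred.obj (op Y))
    (a : K.Tm.obj (A.cl g)) (x : A.fam.obj (A.elem g a)) : B.fam.obj (B.elem g (efun f g a)) :=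
  (unlam F (A := A) (B := B.pullback (p A)) f).sec (tot A g a x)

variable {A B : Ty Γ}

theorem efun_res (f : Tm (arrow F A B)) {X Y : C} (k : Y ⟶ X) {g : Γ.2.pred.obj (op X)}
    {g' : Γ.2.pred.obj (op Y)} (h : res _ k g = g') {a : K.Tm.obj (A.cl g)}
    {a' : K.Tm.obj (A.cl g')} (ha : K.Tm.map (K.unitMap k) (cl_res' A k h) a = a') :
    K.Tm.map (K.unitMap k) (cl_res' B k h) (efun f g a) = efun f g' a' := by
  subst h ha
  rw [efun, efun, K.Tm.map_map]
  refine K.Tm.map_eq ?_ _ _ _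
  refine (Cwf.comp_pair _ _ _ (A.cl_res k g) _).trans ?_
  exact Cwf.pair_congr (pr_res Γ k g).symm _ _ _

/-- the map `(ρ, a) ↦ (ρ, efun f ρ a)` -/
def efunMap (f : Tm (arrow F A B)) : A.secs ⟶ B.secs :=
  mkHom (fun s => B.elem s.1 (efun f s.1 s.2)) (fun k s =>
    (B.res_elem k rfl (efun_res f k rfl rfl)).symm)

theorem efun'_res (f : Tm (arrow F A B)) {X Y : C} (k : Y ⟶ X) {g : Γ.2.pred.obj (op X)}
    {g' : Γ.2.pred.obj (op Y)} (h : res _ k g = g') {a : K.Tm.obj (A.cl g)}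
    {a' : K.Tm.obj (A.cl g')} (ha : K.Tm.map (K.unitMap k) (cl_res' A k h) a = a')
    (x : A.fam.obj (A.elem g a)) :
    B.fam.map k (B.res_elem k h (efun_res f k h ha)) (efun' f g a x)
      = efun' f g' a' (A.fam.map k (A.res_elem k h ha) x) := by
  subst h ha
  exact (unlam F (A := A) (B := B.pullback (p A)) f).nat k (tot A g a x)

/-- the family `Σ (a : |A| ρ). A' ρ ρ' a` over the contexts `(ρ, ρ')` -/
def Ty.sumFam (A : Ty Γ) : Fam.{u, u, u, u} Γ.2.pred where
  obj g := Σ a : K.Tm.obj (A.cl g), A.fam.obj (A.elem g a)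
  map := fun {_ _} k {_ _} h t =>
    ⟨K.Tm.map (K.unitMap k) (cl_res' A k h) t.1, A.fam.map k (A.res_elem k h rfl) t.2⟩
  map_id := fun {X g} h t => by
    refine Sigma.ext ?_ ?_
    · exact eq_of_heq ((K.Tm.map_heq (K.unitMap_id X) _ (res_id _ _) rfl HEq.rfl).trans
        (heq_of_eq (K.Tm.map_id _ _)))
    · exact A.fam.map_id_heq _ _
  map_comp := fun {_ _ _} f k {_ _ _} h h' l t => by
    refine Sigma.ext ?_ ?_
    · exact (K.Tm.map_map _ _ _).trans (K.Tm.map_eq (K.unitMap_comp f k).symm _ _ _)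
    · refine (heq_of_eq (A.fam.map_map _ _ _)).trans ?_
      exact A.fam.map_heq'' _ _ _ _

/-- the map on total spaces, `(a, a') ↦ (efun f ρ a, f' ρ ρ' a a')` -/
def sumMap (f : Tm (arrow F A B)) : FamMap Γ.2.pred where
  dom := A.sumFam
  cod := B.sumFam
  fn g t := ⟨efun f g t.1, efun' f g t.1 t.2⟩
  nat k _ _ h t := by
    refine Sigma.ext (efun_res f k h rfl) ?_
    refine (B.fam.map_heq'' _ _ _ _).trans (heq_of_eq (efun'_res f k h rfl t.2))

/-- the maps of fibres `f' ρ ρ' a : A' ρ ρ' a → B' ρ ρ' (efun f ρ a)` -/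
def fibMap (f : Tm (arrow F A B)) : FamMap A.secs where
  dom := A.fam
  cod := B.fam.pull (efunMap f)
  fn s x := efun' f s.1 s.2 x
  nat k s r h x := by
    subst h; exact efun'_res f k rfl rfl x

/-- substitution in a function -/
def subst (σ : Δ ⟶ Γ) (f : Tm (arrow F A B)) : Tm (arrow F (A.pullback σ) (B.pullback σ)) :=
  (cwf K).Tm.map σ ((formers F).arr_sub (K := cwf K) (A := A) (B := B) σ rfl rfl) f

theorem efun_subst (σ : Δ ⟶ Γ) (f : Tm (arrow F A B)) {Y : C} (d : Δ.2.pred.obj (op Y))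
    (a : K.Tm.obj (A.cl (ap σ.map d))) :
    efun (A := A.pullback σ) (B := B.pullback σ) (subst σ f) d a = efun f (ap σ.map d) a := by
  have e' := F.unlam_arr_sub σ.sub (A := A.ty) (B := B.ty) rfl rfl (F.arr_sub σ.sub rfl rfl) f.tm
  refine (congrArg (K.Tm.map (K.pair (pr Δ d) ((A.pullback σ).cl_eq d) a) _) e').trans ?_
  refine (K.Tm.map_map _ _ _).trans (K.Tm.map_eq ?_ _ _ _)
  refine (Cwf.pair_lift _ _ _ _ _).trans ?_
  exact Cwf.pair_congr (σ.comm d).symm _ _ _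

theorem efun'_subst (σ : Δ ⟶ Γ) (f : Tm (arrow F A B)) {Y : C} (d : Δ.2.pred.obj (op Y))
    (a : K.Tm.obj (A.cl (ap σ.map d))) (x : A.fam.obj (A.elem (ap σ.map d) a)) :
    HEq (efun' (A := A.pullback σ) (B := B.pullback σ) (subst σ f) d a x)
      (efun' f (ap σ.map d) a x) := by
  have e := (formers F).unlam_arr_sub (K := cwf K) σ (A := A) (B := B) rfl rfl
    ((formers F).arr_sub (K := cwf K) (A := A) (B := B) σ rfl rfl) f
  refine (Tm.sec_of_eq e (tot (A.pullback σ) d a x)).trans ?_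
  refine (Tm.map_sec _ (TypeFormers.arr_aux (K := cwf K) σ (A := A) (B := B) rfl rfl) _ _).trans ?_
  refine Tm.sec_heq (unlam F (A := A) (B := B.pullback (p A)) f) ?_
  exact congrArg (fun τ : extend Δ (A.pullback σ) ⟶ extend Γ A =>
    ap τ.map (tot (A.pullback σ) d a x)) (lift_eq σ A)

theorem FamMap.mk_congr {T : Cᵒᵖ ⥤ Type u} {φ ψ : FamMap T} (hd : φ.dom = ψ.dom)
    (hc : φ.cod = ψ.cod) (hf : ∀ {X : C} (t : T.obj (op X)), HEq (@φ.fn X t) (@ψ.fn X t)) :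
    φ = ψ := by
  obtain ⟨d, c, f, n⟩ := φ
  obtain ⟨d', c', f', n'⟩ := ψ
  obtain rfl : d = d' := hd
  obtain rfl : c = c' := hc
  obtain rfl : @f = @f' := by
    funext X t; exact eq_of_heq (hf t)
  rfl

theorem sumMap_subst (σ : Δ ⟶ Γ) (f : Tm (arrow F A B)) :
    (sumMap f).pull σ.map
      = sumMap (A := A.pullback σ) (B := B.pullback σ) (subst σ f) := by
  refine FamMap.mk_congr rfl rfl (fun {X} d => heq_of_eq ?_)
  funext t
  exact Sigma.ext (efun_subst σ f d t.1).symm (efun'_subst σ f d t.1 t.2).symm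

theorem efunMap_subst (σ : Δ ⟶ Γ) (f : Tm (arrow F A B)) :
    A.secsMap σ ≫ efunMap f
      = efunMap (A := A.pullback σ) (B := B.pullback σ) (subst σ f) ≫ B.secsMap σ :=
  psh_hom_ext (fun s => congrArg (B.elem (ap σ.map s.1)) (efun_subst σ f s.1 s.2).symm)

theorem fibMap_subst (σ : Δ ⟶ Γ) (f : Tm (arrow F A B)) :
    (fibMap f).pull (A.secsMap σ)
      = fibMap (A := A.pullback σ) (B := B.pullback σ) (subst σ f) := by
  refine FamMap.mk_congr rfl (congrArg B.fam.pull (efunMap_subst σ f)) (fun {X} s => ?_)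
  refine Function.hfunext rfl (fun x x' hx => ?_)
  obtain rfl := eq_of_heq hx
  exact (efun'_subst σ f s.1 s.2 x).symm

/-! ### The three assertions and natural logical equivalence -/

/-- A map `(f, f') : Elem((Γ, Γ'), (A, A') → (B, B'))` between types of the sconing. -/
structure MapIn (P : CubeBase C) (F : TypeFormers P K) (Γ : Ctx K) where
  A : FibTy P Γ
  B : FibTy P Γ
  f : Tm (arrow F A.ty B.ty)

/-- substitution in a map of the sconing -/
def MapIn.sub (m : MapIn P F Γ) (σ : Δ ⟶ Γ) : MapIn P F Δ :=
  ⟨m.A.pullback σ, m.B.pullback σ, subst σ m.f⟩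

variable (P F) in
/-- An assertion about maps of the sconing, as the type of its witnesses, together with the action of
the substitutions of the sconing on witnesses. -/
structure Assertion where
  wit : ∀ {Γ : Ctx K}, MapIn P F Γ → Type u
  act : ∀ {Δ Γ : Ctx K} (σ : Δ ⟶ Γ) (m : MapIn P F Γ), wit m → wit (m.sub σ)

/-- A natural implication: an operation on witnesses which commutes with substitution. -/
def Assertion.NatImplies (S T : Assertion P F) : Prop :=
  ∃ t : ∀ {Γ : Ctx K} (m : MapIn P F Γ), S.wit m → T.wit m,
    ∀ {Δ Γ : Ctx K} (σ : Δ ⟶ Γ) (m : MapIn P F Γ) (x : S.wit m),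
      t (m.sub σ) (S.act σ m x) = T.act σ m (t m x)

/-- natural logical equivalence -/
def Assertion.NatIff (S T : Assertion P F) : Prop := S.NatImplies T ∧ T.NatImplies S

variable (P F) in
/-- `Elem((Γ, Γ'), isEquiv* (f, f'))`, where `isEquiv*` is formed with the type formers of `M*` -/
def equivInSconing : Assertion P F where
  wit m := (cwf K).Tm.obj ((formers F).isEquiv (K := cwf K) (A := m.A.ty) (B := m.B.ty) m.f)
  act σ m x := (cwf K).Tm.map σ
    ((formers F).isEquiv_sub (K := cwf K) σ (A := m.A.ty) (B := m.B.ty) rfl rfl m.f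
      (f' := subst σ m.f)
      ((formers F).arr_sub (K := cwf K) (A := m.A.ty) (B := m.B.ty) σ rfl rfl) rfl) x

/-- the action of substitutions on `Elem(Γ, isEquiv f)` -/
def baseAct (σ : Δ ⟶ Γ) (m : MapIn P F Γ)
    (x : K.Tm.obj (F.isEquiv (A := m.A.ty.ty) (B := m.B.ty.ty) m.f.tm)) :
    K.Tm.obj (F.isEquiv (A := (m.sub σ).A.ty.ty) (B := (m.sub σ).B.ty.ty) (m.sub σ).f.tm) :=
  K.Tm.map σ.sub
    (F.isEquiv_sub σ.sub (A := m.A.ty.ty) (B := m.B.ty.ty) rfl rfl m.f.tm _ rfl) x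

variable (P F) in
/-- `Elem(Γ, isEquiv f) × Π ρ ρ'. isEquiv (Σ_{efun f ρ} f' ρ ρ')` -/
def equivOnTotals : Assertion P F where
  wit m := K.Tm.obj (F.isEquiv (A := m.A.ty.ty) (B := m.B.ty.ty) m.f.tm) × FamEquiv P (sumMap m.f)
  act σ m x := (baseAct σ m x.1,
    cast (congrArg (FamEquiv P) (sumMap_subst σ m.f)) (x.2.pull σ.map))

variable (P F) in
/-- `Elem(Γ, isEquiv f) × Π ρ ρ' a. isEquiv (f' ρ ρ' a)` -/
def equivOnFibres : Assertion P F where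
  wit m := K.Tm.obj (F.isEquiv (A := m.A.ty.ty) (B := m.B.ty.ty) m.f.tm) × FamEquiv P (fibMap m.f)
  act σ m x := (baseAct σ m x.1,
    cast (congrArg (FamEquiv P) (fibMap_subst σ m.f)) (x.2.pull (m.A.ty.secsMap σ)))

end Scone
end Sconing

/-! An element of `isEquiv* (f, f')` unfolds to an element `c` of `isEquiv f` together with a left
inverse, a right inverse and homotopies for the maps of total spaces `Σ_{⟨f⟩ρ} f' ρ ρ'`, whose first
components are strictly those that `c` induces on `|A| ρ → |B| ρ`. This description is exact
(`totEquiv_injective`, `totEquiv_exists`), so (1) implies (2) by forgetting that the first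
components match. The content lies in (2) ⇒ (3), which extracts equivalences of fibres, and in (3) ⇒
(1), which has to rebuild an equivalence of total spaces strictly over the given `c`.

The tool is to trade inverses for an extension property `Ext`: a point `(x, p)` of the homotopy
fibre over `y`, with `p` a path from `f x` to `y`, extends to a total one whenever it is given on a
cofibrant part `φ` of the parameters. This says that homotopy fibres are contractible. `QInv.toExt`
derives it for maps of fibrations from a left and a right homotopy inverse. No triangle identity is
needed: `x` is found by filling, a line from `l (f x)` to `l y` is arranged to be `l ∘ p` on `φ`,
and conjugating its image under `f` by a homotopy `f ∘ l ∼ id` returns `p` on `φ`.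

Let `A' → A` and `B' → B` be fibrations over `A → G` and `B → G`. The homotopy fibre of `f'` maps to
that of `f`, and if both have the extension property, a point below and a partial lift of it have a
total lift strictly over the given point (`CentIn.result`): extend upstairs, connect the projection
to the given point by a path downstairs, and lift that path. For the constant paths below this
yields inverses of the maps of fibres (`Cfg.fibInv`); for the points `(r, rh)` given by `c` it
yields a right inverse over `c`. In the other direction, extension for the base and for the fibres
composes to extension for the total spaces (`Ext.sum`). A left inverse over `c` arises by
transporting a centre of contraction along the homotopy of `c` and back (`Cfg.sumL`, `Cfg.sumLh`).

Naturality is obtained by making every construction over an arbitrary parameter presheaf `H` out of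
uniform fillings, and by proving next to it that it preserves relations between two sets of data
(`FibrRel`, `QInv.Rel`, `Ext.Rel` and the lemmas ending in `_rel`). A substitution of the sconing
gives such a relation, and `famEquiv_eq_pull` turns the resulting relation of outputs into the
required equation. -/

namespace Sconing
namespace Kan

/-! ## Presheaves by elements, and uniform filling -/

/-- A presheaf over `C`, with plain restriction functions. -/
structure Psh (C : Type u) [SmallCategory C] where
  obj : C → Type u
  res : ∀ {X Y : C}, (Y ⟶ X) → obj X → obj Y
  res_id : ∀ {X : C} (t : obj X), res (𝟙 X) t = t
  res_res : ∀ {X Y Z : C} (f : Y ⟶ X) (g : Z ⟶ Y) (t : obj X), res g (res f t) = res (g ≫ f) t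

variable {C : Type u} [SmallCategory C]

/-- A map of presheaves. -/
structure Map (S T : Psh C) where
  fn : ∀ {X : C}, S.obj X → T.obj X
  res_fn : ∀ {X Y : C} (f : Y ⟶ X) (s : S.obj X), T.res f (fn s) = fn (S.res f s)

infixr:75 " ⋄ " => Map.fn

namespace Map
variable {S T R : Psh C}

@[reducible] def id (S : Psh C) : Map S S := ⟨fun s => s, fun _ _ => rfl⟩

@[reducible] def comp (a : Map S T) (b : Map T R) : Map S R :=
  ⟨fun s => b ⋄ a ⋄ s, fun f s => by rw [b.res_fn, a.res_fn]⟩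

end Map

/-! ### Cylinders. -/

variable (P : CubeBase C)

/-- The cylinder `H × I`. -/
@[reducible] def cyl (H : Psh C) : Psh C where
  obj X := H.obj X × P.I.obj (op X)
  res f t := (H.res f t.1, Sconing.res P.I f t.2)
  res_id t := Prod.ext (H.res_id _) (Sconing.res_id _ _)
  res_res f g t := Prod.ext (H.res_res _ _ _) (Sconing.res_res _ _ _ _)

variable {P}
variable {H H' J J' S T E F G : Psh C}

@[reducible] def Map.fst : Map (cyl P H) H := ⟨fun t => t.1, fun _ _ => rfl⟩

/-- `(h, i) ↦ (k h, i)` -/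
@[reducible] def Map.cyl (k : Map H' H) : Map (cyl P H') (cyl P H) :=
  ⟨fun t => (k ⋄ t.1, t.2), fun f t => Prod.ext (k.res_fn f t.1) rfl⟩

/-- the inclusion of an end of the cylinder -/
@[reducible] def Map.face (b : Bool) : Map H (Kan.cyl P H) :=
  ⟨fun t => (t, P.pt b _), fun f t => Prod.ext rfl (P.pt_res b f)⟩

/-- `((h, i), j) ↦ ((h, j), i)` -/
@[reducible] def Map.swap : Map (Kan.cyl P (Kan.cyl P H)) (Kan.cyl P (Kan.cyl P H)) :=
  ⟨fun t => ((t.1.1, t.2), t.1.2), fun _ _ => rfl⟩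

/-- `((h, i), j) ↦ (h, j)` -/
@[reducible] def Map.skip : Map (Kan.cyl P (Kan.cyl P H)) (Kan.cyl P H) :=
  ⟨fun t => (t.1.1, t.2), fun _ _ => rfl⟩

/-! ### Cofibrant predicates on a presheaf. -/

/-- A cofibrant predicate on `H`. -/
structure Cofib (P : CubeBase C) (H : Psh C) where
  holds : ∀ {X : C}, H.obj X → Prop
  mono : ∀ {X Y : C} (f : Y ⟶ X) {t : H.obj X}, holds t → holds (H.res f t)
  cof : ∀ {X : C} (t : H.obj X), (⟨fun _ f => holds (H.res f t), fun {Y Z f} h g => by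
    rw [← H.res_res]; exact mono g h⟩ : Sieve X) ∈ P.Cof X

namespace Cofib

/-- the sieve of the restrictions which satisfy `φ` -/
def sieve (φ : Cofib P H) {X : C} (t : H.obj X) : Sieve X :=
  ⟨fun _ f => φ.holds (H.res f t), fun {Y Z f} h g => by
    rw [← H.res_res]; exact φ.mono g h⟩

theorem sieve_mem (φ : Cofib P H) {X : C} (t : H.obj X) : φ.sieve t ∈ P.Cof X := φ.cof t

theorem sieve_pullback (φ : Cofib P H) {X Y : C} (f : Y ⟶ X) (t : H.obj X) :
    (φ.sieve t).pullback f = φ.sieve (H.res f t) := by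
  ext Z g
  show φ.holds _ ↔ φ.holds _
  rw [H.res_res]

variable (P H) in
/-- the false predicate -/
@[reducible] def bot : Cofib P H where
  holds _ := False
  mono _ _ h := h
  cof {X} t := by
    -- The empty sieve is the truth value of `0 = 1`, because the end points differ at every stage.
    convert P.Cof_eq (P.pt false X) true using 1
    ext Y f
    show False ↔ Sconing.res P.I f _ = Sconing.res P.I f _
    rw [P.pt_res, P.pt_res]
    exact (iff_false_intro (P.pt_ne Y)).symm

/-- the predicate `φ ∨ i = 0 ∨ i = 1` on the cylinder -/
@[reducible] def faces (φ : Cofib P H) : Cofib P (cyl P H) where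
  holds {X} t := φ.holds t.1 ∨ ∃ c, t.2 = P.pt c X
  mono f t h := h.imp (φ.mono f) (fun ⟨c, h⟩ => ⟨c, by dsimp only; rw [h, P.pt_res]⟩)
  cof {X} t := by
    have h := P.Cof_or _ _ (P.Cof_or _ _ (φ.sieve_mem t.1) (P.Cof_eq t.2 false)) (P.Cof_eq t.2 true)
    convert h using 1
    ext Y f
    show (φ.holds _ ∨ ∃ c, _ = _) ↔ ((φ.holds _ ∨ (Sconing.res P.I f _ = Sconing.res P.I f _)) ∨
      (Sconing.res P.I f _ = Sconing.res P.I f _))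
    rw [P.pt_res, P.pt_res, or_assoc]
    refine or_congr Iff.rfl ⟨?_, ?_⟩
    · rintro ⟨c, h⟩
      cases c
      · exact Or.inl h
      · exact Or.inr h
    · rintro (h | h)
      · exact ⟨_, h⟩
      · exact ⟨_, h⟩

end Cofib

/-! ### Partial maps, and their gluing along the faces of a cylinder. -/

/-- A partial map. -/
structure PMap (p : ∀ X : C, H.obj X → Prop) (E : Psh C) where
  val : ∀ {X : C} (t : H.obj X), p X t → E.obj X
  res_val : ∀ {X Y : C} (f : Y ⟶ X) (t : H.obj X) (h : p X t) (h' : p Y (H.res f t)),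
    E.res f (val t h) = val (H.res f t) h'

namespace PMap

theorem val_congr {p : ∀ X : C, H.obj X → Prop} (u : PMap p E) {X : C} {t t' : H.obj X} (e : t = t')
    (h : p X t) (h' : p X t') : u.val t h = u.val t' h' := by subst e; rfl

@[reducible] def comp {p : ∀ X : C, H.obj X → Prop} (u : PMap p E) (a : Map E F) : PMap p F :=
  ⟨fun t h => a ⋄ u.val t h, fun f t h h' => by rw [a.res_fn, u.res_val f t h h']⟩

@[reducible] def pre {p : ∀ X : C, H.obj X → Prop} (u : PMap p E) (k : Map H' H) :
    PMap (fun X t => p X (k ⋄ t)) E :=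
  ⟨fun t h => u.val (k ⋄ t) h, fun f t h h' => by
    rw [u.res_val f _ h (by rw [k.res_fn]; exact h')]
    exact u.val_congr (k.res_fn f t) _ _⟩

@[reducible] def ofMap (p : ∀ X : C, H.obj X → Prop) (a : Map H E) : PMap p E :=
  ⟨fun t _ => a ⋄ t, fun f t _ _ => a.res_fn f t⟩

@[reducible] def empty (a : Map H' H) (E : Psh C) :
    PMap (fun X t => (Cofib.bot P H).holds (a ⋄ t)) E :=
  ⟨fun _ h => h.elim, fun _ _ h => h.elim⟩

/-- Partial maps which are related by `k` and `ε`. -/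
def Rel {p' : ∀ X : C, H'.obj X → Prop} {p : ∀ X : C, H.obj X → Prop} (k : Map H' H) (ε : Map E F)
    (u' : PMap p' E) (u : PMap p F) : Prop :=
  ∀ {X : C} (t : H'.obj X) (h' : p' X t) (h : p X (k ⋄ t)), ε ⋄ u'.val t h' = u.val (k ⋄ t) h

open Classical in
/-- The partial map on `φ ∨ i = 0 ∨ i = 1` which is `u` on `φ` and `v` on the faces. -/
noncomputable def faces (κ : Map J (cyl P H)) (φ : Cofib P H)
    (u : PMap (fun X (t : J.obj X) => φ.holds (κ ⋄ t).1) E) (v : Bool → Map J E)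
    (huv : ∀ (c : Bool) {X : C} (t : J.obj X) (hc : (κ ⋄ t).2 = P.pt c X) (h : φ.holds (κ ⋄ t).1),
      u.val t h = v c ⋄ t) : PMap (fun X (t : J.obj X) => φ.faces.holds (κ ⋄ t)) E where
  val {X} t _ := if h : φ.holds (κ ⋄ t).1 then u.val t h else
    if (κ ⋄ t).2 = P.pt false X then v false ⋄ t else v true ⋄ t
  res_val {X Y} f t h h' := by
    -- On the face `c` every branch returns `v c`: on `φ` this is `huv`, and off `φ` the test for
    -- the end `0` decides correctly since `0 ≠ 1`. For the same reason `v false` and `v true` need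
    -- not be compatible with each other.
    have key : ∀ {Z : C} (t : J.obj Z) (c : Bool), (κ ⋄ t).2 = P.pt c Z →
        (if h : φ.holds (κ ⋄ t).1 then u.val t h else
          if (κ ⋄ t).2 = P.pt false Z then v false ⋄ t else v true ⋄ t) = v c ⋄ t := by
      intro Z t c hc
      split_ifs with h1 h2
      · exact huv c t hc h1
      · cases c
        · rfl
        · exact absurd (h2.symm.trans hc) (P.pt_ne Z)
      · cases c
        · exact absurd hc h2
        · rfl
    have e := κ.res_fn f t
    rcases h with h | ⟨c, hc⟩
    · have h2 : φ.holds (κ ⋄ (J.res f t)).1 := by rw [← e]; exact φ.mono f h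
      rw [dif_pos h, dif_pos h2, u.res_val f t h h2]
    · have h2 : (κ ⋄ (J.res f t)).2 = P.pt c Y := by rw [← e, ← P.pt_res c f, ← hc]
      rw [key t c hc, key _ c h2, (v c).res_fn]

section
variable (κ : Map J (cyl P H)) (φ : Cofib P H)
    (u : PMap (fun X (t : J.obj X) => φ.holds (κ ⋄ t).1) E) (v : Bool → Map J E)
    (huv : ∀ (c : Bool) {X : C} (t : J.obj X) (hc : (κ ⋄ t).2 = P.pt c X) (h : φ.holds (κ ⋄ t).1),
      u.val t h = v c ⋄ t)

theorem faces_part {X : C} (t : J.obj X) (h : φ.holds (κ ⋄ t).1) (h') :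
    (faces κ φ u v huv).val t h' = u.val t h := dif_pos h

theorem faces_face {X : C} (t : J.obj X) (c : Bool) (hc : (κ ⋄ t).2 = P.pt c X) (h') :
    (faces κ φ u v huv).val t h' = v c ⋄ t := by
  by_cases h : φ.holds (κ ⋄ t).1
  · rw [faces_part κ φ u v huv t h, huv c t hc h]
  · refine (dif_neg h).trans ?_
    cases c
    · exact if_pos hc
    · refine if_neg (fun h => P.pt_ne X (h.symm.trans hc))

/-- Case distinction for statements about `PMap.faces`. -/
theorem faces_ind {X : C} (t : J.obj X) (h') (Q : E.obj X → Prop)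
    (h1 : ∀ h, Q (u.val t h)) (h2 : ∀ c, (κ ⋄ t).2 = P.pt c X → Q (v c ⋄ t)) :
    Q ((faces κ φ u v huv).val t h') := by
  rcases h' with h | ⟨c, hc⟩
  · rw [faces_part κ φ u v huv t h]; exact h1 h
  · rw [faces_face κ φ u v huv t c hc]; exact h2 c hc
end

/-- Related pieces glue to related partial maps, because `hφ` and `hl` make both sides take
corresponding branches. This carries the naturality of all fillings with faces. -/
theorem faces_rel {κ' : Map J' (cyl P H')} {κ : Map J (cyl P H)} {φ' : Cofib P H'} {φ : Cofib P H}
    {u' : PMap (fun X (t : J'.obj X) => φ'.holds (κ' ⋄ t).1) E} {v' : Bool → Map J' E} {huv'}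
    {u : PMap (fun X (t : J.obj X) => φ.holds (κ ⋄ t).1) F} {v : Bool → Map J F} {huv}
    {k : Map H' H} {l : Map J' J} {ε : Map E F}
    (hφ : ∀ {X : C} (t : H'.obj X), φ'.holds t ↔ φ.holds (k ⋄ t))
    (hl : ∀ {X : C} (t : J'.obj X), κ ⋄ l ⋄ t = (k ⋄ (κ' ⋄ t).1, (κ' ⋄ t).2))
    (hu : PMap.Rel l ε u' u)
    (hv : ∀ (c : Bool) {X : C} (t : J'.obj X), (κ' ⋄ t).2 = P.pt c X → ε ⋄ v' c ⋄ t = v c ⋄ l ⋄ t) :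
    PMap.Rel l ε (faces κ' φ' u' v' huv') (faces κ φ u v huv) := by
  intro X t h' h
  rcases h' with h1 | ⟨c, hc⟩
  · have h2 : φ.holds (κ ⋄ l ⋄ t).1 := by rw [hl]; exact (hφ _).1 h1
    rw [faces_part κ' φ' u' v' huv' t h1, faces_part κ φ u v huv _ h2]
    exact hu _ _ _
  · rw [faces_face κ' φ' u' v' huv' t c hc, faces_face κ φ u v huv (l ⋄ t) c (by rw [hl]; exact hc)]
    exact hv c t hc

end PMap

/-! ### Filling problems, filling operations, and the filling of squares. -/

/-- A filling problem: a partial map on `φ`, and a base at the end `b` of the cylinder. -/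
structure Box (π : Map E T) (y : Map (cyl P H) T) (φ : Cofib P H) (b : Bool)
    (u : PMap (fun X (t : (cyl P H).obj X) => φ.holds t.1) E) (w : Map H E) : Prop where
  over_u : ∀ {X : C} (t : (cyl P H).obj X) (h : φ.holds t.1), π ⋄ u.val t h = y ⋄ t
  over_w : ∀ {X : C} (t : H.obj X), π ⋄ w ⋄ t = y ⋄ (t, P.pt b X)
  uw : ∀ {X : C} (t : H.obj X) (h : φ.holds t), u.val (t, P.pt b X) h = w ⋄ t

/-- A filling operation for `π`. -/
structure Fibr (P : CubeBase C) (π : Map E T) where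
  fill : ∀ {H : Psh C} (y : Map (cyl P H) T) (φ : Cofib P H) (b : Bool)
    (u : PMap (fun X (t : (cyl P H).obj X) => φ.holds t.1) E) (w : Map H E),
    Box π y φ b u w → Map (cyl P H) E
  above : ∀ {H : Psh C} {y : Map (cyl P H) T} {φ : Cofib P H} {b : Bool}
    {u : PMap (fun X (t : (cyl P H).obj X) => φ.holds t.1) E} {w : Map H E}
    (B : Box π y φ b u w) {X : C} (t : (cyl P H).obj X), π ⋄ fill y φ b u w B ⋄ t = y ⋄ t
  ext : ∀ {H : Psh C} {y : Map (cyl P H) T} {φ : Cofib P H} {b : Bool}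
    {u : PMap (fun X (t : (cyl P H).obj X) => φ.holds t.1) E} {w : Map H E}
    (B : Box π y φ b u w) {X : C} (t : (cyl P H).obj X) (h : φ.holds t.1),
    fill y φ b u w B ⋄ t = u.val t h
  base : ∀ {H : Psh C} {y : Map (cyl P H) T} {φ : Cofib P H} {b : Bool}
    {u : PMap (fun X (t : (cyl P H).obj X) => φ.holds t.1) E} {w : Map H E}
    (B : Box π y φ b u w) {X : C} (t : H.obj X),
    fill y φ b u w B ⋄ (t, P.pt b X) = w ⋄ t

/-- Filling operations which are related by `ε` and `τ`. -/
def FibrRel {π' : Map E F} {π : Map S T} (s' : Fibr P π') (s : Fibr P π) (ε : Map E S) (τ : Map F T) :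
    Prop :=
  ∀ {H' H : Psh C} (k : Map H' H) {y' : Map (cyl P H') F} {φ' : Cofib P H'} {b : Bool}
    {u' : PMap (fun X (t : (cyl P H').obj X) => φ'.holds t.1) E} {w' : Map H' E}
    (B' : Box π' y' φ' b u' w') {y : Map (cyl P H) T} {φ : Cofib P H}
    {u : PMap (fun X (t : (cyl P H).obj X) => φ.holds t.1) S} {w : Map H S}
    (B : Box π y φ b u w),
    (∀ {X : C} (t : (cyl P H').obj X), τ ⋄ y' ⋄ t = y ⋄ (k ⋄ t.1, t.2)) →
    (∀ {X : C} (t : H'.obj X), φ'.holds t ↔ φ.holds (k ⋄ t)) →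
    PMap.Rel k.cyl ε u' u → (∀ {X : C} (t : H'.obj X), ε ⋄ w' ⋄ t = w ⋄ k ⋄ t) →
    ∀ {X : C} (t : (cyl P H').obj X), ε ⋄ s'.fill y' φ' b u' w' B' ⋄ t = s.fill y φ b u w B ⋄ (k ⋄ t.1, t.2)

/-- A filling problem for squares, with faces `v` in the first direction. -/
structure SqBox (π : Map E T) (y : Map (cyl P (cyl P H)) T) (φ : Cofib P H) (b : Bool)
    (u : PMap (fun X (t : (cyl P (cyl P H)).obj X) => φ.holds t.1.1) E) (v : Bool → Map (cyl P H) E)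
    (w : Map (cyl P H) E) : Prop where
  over_u : ∀ {X : C} (t : (cyl P (cyl P H)).obj X) (h : φ.holds t.1.1), π ⋄ u.val t h = y ⋄ t
  over_v : ∀ (c : Bool) {X : C} (t : (cyl P H).obj X), π ⋄ v c ⋄ t = y ⋄ ((t.1, P.pt c X), t.2)
  over_w : ∀ {X : C} (t : (cyl P H).obj X), π ⋄ w ⋄ t = y ⋄ (t, P.pt b X)
  uv : ∀ (c : Bool) {X : C} (t : (cyl P H).obj X) (h : φ.holds t.1),
    u.val ((t.1, P.pt c X), t.2) h = v c ⋄ t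
  uw : ∀ {X : C} (t : (cyl P H).obj X) (h : φ.holds t.1), u.val (t, P.pt b X) h = w ⋄ t
  vw : ∀ (c : Bool) {X : C} (t : H.obj X), v c ⋄ (t, P.pt b X) = w ⋄ (t, P.pt c X)

namespace SqBox
variable {π : Map E T} {y : Map (cyl P (cyl P H)) T} {φ : Cofib P H} {b : Bool}
    {u : PMap (fun X (t : (cyl P (cyl P H)).obj X) => φ.holds t.1.1) E} {v : Bool → Map (cyl P H) E}
    {w : Map (cyl P H) E}

theorem agree (B : SqBox π y φ b u v w) (c : Bool) {X : C} (t : (cyl P (cyl P H)).obj X)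
    (hc : t.1.2 = P.pt c X) (h : φ.holds t.1.1) : u.val t h = (Map.skip.comp (v c)) ⋄ t := by
  obtain ⟨⟨t, i⟩, j⟩ := t
  obtain rfl : i = P.pt c X := hc
  exact B.uv c (t, j) h

/-- For a point `((h, i), j)` the filling direction is `j`. The two sides `i = 0` and `i = 1` are
absorbed into the cofibrant predicate on the cylinder of the pairs `(h, i)`, so a square is an
ordinary filling problem with a larger parameter presheaf. -/
theorem box (B : SqBox π y φ b u v w) : Box π y φ.faces b
    (PMap.faces Map.fst φ u (fun c => Map.skip.comp (v c)) B.agree) w where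
  over_u t h := PMap.faces_ind Map.fst φ u (fun c => Map.skip.comp (v c)) B.agree t h
    (fun x => π ⋄ x = y ⋄ t) (fun h => B.over_u t h) (fun c hc => by
      obtain ⟨⟨t, i⟩, j⟩ := t
      obtain rfl : i = P.pt c _ := hc
      exact B.over_v c (t, j))
  over_w t := B.over_w t
  uw t h := PMap.faces_ind Map.fst φ u (fun c => Map.skip.comp (v c)) B.agree (t, P.pt b _) h
    (fun x => x = w ⋄ t) (fun h => B.uw t h) (fun c hc => by
      obtain ⟨t, i⟩ := t
      obtain rfl : i = P.pt c _ := hc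
      exact B.vw c t)
end SqBox

namespace Fibr
variable {π : Map E T} (s : Fibr P π)

/-- filling of squares -/
noncomputable def sq (y : Map (cyl P (cyl P H)) T) (φ : Cofib P H) (b : Bool)
    (u : PMap (fun X (t : (cyl P (cyl P H)).obj X) => φ.holds t.1.1) E) (v : Bool → Map (cyl P H) E)
    (w : Map (cyl P H) E) (B : SqBox π y φ b u v w) : Map (cyl P (cyl P H)) E :=
  s.fill y φ.faces b (PMap.faces Map.fst φ u (fun c => Map.skip.comp (v c)) B.agree) w B.box

variable {y : Map (cyl P (cyl P H)) T} {φ : Cofib P H} {b : Bool}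
    {u : PMap (fun X (t : (cyl P (cyl P H)).obj X) => φ.holds t.1.1) E} {v : Bool → Map (cyl P H) E}
    {w : Map (cyl P H) E} (B : SqBox π y φ b u v w)

theorem sq_above {X : C} (t : (cyl P (cyl P H)).obj X) : π ⋄ s.sq y φ b u v w B ⋄ t = y ⋄ t :=
  s.above B.box t

theorem sq_ext {X : C} (t : (cyl P (cyl P H)).obj X) (h : φ.holds t.1.1) :
    s.sq y φ b u v w B ⋄ t = u.val t h :=
  (s.ext B.box t (Or.inl h)).trans (PMap.faces_part Map.fst φ u _ B.agree t h _)

theorem sq_face (c : Bool) {X : C} (t : H.obj X) (j : P.I.obj (op X)) :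
    s.sq y φ b u v w B ⋄ ((t, P.pt c X), j) = v c ⋄ (t, j) :=
  (s.ext B.box ((t, P.pt c X), j) (Or.inr ⟨c, rfl⟩)).trans
    (PMap.faces_face Map.fst φ u _ B.agree ((t, P.pt c X), j) c rfl _)
end Fibr

/-- The relation of fillings is applied to the parameter map `k.cyl`; the glued partial maps are
related by `PMap.faces_rel`. -/
theorem FibrRel.sq {π' : Map E F} {π : Map S T} {s' : Fibr P π'} {s : Fibr P π} {ε : Map E S}
    {τ : Map F T} (R : FibrRel s' s ε τ) (k : Map H' H)
    {y' : Map (cyl P (cyl P H')) F} {φ' : Cofib P H'} {b : Bool}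
    {u' : PMap (fun X (t : (cyl P (cyl P H')).obj X) => φ'.holds t.1.1) E}
    {v' : Bool → Map (cyl P H') E} {w' : Map (cyl P H') E} (B' : SqBox π' y' φ' b u' v' w')
    {y : Map (cyl P (cyl P H)) T} {φ : Cofib P H}
    {u : PMap (fun X (t : (cyl P (cyl P H)).obj X) => φ.holds t.1.1) S}
    {v : Bool → Map (cyl P H) S} {w : Map (cyl P H) S} (B : SqBox π y φ b u v w)
    (hy : ∀ {X : C} (t : (cyl P (cyl P H')).obj X), τ ⋄ y' ⋄ t = y ⋄ k.cyl.cyl ⋄ t)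
    (hφ : ∀ {X : C} (t : H'.obj X), φ'.holds t ↔ φ.holds (k ⋄ t))
    (hu : PMap.Rel k.cyl.cyl ε u' u)
    (hv : ∀ (c : Bool) {X : C} (t : (cyl P H').obj X), ε ⋄ v' c ⋄ t = v c ⋄ k.cyl ⋄ t)
    (hw : ∀ {X : C} (t : (cyl P H').obj X), ε ⋄ w' ⋄ t = w ⋄ k.cyl ⋄ t) {X : C}
    (t : (cyl P (cyl P H')).obj X) :
    ε ⋄ s'.sq y' φ' b u' v' w' B' ⋄ t = s.sq y φ b u v w B ⋄ k.cyl.cyl ⋄ t :=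
  R k.cyl B'.box B.box hy (fun t => or_congr (hφ _) Iff.rfl)
    (PMap.faces_rel (κ' := Map.fst) (κ := Map.fst) (k := k) (l := k.cyl.cyl) hφ (fun _ => rfl) hu (fun c {X} t _ => hv c (t.1.1, t.2)))
    hw t

/-! ### Closure of filling operations -/

/-- filling for a composite -/
noncomputable def Fibr.comp {π : Map E F} {ρ : Map F T} (s : Fibr P π) (r : Fibr P ρ) :
    Fibr P (π.comp ρ) where
  -- The problem is projected to `F` and filled there; the filler is the line over which the
  -- original problem is filled by `s`.
  fill y φ b u w B := s.fill (r.fill y φ b (u.comp π) (w.comp π) ⟨B.over_u, B.over_w, fun t h =>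
      congrArg π.fn (B.uw t h)⟩) φ b u w ⟨fun t h => (r.ext (u := u.comp π) _ t h).symm, fun t => (r.base (w := w.comp π) _ t).symm, B.uw⟩
  above := fun {_ _ _ _ _ _} B {X} t => (congrArg ρ.fn (s.above _ t)).trans (r.above _ t)
  ext := fun {_ _ _ _ _ _} B {X} t h => s.ext _ t h
  base := fun {_ _ _ _ _ _} B {X} t => s.base _ t

theorem FibrRel.comp {E' F' T' : Psh C} {π' : Map E' F'} {ρ' : Map F' T'} {π : Map E F} {ρ : Map F T}
    {s' : Fibr P π'} {r' : Fibr P ρ'} {s : Fibr P π} {r : Fibr P ρ} {ε : Map E' E} {δ : Map F' F}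
    {τ : Map T' T} (h : ∀ {X : C} (x : E'.obj X), δ ⋄ π' ⋄ x = π ⋄ ε ⋄ x)
    (R : FibrRel s' s ε δ) (Q : FibrRel r' r δ τ) : FibrRel (s'.comp r') (s.comp r) ε τ := by
  intro H' H k y' φ' b u' w' B' y φ u w B hy hφ hu hw X t
  show ε ⋄ s'.fill _ φ' b u' w' _ ⋄ t = s.fill _ φ b u w _ ⋄ _
  refine R k _ _ (fun t => ?_) hφ hu hw t
  show δ ⋄ r'.fill _ φ' b _ _ _ ⋄ t = r.fill _ φ b _ _ _ ⋄ _
  refine Q k _ _ hy hφ (fun t h' h1 => ?_) (fun t => ?_) t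
  · exact (h _).trans (congrArg π.fn (hu t h' h1))
  · exact (h _).trans (congrArg π.fn (hw t))

/-- the pullback of `π` along `f` -/
@[reducible] def pb (f : Map F T) (π : Map E T) : Psh C where
  obj X := {t : F.obj X × E.obj X // f ⋄ t.1 = π ⋄ t.2}
  res g t := ⟨(F.res g t.1.1, E.res g t.1.2), by dsimp only; rw [← f.res_fn, ← π.res_fn, t.2]⟩
  res_id t := Subtype.ext (Prod.ext (F.res_id _) (E.res_id _))
  res_res g k t := Subtype.ext (Prod.ext (F.res_res _ _ _) (E.res_res _ _ _))

@[reducible] def pb.fst (f : Map F T) (π : Map E T) : Map (pb f π) F := ⟨fun t => t.1.1, fun _ _ => rfl⟩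
@[reducible] def pb.snd (f : Map F T) (π : Map E T) : Map (pb f π) E := ⟨fun t => t.1.2, fun _ _ => rfl⟩
@[reducible] def pb.lift (f : Map F T) (π : Map E T) (a : Map H F) (b : Map H E)
    (h : ∀ {X : C} (t : H.obj X), f ⋄ a ⋄ t = π ⋄ b ⋄ t) : Map H (pb f π) :=
  ⟨fun t => ⟨(a ⋄ t, b ⋄ t), h t⟩, fun g t => Subtype.ext (Prod.ext (a.res_fn g t) (b.res_fn g t))⟩

/-- filling for a pullback -/
noncomputable def Fibr.pb (f : Map F T) {π : Map E T} (s : Fibr P π) : Fibr P (pb.fst f π) where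
  fill y φ b u w B := pb.lift f π y (s.fill (y.comp f) φ b (u.comp (pb.snd f π)) (w.comp (pb.snd f π))
    ⟨fun t h => (u.val t h).2.symm.trans (congrArg f.fn (B.over_u t h)),
      fun t => (w ⋄ t).2.symm.trans (congrArg f.fn (B.over_w t)),
      fun t h => congrArg (pb.snd f π).fn (B.uw t h)⟩) (fun t => (s.above (y := y.comp f) _ t).symm)
  above := fun {_ _ _ _ _ _} B {X} t => rfl
  ext := fun {_ _ _ _ _ _} B {X} t h => Subtype.ext (Prod.ext (B.over_u t h).symm (s.ext _ t h))
  base := fun {_ _ _ _ _ _} B {X} t => Subtype.ext (Prod.ext (B.over_w t).symm (s.base _ t))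

/-- The map `ζ` is left arbitrary apart from its components, so that the lemma applies to any
definition of the map of pullbacks. -/
theorem FibrRel.pb {E' F' T' : Psh C} {f' : Map F' T'} {π' : Map E' T'} {f : Map F T} {π : Map E T}
    {s' : Fibr P π'} {s : Fibr P π} {ε : Map E' E} {δ : Map F' F} {τ : Map T' T}
    (R : FibrRel s' s ε τ) (h : ∀ {X : C} (x : F'.obj X), τ ⋄ f' ⋄ x = f ⋄ δ ⋄ x)
    (ζ : Map (Kan.pb f' π') (Kan.pb f π))
    (hζ : ∀ {X : C} (x : (Kan.pb f' π').obj X), (ζ ⋄ x).1 = (δ ⋄ x.1.1, ε ⋄ x.1.2)) :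
    FibrRel (s'.pb f') (s.pb f) ζ δ := by
  intro H' H k y' φ' b u' w' B' y φ u w B hy hφ hu hw X t
  refine Subtype.ext ((hζ _).trans (Prod.ext ?_ ?_))
  · exact hy t
  show ε ⋄ s'.fill _ φ' b _ _ _ ⋄ t = s.fill _ φ b _ _ _ ⋄ _
  refine R k _ _ (fun t => (h _).trans (congrArg f.fn (hy t))) hφ (fun t h' h1 => ?_) (fun t => ?_) t
  · exact (congrArg Prod.snd (hζ _)).symm.trans (congrArg (fun x => x.1.2) (hu t h' h1))
  · exact (congrArg Prod.snd (hζ _)).symm.trans (congrArg (fun x => x.1.2) (hw t))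

end Kan
end Sconing

namespace Sconing
namespace Kan
variable {C : Type u} [SmallCategory C] {P : CubeBase C} {H H' J J' S T E F G : Psh C}

/-! ## Equivalences and the extension property of homotopy fibres -/

/-- A map over `T`. -/
structure Arrow (C : Type u) [SmallCategory C] where
  T : Psh C
  dom : Psh C
  cod : Psh C
  πd : Map dom T
  πc : Map cod T
  fn : Map dom cod
  πc_fn : ∀ {X : C} (x : dom.obj X), πc ⋄ fn ⋄ x = πd ⋄ x

/-- A morphism of arrows. -/
structure ArrowHom (a' a : Arrow C) where
  τ : Map a'.T a.T
  δ : Map a'.dom a.dom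
  κ : Map a'.cod a.cod
  πd_δ : ∀ {X : C} (x : a'.dom.obj X), τ ⋄ a'.πd ⋄ x = a.πd ⋄ δ ⋄ x
  πc_κ : ∀ {X : C} (x : a'.cod.obj X), τ ⋄ a'.πc ⋄ x = a.πc ⋄ κ ⋄ x
  κ_fn : ∀ {X : C} (x : a'.dom.obj X), κ ⋄ a'.fn ⋄ x = a.fn ⋄ δ ⋄ x

@[reducible] def ArrowHom.refl (a : Arrow C) : ArrowHom a a :=
  ⟨Map.id _, Map.id _, Map.id _, fun _ => rfl, fun _ => rfl, fun _ => rfl⟩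

/-- A left and a right homotopy inverse over `T`. -/
structure QInv (P : CubeBase C) (a : Arrow C) where
  l : Map a.cod a.dom
  lh : Map (cyl P a.dom) a.dom
  r : Map a.cod a.dom
  rh : Map (cyl P a.cod) a.cod
  l_π : ∀ {X : C} (y : a.cod.obj X), a.πd ⋄ l ⋄ y = a.πc ⋄ y
  lh_π : ∀ {X : C} (t : (cyl P a.dom).obj X), a.πd ⋄ lh ⋄ t = a.πd ⋄ t.1
  lh_zero : ∀ {X : C} (x : a.dom.obj X), lh ⋄ (x, P.pt false X) = l ⋄ a.fn ⋄ x
  lh_one : ∀ {X : C} (x : a.dom.obj X), lh ⋄ (x, P.pt true X) = x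
  r_π : ∀ {X : C} (y : a.cod.obj X), a.πd ⋄ r ⋄ y = a.πc ⋄ y
  rh_π : ∀ {X : C} (t : (cyl P a.cod).obj X), a.πc ⋄ rh ⋄ t = a.πc ⋄ t.1
  rh_zero : ∀ {X : C} (y : a.cod.obj X), rh ⋄ (y, P.pt false X) = a.fn ⋄ r ⋄ y
  rh_one : ∀ {X : C} (y : a.cod.obj X), rh ⋄ (y, P.pt true X) = y

/-- Naturality is recorded by relations of this kind. They compare structures on different arrows
along a morphism, so no transport of structures along equalities of presheaves is needed. -/
structure QInv.Rel {a' a : Arrow C} (m : ArrowHom a' a) (q' : QInv P a') (q : QInv P a) : Prop where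
  l : ∀ {X : C} (y : a'.cod.obj X), m.δ ⋄ q'.l ⋄ y = q.l ⋄ m.κ ⋄ y
  lh : ∀ {X : C} (t : (cyl P a'.dom).obj X), m.δ ⋄ q'.lh ⋄ t = q.lh ⋄ m.δ.cyl ⋄ t
  r : ∀ {X : C} (y : a'.cod.obj X), m.δ ⋄ q'.r ⋄ y = q.r ⋄ m.κ ⋄ y
  rh : ∀ {X : C} (t : (cyl P a'.cod).obj X), m.κ ⋄ q'.rh ⋄ t = q.rh ⋄ m.κ.cyl ⋄ t

/-- A point of the homotopy fibre over `y`, in context `H`. -/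
structure FibPt (P : CubeBase C) (a : Arrow C) (y : Map H a.cod) where
  x : Map H a.dom
  p : Map (cyl P H) a.cod
  zero : ∀ {X : C} (t : H.obj X), p ⋄ (t, P.pt false X) = a.fn ⋄ x ⋄ t
  one : ∀ {X : C} (t : H.obj X), p ⋄ (t, P.pt true X) = y ⋄ t
  p_π : ∀ {X : C} (t : (cyl P H).obj X), a.πc ⋄ p ⋄ t = a.πc ⋄ y ⋄ t.1

/-- A partial point of the homotopy fibre over `y`. -/
structure PFibPt (a : Arrow C) (y : Map H a.cod) (φ : Cofib P H) where
  x : PMap (fun X (t : H.obj X) => φ.holds t) a.dom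
  p : PMap (fun X (t : (cyl P H).obj X) => φ.holds t.1) a.cod
  zero : ∀ {X : C} (t : H.obj X) (h : φ.holds t), p.val (t, P.pt false X) h = a.fn ⋄ x.val t h
  one : ∀ {X : C} (t : H.obj X) (h : φ.holds t), p.val (t, P.pt true X) h = y ⋄ t
  p_π : ∀ {X : C} (t : (cyl P H).obj X) (h : φ.holds t.1), a.πc ⋄ p.val t h = a.πc ⋄ y ⋄ t.1

/-- The path begins at the image of `x` and is vertical over `T`. -/
theorem PFibPt.x_π {a : Arrow C} {y : Map H a.cod} {φ : Cofib P H} (u : PFibPt a y φ) {X : C}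
    (t : H.obj X) (h : φ.holds t) : a.πd ⋄ u.x.val t h = a.πc ⋄ y ⋄ t := by
  rw [← a.πc_fn, ← u.zero, u.p_π]

structure FibPt.Rel {a' a : Arrow C} (m : ArrowHom a' a) (k : Map H' H) {y' : Map H' a'.cod}
    {y : Map H a.cod} (u' : FibPt P a' y') (u : FibPt P a y) : Prop where
  x : ∀ {X : C} (t : H'.obj X), m.δ ⋄ u'.x ⋄ t = u.x ⋄ k ⋄ t
  p : ∀ {X : C} (t : (cyl P H').obj X), m.κ ⋄ u'.p ⋄ t = u.p ⋄ k.cyl ⋄ t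

structure PFibPt.Rel {a' a : Arrow C} (m : ArrowHom a' a) (k : Map H' H) {y' : Map H' a'.cod}
    {y : Map H a.cod} {φ' : Cofib P H'} {φ : Cofib P H} (u' : PFibPt a' y' φ') (u : PFibPt a y φ) :
    Prop where
  x : PMap.Rel k m.δ u'.x u.x
  p : PMap.Rel k.cyl m.κ u'.p u.p

/-- Partial points of homotopy fibres extend to total ones. -/
structure Ext (P : CubeBase C) (a : Arrow C) where
  ext : ∀ {H : Psh C} (y : Map H a.cod) (φ : Cofib P H), PFibPt a y φ → FibPt P a y
  ext_x : ∀ {H : Psh C} {y : Map H a.cod} {φ : Cofib P H} (u : PFibPt a y φ) {X : C} (t : H.obj X)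
    (h : φ.holds t), (ext y φ u).x ⋄ t = u.x.val t h
  ext_p : ∀ {H : Psh C} {y : Map H a.cod} {φ : Cofib P H} (u : PFibPt a y φ) {X : C}
    (t : (cyl P H).obj X) (h : φ.holds t.1), (ext y φ u).p ⋄ t = u.p.val t h

/-- Change of the arrow along `m` and reindexing of the parameters along `k` are treated at once;
for the identity morphism this is uniformity of the extension. -/
def Ext.Rel {a' a : Arrow C} (m : ArrowHom a' a) (e' : Ext P a') (e : Ext P a) : Prop :=
  ∀ {H' H : Psh C} (k : Map H' H) {y' : Map H' a'.cod} {φ' : Cofib P H'} {u' : PFibPt a' y' φ'}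
    {y : Map H a.cod} {φ : Cofib P H} {u : PFibPt a y φ},
    (∀ {X : C} (t : H'.obj X), m.κ ⋄ y' ⋄ t = y ⋄ k ⋄ t) →
    (∀ {X : C} (t : H'.obj X), φ'.holds t ↔ φ.holds (k ⋄ t)) →
    PFibPt.Rel m k u' u → FibPt.Rel m k (e'.ext y' φ' u') (e.ext y φ u)

/-- the pair of `a` and `b` -/
@[reducible] def two {α : Type z} (a b : α) : Bool → α
  | false => a
  | true => b

@[reducible] def PMap.cyl {p : ∀ X : C, H.obj X → Prop} (u : PMap p E) :
    PMap (fun X (t : (Kan.cyl P H).obj X) => p X t.1) (Kan.cyl P E) :=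
  ⟨fun t h => (u.val t.1 h, t.2), fun f t h h' => Prod.ext (u.res_val f t.1 h h') rfl⟩

namespace QInv
variable {a a' : Arrow C}

/-- The base is the image under `f` of the homotopy `lh` at `r y`, from `f (l (f (r y)))` to `f (r
y)`. One side is `f ∘ l` applied to the homotopy `rh` at `y`, the other is `rh` itself. The side
opposite to the base therefore runs from `f (l y)` to `y`, which shows that the left inverse is also
a right inverse. -/
theorem counit_box (q : QInv P a) : SqBox (P := P) a.πc (Map.fst.comp (Map.fst.comp a.πc))
    (Cofib.bot P a.cod) false (PMap.empty (Map.fst.comp Map.fst) _)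
    (two (q.rh.comp (q.l.comp a.fn)) q.rh) (q.r.cyl.comp (q.lh.comp a.fn)) where
  over_u _ h := h.elim
  over_v c {X} t := by
    cases c
    · show a.πc ⋄ a.fn ⋄ q.l ⋄ q.rh ⋄ t = a.πc ⋄ t.1
      rw [a.πc_fn, q.l_π, q.rh_π]
    · exact q.rh_π t
  over_w t := by
    show a.πc ⋄ a.fn ⋄ q.lh ⋄ (q.r ⋄ t.1, t.2) = a.πc ⋄ t.1
    rw [a.πc_fn, q.lh_π, q.r_π]
  uv _ _ _ h := h.elim
  uw _ h := h.elim
  vw c {X} t := by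
    cases c
    · show a.fn ⋄ q.l ⋄ q.rh ⋄ (t, _) = a.fn ⋄ q.lh ⋄ (q.r ⋄ t, _)
      rw [q.lh_zero, q.rh_zero]
    · show q.rh ⋄ (t, _) = a.fn ⋄ q.lh ⋄ (q.r ⋄ t, _)
      rw [q.lh_one, q.rh_zero]

/-- a homotopy from `f (l y)` to `y` -/
noncomputable def counit (q : QInv P a) (sc : Fibr P a.πc) : Map (cyl P a.cod) a.cod :=
  (Map.face true).comp (sc.sq _ _ _ _ _ _ q.counit_box)

theorem counit_zero (q : QInv P a) (sc : Fibr P a.πc) {X : C} (y : a.cod.obj X) :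
    q.counit sc ⋄ (y, P.pt false X) = a.fn ⋄ q.l ⋄ y := by
  refine (sc.sq_face q.counit_box false y (P.pt true X)).trans ?_
  show a.fn ⋄ q.l ⋄ q.rh ⋄ (y, _) = _
  rw [q.rh_one]

theorem counit_one (q : QInv P a) (sc : Fibr P a.πc) {X : C} (y : a.cod.obj X) :
    q.counit sc ⋄ (y, P.pt true X) = y := by
  refine (sc.sq_face q.counit_box true y (P.pt true X)).trans ?_
  exact q.rh_one y

theorem counit_π (q : QInv P a) (sc : Fibr P a.πc) {X : C} (t : (cyl P a.cod).obj X) :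
    a.πc ⋄ q.counit sc ⋄ t = a.πc ⋄ t.1 := sc.sq_above q.counit_box _

theorem counit_rel {m : ArrowHom a' a} {q' : QInv P a'} {q : QInv P a} (Q : QInv.Rel m q' q)
    {sc' : Fibr P a'.πc} {sc : Fibr P a.πc} (R : FibrRel sc' sc m.κ m.τ) {X : C}
    (t : (cyl P a'.cod).obj X) : m.κ ⋄ q'.counit sc' ⋄ t = q.counit sc ⋄ m.κ.cyl ⋄ t := by
  refine FibrRel.sq R m.κ q'.counit_box q.counit_box (fun t => m.πc_κ _) (fun _ => Iff.rfl)
    (fun _ h => h.elim) (fun c {X} t => ?_) (fun t => ?_) _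
  · cases c
    · show m.κ ⋄ a'.fn ⋄ q'.l ⋄ q'.rh ⋄ t = a.fn ⋄ q.l ⋄ q.rh ⋄ m.κ.cyl ⋄ t
      rw [m.κ_fn, Q.l, Q.rh]
    · exact Q.rh t
  · show m.κ ⋄ a'.fn ⋄ q'.lh ⋄ (q'.r ⋄ t.1, t.2) = a.fn ⋄ q.lh ⋄ (q.r ⋄ m.κ ⋄ t.1, t.2)
    rw [m.κ_fn, Q.lh, ← Q.r]

end QInv

/-! ### Extension of partial points of homotopy fibres from a left and a right inverse. -/

/-- The input for the extension of a partial point of a homotopy fibre. -/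
structure ExtIn (P : CubeBase C) where
  a : Arrow C
  sd : Fibr P a.πd
  sc : Fibr P a.πc
  q : QInv P a
  H : Psh C
  y : Map H a.cod
  φ : Cofib P H
  u : PFibPt a y φ

structure ExtIn.Rel (I' I : ExtIn P) where
  m : ArrowHom I'.a I.a
  sd : FibrRel I'.sd I.sd m.δ m.τ
  sc : FibrRel I'.sc I.sc m.κ m.τ
  q : QInv.Rel m I'.q I.q
  k : Map I'.H I.H
  y : ∀ {X : C} (t : I'.H.obj X), m.κ ⋄ I'.y ⋄ t = I.y ⋄ k ⋄ t
  φ : ∀ {X : C} (t : I'.H.obj X), I'.φ.holds t ↔ I.φ.holds (k ⋄ t)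
  u : PFibPt.Rel m k I'.u I.u

namespace ExtIn
variable (I I' : ExtIn P)

@[reducible] def t : Map I.H I.a.T := I.y.comp I.a.πc

theorem t_rel {I' I : ExtIn P} (R : Rel I' I) {X : C} (t : I'.H.obj X) :
    R.m.τ ⋄ I'.t ⋄ t = I.t ⋄ R.k ⋄ t := by
  show R.m.τ ⋄ I'.a.πc ⋄ I'.y ⋄ t = I.a.πc ⋄ I.y ⋄ R.k ⋄ t
  rw [R.m.πc_κ, R.y]

/-- Off `φ` only the end `l y` is known, so the line is filled backwards from it. On `φ` it is `l ∘
p`, which begins at `l (f x)` for the given partial `x`. -/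
theorem toL_box : Box (P := P) I.a.πd (Map.fst.comp I.t) I.φ true (I.u.p.comp I.q.l)
    (I.y.comp I.q.l) where
  over_u t h := (I.q.l_π _).trans (I.u.p_π t h)
  over_w t := I.q.l_π _
  uw t h := congrArg I.q.l.fn (I.u.one t h)

/-- a line to `l y` -/
noncomputable def toL : Map (cyl P I.H) I.a.dom := I.sd.fill _ _ _ _ _ I.toL_box

/-- On `φ` the homotopy `lh` leads from `l (f x)`, the beginning of `toL`, to the given `x`. The end
of the filling is hence a total point that extends it. -/
theorem toX_box : Box (P := P) I.a.πd (Map.fst.comp I.t) I.φ false (I.u.x.cyl.comp I.q.lh)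
    ((Map.face false).comp I.toL) where
  over_u t h := (I.q.lh_π _).trans (I.u.x_π _ h)
  over_w t := I.sd.above I.toL_box _
  uw t h := by
    show I.q.lh ⋄ (I.u.x.val t h, _) = I.toL ⋄ (t, _)
    rw [I.q.lh_zero, ← I.u.zero]
    exact (I.sd.ext I.toL_box (t, P.pt false _) h).symm

/-- a line to the point of the homotopy fibre -/
noncomputable def toX : Map (cyl P I.H) I.a.dom := I.sd.fill _ _ _ _ _ I.toX_box

noncomputable def x : Map I.H I.a.dom := (Map.face true).comp I.toX

theorem x_ext {X : C} (t : I.H.obj X) (h : I.φ.holds t) : I.x ⋄ t = I.u.x.val t h :=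
  (I.sd.ext I.toX_box (t, P.pt true X) h).trans (I.q.lh_one _)

theorem x_π {X : C} (t : I.H.obj X) : I.a.πd ⋄ I.x ⋄ t = I.t ⋄ t := I.sd.above I.toX_box _

/-- Both `toX` and the homotopy `lh` at `x` end at `x`. Filling backwards from the constant line at
`x` connects their beginnings, that is, the beginning of `toL` with `l (f x)`. On `φ` the two lines
are the same, so that the connection is constant there. -/
theorem turn_box : SqBox (P := P) I.a.πd (Map.fst.comp (Map.fst.comp I.t)) I.φ true
    ((I.u.x.cyl.pre Map.skip).comp I.q.lh) (two I.toX (I.x.cyl.comp I.q.lh)) (Map.fst.comp I.x) where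
  over_u t h := (I.q.lh_π _).trans (I.u.x_π _ h)
  over_v c {X} t := by
    cases c
    · exact I.sd.above I.toX_box _
    · exact (I.q.lh_π _).trans (I.x_π _)
  over_w t := I.x_π _
  uv c {X} t h := by
    cases c
    · exact (I.sd.ext I.toX_box t h).symm
    · show I.q.lh ⋄ (I.u.x.val t.1 h, t.2) = I.q.lh ⋄ (I.x ⋄ t.1, t.2)
      rw [I.x_ext t.1 h]
  uw t h := (I.q.lh_one _).trans (I.x_ext t.1 h).symm
  vw c {X} t := by
    cases c
    · rfl
    · exact I.q.lh_one _

/-- a line from the beginning of `toL` to `l (f x)` -/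
noncomputable def turn : Map (cyl P I.H) I.a.dom :=
  (Map.face false).comp (I.sd.sq _ _ _ _ _ _ I.turn_box)

theorem turn_zero {X : C} (t : I.H.obj X) :
    I.turn ⋄ (t, P.pt false X) = I.toL ⋄ (t, P.pt false X) :=
  (I.sd.sq_face I.turn_box false t _).trans (I.sd.base I.toX_box t)

theorem turn_one {X : C} (t : I.H.obj X) : I.turn ⋄ (t, P.pt true X) = I.q.l ⋄ I.a.fn ⋄ I.x ⋄ t :=
  (I.sd.sq_face I.turn_box true t _).trans (I.q.lh_zero _)

theorem turn_ext {X : C} (t : (cyl P I.H).obj X) (h : I.φ.holds t.1) :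
    I.turn ⋄ t = I.q.l ⋄ I.a.fn ⋄ I.u.x.val t.1 h :=
  (I.sd.sq_ext I.turn_box (t, P.pt false X) h).trans (I.q.lh_zero _)

theorem turn_π {X : C} (t : (cyl P I.H).obj X) : I.a.πd ⋄ I.turn ⋄ t = I.t ⋄ t.1 :=
  I.sd.sq_above I.turn_box _

/-- Replaces the beginning of `toL` by `l (f x)` along `turn`, with the end `l y` kept fixed. Since
`turn` is constant on `φ`, the resulting line is still `l ∘ p` there. -/
theorem line_box : SqBox (P := P) I.a.πd (Map.fst.comp (Map.fst.comp I.t)) I.φ false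
    ((I.u.p.pre Map.fst).comp I.q.l) (two I.turn (Map.fst.comp (I.y.comp I.q.l))) I.toL where
  over_u t h := (I.q.l_π _).trans (I.u.p_π _ h)
  over_v c {X} t := by
    cases c
    · exact I.turn_π t
    · exact I.q.l_π _
  over_w t := I.sd.above I.toL_box _
  uv c {X} t h := by
    cases c
    · show I.q.l ⋄ I.u.p.val (t.1, P.pt false X) h = I.turn ⋄ t
      rw [I.turn_ext t h, I.u.zero]
    · exact congrArg I.q.l.fn (I.u.one t.1 h)
  uw t h := (I.sd.ext I.toL_box t h).symm
  vw c {X} t := by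
    cases c
    · exact I.turn_zero t
    · exact (I.sd.base I.toL_box t).symm

/-- a line from `l (f x)` to `l y` -/
noncomputable def line : Map (cyl P I.H) I.a.dom :=
  (Map.face true).comp (I.sd.sq _ _ _ _ _ _ I.line_box)

/-- The image of `line` under `f` runs from `f (l (f x))` to `f (l y)`; conjugation by the homotopy
`counit` makes it a path from `f x` to `y`. On `φ` the base is `f ∘ l ∘ p`, and `counit` evaluated
along `p` fills the square there, with `p` as opposite side. This is where a triangle identity would
be expected, and why none is needed. -/
theorem path_box : SqBox (P := P) I.a.πc (Map.fst.comp (Map.fst.comp I.t)) I.φ false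
    (I.u.p.cyl.comp (I.q.counit I.sc)) (two ((I.x.comp I.a.fn).cyl.comp (I.q.counit I.sc))
      (I.y.cyl.comp (I.q.counit I.sc))) (I.line.comp I.a.fn) where
  over_u t h := (I.q.counit_π _ _).trans (I.u.p_π _ h)
  over_v c {X} t := by
    cases c
    · exact (I.q.counit_π _ _).trans ((I.a.πc_fn _).trans (I.x_π _))
    · exact I.q.counit_π _ _
  over_w t := (I.a.πc_fn _).trans (I.sd.sq_above I.line_box _)
  uv c {X} t h := by
    cases c
    · show I.q.counit I.sc ⋄ (I.u.p.val (t.1, P.pt false X) h, t.2) =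
        I.q.counit I.sc ⋄ (I.a.fn ⋄ I.x ⋄ t.1, t.2)
      rw [I.u.zero, I.x_ext t.1 h]
    · show I.q.counit I.sc ⋄ (I.u.p.val (t.1, P.pt true X) h, t.2) = I.q.counit I.sc ⋄ (I.y ⋄ t.1, t.2)
      rw [I.u.one]
  uw {X} t h := by
    refine (I.q.counit_zero I.sc _).trans (congrArg I.a.fn.fn ?_)
    exact (I.sd.sq_ext I.line_box (t, P.pt true X) h).symm
  vw c {X} t := by
    cases c
    · refine (I.q.counit_zero I.sc _).trans (congrArg I.a.fn.fn ?_)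
      exact ((I.sd.sq_face I.line_box false t (P.pt true X)).trans (I.turn_one t)).symm
    · refine (I.q.counit_zero I.sc _).trans (congrArg I.a.fn.fn ?_)
      exact (I.sd.sq_face I.line_box true t (P.pt true X)).symm

noncomputable def path : Map (cyl P I.H) I.a.cod :=
  (Map.face true).comp (I.sc.sq _ _ _ _ _ _ I.path_box)

noncomputable def result : FibPt P I.a I.y where
  x := I.x
  p := I.path
  zero {X} t := (I.sc.sq_face I.path_box false t (P.pt true X)).trans (I.q.counit_one _ _)
  one {X} t := (I.sc.sq_face I.path_box true t (P.pt true X)).trans (I.q.counit_one _ _)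
  p_π t := I.sc.sq_above I.path_box _

theorem result_p {X : C} (t : (cyl P I.H).obj X) (h : I.φ.holds t.1) :
    I.result.p ⋄ t = I.u.p.val t h :=
  (I.sc.sq_ext I.path_box (t, P.pt true X) h).trans (I.q.counit_one _ _)

/-! ### Naturality of the extension. -/

variable {I I'} (R : Rel I' I)
include R

theorem toL_rel {X : C} (t : (cyl P I'.H).obj X) : R.m.δ ⋄ I'.toL ⋄ t = I.toL ⋄ R.k.cyl ⋄ t := by
  refine R.sd R.k I'.toL_box I.toL_box (fun t => t_rel R _) R.φ (fun t h' h => ?_) (fun t => ?_) t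
  · exact (R.q.l _).trans (congrArg I.q.l.fn (R.u.p t h' h))
  · exact (R.q.l _).trans (congrArg I.q.l.fn (R.y t))

theorem lh_rel {X : C} (t : I'.H.obj X) (i : P.I.obj (op X)) (h' h) :
    R.m.δ ⋄ I'.q.lh ⋄ (I'.u.x.val t h', i) = I.q.lh ⋄ (I.u.x.val (R.k ⋄ t) h, i) := by
  rw [R.q.lh, ← R.u.x t h' h]

theorem toX_rel {X : C} (t : (cyl P I'.H).obj X) : R.m.δ ⋄ I'.toX ⋄ t = I.toX ⋄ R.k.cyl ⋄ t :=
  R.sd R.k I'.toX_box I.toX_box (fun t => t_rel R _) R.φ (fun t h' h => lh_rel R _ _ _ _)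
    (fun t => toL_rel R _) t

theorem x_rel {X : C} (t : I'.H.obj X) : R.m.δ ⋄ I'.x ⋄ t = I.x ⋄ R.k ⋄ t := toX_rel R (t, _)

theorem turn_rel {X : C} (t : (cyl P I'.H).obj X) : R.m.δ ⋄ I'.turn ⋄ t = I.turn ⋄ R.k.cyl ⋄ t := by
  refine FibrRel.sq R.sd R.k I'.turn_box I.turn_box (fun t => t_rel R _) R.φ (fun t h' h => lh_rel R _ _ _ _)
    (fun c {X} t => ?_) (fun t => x_rel R _) (t, _)
  cases c
  · exact toX_rel R t
  · show R.m.δ ⋄ I'.q.lh ⋄ (I'.x ⋄ t.1, t.2) = I.q.lh ⋄ (I.x ⋄ R.k ⋄ t.1, t.2)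
    rw [R.q.lh, ← x_rel R]

theorem line_rel {X : C} (t : (cyl P I'.H).obj X) : R.m.δ ⋄ I'.line ⋄ t = I.line ⋄ R.k.cyl ⋄ t := by
  refine FibrRel.sq R.sd R.k I'.line_box I.line_box (fun t => t_rel R _) R.φ (fun t h' h => ?_)
    (fun c {X} t => ?_) (fun t => toL_rel R _) (t, _)
  · exact (R.q.l _).trans (congrArg I.q.l.fn (R.u.p _ _ _))
  · cases c
    · exact turn_rel R t
    · exact (R.q.l _).trans (congrArg I.q.l.fn (R.y _))

theorem path_rel {X : C} (t : (cyl P I'.H).obj X) : R.m.κ ⋄ I'.path ⋄ t = I.path ⋄ R.k.cyl ⋄ t := by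
  refine FibrRel.sq R.sc R.k I'.path_box I.path_box (fun t => t_rel R _) R.φ (fun t h' h => ?_)
    (fun c {X} t => ?_) (fun t => ?_) (t, _)
  · refine (QInv.counit_rel R.q R.sc _).trans (congrArg (I.q.counit I.sc).fn (Prod.ext ?_ rfl))
    exact R.u.p _ _ _
  · cases c
    · refine (QInv.counit_rel R.q R.sc _).trans (congrArg (I.q.counit I.sc).fn (Prod.ext ?_ rfl))
      exact (R.m.κ_fn _).trans (congrArg I.a.fn.fn (x_rel R t.1))
    · refine (QInv.counit_rel R.q R.sc _).trans (congrArg (I.q.counit I.sc).fn (Prod.ext ?_ rfl))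
      exact R.y t.1
  · exact (R.m.κ_fn _).trans (congrArg I.a.fn.fn (line_rel R t))

theorem result_rel : FibPt.Rel R.m R.k I'.result I.result := ⟨x_rel R, path_rel R⟩

end ExtIn

/-- Equivalences between fibrant families have the extension property. -/
noncomputable def QInv.toExt {a : Arrow C} (q : QInv P a) (sd : Fibr P a.πd) (sc : Fibr P a.πc) :
    Ext P a where
  ext y φ u := (ExtIn.mk a sd sc q _ y φ u).result
  ext_x {H y φ} u {X} t h := (ExtIn.mk a sd sc q H y φ u).x_ext t h
  ext_p {H y φ} u {X} t h := (ExtIn.mk a sd sc q H y φ u).result_p t h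

theorem QInv.toExt_rel {a' a : Arrow C} {m : ArrowHom a' a} {q' : QInv P a'} {q : QInv P a}
    (Q : QInv.Rel m q' q) {sd' : Fibr P a'.πd} {sc' : Fibr P a'.πc} {sd : Fibr P a.πd}
    {sc : Fibr P a.πc} (D : FibrRel sd' sd m.δ m.τ) (D' : FibrRel sc' sc m.κ m.τ) :
    Ext.Rel m (q'.toExt sd' sc') (q.toExt sd sc) :=
  fun {H' H} k y' φ' u' y φ u hy hφ hu => ExtIn.result_rel
    (I' := ExtIn.mk a' sd' sc' q' H' y' φ' u') (I := ExtIn.mk a sd sc q H y φ u)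
    ⟨m, D, D', Q, k, hy, hφ, hu⟩

end Kan
end Sconing

namespace Sconing
namespace Kan
variable {C : Type u} [SmallCategory C] {P : CubeBase C} {H H' S T E F : Psh C}

/-! ## Points of homotopy fibres -/

namespace FibPt
variable {a a' : Arrow C}

@[reducible] def map (m : ArrowHom a' a) {y : Map H a'.cod} (v : FibPt P a' y) :
    FibPt P a (y.comp m.κ) where
  x := v.x.comp m.δ
  p := v.p.comp m.κ
  zero t := (congrArg m.κ.fn (v.zero t)).trans (m.κ_fn _)
  one t := congrArg m.κ.fn (v.one t)
  p_π t := (m.πc_κ _).symm.trans ((congrArg m.τ.fn (v.p_π t)).trans (m.πc_κ _))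

@[reducible] def pre (k : Map H' H) {y : Map H a.cod} (v : FibPt P a y) :
    FibPt P a (k.comp y) where
  x := k.comp v.x
  p := k.cyl.comp v.p
  zero t := v.zero _
  one t := v.one _
  p_π t := v.p_π (k ⋄ t.1, t.2)

variable (P) in
/-- the point `x` with the constant path -/
@[reducible] def triv (x : Map H a.dom) : FibPt P a (x.comp a.fn) where
  x := x
  p := Map.fst.comp (x.comp a.fn)
  zero t := rfl
  one t := rfl
  p_π t := rfl

/-- Points which agree on `φ`. -/
structure Agree {y : Map H a.cod} (φ : Cofib P H) (v : Bool → FibPt P a y) : Prop where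
  x : ∀ {X : C} (t : H.obj X), φ.holds t → (v true).x ⋄ t = (v false).x ⋄ t
  p : ∀ {X : C} (t : (cyl P H).obj X), φ.holds t.1 → (v true).p ⋄ t = (v false).p ⋄ t

theorem Agree.bot {y : Map H a.cod} (v : Bool → FibPt P a y) : Agree (Cofib.bot P H) v :=
  ⟨fun t h => h.elim, fun t h => h.elim⟩

section
variable {y : Map H a.cod} {φ : Cofib P H} {v : Bool → FibPt P a y}

theorem Agree.hx (h : Agree φ v) (c : Bool) {X : C} (t : (cyl P H).obj X) (hc : t.2 = P.pt c X)
    (h1 : φ.holds t.1) : (v true).x ⋄ t.1 = (v c).x ⋄ t.1 := by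
  cases c
  · exact h.x _ h1
  · rfl

theorem Agree.hp (h : Agree φ v) (c : Bool) {X : C} (t : (cyl P (cyl P H)).obj X)
    (hc : t.1.2 = P.pt c X) (h1 : φ.holds t.1.1) :
    (v true).p ⋄ (t.1.1, t.2) = (v c).p ⋄ (t.1.1, t.2) := by
  cases c
  · exact h.p (t.1.1, t.2) h1
  · rfl

/-- Two points, as a partial point over the cylinder. -/
noncomputable def join (h : Agree φ v) : PFibPt (P := P) a (Map.fst.comp y) φ.faces where
  x := PMap.faces (Map.id _) φ (PMap.ofMap _ (Map.fst.comp (v true).x))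
    (fun c => Map.fst.comp (v c).x) h.hx
  p := PMap.faces Map.fst φ (PMap.ofMap _ (Map.skip.comp (v true).p))
    (fun c => Map.skip.comp (v c).p) h.hp
  zero {X} t ht := by
    rcases ht with ht | ⟨c, hc⟩
    · refine (PMap.faces_part Map.fst φ (PMap.ofMap _ (Map.skip.comp (v true).p))
      (fun c => Map.skip.comp (v c).p) h.hp (t, P.pt false X) ht _).trans ?_
      refine Eq.trans ?_ (congrArg a.fn.fn (PMap.faces_part (Map.id _) φ (PMap.ofMap _ (Map.fst.comp (v true).x))
      (fun c => Map.fst.comp (v c).x) h.hx t ht _).symm)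
      exact (v true).zero _
    · refine (PMap.faces_face Map.fst φ (PMap.ofMap _ (Map.skip.comp (v true).p))
      (fun c => Map.skip.comp (v c).p) h.hp (t, P.pt false X) c hc _).trans ?_
      refine Eq.trans ?_ (congrArg a.fn.fn (PMap.faces_face (Map.id _) φ (PMap.ofMap _ (Map.fst.comp (v true).x))
      (fun c => Map.fst.comp (v c).x) h.hx t c hc _).symm)
      exact (v c).zero _
  one {X} t ht := by
    rcases ht with ht | ⟨c, hc⟩
    · refine (PMap.faces_part Map.fst φ (PMap.ofMap _ (Map.skip.comp (v true).p))
      (fun c => Map.skip.comp (v c).p) h.hp (t, P.pt true X) ht _).trans ?_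
      exact (v true).one _
    · refine (PMap.faces_face Map.fst φ (PMap.ofMap _ (Map.skip.comp (v true).p))
      (fun c => Map.skip.comp (v c).p) h.hp (t, P.pt true X) c hc _).trans ?_
      exact (v c).one _
  p_π {X} t ht := PMap.faces_ind Map.fst φ _ _ h.hp t ht (fun x => a.πc ⋄ x = a.πc ⋄ y ⋄ t.1.1)
    (fun _ => (v true).p_π (t.1.1, t.2)) (fun c _ => (v c).p_π (t.1.1, t.2))

/-- Each value of `join` is a value of one of the two points; on `φ` it is taken from `v true`. -/
theorem join_x_ind (h : Agree φ v) {X : C} (t : (cyl P H).obj X) (ht) (Q : a.dom.obj X → Prop)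
    (hQ : ∀ c, Q ((v c).x ⋄ t.1)) : Q ((join h).x.val t ht) :=
  PMap.faces_ind (Map.id _) φ (PMap.ofMap _ (Map.fst.comp (v true).x))
    (fun c => Map.fst.comp (v c).x) h.hx t ht Q (fun _ => hQ true) (fun c _ => hQ c)

theorem join_p_ind (h : Agree φ v) {X : C} (t : (cyl P (cyl P H)).obj X) (ht)
    (Q : a.cod.obj X → Prop) (hQ : ∀ c, Q ((v c).p ⋄ (t.1.1, t.2))) : Q ((join h).p.val t ht) :=
  PMap.faces_ind Map.fst φ (PMap.ofMap _ (Map.skip.comp (v true).p))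
    (fun c => Map.skip.comp (v c).p) h.hp t ht Q (fun _ => hQ true) (fun c _ => hQ c)

theorem join_x (h : Agree φ v) (c : Bool) {X : C} (t : H.obj X) (ht) :
    (join h).x.val (t, P.pt c X) ht = (v c).x ⋄ t :=
  PMap.faces_face (Map.id _) φ (PMap.ofMap _ (Map.fst.comp (v true).x))
    (fun c => Map.fst.comp (v c).x) h.hx (t, P.pt c X) c rfl _

theorem join_rel {m : ArrowHom a' a} (k : Map H' H) {y' : Map H' a'.cod} {φ' : Cofib P H'}
    {v' : Bool → FibPt P a' y'} (h' : Agree φ' v') (h : Agree φ v)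
    (hφ : ∀ {X : C} (t : H'.obj X), φ'.holds t ↔ φ.holds (k ⋄ t))
    (hv : ∀ c, Rel m k (v' c) (v c)) : PFibPt.Rel m k.cyl (join h') (join h) :=
  ⟨PMap.faces_rel (κ' := Map.id _) (κ := Map.id _) (k := k) (l := k.cyl)
      (u' := PMap.ofMap _ (Map.fst.comp (v' true).x)) (v' := fun c => Map.fst.comp (v' c).x)
      (u := PMap.ofMap _ (Map.fst.comp (v true).x)) (v := fun c => Map.fst.comp (v c).x) (ε := m.δ)
      (huv' := h'.hx) (huv := h.hx) hφ (fun _ => rfl)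
      (fun t _ _ => (hv true).x _) (fun c {X} t _ => (hv c).x _),
    PMap.faces_rel (κ' := Map.fst) (κ := Map.fst) (k := k) (l := k.cyl.cyl)
      (u' := PMap.ofMap _ (Map.skip.comp (v' true).p)) (v' := fun c => Map.skip.comp (v' c).p)
      (u := PMap.ofMap _ (Map.skip.comp (v true).p)) (v := fun c => Map.skip.comp (v c).p) (ε := m.κ)
      (huv' := h'.hp) (huv := h.hp) hφ (fun _ => rfl)
      (fun {X} t _ _ => (hv true).p (t.1.1, t.2)) (fun c {X} t _ => (hv c).p (t.1.1, t.2))⟩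

end
end FibPt

/-- the empty partial point -/
@[reducible] def PFibPt.empty (P : CubeBase C) {a : Arrow C} (y : Map H a.cod) :
    PFibPt a y (Cofib.bot P H) where
  x := PMap.empty (Map.id _) _
  p := PMap.empty Map.fst _
  zero _ h := h.elim
  one _ h := h.elim
  p_π _ h := h.elim

theorem PFibPt.empty_rel {a' a : Arrow C} (m : ArrowHom a' a) (k : Map H' H) (y' : Map H' a'.cod)
    (y : Map H a.cod) : PFibPt.Rel m k (PFibPt.empty P y') (PFibPt.empty P y) :=
  ⟨fun _ h => h.elim, fun _ h => h.elim⟩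

namespace Ext
variable {a a' : Arrow C} (e : Ext P a) {y : Map H a.cod} {φ : Cofib P H} {v : Bool → FibPt P a y}

/-- a path between two points of a homotopy fibre -/
noncomputable def path (h : FibPt.Agree φ v) : FibPt P a ((Map.fst (P := P)).comp y) :=
  e.ext _ _ (FibPt.join h)

variable (h : FibPt.Agree φ v)

theorem path_x (c : Bool) {X : C} (t : H.obj X) : (e.path h).x ⋄ (t, P.pt c X) = (v c).x ⋄ t :=
  (e.ext_x (FibPt.join h) (t, P.pt c X) (Or.inr ⟨c, rfl⟩)).trans
    (PMap.faces_face (Map.id _) φ (PMap.ofMap _ (Map.fst.comp (v true).x))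
      (fun c => Map.fst.comp (v c).x) h.hx (t, P.pt c X) c rfl _)

theorem path_p (c : Bool) {X : C} (t : H.obj X) (j : P.I.obj (op X)) :
    (e.path h).p ⋄ ((t, P.pt c X), j) = (v c).p ⋄ (t, j) :=
  (e.ext_p (FibPt.join h) ((t, P.pt c X), j) (Or.inr ⟨c, rfl⟩)).trans
    (PMap.faces_face Map.fst φ (PMap.ofMap _ (Map.skip.comp (v true).p))
      (fun c => Map.skip.comp (v c).p) h.hp ((t, P.pt c X), j) c rfl _)

/-- Where the two points agree the path between them is stationary. A partial lift that is constant
along the path can therefore be prescribed on `φ` when the path is lifted. -/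
theorem path_x_ext {X : C} (t : (cyl P H).obj X) (ht : φ.holds t.1) :
    (e.path h).x ⋄ t = (v true).x ⋄ t.1 :=
  (e.ext_x (FibPt.join h) t (Or.inl ht)).trans (PMap.faces_part (Map.id _) φ (PMap.ofMap _ (Map.fst.comp (v true).x))
      (fun c => Map.fst.comp (v c).x) h.hx t ht _)

theorem path_p_ext {X : C} (t : (cyl P (cyl P H)).obj X) (ht : φ.holds t.1.1) :
    (e.path h).p ⋄ t = (v true).p ⋄ (t.1.1, t.2) :=
  (e.ext_p (FibPt.join h) t (Or.inl ht)).trans (PMap.faces_part Map.fst φ (PMap.ofMap _ (Map.skip.comp (v true).p))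
      (fun c => Map.skip.comp (v c).p) h.hp t ht _)

theorem path_rel {m : ArrowHom a' a} {e' : Ext P a'} {e : Ext P a} (R : Ext.Rel m e' e)
    (k : Map H' H) {y' : Map H' a'.cod} {φ' : Cofib P H'} {v' : Bool → FibPt P a' y'}
    (h' : FibPt.Agree φ' v') (h : FibPt.Agree φ v)
    (hy : ∀ {X : C} (t : H'.obj X), m.κ ⋄ y' ⋄ t = y ⋄ k ⋄ t)
    (hφ : ∀ {X : C} (t : H'.obj X), φ'.holds t ↔ φ.holds (k ⋄ t))
    (hv : ∀ c, FibPt.Rel m k (v' c) (v c)) : FibPt.Rel m k.cyl (e'.path h') (e.path h) :=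
  R k.cyl (fun t => hy _) (fun t => or_congr (hφ _) Iff.rfl) (FibPt.join_rel k h' h hφ hv)

end Ext

/-! ## A map of fibrations -/

variable (P) in
/-- A map `(f, f')` from `A' → A` to `B' → B` over `G`, with filling operations. -/
structure Cfg where
  G : Psh C
  A : Psh C
  B : Psh C
  A' : Psh C
  B' : Psh C
  πA : Map A G
  πB : Map B G
  qA : Map A' A
  qB : Map B' B
  f : Map A B
  f' : Map A' B'
  πB_f : ∀ {X : C} (a : A.obj X), πB ⋄ f ⋄ a = πA ⋄ a
  qB_f' : ∀ {X : C} (x : A'.obj X), qB ⋄ f' ⋄ x = f ⋄ qA ⋄ x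
  sA : Fibr P πA
  sB : Fibr P πB
  sA' : Fibr P qA
  sB' : Fibr P qB
  uniform : FibrRel sA' sA' (Map.id _) (Map.id _)

namespace Cfg
variable (c : Cfg P)

@[reducible] def base : Arrow C := ⟨c.G, c.A, c.B, c.πA, c.πB, c.f, c.πB_f⟩

@[reducible] def total : Arrow C :=
  ⟨c.G, c.A', c.B', c.qA.comp c.πA, c.qB.comp c.πB, c.f', fun x =>
    (congrArg c.πB.fn (c.qB_f' x)).trans (c.πB_f _)⟩

-- The family of maps from the fibre of `A'` at `a` to the fibre of `B'` at `f a`, as one map over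
-- `A`. Its inverses are the content of the third assertion.
@[reducible] def fibre : Arrow C :=
  ⟨c.A, c.A', pb c.f c.qB, c.qA, pb.fst c.f c.qB,
    pb.lift c.f c.qB c.qA c.f' (fun x => (c.qB_f' x).symm), fun _ => rfl⟩

@[reducible] def proj : ArrowHom c.total c.base :=
  ⟨Map.id _, c.qA, c.qB, fun _ => rfl, fun _ => rfl, c.qB_f'⟩

/-- A morphism of maps of fibrations. -/
structure Hom (c' c : Cfg P) where
  g : Map c'.G c.G
  a : Map c'.A c.A
  b : Map c'.B c.B
  a' : Map c'.A' c.A'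
  b' : Map c'.B' c.B'
  πA_a : ∀ {X : C} (x : c'.A.obj X), g ⋄ c'.πA ⋄ x = c.πA ⋄ a ⋄ x
  πB_b : ∀ {X : C} (x : c'.B.obj X), g ⋄ c'.πB ⋄ x = c.πB ⋄ b ⋄ x
  qA_a' : ∀ {X : C} (x : c'.A'.obj X), a ⋄ c'.qA ⋄ x = c.qA ⋄ a' ⋄ x
  qB_b' : ∀ {X : C} (x : c'.B'.obj X), b ⋄ c'.qB ⋄ x = c.qB ⋄ b' ⋄ x
  b_f : ∀ {X : C} (x : c'.A.obj X), b ⋄ c'.f ⋄ x = c.f ⋄ a ⋄ x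
  b'_f' : ∀ {X : C} (x : c'.A'.obj X), b' ⋄ c'.f' ⋄ x = c.f' ⋄ a' ⋄ x
  sA : FibrRel c'.sA c.sA a g
  sB : FibrRel c'.sB c.sB b g
  sA' : FibrRel c'.sA' c.sA' a' a
  sB' : FibrRel c'.sB' c.sB' b' b

variable {c} {c' : Cfg P} (m : Hom c' c)

@[reducible] def Hom.base : ArrowHom c'.base c.base := ⟨m.g, m.a, m.b, m.πA_a, m.πB_b, m.b_f⟩

@[reducible] def Hom.total : ArrowHom c'.total c.total :=
  ⟨m.g, m.a', m.b', fun x => (m.πA_a _).trans (congrArg c.πA.fn (m.qA_a' x)),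
    fun x => (m.πB_b _).trans (congrArg c.πB.fn (m.qB_b' x)), m.b'_f'⟩

@[reducible] def Hom.pb : Map (pb c'.f c'.qB) (pb c.f c.qB) :=
  ⟨fun t => ⟨(m.a ⋄ t.1.1, m.b' ⋄ t.1.2), by
    dsimp only; rw [← m.b_f, t.2, m.qB_b']⟩, fun g t =>
      Subtype.ext (Prod.ext (m.a.res_fn g _) (m.b'.res_fn g _))⟩

@[reducible] def Hom.fibre : ArrowHom c'.fibre c.fibre :=
  ⟨m.a, m.a', m.pb, m.qA_a', fun _ => rfl, fun x => Subtype.ext (Prod.ext (m.qA_a' x) (m.b'_f' x))⟩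

/-! ## Points of the homotopy fibres of `f'` over given points of those of `f` -/

end Cfg

/-- A point of the homotopy fibre of `f`, and a partial point of that of `f'` over it. -/
structure CentIn (P : CubeBase C) where
  c : Cfg P
  ef : Ext P c.base
  eF : Ext P c.total
  H : Psh C
  y : Map H c.B'
  d : FibPt P c.base (y.comp c.qB)
  φ : Cofib P H
  u : PFibPt c.total y φ
  ux : ∀ {X : C} (t : H.obj X) (h : φ.holds t), c.qA ⋄ u.x.val t h = d.x ⋄ t
  up : ∀ {X : C} (t : (cyl P H).obj X) (h : φ.holds t.1), c.qB ⋄ u.p.val t h = d.p ⋄ t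

structure CentIn.Rel (J' J : CentIn P) where
  m : Cfg.Hom J'.c J.c
  ef : Ext.Rel m.base J'.ef J.ef
  eF : Ext.Rel m.total J'.eF J.eF
  k : Map J'.H J.H
  y : ∀ {X : C} (t : J'.H.obj X), m.b' ⋄ J'.y ⋄ t = J.y ⋄ k ⋄ t
  d : FibPt.Rel m.base k J'.d J.d
  φ : ∀ {X : C} (t : J'.H.obj X), J'.φ.holds t ↔ J.φ.holds (k ⋄ t)
  u : PFibPt.Rel m.total k J'.u J.u

namespace CentIn
variable (J J' : CentIn P)

/-- Only the total space is used for this extension, so off `φ` its projection need not be `d`. The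
discrepancy is removed by lifting the path `w`. -/
noncomputable def z : FibPt P J.c.total J.y := J.eF.ext _ _ J.u

theorem agree : FibPt.Agree J.φ (two (J.z.map J.c.proj) J.d) where
  x t h := (J.ux t h).symm.trans (congrArg J.c.qA.fn (J.eF.ext_x J.u t h).symm)
  p t h := (J.up t h).symm.trans (congrArg J.c.qB.fn (J.eF.ext_p J.u t h).symm)

/-- the path from the projection of `z` to `d` -/
noncomputable def w : FibPt P J.c.base ((Map.fst (P := P)).comp (J.y.comp J.c.qB)) := J.ef.path J.agree

/-- The path `w` is stationary on `φ`, so the constant line at the given partial point lies over it.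
-/
theorem lineX_box : Box (P := P) J.c.qA J.w.x J.φ false (J.u.x.pre Map.fst) J.z.x where
  over_u t h := (J.ux _ h).trans (J.ef.path_x_ext J.agree t h).symm
  over_w t := (J.ef.path_x J.agree false t).symm
  uw t h := (J.eF.ext_x J.u t h).symm

noncomputable def lineX : Map (cyl P J.H) J.c.A' := J.c.sA'.fill _ _ _ _ _ J.lineX_box

theorem lineX_above {X : C} (t : (cyl P J.H).obj X) : J.c.qA ⋄ J.lineX ⋄ t = J.w.x ⋄ t :=
  J.c.sA'.above J.lineX_box t

theorem lineX_ext {X : C} (t : (cyl P J.H).obj X) (h : J.φ.holds t.1) :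
    J.lineX ⋄ t = J.u.x.val t.1 h := J.c.sA'.ext J.lineX_box t h

/-- In `((h, i), j)` the coordinate `i` runs along the paths of the points of homotopy fibres and
`j` along `w`; `w.p` has them in the other order, hence `Map.swap`. The sides `f' ∘ lineX` and `y`
make every slice at fixed `j` a path that, with `lineX` at `j`, is again a point of the homotopy
fibre over `y`. -/
theorem lineP_box : SqBox (P := P) J.c.qB (Map.swap.comp J.w.p) J.φ false (J.u.p.pre Map.fst)
    (two (J.lineX.comp J.c.f') (Map.fst.comp J.y)) J.z.p where
  over_u {X} t h := (J.up _ h).trans (J.ef.path_p_ext J.agree ((t.1.1, t.2), t.1.2) h).symm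
  over_v c {X} t := by
    cases c
    · refine (J.c.qB_f' _).trans ?_
      refine (congrArg J.c.f.fn (J.lineX_above t)).trans ?_
      exact (J.w.zero t).symm
    · exact (J.w.one t).symm
  over_w {X} t := (J.ef.path_p J.agree false t.1 t.2).symm
  uv c {X} t h := by
    cases c
    · refine (J.u.zero t.1 h).trans (congrArg J.c.f'.fn ?_)
      exact (J.lineX_ext t h).symm
    · exact J.u.one t.1 h
  uw t h := (J.eF.ext_p J.u t h).symm
  vw c {X} t := by
    cases c
    · exact (congrArg J.c.f'.fn (J.c.sA'.base J.lineX_box t)).trans (J.z.zero t).symm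
    · exact (J.z.one t).symm

noncomputable def lineP : Map (cyl P (cyl P J.H)) J.c.B' := J.c.sB'.sq _ _ _ _ _ _ J.lineP_box

theorem lineP_above {X : C} (t : (cyl P (cyl P J.H)).obj X) :
    J.c.qB ⋄ J.lineP ⋄ t = J.w.p ⋄ ((t.1.1, t.2), t.1.2) := J.c.sB'.sq_above J.lineP_box t

noncomputable def result : FibPt P J.c.total J.y where
  x := (Map.face true).comp J.lineX
  p := (Map.face true).comp J.lineP
  zero {X} t := J.c.sB'.sq_face J.lineP_box false t (P.pt true X)
  one {X} t := J.c.sB'.sq_face J.lineP_box true t (P.pt true X)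
  p_π t := (congrArg J.c.πB.fn (J.lineP_above _)).trans (J.w.p_π _)

theorem result_x {X : C} (t : J.H.obj X) (h : J.φ.holds t) : J.result.x ⋄ t = J.u.x.val t h :=
  J.lineX_ext (t, P.pt true X) h

/-- The equality with `d` is strict and not only up to a path. Both later uses rest on this:
inverses of the maps of fibres have to preserve the point of `A`, and a right inverse of total
spaces has to lie over a prescribed one. -/
theorem result_qA {X : C} (t : J.H.obj X) : J.c.qA ⋄ J.result.x ⋄ t = J.d.x ⋄ t :=
  (J.lineX_above (t, P.pt true X)).trans (J.ef.path_x J.agree true t)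

theorem result_qB {X : C} (t : (cyl P J.H).obj X) : J.c.qB ⋄ J.result.p ⋄ t = J.d.p ⋄ t :=
  (J.lineP_above (t, P.pt true X)).trans (J.ef.path_p J.agree true t.1 t.2)

variable {J J'} (R : Rel J' J)
include R

theorem z_rel : FibPt.Rel R.m.total R.k J'.z J.z := R.eF R.k R.y R.φ R.u

theorem y_rel {X : C} (t : J'.H.obj X) :
    R.m.b ⋄ J'.c.qB ⋄ J'.y ⋄ t = J.c.qB ⋄ J.y ⋄ R.k ⋄ t :=
  (R.m.qB_b' _).trans (congrArg J.c.qB.fn (R.y t))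

theorem w_rel : FibPt.Rel R.m.base R.k.cyl J'.w J.w := by
  refine Ext.path_rel R.ef R.k J'.agree J.agree (fun t => y_rel R t) R.φ (fun c => ?_)
  cases c
  · exact ⟨fun t => (R.m.qA_a' _).trans (congrArg J.c.qA.fn ((z_rel R).x t)),
      fun t => (R.m.qB_b' _).trans (congrArg J.c.qB.fn ((z_rel R).p t))⟩
  · exact R.d

theorem lineX_rel {X : C} (t : (cyl P J'.H).obj X) :
    R.m.a' ⋄ J'.lineX ⋄ t = J.lineX ⋄ R.k.cyl ⋄ t :=
  R.m.sA' R.k J'.lineX_box J.lineX_box (fun t => (w_rel R).x t) R.φ (fun t h' h => R.u.x _ h' h)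
    (fun t => (z_rel R).x t) t

theorem lineP_rel {X : C} (t : (cyl P (cyl P J'.H)).obj X) :
    R.m.b' ⋄ J'.lineP ⋄ t = J.lineP ⋄ R.k.cyl.cyl ⋄ t := by
  refine FibrRel.sq R.m.sB' R.k J'.lineP_box J.lineP_box
    (fun {X} t => (w_rel R).p ((t.1.1, t.2), t.1.2)) R.φ
    (fun t h' h => R.u.p _ h' h) (fun c {X} t => ?_) (fun t => (z_rel R).p t) t
  cases c
  · exact (R.m.b'_f' _).trans (congrArg J.c.f'.fn (lineX_rel R t))
  · exact R.y _

theorem result_rel : FibPt.Rel R.m.total R.k J'.result J.result :=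
  ⟨fun {X} t => lineX_rel R (t, _), fun {X} t => lineP_rel R (t, _)⟩

end CentIn

end Kan
end Sconing

namespace Sconing
namespace Kan
variable {C : Type u} [SmallCategory C] {P : CubeBase C} {H H' S T E F : Psh C}

/-! ## Equivalences of fibres from equivalences of total spaces -/

section
variable (c : Cfg P) (ef : Ext P c.base) (eF : Ext P c.total)

/-- the point `a` of the homotopy fibre over `f a = qB y` -/
@[reducible] def Cfg.pbPt : FibPt P c.base ((pb.snd c.f c.qB).comp c.qB) where
  x := pb.fst c.f c.qB
  p := Map.fst.comp ((pb.fst c.f c.qB).comp c.f)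
  zero t := rfl
  one t := t.2
  p_π t := congrArg c.πB.fn t.1.2

/-- the data for the inverse of the map of fibres -/
@[reducible] def Cfg.fibIn : CentIn P where
  c := c
  ef := ef
  eF := eF
  H := pb c.f c.qB
  y := pb.snd c.f c.qB
  d := c.pbPt
  φ := Cofib.bot P _
  u := PFibPt.empty P _
  ux _ h := h.elim
  up _ h := h.elim

/-- Two points of the homotopy fibre of `f'` over `f' x`: the one chosen for the inverse, and `x`
itself with the constant path. A path between them over constant paths is the left homotopy. -/
noncomputable def Cfg.fibVal : Bool → FibPt P c.total c.f' :=
  two ((c.fibIn ef eF).result.pre c.fibre.fn) (FibPt.triv (a := c.total) P (Map.id c.A'))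

theorem Cfg.fibAgree : FibPt.Agree (Cofib.bot P c.A') (c.fibVal ef eF) := FibPt.Agree.bot _

/-- the data for the left homotopy of the map of fibres -/
@[reducible] noncomputable def Cfg.fibHtpyIn : CentIn P where
  c := c
  ef := ef
  eF := eF
  H := cyl P c.A'
  y := Map.fst.comp c.f'
  d :=
    { x := Map.fst.comp c.qA
      p := Map.fst.comp (Map.fst.comp (c.qA.comp c.f))
      zero := fun t => rfl
      one := fun t => (c.qB_f' _).symm
      p_π := fun t => congrArg c.πB.fn (c.qB_f' _).symm }
  -- The homotopy is prescribed at its two ends and nowhere else.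
  φ := (Cofib.bot P c.A').faces
  u := FibPt.join (c.fibAgree ef eF)
  ux {X} t h := FibPt.join_x_ind (c.fibAgree ef eF) t h (fun x => c.qA ⋄ x = c.qA ⋄ t.1) (fun b => by
    cases b
    · exact (c.fibIn ef eF).result_qA _
    · rfl)
  up {X} t h := FibPt.join_p_ind (c.fibAgree ef eF) t h (fun x => c.qB ⋄ x = c.f ⋄ c.qA ⋄ t.1.1)
    (fun b => by
      cases b
      -- The chosen point lies strictly over the constant path, so both ends lie over the constant
      -- `d`.
      · exact (c.fibIn ef eF).result_qB (c.fibre.fn ⋄ t.1.1, t.2)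
      · exact c.qB_f' _)

/-- An equivalence of bases and one of total spaces induce equivalences of the fibres. -/
noncomputable def Cfg.fibInv : QInv P c.fibre where
  l := (c.fibIn ef eF).result.x
  lh := (c.fibHtpyIn ef eF).result.x
  r := (c.fibIn ef eF).result.x
  -- The path of the chosen point lies over the constant path at `f a`, hence stays in one fibre of
  -- `B'`: it is the right homotopy.
  rh := pb.lift c.f c.qB (Map.fst.comp (pb.fst c.f c.qB)) (c.fibIn ef eF).result.p
    (fun t => ((c.fibIn ef eF).result_qB t).symm)
  l_π y := (c.fibIn ef eF).result_qA y
  lh_π t := (c.fibHtpyIn ef eF).result_qA t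
  lh_zero {X} x := ((c.fibHtpyIn ef eF).result_x (x, P.pt false X) (Or.inr ⟨false, rfl⟩)).trans
    (FibPt.join_x (c.fibAgree ef eF) false x _)
  lh_one {X} x := ((c.fibHtpyIn ef eF).result_x (x, P.pt true X) (Or.inr ⟨true, rfl⟩)).trans
    (FibPt.join_x (c.fibAgree ef eF) true x _)
  r_π y := (c.fibIn ef eF).result_qA y
  rh_π t := rfl
  rh_zero y := Subtype.ext (Prod.ext ((c.fibIn ef eF).result_qA y).symm ((c.fibIn ef eF).result.zero y))
  rh_one y := Subtype.ext (Prod.ext rfl ((c.fibIn ef eF).result.one y))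

end

section
variable {c c' : Cfg P} (m : Cfg.Hom c' c) {ef' : Ext P c'.base} {eF' : Ext P c'.total}
  {ef : Ext P c.base} {eF : Ext P c.total} (R : Ext.Rel m.base ef' ef) (R' : Ext.Rel m.total eF' eF)

def Cfg.fibIn_rel : CentIn.Rel (c'.fibIn ef' eF') (c.fibIn ef eF) where
  m := m
  ef := R
  eF := R'
  k := m.pb
  y _ := rfl
  d := ⟨fun _ => rfl, fun _ => m.b_f _⟩
  φ _ := Iff.rfl
  u := PFibPt.empty_rel _ _ _ _

include R R' in
theorem Cfg.fibIn_result : FibPt.Rel m.total m.pb (c'.fibIn ef' eF').result (c.fibIn ef eF).result :=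
  CentIn.result_rel (fibIn_rel m R R')

def Cfg.fibHtpyIn_rel : CentIn.Rel (c'.fibHtpyIn ef' eF') (c.fibHtpyIn ef eF) where
  m := m
  ef := R
  eF := R'
  k := m.a'.cyl
  y _ := m.b'_f' _
  d := ⟨fun _ => m.qA_a' _, fun _ => (m.b_f _).trans (congrArg c.f.fn (m.qA_a' _))⟩
  φ _ := Iff.rfl
  u := FibPt.join_rel m.a' (c'.fibAgree ef' eF') (c.fibAgree ef eF) (fun _ => Iff.rfl) (fun b => by
    cases b
    · exact ⟨fun t => ((fibIn_result m R R').x _).trans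
          (congrArg (c.fibIn ef eF).result.x.fn (m.fibre.κ_fn t)),
        fun t => ((fibIn_result m R R').p _).trans
          (congrArg (c.fibIn ef eF).result.p.fn (Prod.ext (m.fibre.κ_fn t.1) rfl))⟩
    · exact ⟨fun _ => rfl, fun _ => m.b'_f' _⟩)

include R R' in
theorem Cfg.fibInv_rel : QInv.Rel m.fibre (c'.fibInv ef' eF') (c.fibInv ef eF) where
  l y := (fibIn_result m R R').x y
  lh t := (CentIn.result_rel (fibHtpyIn_rel m R R')).x t
  r y := (fibIn_result m R R').x y
  rh t := Subtype.ext (Prod.ext rfl ((fibIn_result m R R').p t))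

end

/-! ## Extension for total spaces from extension for bases and fibres -/

/-- the image of a partial point -/
@[reducible] def PFibPt.map {a a' : Arrow C} (m : ArrowHom a' a) {y : Map H a'.cod} {φ : Cofib P H}
    (v : PFibPt a' y φ) : PFibPt a (y.comp m.κ) φ where
  x := v.x.comp m.δ
  p := v.p.comp m.κ
  zero t h := (congrArg m.κ.fn (v.zero t h)).trans (m.κ_fn _)
  one t h := congrArg m.κ.fn (v.one t h)
  p_π t h := (m.πc_κ _).symm.trans ((congrArg m.τ.fn (v.p_π t h)).trans (m.πc_κ _))

/-- The data for extending a partial point of the homotopy fibre of a total space. -/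
structure SumIn (P : CubeBase C) where
  c : Cfg P
  ef : Ext P c.base
  e' : Ext P c.fibre
  H : Psh C
  y : Map H c.B'
  φ : Cofib P H
  u : PFibPt c.total y φ

structure SumIn.Rel (J' J : SumIn P) where
  m : Cfg.Hom J'.c J.c
  ef : Ext.Rel m.base J'.ef J.ef
  e' : Ext.Rel m.fibre J'.e' J.e'
  k : Map J'.H J.H
  y : ∀ {X : C} (t : J'.H.obj X), m.b' ⋄ J'.y ⋄ t = J.y ⋄ k ⋄ t
  φ : ∀ {X : C} (t : J'.H.obj X), J'.φ.holds t ↔ J.φ.holds (k ⋄ t)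
  u : PFibPt.Rel m.total k J'.u J.u

namespace SumIn
variable (J J' : SumIn P)

noncomputable def d : FibPt P J.c.base (J.y.comp J.c.qB) := J.ef.ext _ _ (J.u.map J.c.proj)

theorem d_x {X : C} (t : J.H.obj X) (h : J.φ.holds t) : J.d.x ⋄ t = J.c.qA ⋄ J.u.x.val t h :=
  J.ef.ext_x (J.u.map J.c.proj) t h

theorem d_p {X : C} (t : (cyl P J.H).obj X) (h : J.φ.holds t.1) :
    J.d.p ⋄ t = J.c.qB ⋄ J.u.p.val t h :=
  J.ef.ext_p (J.u.map J.c.proj) t h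

/-- The element `y` is transported backwards along the path of `d` in the base. On `φ` that path is
the projection of the given path, which serves as its lift. -/
theorem lift_box : Box (P := P) J.c.qB J.d.p J.φ true J.u.p J.y where
  over_u t h := (J.d_p t h).symm
  over_w t := (J.d.one t).symm
  uw t h := J.u.one t h

/-- a lift of the path in the base which ends at `y` -/
noncomputable def lift : Map (cyl P J.H) J.c.B' := J.c.sB'.fill _ _ _ _ _ J.lift_box

theorem lift_above {X : C} (t : (cyl P J.H).obj X) : J.c.qB ⋄ J.lift ⋄ t = J.d.p ⋄ t :=
  J.c.sB'.above J.lift_box t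

theorem lift_ext {X : C} (t : (cyl P J.H).obj X) (h : J.φ.holds t.1) :
    J.lift ⋄ t = J.u.p.val t h := J.c.sB'.ext J.lift_box t h

/-- The transported element lies in the fibre of `B'` over `f` of the point of `d`. A homotopy
preimage of it under the map of fibres, followed by `lift`, is a homotopy preimage of `y`. -/
noncomputable def y' : Map J.H J.c.fibre.cod :=
  pb.lift J.c.f J.c.qB J.d.x ((Map.face false).comp J.lift)
    (fun t => ((J.lift_above _).trans (J.d.zero t)).symm)

-- On `φ` the line `lift` begins at the image of the given point, so that point with the constant
-- path is a partial solution over `y'`.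
@[reducible] noncomputable def u' : PFibPt J.c.fibre J.y' J.φ where
  x := J.u.x
  p := (J.u.x.pre (Map.fst (P := P))).comp J.c.fibre.fn
  zero t h := rfl
  one {X} t h := Subtype.ext (Prod.ext (J.d_x t h).symm
    ((J.u.zero t h).symm.trans (J.lift_ext (t, P.pt false X) h).symm))
  p_π t h := (J.d_x _ h).symm

noncomputable def e : FibPt P J.c.fibre J.y' := J.e'.ext _ _ J.u'

/-- Composition of `e.p`, over a constant path, with `lift`, over the path of `d`: the square is
filled backwards from `lift`, and its other end runs from `f'` of the new point to `y`. On `φ` the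
path `e.p` is constant, so that the given path is kept there. -/
theorem line_box : SqBox (P := P) J.c.qB (Map.fst.comp J.d.p) J.φ true (J.u.p.pre Map.fst)
    (two (J.e.p.comp (pb.snd _ _)) (Map.fst.comp J.y)) J.lift where
  over_u t h := (J.d_p _ h).symm
  over_v b {X} t := by
    cases b
    · refine (J.e.p ⋄ t).2.symm.trans ?_
      exact (congrArg J.c.f.fn (J.e.p_π t)).trans (J.d.zero t.1).symm
    · exact (J.d.one t.1).symm
  over_w t := J.lift_above t
  uv b {X} t h := by
    cases b
    · refine (J.u.zero t.1 h).trans ?_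
      exact (congrArg (pb.snd J.c.f J.c.qB).fn (J.e'.ext_p J.u' t h)).symm
    · exact J.u.one t.1 h
  uw t h := (J.lift_ext t h).symm
  vw b {X} t := by
    cases b
    · exact congrArg (pb.snd J.c.f J.c.qB).fn (J.e.one t)
    · exact (J.c.sB'.base J.lift_box t).symm

noncomputable def line : Map (cyl P (cyl P J.H)) J.c.B' := J.c.sB'.sq _ _ _ _ _ _ J.line_box

noncomputable def result : FibPt P J.c.total J.y where
  x := J.e.x
  p := (Map.face false).comp J.line
  zero {X} t := (J.c.sB'.sq_face J.line_box false t (P.pt false X)).trans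
    (congrArg (pb.snd J.c.f J.c.qB).fn (J.e.zero t))
  one {X} t := J.c.sB'.sq_face J.line_box true t (P.pt false X)
  p_π t := (congrArg J.c.πB.fn (J.c.sB'.sq_above J.line_box _)).trans (J.d.p_π _)

variable {J J'} (R : Rel J' J)
include R

theorem d_rel : FibPt.Rel R.m.base R.k J'.d J.d :=
  R.ef R.k (fun t => (R.m.qB_b' _).trans (congrArg J.c.qB.fn (R.y t))) R.φ
    ⟨fun t h' h => (R.m.qA_a' _).trans (congrArg J.c.qA.fn (R.u.x t h' h)),
      fun t h' h => (R.m.qB_b' _).trans (congrArg J.c.qB.fn (R.u.p t h' h))⟩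

theorem lift_rel {X : C} (t : (cyl P J'.H).obj X) :
    R.m.b' ⋄ J'.lift ⋄ t = J.lift ⋄ R.k.cyl ⋄ t :=
  R.m.sB' R.k J'.lift_box J.lift_box (fun t => (d_rel R).p t) R.φ R.u.p R.y t

theorem e_rel : FibPt.Rel R.m.fibre R.k J'.e J.e :=
  R.e' R.k (fun t => Subtype.ext (Prod.ext ((d_rel R).x t) (lift_rel R (t, _)))) R.φ
    ⟨R.u.x, fun t h' h => (R.m.fibre.κ_fn _).trans (congrArg J.c.fibre.fn.fn (R.u.x t.1 h' h))⟩

theorem line_rel {X : C} (t : (cyl P (cyl P J'.H)).obj X) :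
    R.m.b' ⋄ J'.line ⋄ t = J.line ⋄ R.k.cyl.cyl ⋄ t := by
  refine FibrRel.sq R.m.sB' R.k J'.line_box J.line_box (fun t => (d_rel R).p t.1) R.φ
    (fun t h' h => R.u.p _ h' h) (fun b {X} t => ?_) (fun t => lift_rel R t) t
  cases b
  · exact congrArg (pb.snd J.c.f J.c.qB).fn ((e_rel R).p t)
  · exact R.y _

theorem result_rel : FibPt.Rel R.m.total R.k J'.result J.result :=
  ⟨fun {X} t => (e_rel R).x t, fun {X} t => line_rel R (t, _)⟩

end SumIn

/-- The centre of contraction over an element of `B'` that this provides need not project to the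
value of a given inverse of the base. `Cfg.sumInv` corrects this. -/
noncomputable def Ext.sum (c : Cfg P) (ef : Ext P c.base) (e' : Ext P c.fibre) : Ext P c.total where
  ext y φ u := (SumIn.mk c ef e' _ y φ u).result
  ext_x {H y φ} u {X} t h := e'.ext_x (SumIn.mk c ef e' H y φ u).u' t h
  ext_p {H y φ} u {X} t h := c.sB'.sq_ext (SumIn.mk c ef e' H y φ u).line_box (t, P.pt false X) h

theorem Ext.sum_rel {c' c : Cfg P} {m : Cfg.Hom c' c} {ef' : Ext P c'.base} {ef : Ext P c.base}
    {e'' : Ext P c'.fibre} {e' : Ext P c.fibre} (R : Ext.Rel m.base ef' ef)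
    (R' : Ext.Rel m.fibre e'' e') : Ext.Rel m.total (Ext.sum c' ef' e'') (Ext.sum c ef e') :=
  fun {H' H} k y' φ' u' y φ u hy hφ hu => SumIn.result_rel
    (J' := SumIn.mk c' ef' e'' H' y' φ' u') (J := SumIn.mk c ef e' H y φ u)
    ⟨m, R, R', k, hy, hφ, hu⟩

end Kan
end Sconing

namespace Sconing
namespace Kan
variable {C : Type u} [SmallCategory C] {P : CubeBase C} {H H' S T E F : Psh C}

/-! ## Equivalences of total spaces over equivalences of bases -/

/-- Two lines with the same beginning, and a lift of the end of the first one. -/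
structure Zig (P : CubeBase C) (π : Map E T) (y₁ y₂ : Map (cyl P H) T) (x : Map H E) : Prop where
  over_x : ∀ {X : C} (t : H.obj X), π ⋄ x ⋄ t = y₁ ⋄ (t, P.pt true X)
  begin : ∀ {X : C} (t : H.obj X), y₁ ⋄ (t, P.pt false X) = y₂ ⋄ (t, P.pt false X)

namespace Zig
variable {π : Map E T} {y₁ y₂ : Map (cyl P H) T} {x : Map H E}

theorem box₁ (Z : Zig P π y₁ y₂ x) :
    Box (P := P) π y₁ (Cofib.bot P H) true (PMap.empty Map.fst _) x where
  over_u _ h := h.elim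
  over_w t := Z.over_x t
  uw _ h := h.elim

/-- the lift of the first line -/
noncomputable def back (s : Fibr P π) (Z : Zig P π y₁ y₂ x) : Map (cyl P H) E :=
  s.fill _ _ _ _ _ Z.box₁

theorem box₂ (s : Fibr P π) (Z : Zig P π y₁ y₂ x) :
    Box (P := P) π y₂ (Cofib.bot P H) false (PMap.empty Map.fst _) ((Map.face false).comp (Z.back s)) where
  over_u _ h := h.elim
  over_w t := (s.above Z.box₁ _).trans (Z.begin t)
  uw _ h := h.elim

/-- the lift of the second line -/
noncomputable def forth (s : Fibr P π) (Z : Zig P π y₁ y₂ x) : Map (cyl P H) E :=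
  s.fill _ _ _ _ _ (Z.box₂ s)

/-- Besides naturality in the data, the case of identity maps `ε` and `τ` and of uniform fillings
says that transport along a zigzag commutes with reindexing; `Cfg.pathForth_zero` uses it in this
form. -/
theorem forth_rel {π' : Map F S} {y₁' y₂' : Map (cyl P H') S} {x' : Map H' F} {s' : Fibr P π'}
    {s : Fibr P π} {ε : Map F E} {τ : Map S T} (R : FibrRel s' s ε τ) (Z' : Zig P π' y₁' y₂' x')
    (Z : Zig P π y₁ y₂ x) (k : Map H' H)
    (h₁ : ∀ {X : C} (t : (cyl P H').obj X), τ ⋄ y₁' ⋄ t = y₁ ⋄ k.cyl ⋄ t)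
    (h₂ : ∀ {X : C} (t : (cyl P H').obj X), τ ⋄ y₂' ⋄ t = y₂ ⋄ k.cyl ⋄ t)
    (hx : ∀ {X : C} (t : H'.obj X), ε ⋄ x' ⋄ t = x ⋄ k ⋄ t) :
    (∀ {X : C} (t : (cyl P H').obj X), ε ⋄ Z'.back s' ⋄ t = Z.back s ⋄ k.cyl ⋄ t) ∧
    (∀ {X : C} (t : (cyl P H').obj X), ε ⋄ Z'.forth s' ⋄ t = Z.forth s ⋄ k.cyl ⋄ t) := by
  have h : ∀ {X : C} (t : (cyl P H').obj X), ε ⋄ Z'.back s' ⋄ t = Z.back s ⋄ k.cyl ⋄ t :=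
    fun t => R k Z'.box₁ Z.box₁ h₁ (fun _ => Iff.rfl) (fun _ h => h.elim) hx t
  exact ⟨h, fun t => R k (Z'.box₂ s') (Z.box₂ s) h₂ (fun _ => Iff.rfl) (fun _ h => h.elim)
    (fun t => h _) t⟩

end Zig

namespace Cfg
section
variable (c : Cfg P) (q : QInv P c.base) (eF : Ext P c.total)

/-- A centre of contraction of the homotopy fibre over the generic element of `B'`, as extension of
the nowhere defined point. -/
noncomputable def sumCent : FibPt P c.total (Map.id c.B') := eF.ext _ _ (PFibPt.empty P _)

/-- Let `(x, p)` be the centre over `y`. In `A` the homotopy `lh` leads from `l (f (qA x))` to `qA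
x`, and `l ∘ qB ∘ p` leads from the same point to `l (qB y)`. Transport of `x` back along the former
line and along the latter one gives an element over `l (qB y)`, the value of the left inverse. -/
theorem sumCent_zig : Zig P c.qA (((c.sumCent eF).x.comp c.qA).cyl.comp q.lh)
    (((c.sumCent eF).p.comp c.qB).comp q.l) (c.sumCent eF).x where
  over_x t := (q.lh_one _).symm
  begin t := (q.lh_zero _).trans (congrArg q.l.fn
    ((c.qB_f' _).symm.trans (congrArg c.qB.fn ((c.sumCent eF).zero t).symm)))

noncomputable def sumL : Map c.B' c.A' := (Map.face true).comp ((c.sumCent_zig q eF).forth c.sA')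

theorem sumL_above {X : C} (y : c.B'.obj X) : c.qA ⋄ c.sumL q eF ⋄ y = q.l ⋄ c.qB ⋄ y :=
  (c.sA'.above ((c.sumCent_zig q eF).box₂ c.sA') (y, P.pt true X)).trans
    (congrArg (fun y => q.l ⋄ c.qB ⋄ y) ((c.sumCent eF).one y))

noncomputable def sumEnds : Bool → FibPt P c.total c.f' :=
  two ((c.sumCent eF).pre c.f') (FibPt.triv (a := c.total) P (Map.id c.A'))

theorem sumAgree : FibPt.Agree (Cofib.bot P c.A') (c.sumEnds eF) := FibPt.Agree.bot _

/-- a path in the homotopy fibre over `f' x` from the chosen point to `x` -/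
noncomputable def sumPath : FibPt P c.total ((Map.fst (P := P)).comp c.f') :=
  eF.path (c.sumAgree eF)

/-- The same zigzag for all points on the path from the centre over `f' x` to `x`. At one end of
that path the transport is the left inverse applied to `f' x`, at the other end it is a transport of
`x` itself. -/
theorem sumPath_zig : Zig P c.qA (((c.sumPath eF).x.comp c.qA).cyl.comp q.lh)
    (((c.sumPath eF).p.comp c.qB).comp q.l) (c.sumPath eF).x where
  over_x t := (q.lh_one _).symm
  begin t := (q.lh_zero _).trans (congrArg q.l.fn
    ((c.qB_f' _).symm.trans (congrArg c.qB.fn ((c.sumPath eF).zero t).symm)))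

noncomputable def pathBack : Map (cyl P (cyl P c.A')) c.A' := (c.sumPath_zig q eF).back c.sA'

noncomputable def pathForth : Map (cyl P (cyl P c.A')) c.A' := (c.sumPath_zig q eF).forth c.sA'

/-- The transport of a family, evaluated at an end of the path, is the transport of its value there.
This is where uniformity of the filling in the parameters enters the construction itself and not
only its naturality. -/
theorem pathForth_zero {X : C} (x : c.A'.obj X) :
    c.pathForth q eF ⋄ ((x, P.pt false X), P.pt true X) = c.sumL q eF ⋄ c.f' ⋄ x := by
  -- A common restriction of two zigzags: of that of the centre along `f'`, and of that of the path
  -- along its beginning.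
  have Z : Zig P c.qA ((c.f'.comp ((c.sumCent eF).x.comp c.qA)).cyl.comp q.lh)
      (c.f'.cyl.comp (((c.sumCent eF).p.comp c.qB).comp q.l)) (c.f'.comp (c.sumCent eF).x) :=
    ⟨fun t => (c.sumCent_zig q eF).over_x _, fun t => (c.sumCent_zig q eF).begin _⟩
  have h₁ := (Zig.forth_rel c.uniform Z (c.sumCent_zig q eF) c.f' (fun _ => rfl) (fun _ => rfl)
    (fun _ => rfl)).2 (x, P.pt true X)
  have h₂ := (Zig.forth_rel c.uniform Z (c.sumPath_zig q eF) (Map.face false)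
    (fun t => congrArg (fun z => q.lh ⋄ (c.qA ⋄ z, t.2)) (eF.path_x (c.sumAgree eF) false t.1).symm)
    (fun t => congrArg (fun z => q.l ⋄ c.qB ⋄ z) (eF.path_p (c.sumAgree eF) false t.1 t.2).symm)
    (fun t => (eF.path_x (c.sumAgree eF) false t).symm)).2 (x, P.pt true X)
  exact h₂.symm.trans h₁

theorem pathForth_above {X : C} (t : (cyl P (cyl P c.A')).obj X) :
    c.qA ⋄ c.pathForth q eF ⋄ t = q.l ⋄ c.qB ⋄ (c.sumPath eF).p ⋄ t :=
  c.sA'.above ((c.sumPath_zig q eF).box₂ c.sA') t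

theorem pathBack_above {X : C} (t : (cyl P (cyl P c.A')).obj X) :
    c.qA ⋄ c.pathBack q eF ⋄ t = q.lh ⋄ (c.qA ⋄ (c.sumPath eF).x ⋄ t.1, t.2) :=
  c.sA'.above (c.sumPath_zig q eF).box₁ t

theorem sumPath_x_one {X : C} (x : c.A'.obj X) : (c.sumPath eF).x ⋄ (x, P.pt true X) = x :=
  eF.path_x (c.sumAgree eF) true x

theorem sumPath_p_one {X : C} (x : c.A'.obj X) (j : P.I.obj (op X)) :
    (c.sumPath eF).p ⋄ ((x, P.pt true X), j) = c.f' ⋄ x :=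
  eF.path_p (c.sumAgree eF) true x j

/-- At the end of the path the point is `x` and its path is constant. There `pathBack` lies over
`lh` and ends at `x`, while `pathForth` lies over a constant line. Moving the beginning of
`pathBack` along `pathForth` gives a line over `lh` from the transport of `x` to `x`. -/
theorem turn_box : SqBox (P := P) c.qA (Map.fst.comp (c.qA.cyl.comp q.lh)) (Cofib.bot P c.A') false
    (PMap.empty (Map.fst.comp Map.fst) _)
    (two ((Map.face true).cyl.comp (c.pathForth q eF)) Map.fst)
    ((Map.face true).cyl.comp (c.pathBack q eF)) where
  over_u _ h := h.elim
  over_v b {X} t := by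
    cases b
    · refine (c.pathForth_above q eF _).trans ?_
      refine (congrArg (fun z => q.l ⋄ c.qB ⋄ z) (c.sumPath_p_one eF t.1 t.2)).trans ?_
      exact (congrArg q.l.fn (c.qB_f' t.1)).trans (q.lh_zero _).symm
    · exact (q.lh_one _).symm
  over_w {X} t := (c.pathBack_above q eF _).trans
    (congrArg (fun z => q.lh ⋄ (c.qA ⋄ z, t.2)) (c.sumPath_x_one eF t.1))
  uv _ _ _ h := h.elim
  uw _ h := h.elim
  vw b {X} t := by
    cases b
    · exact c.sA'.base ((c.sumPath_zig q eF).box₂ c.sA') (t, P.pt true X)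
    · exact ((c.sA'.base (c.sumPath_zig q eF).box₁ (t, P.pt true X)).trans
        (c.sumPath_x_one eF t)).symm

/-- a line over `lh` -/
noncomputable def turn : Map (cyl P c.A') c.A' :=
  (Map.face true).comp (c.sA'.sq _ _ _ _ _ _ (c.turn_box q eF))

theorem turn_zero {X : C} (x : c.A'.obj X) :
    c.turn q eF ⋄ (x, P.pt false X) = c.pathForth q eF ⋄ ((x, P.pt true X), P.pt true X) :=
  c.sA'.sq_face (c.turn_box q eF) false x (P.pt true X)

theorem turn_one {X : C} (x : c.A'.obj X) : c.turn q eF ⋄ (x, P.pt true X) = x :=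
  c.sA'.sq_face (c.turn_box q eF) true x (P.pt true X)

/-- The ends of `pathForth` form a line in one fibre of `A'`, from the left inverse at `f' x` to the
transport of `x`. Filling backwards from `turn` along it yields the left homotopy, strictly over
`lh`. -/
theorem sumLh_box : SqBox (P := P) c.qA (Map.fst.comp (c.qA.cyl.comp q.lh)) (Cofib.bot P c.A') true
    (PMap.empty (Map.fst.comp Map.fst) _)
    (two ((Map.face true).comp (c.pathForth q eF)) Map.fst) (c.turn q eF) where
  over_u _ h := h.elim
  over_v b {X} t := by
    cases b
    · refine (c.pathForth_above q eF _).trans ?_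
      refine (congrArg (fun z => q.l ⋄ c.qB ⋄ z) ((c.sumPath eF).one t)).trans ?_
      exact (congrArg q.l.fn (c.qB_f' t.1)).trans (q.lh_zero _).symm
    · exact (q.lh_one _).symm
  over_w {X} t := c.sA'.sq_above (c.turn_box q eF) (t, P.pt true X)
  uv _ _ _ h := h.elim
  uw _ h := h.elim
  vw b {X} t := by
    cases b
    · exact (c.turn_zero q eF t).symm
    · exact (c.turn_one q eF t).symm

noncomputable def sumLh : Map (cyl P c.A') c.A' :=
  (Map.face false).comp (c.sA'.sq _ _ _ _ _ _ (c.sumLh_box q eF))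

/-- the data for the right inverse -/
@[reducible] noncomputable def sumIn : CentIn P where
  c := c
  ef := q.toExt c.sA c.sB
  eF := eF
  H := c.B'
  y := Map.id _
  -- The point of the homotopy fibre of `f` that the right inverse and the right homotopy of the
  -- base equivalence provide.
  d :=
    { x := c.qB.comp q.r
      p := c.qB.cyl.comp q.rh
      zero := fun t => q.rh_zero _
      one := fun t => q.rh_one _
      p_π := fun t => q.rh_π _ }
  φ := Cofib.bot P _
  u := PFibPt.empty P _
  ux _ h := h.elim
  up _ h := h.elim

/-- An equivalence of total spaces over a given equivalence of bases. -/
noncomputable def sumInv : QInv P c.total where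
  l := c.sumL q eF
  lh := c.sumLh q eF
  r := (c.sumIn q eF).result.x
  rh := (c.sumIn q eF).result.p
  l_π y := (congrArg c.πA.fn (c.sumL_above q eF y)).trans (q.l_π _)
  lh_π t := (congrArg c.πA.fn (c.sA'.sq_above (c.sumLh_box q eF) _)).trans (q.lh_π _)
  lh_zero {X} x := (c.sA'.sq_face (c.sumLh_box q eF) false x (P.pt false X)).trans
    (c.pathForth_zero q eF x)
  lh_one {X} x := c.sA'.sq_face (c.sumLh_box q eF) true x (P.pt false X)
  r_π y := (congrArg c.πA.fn ((c.sumIn q eF).result_qA y)).trans (q.r_π _)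
  rh_π t := (congrArg c.πB.fn ((c.sumIn q eF).result_qB t)).trans (q.rh_π _)
  rh_zero y := (c.sumIn q eF).result.zero y
  rh_one y := (c.sumIn q eF).result.one y

/-- The strict equalities that an element of `isEquiv*` needs, since the first components of its
inverses and homotopies are determined by an element of `isEquiv f`. -/
theorem sumInv_over : QInv.Rel c.proj (c.sumInv q eF) q where
  l y := c.sumL_above q eF y
  lh t := c.sA'.sq_above (c.sumLh_box q eF) _
  r y := (c.sumIn q eF).result_qA y
  rh t := (c.sumIn q eF).result_qB t

end

section
variable {c c' : Cfg P} {m : Cfg.Hom c' c} {q' : QInv P c'.base} {eF' : Ext P c'.total}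
  {q : QInv P c.base} {eF : Ext P c.total} (R : QInv.Rel m.base q' q) (R' : Ext.Rel m.total eF' eF)

def sumIn_rel : CentIn.Rel (c'.sumIn q' eF') (c.sumIn q eF) where
  m := m
  ef := QInv.toExt_rel R m.sA m.sB
  eF := R'
  k := m.b'
  y _ := rfl
  d := ⟨fun t => (R.r _).trans (congrArg q.r.fn (m.qB_b' t)),
    fun t => (R.rh _).trans (congrArg q.rh.fn (Prod.ext (m.qB_b' t.1) rfl))⟩
  φ _ := Iff.rfl
  u := PFibPt.empty_rel _ _ _ _

include R' in
theorem sumCent_rel : FibPt.Rel m.total m.b' (c'.sumCent eF') (c.sumCent eF) :=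
  R' m.b' (fun _ => rfl) (fun _ => Iff.rfl) (PFibPt.empty_rel _ _ _ _)

include R' in
theorem sumPath_rel : FibPt.Rel m.total m.a'.cyl (c'.sumPath eF') (c.sumPath eF) := by
  refine Ext.path_rel R' m.a' (c'.sumAgree eF') (c.sumAgree eF) m.b'_f' (fun _ => Iff.rfl)
    (fun b => ?_)
  cases b
  · exact ⟨fun t => ((sumCent_rel R').x _).trans (congrArg (c.sumCent eF).x.fn (m.b'_f' t)),
      fun t => ((sumCent_rel R').p _).trans
        (congrArg (c.sumCent eF).p.fn (Prod.ext (m.b'_f' t.1) rfl))⟩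
  · exact ⟨fun _ => rfl, fun _ => m.b'_f' _⟩

include R in
theorem lh_qA {X : C} (x : c'.A'.obj X) (z : c.A'.obj X) (h : m.a' ⋄ x = z) (i : P.I.obj (op X)) :
    m.a ⋄ q'.lh ⋄ (c'.qA ⋄ x, i) = q.lh ⋄ (c.qA ⋄ z, i) := by
  subst h
  exact (R.lh _).trans (congrArg q.lh.fn (Prod.ext (m.qA_a' x) rfl))

include R in
theorem l_qB {X : C} (y : c'.B'.obj X) (z : c.B'.obj X) (h : m.b' ⋄ y = z) :
    m.a ⋄ q'.l ⋄ c'.qB ⋄ y = q.l ⋄ c.qB ⋄ z := by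
  subst h
  exact (R.l _).trans (congrArg q.l.fn (m.qB_b' y))

include R R' in
theorem sumL_rel {X : C} (y : c'.B'.obj X) : m.a' ⋄ c'.sumL q' eF' ⋄ y = c.sumL q eF ⋄ m.b' ⋄ y :=
  (Zig.forth_rel m.sA' (c'.sumCent_zig q' eF') (c.sumCent_zig q eF) m.b'
    (fun t => lh_qA R _ _ ((sumCent_rel R').x _) _) (fun t => l_qB R _ _ ((sumCent_rel R').p _))
    (sumCent_rel R').x).2 (y, _)

include R R' in
theorem pathForth_rel :
    (∀ {X : C} (t : (cyl P (cyl P c'.A')).obj X),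
      m.a' ⋄ c'.pathBack q' eF' ⋄ t = c.pathBack q eF ⋄ m.a'.cyl.cyl ⋄ t) ∧
    (∀ {X : C} (t : (cyl P (cyl P c'.A')).obj X),
      m.a' ⋄ c'.pathForth q' eF' ⋄ t = c.pathForth q eF ⋄ m.a'.cyl.cyl ⋄ t) :=
  Zig.forth_rel m.sA' (c'.sumPath_zig q' eF') (c.sumPath_zig q eF) m.a'.cyl
    (fun t => lh_qA R _ _ ((sumPath_rel R').x _) _) (fun t => l_qB R _ _ ((sumPath_rel R').p _))
    (sumPath_rel R').x

include R R' in
theorem turn_rel {X : C} (t : (cyl P c'.A').obj X) :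
    m.a' ⋄ c'.turn q' eF' ⋄ t = c.turn q eF ⋄ m.a'.cyl ⋄ t := by
  refine FibrRel.sq m.sA' m.a' (c'.turn_box q' eF') (c.turn_box q eF) (fun t => lh_qA R _ _ rfl _)
    (fun _ => Iff.rfl) (fun _ h => h.elim) (fun b {X} t => ?_)
    (fun {X} t => (pathForth_rel R R').1 ((t.1, P.pt true X), t.2)) (t, _)
  cases b
  · exact (pathForth_rel R R').2 ((t.1, P.pt true X), t.2)
  · rfl

include R R' in
theorem sumLh_rel {X : C} (t : (cyl P c'.A').obj X) :
    m.a' ⋄ c'.sumLh q' eF' ⋄ t = c.sumLh q eF ⋄ m.a'.cyl ⋄ t := by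
  refine FibrRel.sq m.sA' m.a' (c'.sumLh_box q' eF') (c.sumLh_box q eF)
    (fun t => lh_qA R _ _ rfl _) (fun _ => Iff.rfl) (fun _ h => h.elim) (fun b {X} t => ?_)
    (fun {X} t => turn_rel R R' t) (t, _)
  cases b
  · exact (pathForth_rel R R').2 (t, P.pt true X)
  · rfl

include R R' in
theorem sumInv_rel : QInv.Rel m.total (c'.sumInv q' eF') (c.sumInv q eF) where
  l := sumL_rel R R'
  lh := sumLh_rel R R'
  r := (CentIn.result_rel (sumIn_rel R R')).x
  rh := (CentIn.result_rel (sumIn_rel R R')).p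

end
end Cfg

end Kan
end Sconing

namespace Sconing

/-! ### Extensionality for equivalences and fillings of families. -/

section FamEquivs
variable {C : Type u} [SmallCategory C] {P : CubeBase C} {S T : Cᵒᵖ ⥤ Type u}

theorem FamEquiv.ext {φ : FamMap T} {e e' : FamEquiv P φ}
    (hl : ∀ {X : C} (t : T.obj (op X)) (y : φ.cod.obj t), e.linv t y = e'.linv t y)
    (hlh : ∀ {X : C} (t : T.obj (op X)) (x : φ.dom.obj t) (i : P.I.obj (op X)),
      e.lhtpy t x i = e'.lhtpy t x i)
    (hr : ∀ {X : C} (t : T.obj (op X)) (y : φ.cod.obj t), e.rinv t y = e'.rinv t y)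
    (hrh : ∀ {X : C} (t : T.obj (op X)) (y : φ.cod.obj t) (i : P.I.obj (op X)),
      e.rhtpy t y i = e'.rhtpy t y i) : e = e' := by
  obtain ⟨l, _, lh, _, _, _, r, _, rh, _, _, _⟩ := e
  obtain ⟨l', _, lh', _, _, _, r', _, rh', _, _, _⟩ := e'
  obtain rfl : @l = @l' := by funext X t y; exact hl t y
  obtain rfl : @lh = @lh' := by funext X t x i; exact hlh t x i
  obtain rfl : @r = @r' := by funext X t y; exact hr t y
  obtain rfl : @rh = @rh' := by funext X t y i; exact hrh t y i
  rfl

theorem LineSec.ext {F : Fam.{u, u, u, u} T} {Z : C} {y : Line P T Z} {s s' : LineSec F y}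
    (h : ∀ {Y : C} (f : Y ⟶ Z) (i : P.I.obj (op Y)), s.val f i = s'.val f i) : s = s' := by
  obtain ⟨v, _⟩ := s
  obtain ⟨v', _⟩ := s'
  obtain rfl : @v = @v' := by funext Y f i; exact h f i
  rfl

theorem LineSec.val_heq {F : Fam.{u, u, u, u} T} {Z : C} {y : Line P T Z} (s : LineSec F y) {Y : C}
    {f f' : Y ⟶ Z} (h : f = f') (i : P.I.obj (op Y)) : HEq (s.val f i) (s.val f' i) := by
  subst h; rfl

/-- The values of a filling depend only on the values of the filling problem. -/
theorem FillStr.fill_heq {F : Fam.{u, u, u, u} T} (s : FillStr P F) {Z : C} {y y' : Line P T Z}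
    (hy : ∀ {Y : C} (f : Y ⟶ Z) (i : P.I.obj (op Y)), y.pt f i = y'.pt f i) {φ φ' : Sieve Z}
    (hφ : φ = φ') (c : φ ∈ P.Cof Z) (c' : φ' ∈ P.Cof Z) (b : Bool) {u : PartialLineSec F y φ b}
    {u' : PartialLineSec F y' φ' b}
    (hu : ∀ {Y : C} (f : Y ⟶ Z) (i : P.I.obj (op Y)) (h h'), HEq (u.val f i h) (u'.val f i h'))
    {Y : C} (f : Y ⟶ Z) (i : P.I.obj (op Y)) :
    HEq ((s.fill y φ c b u).val f i) ((s.fill y' φ' c' b u').val f i) := by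
  obtain rfl : y = y' := by
    obtain ⟨p, _⟩ := y
    obtain ⟨p', _⟩ := y'
    obtain rfl : @p = @p' := by funext Y f i; exact hy f i
    rfl
  subst hφ
  obtain rfl : u = u' := by
    obtain ⟨v, _⟩ := u
    obtain ⟨v', _⟩ := u'
    obtain rfl : @v = @v' := by funext Y f i h; exact eq_of_heq (hu f i h h)
    rfl
  rfl

end FamEquivs

namespace Kan
variable {C : Type u} [SmallCategory C] {P : CubeBase C} {H H' E' : Psh C} {S T : Cᵒᵖ ⥤ Type u}

/-! ## Filling structures of families as filling operations for maps -/

@[reducible] def Psh.of (T : Cᵒᵖ ⥤ Type u) : Psh C where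
  obj X := T.obj (op X)
  res f t := Sconing.res T f t
  res_id t := Sconing.res_id T t
  res_res f g t := Sconing.res_res T f g t

@[reducible] def Map.of (α : S ⟶ T) : Map (Psh.of S) (Psh.of T) :=
  ⟨fun s => ap α s, fun f s => (ap_res α f s).symm⟩

variable (F : Fam.{u, u, u, u} T)

/-- the projection of the total space of a family -/
@[reducible] def famProj : Map (Psh.of F.tot) (Psh.of T) := ⟨fun t => t.1, fun _ _ => rfl⟩

variable {F}

/-- the second component, with a flexible index -/
def famAt {X : C} (x : (Psh.of F.tot).obj X) {t : T.obj (op X)} (h : x.1 = t) : F.obj t :=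
  cast (congrArg (fun t => F.obj t) h) x.2

theorem famAt_heq {X : C} (x : (Psh.of F.tot).obj X) {t : T.obj (op X)} (h : x.1 = t) :
    HEq (famAt x h) x.2 := cast_heq _ _

theorem famAt_map {X Y : C} (f : Y ⟶ X) {x : (Psh.of F.tot).obj X} {x' : (Psh.of F.tot).obj Y}
    (e : (Psh.of F.tot).res f x = x') {t : T.obj (op X)} {t' : T.obj (op Y)} (h : x.1 = t)
    (h' : x'.1 = t') (k : Sconing.res T f t = t') : F.map f k (famAt x h) = famAt x' h' := by
  subst e h k; rfl

theorem famAt_congr {X : C} {x x' : (Psh.of F.tot).obj X} (e : x = x') {t t' : T.obj (op X)}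
    (h : x.1 = t) (h' : x'.1 = t') : HEq (famAt x h) (famAt x' h') := by
  subst e h h'; rfl

theorem tot_ext {X : C} {x x' : (Psh.of F.tot).obj X} (h : x.1 = x'.1) (h' : HEq x.2 x'.2) :
    x = x' := Sigma.ext h h'

section
variable {E T' : Psh C} {π : Map E T'} {y : Map (cyl P H) T'} {φ : Cofib P H} {b : Bool}
    {u : PMap (fun X (t : (cyl P H).obj X) => φ.holds t.1) E} {w : Map H E}

open Classical in
/-- the union of the two parts of a filling problem -/
noncomputable def boxVal (φ : Cofib P H) (u : PMap (fun X (t : (cyl P H).obj X) => φ.holds t.1) E)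
    (w : Map H E) {X : C} (t : (cyl P H).obj X) : E.obj X :=
  if h : φ.holds t.1 then u.val t h else w ⋄ t.1

theorem boxVal_part {X : C} (t : (cyl P H).obj X) (h : φ.holds t.1) : boxVal φ u w t = u.val t h :=
  dif_pos h

theorem boxVal_base (B : Box π y φ b u w) {X : C} (t : (cyl P H).obj X) (h : t.2 = P.pt b X) :
    boxVal φ u w t = w ⋄ t.1 := by
  by_cases h' : φ.holds t.1
  · obtain ⟨t, i⟩ := t
    obtain rfl : i = P.pt b X := h
    exact (boxVal_part _ h').trans (B.uw t h')
  · exact dif_neg h'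

/-- The function `boxVal` is total, but away from `φ` and the base its value `w ⋄ t.1` is a default
without meaning. The hypothesis `h` excludes that case. -/
theorem boxVal_over (B : Box π y φ b u w) {X : C} (t : (cyl P H).obj X)
    (h : φ.holds t.1 ∨ t.2 = P.pt b X) : π ⋄ boxVal φ u w t = y ⋄ t := by
  rcases h with h | h
  · rw [boxVal_part t h, B.over_u]
  · rw [boxVal_base B t h, B.over_w, ← h]

theorem boxVal_res (B : Box π y φ b u w) {X Y : C} (f : Y ⟶ X) (t : (cyl P H).obj X)
    (h : φ.holds t.1 ∨ t.2 = P.pt b X) :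
    E.res f (boxVal φ u w t) = boxVal φ u w ((cyl P H).res f t) := by
  rcases h with h | h
  · rw [boxVal_part t h, boxVal_part ((cyl P H).res f t) (φ.mono f h)]
    exact u.res_val f t h _
  · rw [boxVal_base B t h, boxVal_base B ((cyl P H).res f t) (by dsimp only; rw [h, P.pt_res])]
    exact w.res_fn f _

theorem boxVal_rel {E₁ T₁ : Psh C} {π₁ : Map E₁ T₁} {y₁ : Map (cyl P H') T₁} {φ₁ : Cofib P H'}
    {u₁ : PMap (fun X (t : (cyl P H').obj X) => φ₁.holds t.1) E₁} {w₁ : Map H' E₁}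
    (B₁ : Box π₁ y₁ φ₁ b u₁ w₁) (B : Box π y φ b u w) (k : Map H' H) (ε : Map E₁ E)
    (hφ : ∀ {X : C} (t : H'.obj X), φ₁.holds t ↔ φ.holds (k ⋄ t))
    (hu : PMap.Rel k.cyl ε u₁ u) (hw : ∀ {X : C} (t : H'.obj X), ε ⋄ w₁ ⋄ t = w ⋄ k ⋄ t) {X : C}
    (t : (cyl P H').obj X) (h : φ₁.holds t.1 ∨ t.2 = P.pt b X) :
    ε ⋄ boxVal φ₁ u₁ w₁ t = boxVal φ u w (k.cyl ⋄ t) := by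
  rcases h with h | h
  · rw [boxVal_part t h, boxVal_part (k.cyl ⋄ t) ((hφ _).1 h)]
    exact hu t h _
  · rw [boxVal_base B₁ t h, boxVal_base B (k.cyl ⋄ t) h]
    exact hw _

end

/-- the line `j ↦ y (h, j)` -/
@[reducible] def lineOf (y : Map (cyl P H) (Psh.of T)) {X : C} (h : H.obj X) : Line P T X where
  pt f j := y ⋄ (H.res f h, j)
  nat f g j := (y.res_fn g (H.res f h, j)).trans
    (congrArg (fun t => y ⋄ (t, Sconing.res P.I g j)) (H.res_res f g h))

section
variable {y : Map (cyl P H) (Psh.of T)} {φ : Cofib P H} {b : Bool}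
    {u : PMap (fun X (t : (cyl P H).obj X) => φ.holds t.1) (Psh.of F.tot)}
    {w : Map H (Psh.of F.tot)}

/-- a filling problem as a partial section over a line -/
@[reducible] noncomputable def partOf (B : Box (famProj F) y φ b u w) {X : C} (h : H.obj X) :
    PartialLineSec F (lineOf y h) (φ.sieve h) b where
  val f j hh := famAt (boxVal φ u w (H.res f h, j)) (boxVal_over B (H.res f h, j) hh)
  nat f g j hh hh' := famAt_map g ((boxVal_res B g (H.res f h, j) hh).trans
    (congrArg (fun t => boxVal φ u w (t, Sconing.res P.I g j)) (H.res_res f g h))) _ _ _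

/-- A filling structure works along one line at one stage. A problem with parameters in `H` is
solved separately for every element of `H`. -/
noncomputable def fillOf (s : FillStr P F) (B : Box (famProj F) y φ b u w) {X : C} (h : H.obj X) :
    LineSec F (lineOf y h) := s.fill (lineOf y h) (φ.sieve h) (φ.sieve_mem h) b (partOf B h)

/-- The problem at a restricted parameter is the restriction of the problem, so stability of the
filling structure under restriction applies. This makes the separate fillings a map out of the
cylinder. -/
theorem fillOf_res (s : FillStr P F) (B : Box (famProj F) y φ b u w) {X Y : C} (g : Y ⟶ X)
    (h : H.obj X) {Z : C} (f : Z ⟶ Y) (i : P.I.obj (op Z)) :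
    HEq ((fillOf s B (H.res g h)).val f i) ((fillOf s B h).val (f ≫ g) i) := by
  refine HEq.trans ?_ (congr_arg_heq (fun r : LineSec F ((lineOf y h).pre g) => r.val f i)
    (s.fill_pre g (lineOf y h) (φ.sieve h) (φ.sieve_mem h) b (partOf B h)).symm)
  refine s.fill_heq (fun f' j => ?_) (φ.sieve_pullback g h).symm _ _ b (fun f' j h1 h2 => ?_) f i
  · exact congrArg (fun t => y ⋄ (t, j)) (H.res_res g f' h)
  · exact famAt_congr (congrArg (fun t => boxVal φ u w (t, j)) (H.res_res g f' h))
      (boxVal_over B (H.res f' (H.res g h), j) h1) (boxVal_over B (H.res (f' ≫ g) h, j) h2)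

end

/-- A filling structure as a filling operation. -/
noncomputable def Fibr.ofFillStr (s : FillStr P F) : Fibr P (famProj F) where
  fill {H} y φ b u w B :=
    -- The line of the parameter is evaluated at the identity of the stage; its value there involves
    -- the restriction along `𝟙 X`, which is equal, but not definitionally, to the parameter.
    { fn := fun {X} t => ⟨y ⋄ (H.res (𝟙 X) t.1, t.2), (fillOf s B t.1).val (𝟙 X) t.2⟩
      res_fn := fun {X Y} f t => by
        have e : H.res f (H.res (𝟙 X) t.1) = H.res (𝟙 Y) (H.res f t.1) := by
          rw [H.res_id, H.res_id]
        refine tot_ext ((y.res_fn f (H.res (𝟙 X) t.1, t.2)).trans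
          (congrArg (fun s => y ⋄ (s, Sconing.res P.I f t.2)) e)) ?_
        refine HEq.trans ?_ (fillOf_res s B f t.1 (𝟙 Y) (Sconing.res P.I f t.2)).symm
        refine (F.map_heq'' f _ _ _).trans ((heq_of_eq ((fillOf s B t.1).nat (𝟙 X) f t.2)).trans ?_)
        exact LineSec.val_heq _ (by simp) _ }
  above := fun {H y φ b u w} B {X} t => congrArg (fun s => y ⋄ (s, t.2)) (H.res_id t.1)
  ext := fun {H y φ b u w} B {X} t h => by
    have h' : φ.holds (H.res (𝟙 X) t.1) := by rw [H.res_id]; exact h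
    have e : boxVal φ u w (H.res (𝟙 X) t.1, t.2) = u.val t h :=
      (congrArg (fun s => boxVal φ u w (s, t.2)) (H.res_id t.1)).trans (boxVal_part t h)
    refine tot_ext ?_ ?_
    · exact (boxVal_over B (H.res (𝟙 X) t.1, t.2) (Or.inl h')).symm.trans (congrArg (famProj F).fn e)
    · refine (heq_of_eq (s.fill_extends (lineOf y t.1) (φ.sieve t.1) (φ.sieve_mem t.1) b (partOf B t.1)
        (𝟙 X) t.2 (Or.inl h'))).trans ?_
      exact (famAt_heq _ (boxVal_over B (H.res (𝟙 X) t.1, t.2) (Or.inl h'))).trans (congr_arg_heq (fun s : (Psh.of F.tot).obj X => s.2) e)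
  base := fun {H y φ b u w} B {X} t => by
    have e : boxVal φ u w (H.res (𝟙 X) t, P.pt b X) = w ⋄ t :=
      (congrArg (fun s => boxVal φ u w (s, P.pt b X)) (H.res_id t)).trans (boxVal_base B (t, _) rfl)
    refine tot_ext ?_ ?_
    · exact (boxVal_over B (H.res (𝟙 X) t, P.pt b X) (Or.inr rfl)).symm.trans
        (congrArg (famProj F).fn e)
    · refine (heq_of_eq (s.fill_extends (lineOf y t) (φ.sieve t) (φ.sieve_mem t) b (partOf B t)
        (𝟙 X) (P.pt b X) (Or.inr rfl))).trans ?_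
      exact (famAt_heq _ (boxVal_over B (H.res (𝟙 X) t, P.pt b X) (Or.inr rfl))).trans (congr_arg_heq (fun s : (Psh.of F.tot).obj X => s.2) e)

/-- the map of total spaces of a pullback of families -/
@[reducible] def famPull (F : Fam.{u, u, u, u} T) (α : S ⟶ T) :
    Map (Psh.of (F.pull α).tot) (Psh.of F.tot) :=
  ⟨fun t => ⟨ap α t.1, t.2⟩, fun f t => tot_ext (ap_res α f t.1).symm (F.map_heq'' f _ _ _)⟩

/-- Substitution along `α` and reindexing of parameters come together here. Related problems become,
at each parameter, the same filling problem for `s`, so that their fillings agree. -/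
theorem Fibr.ofFillStr_rel (s : FillStr P F) (α : S ⟶ T) :
    FibrRel (Fibr.ofFillStr (s.pull α)) (Fibr.ofFillStr s) (famPull F α) (Map.of α) := by
  intro H' H k y' φ' b u' w' B' y φ u w B hy hφ hu hw X t
  have e : ∀ {Y : C} (f : Y ⟶ X) (j : P.I.obj (op Y)),
      ap α (y' ⋄ (H'.res f t.1, j)) = y ⋄ (H.res f (k ⋄ t.1), j) := fun f j =>
    (hy (H'.res f t.1, j)).trans (congrArg (fun s => y ⋄ (s, j)) (k.res_fn f t.1).symm)
  refine tot_ext (e (𝟙 X) t.2) ?_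
  refine s.fill_heq (y := (lineOf y' t.1).map α) (y' := lineOf y (k ⋄ t.1)) (φ := φ'.sieve t.1)
    (φ' := φ.sieve (k ⋄ t.1)) (u' := partOf B (k ⋄ t.1)) (u := ⟨fun f i h => (partOf B' t.1).val f i h, fun f g i h h' => (partOf B' t.1).nat f g i h h'⟩)
    (fun f j => e f j) ?_ (φ'.sieve_mem t.1) (φ.sieve_mem (k ⋄ t.1)) b (fun {Y} f j h1 h2 => ?_) (𝟙 X) t.2
  · ext Y f
    show φ'.holds _ ↔ φ.holds _
    rw [hφ, k.res_fn]
  · refine (famAt_heq _ (boxVal_over B' (H'.res f t.1, j) h1)).trans (HEq.trans ?_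
      (famAt_heq _ (boxVal_over B (H.res f (k ⋄ t.1), j) h2)).symm)
    refine congr_arg_heq (fun s : (Psh.of F.tot).obj Y => s.2)
      (?_ : famPull F α ⋄ _ = boxVal φ u w _)
    refine (boxVal_rel B' B k (famPull F α) hφ hu hw (H'.res f t.1, j) h1).trans ?_
    exact congrArg (fun s => boxVal φ u w (s, j)) (k.res_fn f t.1).symm

theorem Fibr.ofFillStr_uniform (s : FillStr P F) :
    FibrRel (Fibr.ofFillStr s) (Fibr.ofFillStr s) (Map.id _) (Map.id _) :=
  Fibr.ofFillStr_rel s (𝟙 T)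

/-! ## Equivalences of families as equivalences of total spaces -/

/-- a map of families, as a map of total spaces -/
@[reducible] def arrowOf (φ : FamMap T) : Arrow C where
  T := Psh.of T
  dom := Psh.of φ.dom.tot
  cod := Psh.of φ.cod.tot
  πd := famProj _
  πc := famProj _
  fn := ⟨fun t => ⟨t.1, φ.fn t.1 t.2⟩, fun f t => tot_ext rfl (heq_of_eq (φ.nat f rfl t.2))⟩
  πc_fn _ := rfl

variable {φ : FamMap T} {ψ : FamMap S}

@[reducible] def toQInv (e : FamEquiv P φ) : QInv P (arrowOf φ) where
  l := ⟨fun t => ⟨t.1, e.linv t.1 t.2⟩, fun f t => tot_ext rfl (heq_of_eq (e.linv_nat f rfl t.2))⟩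
  lh := ⟨fun t => ⟨t.1.1, e.lhtpy t.1.1 t.1.2 t.2⟩,
    fun f t => tot_ext rfl (heq_of_eq (e.lhtpy_nat f rfl t.1.2 t.2))⟩
  r := ⟨fun t => ⟨t.1, e.rinv t.1 t.2⟩, fun f t => tot_ext rfl (heq_of_eq (e.rinv_nat f rfl t.2))⟩
  rh := ⟨fun t => ⟨t.1.1, e.rhtpy t.1.1 t.1.2 t.2⟩,
    fun f t => tot_ext rfl (heq_of_eq (e.rhtpy_nat f rfl t.1.2 t.2))⟩
  l_π _ := rfl
  lh_π _ := rfl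
  lh_zero x := tot_ext rfl (heq_of_eq (e.lhtpy_zero x.1 x.2))
  lh_one x := tot_ext rfl (heq_of_eq (e.lhtpy_one x.1 x.2))
  r_π _ := rfl
  rh_π _ := rfl
  rh_zero x := tot_ext rfl (heq_of_eq (e.rhtpy_zero x.1 x.2))
  rh_one x := tot_ext rfl (heq_of_eq (e.rhtpy_one x.1 x.2))

theorem famAt_of_eq {X : C} {t : T.obj (op X)} {x : F.obj t} {z : (Psh.of F.tot).obj X} (h : z.1 = t)
    (e : z = ⟨t, x⟩) : famAt z h = x := by
  subst e; rfl

theorem famAt_eta {X : C} {t : T.obj (op X)} (z : (Psh.of F.tot).obj X) (h : z.1 = t) :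
    (⟨t, famAt z h⟩ : (Psh.of F.tot).obj X) = z := by
  subst h; rfl

-- All maps of a `QInv` lie strictly over `T`. Their second components can thus be moved to the
-- expected fibre by `famAt`.
@[reducible] def ofQInv (q : QInv P (arrowOf φ)) : FamEquiv P φ where
  linv t y := famAt (q.l ⋄ ⟨t, y⟩) (q.l_π _)
  linv_nat {X Y} f {t s} h y := famAt_map f (x := q.l ⋄ ⟨t, y⟩) (x' := q.l ⋄ ⟨s, φ.cod.map f h y⟩)
    (by subst h; exact q.l.res_fn f ⟨t, y⟩) _ _ _
  lhtpy t x i := famAt (q.lh ⋄ (⟨t, x⟩, i)) (q.lh_π (⟨t, x⟩, i))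
  lhtpy_nat {X Y} f {t s} h x i := famAt_map f (x := q.lh ⋄ (⟨t, x⟩, i))
    (x' := q.lh ⋄ (⟨s, φ.dom.map f h x⟩, Sconing.res P.I f i)) (by subst h; exact q.lh.res_fn f (⟨t, x⟩, i)) _ _ _
  lhtpy_zero t x := eq_of_heq (famAt_congr (q.lh_zero ⟨t, x⟩) _ _)
  lhtpy_one t x := famAt_of_eq _ (q.lh_one ⟨t, x⟩)
  rinv t y := famAt (q.r ⋄ ⟨t, y⟩) (q.r_π _)
  rinv_nat {X Y} f {t s} h y := famAt_map f (x := q.r ⋄ ⟨t, y⟩) (x' := q.r ⋄ ⟨s, φ.cod.map f h y⟩)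
    (by subst h; exact q.r.res_fn f ⟨t, y⟩) _ _ _
  rhtpy t y i := famAt (q.rh ⋄ (⟨t, y⟩, i)) (q.rh_π (⟨t, y⟩, i))
  rhtpy_nat {X Y} f {t s} h y i := famAt_map f (x := q.rh ⋄ (⟨t, y⟩, i))
    (x' := q.rh ⋄ (⟨s, φ.cod.map f h y⟩, Sconing.res P.I f i)) (by subst h; exact q.rh.res_fn f (⟨t, y⟩, i)) _ _ _
  rhtpy_zero {X} t y := famAt_of_eq _ ((q.rh_zero ⟨t, y⟩).trans
    (congrArg (arrowOf φ).fn.fn (famAt_eta (q.r ⋄ ⟨t, y⟩) (q.r_π ⟨t, y⟩)).symm))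
  rhtpy_one t y := famAt_of_eq _ (q.rh_one ⟨t, y⟩)

theorem toQInv_ofQInv (q : QInv P (arrowOf φ)) :
    QInv.Rel (ArrowHom.refl _) (toQInv (ofQInv q)) q where
  l y := famAt_eta (q.l ⋄ y) (q.l_π y)
  lh t := famAt_eta (q.lh ⋄ t) (q.lh_π t)
  r y := famAt_eta (q.r ⋄ y) (q.r_π y)
  rh t := famAt_eta (q.rh ⋄ t) (q.rh_π t)

/-- Equivalences of families which are related by a substitution. -/
theorem famEquiv_eq_pull (α : S ⟶ T) (h : φ.pull α = ψ) (m : ArrowHom (arrowOf ψ) (arrowOf φ))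
    (hτ : ∀ {X : C} (s : S.obj (op X)), m.τ ⋄ s = ap α s)
    (hδ : ∀ {X : C} (t : (arrowOf ψ).dom.obj X), HEq (m.δ ⋄ t).2 t.2)
    (hκ : ∀ {X : C} (t : (arrowOf ψ).cod.obj X), HEq (m.κ ⋄ t).2 t.2) {e' : FamEquiv P ψ}
    {e : FamEquiv P φ} (R : QInv.Rel m (toQInv e') (toQInv e)) :
    e' = cast (congrArg (FamEquiv P) h) (e.pull α) := by
  subst h
  have eδ : ∀ {X : C} (t : (arrowOf (φ.pull α)).dom.obj X), m.δ ⋄ t = ⟨ap α t.1, t.2⟩ := fun t =>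
    tot_ext ((m.πd_δ t).symm.trans (hτ _)) (hδ t)
  have eκ : ∀ {X : C} (t : (arrowOf (φ.pull α)).cod.obj X), m.κ ⋄ t = ⟨ap α t.1, t.2⟩ := fun t =>
    tot_ext ((m.πc_κ t).symm.trans (hτ _)) (hκ t)
  refine FamEquiv.ext (fun {X} t y => ?_) (fun {X} t x i => ?_) (fun {X} t y => ?_)
    (fun {X} t y i => ?_)
  · have h := (eδ _).symm.trans ((R.l ⟨t, y⟩).trans (congrArg (toQInv e).l.fn (eκ _)))
    exact eq_of_heq (Sigma.mk.inj_iff.1 h).2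
  · have h := (eδ _).symm.trans ((R.lh (⟨t, x⟩, i)).trans
      (congrArg (fun z => (toQInv e).lh ⋄ (z, i)) (eδ _)))
    exact eq_of_heq (Sigma.mk.inj_iff.1 h).2
  · have h := (eδ _).symm.trans ((R.r ⟨t, y⟩).trans (congrArg (toQInv e).r.fn (eκ _)))
    exact eq_of_heq (Sigma.mk.inj_iff.1 h).2
  · have h := (eκ _).symm.trans ((R.rh (⟨t, y⟩, i)).trans
      (congrArg (fun z => (toQInv e).rh ⋄ (z, i)) (eκ _)))
    exact eq_of_heq (Sigma.mk.inj_iff.1 h).2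

/-! ## Transport along isomorphisms -/

@[reducible] def ArrowHom.trans {a b c : Arrow C} (m : ArrowHom a b) (n : ArrowHom b c) :
    ArrowHom a c where
  τ := m.τ.comp n.τ
  δ := m.δ.comp n.δ
  κ := m.κ.comp n.κ
  πd_δ x := (congrArg n.τ.fn (m.πd_δ x)).trans (n.πd_δ _)
  πc_κ x := (congrArg n.τ.fn (m.πc_κ x)).trans (n.πc_κ _)
  κ_fn x := (congrArg n.κ.fn (m.κ_fn x)).trans (n.κ_fn _)

theorem QInv.Rel.trans {a b c : Arrow C} {m : ArrowHom a b} {n : ArrowHom b c} {q : QInv P a}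
    {q' : QInv P b} {q'' : QInv P c} (R : QInv.Rel m q q') (Q : QInv.Rel n q' q'') :
    QInv.Rel (m.trans n) q q'' where
  l y := (congrArg n.δ.fn (R.l y)).trans (Q.l _)
  lh t := (congrArg n.δ.fn (R.lh t)).trans (Q.lh _)
  r y := (congrArg n.δ.fn (R.r y)).trans (Q.r _)
  rh t := (congrArg n.κ.fn (R.rh t)).trans (Q.rh _)

/-- An isomorphism of arrows. -/
structure ArrowIso (a b : Arrow C) where
  hom : ArrowHom a b
  inv : ArrowHom b a
  τ_hom : ∀ {X : C} (t : b.T.obj X), hom.τ ⋄ inv.τ ⋄ t = t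
  δ_hom : ∀ {X : C} (x : b.dom.obj X), hom.δ ⋄ inv.δ ⋄ x = x
  κ_hom : ∀ {X : C} (y : b.cod.obj X), hom.κ ⋄ inv.κ ⋄ y = y
  δ_inv : ∀ {X : C} (x : a.dom.obj X), inv.δ ⋄ hom.δ ⋄ x = x
  κ_inv : ∀ {X : C} (y : a.cod.obj X), inv.κ ⋄ hom.κ ⋄ y = y

section
variable {a b : Arrow C} (i : ArrowIso a b) (q : QInv P a)

@[reducible] def QInv.transport : QInv P b where
  l := i.inv.κ.comp (q.l.comp i.hom.δ)
  lh := i.inv.δ.cyl.comp (q.lh.comp i.hom.δ)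
  r := i.inv.κ.comp (q.r.comp i.hom.δ)
  rh := i.inv.κ.cyl.comp (q.rh.comp i.hom.κ)
  l_π y := by
    show b.πd ⋄ i.hom.δ ⋄ q.l ⋄ i.inv.κ ⋄ y = b.πc ⋄ y
    rw [← i.hom.πd_δ, q.l_π, ← i.inv.πc_κ, i.τ_hom]
  lh_π t := by
    show b.πd ⋄ i.hom.δ ⋄ q.lh ⋄ (i.inv.δ ⋄ t.1, t.2) = b.πd ⋄ t.1
    rw [← i.hom.πd_δ, q.lh_π, ← i.inv.πd_δ, i.τ_hom]
  lh_zero {X} x := by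
    show i.hom.δ ⋄ q.lh ⋄ (i.inv.δ ⋄ x, P.pt false X) = i.hom.δ ⋄ q.l ⋄ i.inv.κ ⋄ b.fn ⋄ x
    rw [q.lh_zero, i.inv.κ_fn]
  lh_one {X} x := by
    show i.hom.δ ⋄ q.lh ⋄ (i.inv.δ ⋄ x, P.pt true X) = x
    rw [q.lh_one, i.δ_hom]
  r_π y := by
    show b.πd ⋄ i.hom.δ ⋄ q.r ⋄ i.inv.κ ⋄ y = b.πc ⋄ y
    rw [← i.hom.πd_δ, q.r_π, ← i.inv.πc_κ, i.τ_hom]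
  rh_π t := by
    show b.πc ⋄ i.hom.κ ⋄ q.rh ⋄ (i.inv.κ ⋄ t.1, t.2) = b.πc ⋄ t.1
    rw [← i.hom.πc_κ, q.rh_π, ← i.inv.πc_κ, i.τ_hom]
  rh_zero {X} y := by
    show i.hom.κ ⋄ q.rh ⋄ (i.inv.κ ⋄ y, P.pt false X) = b.fn ⋄ i.hom.δ ⋄ q.r ⋄ i.inv.κ ⋄ y
    rw [q.rh_zero, i.hom.κ_fn]
  rh_one {X} y := by
    show i.hom.κ ⋄ q.rh ⋄ (i.inv.κ ⋄ y, P.pt true X) = y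
    rw [q.rh_one, i.κ_hom]

theorem QInv.transport_hom : QInv.Rel i.hom q (q.transport i) where
  l y := congrArg (fun z => i.hom.δ ⋄ q.l ⋄ z) (i.κ_inv y).symm
  lh t := congrArg (fun z => i.hom.δ ⋄ q.lh ⋄ (z, t.2)) (i.δ_inv t.1).symm
  r y := congrArg (fun z => i.hom.δ ⋄ q.r ⋄ z) (i.κ_inv y).symm
  rh t := congrArg (fun z => i.hom.κ ⋄ q.rh ⋄ (z, t.2)) (i.κ_inv t.1).symm

theorem QInv.transport_inv : QInv.Rel i.inv (q.transport i) q where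
  l y := i.δ_inv _
  lh t := i.δ_inv _
  r y := i.δ_inv _
  rh t := i.κ_inv _

end

/-- the inverse isomorphism -/
@[reducible] def ArrowIso.symm {a b : Arrow C} (i : ArrowIso a b)
    (h : ∀ {X : C} (t : a.T.obj X), i.inv.τ ⋄ i.hom.τ ⋄ t = t) : ArrowIso b a :=
  ⟨i.inv, i.hom, h, i.δ_inv, i.κ_inv, i.δ_hom, i.κ_hom⟩

end Kan
end Sconing

namespace Sconing

/-! ### Extensionality for fillings in the model `M`. -/

section Filling
open Cwf
variable {C : Type u} [SmallCategory C] {P : CubeBase C} {K : Cwf.{u, w, w'} C}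

theorem TmLine.tm_heq {Γ Δ : K.Ctx} {L : TyLine P Γ} (l : TmLine L) {σ σ' : Δ ⟶ Γ} (h : σ = σ')
    {i i' : P.I.obj (op Δ.1)} (hi : i = i') : HEq (l.tm σ i) (l.tm σ' i') := by
  subst h hi; rfl

/-- The values of a filling depend only on the values of the filling problem. -/
theorem Filling.fill_heq (s : Filling P K) {Γ Δ : K.Ctx} {L L' : TyLine P Γ}
    (hL : ∀ {Δ : K.Ctx} (σ : Δ ⟶ Γ) (i : P.I.obj (op Δ.1)), L.ty σ i = L'.ty σ i)
    {φ φ' : Sieve Γ.1} (hφ : φ = φ') (c : φ ∈ P.Cof Γ.1) (c' : φ' ∈ P.Cof Γ.1) (b : Bool)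
    {u : PartialLine L φ b} {u' : PartialLine L' φ' b}
    (hu : ∀ {Δ : K.Ctx} (σ : Δ ⟶ Γ) (i : P.I.obj (op Δ.1)) (h h'), HEq (u.tm σ i h) (u'.tm σ i h'))
    (σ : Δ ⟶ Γ) (i : P.I.obj (op Δ.1)) :
    HEq ((s.fill L φ c b u).tm σ i) ((s.fill L' φ' c' b u').tm σ i) := by
  obtain rfl : L = L' := by
    obtain ⟨t, _⟩ := L
    obtain ⟨t', _⟩ := L'
    obtain rfl : @t = @t' := by funext Δ σ i; exact hL σ i
    rfl
  subst hφ
  obtain rfl : u = u' := by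
    obtain ⟨v, _⟩ := u
    obtain ⟨v', _⟩ := u'
    obtain rfl : @v = @v' := by funext Δ σ i h; exact eq_of_heq (hu σ i h h)
    rfl
  rfl

end Filling

namespace Scone
open Cwf
variable {C : Type u} [SmallCategory C] {P : CubeBase C} {K : Cwf.{u, w, w'} C} {Γ Δ Θ : Ctx K}

/-! ## The families of closed elements -/

theorem Closed.cl_res_eq (A : Closed Γ) {X Y : C} (k : Y ⟶ X) {g : Γ.2.pred.obj (op X)}
    {g' : Γ.2.pred.obj (op Y)} (h : res _ k g = g') :
    Cwf.sub (A.cl g) (K.unitMap k) = A.cl g' := by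
  subst h; exact A.cl_res k g

/-- the family `|A| ρ` over the contexts `(ρ, ρ')` -/
@[reducible] def Closed.clFam (A : Closed Γ) : Fam.{u, u, u, u} Γ.2.pred where
  obj g := K.Tm.obj (A.cl g)
  map := fun {_ _} f {_ _} h a => K.Tm.map (K.unitMap f) (A.cl_res_eq f h) a
  map_id := fun {X g} h a =>
    eq_of_heq ((K.Tm.map_heq (K.unitMap_id X) _ (res_id _ _) rfl HEq.rfl).trans
      (heq_of_eq (K.Tm.map_id _ _)))
  map_comp := fun {_ _ _} f g {_ _ _} h k l a =>
    (K.Tm.map_map _ _ _).trans (K.Tm.map_eq (K.unitMap_comp f g).symm _ _ _)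

variable (A : Closed Γ)

theorem clLine_aux {Z : C} (y : Line P Γ.2.pred Z) {X Y : C} (f : X ⟶ Z) (k : Y ⟶ X)
    (i : P.I.obj (op X)) : Cwf.sub (A.cl (y.pt f i)) (K.unitMap k) = A.cl (y.pt (k ≫ f) (res P.I k i)) :=
  A.cl_res_eq k (y.nat f k i)

theorem comp_toUnit {Δ Θ : K.Ctx} (τ : Θ ⟶ Δ) :
    τ ≫ K.toUnit Δ (𝟙 Δ.1) = K.toUnit Θ (𝟙 Θ.1) ≫ K.unitMap (K.base τ) :=
  unit_hom_ext (by rw [K.base_comp, K.base_comp, K.base_toUnit, K.base_toUnit, K.base_unitMap,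
    Category.comp_id, Category.id_comp])

theorem toUnit_unit (X : C) : K.toUnit (K.unit X) (𝟙 X) = 𝟙 (K.unit X) := K.unitMap_id X

/-- the line of types `A (y i)` -/
@[reducible] def clLine {Z : C} (y : Line P Γ.2.pred Z) : TyLine P (K.unit Z) where
  ty {Δ} σ i := Cwf.sub (A.cl (y.pt (K.base σ) i)) (K.toUnit Δ (𝟙 Δ.1))
  nat {Δ Θ} σ τ i := by
    rw [Cwf.sub_sub, comp_toUnit, ← Cwf.sub_sub, clLine_aux, K.base_comp]

-- A value at stage `Y` is an element in the terminal context at `Y`. Weakening it to arbitrary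
-- contexts turns a partial section of `|A|` into a partial line of `M` over the terminal context.
@[reducible] def clPart {Z : C} {y : Line P Γ.2.pred Z} {φ : Sieve Z} {b : Bool}
    (u : PartialLineSec A.clFam y φ b) : PartialLine (clLine A y) φ b where
  tm {Δ} σ i h := K.Tm.map (K.toUnit Δ (𝟙 Δ.1)) rfl (u.val (K.base σ) i h)
  nat {Δ Θ} σ τ i h h' := by
    have h₁ : φ.arrows (K.base τ ≫ K.base σ) ∨ res P.I (K.base τ) i = P.pt b Θ.1 := by
      rw [← K.base_comp]; exact h'
    have e := u.nat (K.base σ) (K.base τ) i h h₁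
    have key : ∀ (l l' : Θ.1 ⟶ Z), l = l' → ∀ j m m', HEq (u.val l j m) (u.val l' j m') := by
      rintro l _ rfl j _ _; rfl
    rw [K.Tm.map_map]
    refine eq_of_heq ((K.Tm.map_heq (comp_toUnit τ) _ (Cwf.sub_trans (clLine_aux A y _ _ i) rfl) rfl
      HEq.rfl).trans ?_)
    rw [← K.Tm.map_map (clLine_aux A y _ _ i) rfl]
    refine K.Tm.map_heq rfl _ _ ?_ ((heq_of_eq e).trans (key _ _ (K.base_comp τ σ).symm _ _ _))
    exact congrArg (fun l => A.cl (y.pt l (res P.I (K.base τ) i))) (K.base_comp τ σ).symm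

theorem clLine_ty {Z Y : C} (y : Line P Γ.2.pred Z) (f : Y ⟶ Z) (i : P.I.obj (op Y)) :
    Cwf.sub ((clLine A y).ty (K.unitMap f) i) (𝟙 (K.unit Y)) = A.cl (y.pt f i) := by
  refine (res_id K.Ty _).trans ?_
  show Cwf.sub (A.cl (y.pt (K.base (K.unitMap f)) i)) (K.toUnit (K.unit Y) (𝟙 Y)) = _
  rw [toUnit_unit, K.base_unitMap]
  exact res_id K.Ty _

/-- the filling structure of `|A|` -/
def clFill (s : Filling P K) : FillStr P A.clFam where
  fill y φ hφ b u := {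
    -- The filling of `M` is read off at the substitution of terminal contexts over `f`; the map
    -- along the identity only adjusts the type.
    val := fun {Y} f i => K.Tm.map (𝟙 (K.unit Y)) (clLine_ty A y f i)
      ((s.fill (clLine A y) φ hφ b (clPart A u)).tm (K.unitMap f) i)
    nat := fun {X Y} f g i => by
      have e := (s.fill (clLine A y) φ hφ b (clPart A u)).nat (K.unitMap f) (K.unitMap g) i
      refine (K.Tm.map_map _ _ _).trans (eq_of_heq ?_)
      refine HEq.trans ?_ (K.Tm.map_id_heq _ _).symm
      refine (K.Tm.map_heq (Category.comp_id _) _ rfl rfl HEq.rfl).trans ?_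
      refine (K.Tm.map_heq'' _ _ _ _).trans ((heq_of_eq e).trans ?_)
      exact TmLine.tm_heq _ (K.unitMap_comp f g).symm
        (congrArg (fun k => res P.I k i) (K.base_unitMap g)) }
  fill_extends y φ hφ b u Y f i h := by
    have h' : φ.arrows (K.base (K.unitMap f)) ∨ i = P.pt b Y := by rw [K.base_unitMap]; exact h
    have key : ∀ (l l' : Y ⟶ _), l = l' → ∀ j m m', HEq (u.val l j m) (u.val l' j m') := by
      rintro l _ rfl j _ _; rfl
    refine eq_of_heq ((K.Tm.map_id_heq _ _).trans
      ((heq_of_eq (s.fill_extends (clLine A y) φ hφ b (clPart A u) (K.unitMap f) i h')).trans ?_))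
    refine (K.Tm.map_heq (toUnit_unit Y) rfl (res_id K.Ty _) rfl HEq.rfl).trans ?_
    exact (K.Tm.map_id_heq _ _).trans (key _ _ (K.base_unitMap f) _ _ _)
  fill_pre {W Z} k y φ hφ b u := by
    have key : ∀ {Y : C} (l l' : Y ⟶ Z), l = l' → ∀ j m m', HEq (u.val l j m) (u.val l' j m') := by
      rintro Y l _ rfl j _ _; rfl
    refine LineSec.ext (fun {Y} f i => eq_of_heq ((K.Tm.map_id_heq _ _).trans
      (HEq.trans ?_ (K.Tm.map_id_heq _ _).symm)))
    refine (TmLine.tm_heq _ (K.unitMap_comp k f) rfl).trans ?_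
    refine (congr_arg_heq (fun l : TmLine ((clLine A y).sub (K.unitMap k)) => l.tm (K.unitMap f) i)
      -- Restriction along `k` is substitution along the map of terminal contexts over `k`, under
      -- which the filling of `M` is stable.
      (s.fill_sub (K.unitMap k) (clLine A y) φ hφ b (clPart A u))).trans ?_
    have e : ∀ {Δ : K.Ctx} (σ : Δ ⟶ K.unit W), K.base (σ ≫ K.unitMap k) = K.base σ ≫ k :=
      fun σ => (K.base_comp _ _).trans (congrArg (fun f => K.base σ ≫ f) (K.base_unitMap k))
    refine s.fill_heq (fun {Δ} σ i => ?_) (congrArg (fun f => φ.pullback f) (K.base_unitMap k)) _ _ b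
      (fun {Δ} σ i h h' => ?_) _ _
    · exact congrArg (fun f => Cwf.sub (A.cl (y.pt f i)) (K.toUnit Δ (𝟙 Δ.1))) (e σ)
    · exact K.Tm.map_heq rfl _ _ (congrArg (fun f => A.cl (y.pt f i)) (e σ)) (key _ _ (e σ) _ _ _)

end Scone
end Sconing

namespace Sconing

/-! ### Naturality of the translation between families and their total spaces. -/

namespace Kan
variable {C : Type u} [SmallCategory C] {P : CubeBase C} {S T : Cᵒᵖ ⥤ Type u} {φ : FamMap T}
  {ψ : FamMap S}

/-- Converse of `famEquiv_eq_pull`: the action of a substitution on inputs becomes a relation, which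
the constructions on arrows preserve. The hypotheses on `m` say that it is `α` on the base and the
identity on fibres. -/
theorem toQInv_pull_rel (α : S ⟶ T) (h : φ.pull α = ψ) (m : ArrowHom (arrowOf ψ) (arrowOf φ))
    (hτ : ∀ {X : C} (s : S.obj (op X)), m.τ ⋄ s = ap α s)
    (hδ : ∀ {X : C} (t : (arrowOf ψ).dom.obj X), HEq (m.δ ⋄ t).2 t.2)
    (hκ : ∀ {X : C} (t : (arrowOf ψ).cod.obj X), HEq (m.κ ⋄ t).2 t.2) (e : FamEquiv P φ) :
    QInv.Rel m (toQInv (cast (congrArg (FamEquiv P) h) (e.pull α))) (toQInv e) := by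
  subst h
  have eδ : ∀ {X : C} (t : (arrowOf (φ.pull α)).dom.obj X), m.δ ⋄ t = ⟨ap α t.1, t.2⟩ := fun t =>
    tot_ext ((m.πd_δ t).symm.trans (hτ _)) (hδ t)
  have eκ : ∀ {X : C} (t : (arrowOf (φ.pull α)).cod.obj X), m.κ ⋄ t = ⟨ap α t.1, t.2⟩ := fun t =>
    tot_ext ((m.πc_κ t).symm.trans (hτ _)) (hκ t)
  refine ⟨fun y => ?_, fun t => ?_, fun y => ?_, fun t => ?_⟩
  · rw [eδ, eκ]; rfl
  · show m.δ ⋄ _ = (toQInv e).lh ⋄ (m.δ ⋄ t.1, t.2)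
    rw [eδ, eδ]; rfl
  · rw [eδ, eκ]; rfl
  · show m.κ ⋄ _ = (toQInv e).rh ⋄ (m.κ ⋄ t.1, t.2)
    rw [eκ, eκ]; rfl

theorem QInv.Rel.transport {a' b' a b : Arrow C} {i' : ArrowIso a' b'} {i : ArrowIso a b}
    {m : ArrowHom a' a} {q' : QInv P a'} {q : QInv P a} (R : QInv.Rel m q' q) :
    QInv.Rel (i'.inv.trans (m.trans i.hom)) (q'.transport i') (q.transport i) :=
  (q'.transport_inv i').trans (R.trans (q.transport_hom i))

theorem QInv.Rel.transport_symm {a' b' a b : Arrow C} {i' : ArrowIso a' b'} {i : ArrowIso a b}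
    {m : ArrowHom a' a} {q' : QInv P b'} {q : QInv P b} (h' h)
    (R : QInv.Rel (i'.inv.trans (m.trans i.hom)) q' q) :
    QInv.Rel m (q'.transport (i'.symm h')) (q.transport (i.symm h)) where
  l y := (i.δ_inv _).symm.trans ((congrArg i.inv.δ.fn (R.l (i'.hom.κ ⋄ y))).trans
    (congrArg (fun y => i.inv.δ ⋄ q.l ⋄ i.hom.κ ⋄ m.κ ⋄ y) (i'.κ_inv y)))
  lh t := (i.δ_inv _).symm.trans ((congrArg i.inv.δ.fn (R.lh (i'.hom.δ ⋄ t.1, t.2))).trans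
    (congrArg (fun x => i.inv.δ ⋄ q.lh ⋄ (i.hom.δ ⋄ m.δ ⋄ x, t.2)) (i'.δ_inv t.1)))
  r y := (i.δ_inv _).symm.trans ((congrArg i.inv.δ.fn (R.r (i'.hom.κ ⋄ y))).trans
    (congrArg (fun y => i.inv.δ ⋄ q.r ⋄ i.hom.κ ⋄ m.κ ⋄ y) (i'.κ_inv y)))
  rh t := (i.κ_inv _).symm.trans ((congrArg i.inv.κ.fn (R.rh (i'.hom.κ ⋄ t.1, t.2))).trans
    (congrArg (fun x => i.inv.κ ⋄ q.rh ⋄ (i.hom.κ ⋄ m.κ ⋄ x, t.2)) (i'.κ_inv t.1)))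

theorem QInv.Rel.ofQInv {m : ArrowHom (arrowOf ψ) (arrowOf φ)} {q' : QInv P (arrowOf ψ)}
    {q : QInv P (arrowOf φ)} (R : QInv.Rel m q' q) :
    QInv.Rel m (toQInv (Kan.ofQInv q')) (toQInv (Kan.ofQInv q)) where
  l y := (congrArg m.δ.fn ((toQInv_ofQInv q').l y)).trans
    ((R.l y).trans ((toQInv_ofQInv q).l (m.κ ⋄ y)).symm)
  lh t := (congrArg m.δ.fn ((toQInv_ofQInv q').lh t)).trans
    ((R.lh t).trans ((toQInv_ofQInv q).lh (m.δ.cyl ⋄ t)).symm)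
  r y := (congrArg m.δ.fn ((toQInv_ofQInv q').r y)).trans
    ((R.r y).trans ((toQInv_ofQInv q).r (m.κ ⋄ y)).symm)
  rh t := (congrArg m.κ.fn ((toQInv_ofQInv q').rh t)).trans
    ((R.rh t).trans ((toQInv_ofQInv q).rh (m.κ.cyl ⋄ t)).symm)

end Kan

namespace Scone
open Cwf Kan
variable {C : Type u} [SmallCategory C] {P : CubeBase C} {K : Cwf.{u, w, w'} C} {Γ Δ : Ctx K}
  {F : TypeFormers P K}

/-! ## The configuration of a map of the sconing -/

/-- the maps `efun f ρ : |A| ρ → |B| ρ` -/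
@[reducible] def baseMap {A B : Ty Γ} (f : Tm (arrow F A B)) : FamMap Γ.2.pred where
  dom := A.clFam
  cod := B.clFam
  fn g a := efun f g a
  nat k _ _ h _ := efun_res f k h rfl

theorem baseMap_subst {A B : Ty Γ} (σ : Δ ⟶ Γ) (f : Tm (arrow F A B)) :
    (baseMap f).pull σ.map = baseMap (A := A.pullback σ) (B := B.pullback σ) (subst σ f) :=
  FamMap.mk_congr rfl rfl (fun d => heq_of_eq (funext fun a => (efun_subst σ f d a).symm))

/-- the map `((ρ, a), a') ↦ ((ρ, efun f ρ a), f' ρ ρ' a a')` -/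
@[reducible] def totalFn {A B : Ty Γ} (f : Tm (arrow F A B)) :
    Kan.Map (Psh.of A.fam.tot) (Psh.of B.fam.tot) :=
  ⟨fun t => ⟨⟨t.1.1, efun f t.1.1 t.1.2⟩, efun' f t.1.1 t.1.2 t.2⟩, fun k t =>
    tot_ext (B.res_elem k rfl (efun_res f k rfl rfl)) ((B.fam.map_heq'' _ _ _ _).trans
      (heq_of_eq (efun'_res f k rfl rfl t.2)))⟩

variable (s : Filling P K) (m : MapIn P F Γ) (σ : Δ ⟶ Γ)

-- The presheaf `A` consists of the triples `(ρ, ρ', a)`, and `A'` is a family over it. That `A` is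
-- fibrant over the pairs `(ρ, ρ')` comes from the filling of `M`; that `A'` is fibrant over `A` is
-- the filling structure which the type carries in the sconing.
@[reducible] noncomputable def MapIn.cfg : Cfg P where
  G := Psh.of Γ.2.pred
  A := Psh.of m.A.ty.secs
  B := Psh.of m.B.ty.secs
  A' := Psh.of m.A.ty.fam.tot
  B' := Psh.of m.B.ty.fam.tot
  πA := famProj m.A.ty.clFam
  πB := famProj m.B.ty.clFam
  qA := famProj m.A.ty.fam
  qB := famProj m.B.ty.fam
  f := (arrowOf (baseMap m.f)).fn
  f' := totalFn m.f
  πB_f _ := rfl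
  qB_f' _ := rfl
  sA := Fibr.ofFillStr (clFill m.A.ty.toClosed s)
  sB := Fibr.ofFillStr (clFill m.B.ty.toClosed s)
  sA' := Fibr.ofFillStr m.A.fib
  sB' := Fibr.ofFillStr m.B.fib
  uniform := Fibr.ofFillStr_uniform _

/-- Types of the sconing are pulled back strictly, so all components act by `σ` on indices and by
the identity on fibres, and the fillings are related by `Fibr.ofFillStr_rel`. -/
noncomputable def MapIn.cfgHom : Cfg.Hom ((m.sub σ).cfg s) (m.cfg s) where
  g := Map.of σ.map
  a := famPull m.A.ty.clFam σ.map
  b := famPull m.B.ty.clFam σ.map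
  a' := famPull m.A.ty.fam (m.A.ty.secsMap σ)
  b' := famPull m.B.ty.fam (m.B.ty.secsMap σ)
  πA_a _ := rfl
  πB_b _ := rfl
  qA_a' _ := rfl
  qB_b' _ := rfl
  b_f x := tot_ext rfl (heq_of_eq (efun_subst σ m.f x.1 x.2))
  b'_f' x := tot_ext (congrArg (m.B.ty.elem (ap σ.map x.1.1)) (efun_subst σ m.f x.1.1 x.1.2))
    (efun'_subst σ m.f x.1.1 x.1.2 x.2)
  sA := Fibr.ofFillStr_rel (clFill m.A.ty.toClosed s) σ.map
  sB := Fibr.ofFillStr_rel (clFill m.B.ty.toClosed s) σ.map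
  sA' := Fibr.ofFillStr_rel m.A.fib (m.A.ty.secsMap σ)
  sB' := Fibr.ofFillStr_rel m.B.fib (m.B.ty.secsMap σ)

/-- `((ρ, a), a') ↦ (ρ, (a, a'))` -/
@[reducible] def Ty.assoc (A : Ty Γ) : Kan.Map (Psh.of A.fam.tot) (Psh.of A.sumFam.tot) :=
  ⟨fun t => ⟨t.1.1, t.1.2, t.2⟩, fun _ _ => rfl⟩

@[reducible] def Ty.assocInv (A : Ty Γ) : Kan.Map (Psh.of A.sumFam.tot) (Psh.of A.fam.tot) :=
  ⟨fun t => ⟨⟨t.1, t.2.1⟩, t.2.2⟩, fun _ _ => rfl⟩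

-- Associativity of sums: the total space of `A'` over the triples `(ρ, ρ', a)` is that of the
-- family of sums over the pairs `(ρ, ρ')`.
@[reducible] noncomputable def MapIn.totalIso : ArrowIso (m.cfg s).total (arrowOf (sumMap m.f)) where
  hom := ⟨Map.id _, m.A.ty.assoc, m.B.ty.assoc, fun _ => rfl, fun _ => rfl, fun _ => rfl⟩
  inv := ⟨Map.id _, m.A.ty.assocInv, m.B.ty.assocInv, fun _ => rfl, fun _ => rfl, fun _ => rfl⟩
  τ_hom _ := rfl
  δ_hom _ := rfl
  κ_hom _ := rfl
  δ_inv _ := rfl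
  κ_inv _ := rfl

@[reducible] noncomputable def MapIn.toFibre :
    Kan.Map (pb (m.cfg s).f (m.cfg s).qB) (Psh.of (fibMap m.f).cod.tot) :=
  ⟨fun t => ⟨t.1.1, famAt (F := m.B.ty.fam) t.1.2 t.2.symm⟩, fun k t => tot_ext rfl
    (heq_of_eq (famAt_map (F := m.B.ty.fam) k rfl t.2.symm
      ((pb (m.cfg s).f (m.cfg s).qB).res k t).2.symm _))⟩

@[reducible] noncomputable def MapIn.ofFibre :
    Kan.Map (Psh.of (fibMap m.f).cod.tot) (pb (m.cfg s).f (m.cfg s).qB) :=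
  ⟨fun t => ⟨(t.1, ⟨ap (efunMap m.f) t.1, t.2⟩), rfl⟩, fun k t => Subtype.ext (Prod.ext rfl
    (tot_ext (ap_res (efunMap m.f) k t.1).symm (m.B.ty.fam.map_heq'' _ _ _ _)))⟩

@[reducible] noncomputable def MapIn.fibreIso : ArrowIso (m.cfg s).fibre (arrowOf (fibMap m.f)) where
  hom := ⟨Map.id _, Map.id _, m.toFibre s, fun _ => rfl, fun _ => rfl, fun _ => rfl⟩
  inv := ⟨Map.id _, Map.id _, m.ofFibre s, fun _ => rfl, fun _ => rfl, fun _ => rfl⟩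
  τ_hom _ := rfl
  δ_hom _ := rfl
  κ_hom _ := rfl
  δ_inv _ := rfl
  κ_inv t := Subtype.ext (congrArg (Prod.mk t.1.1) (famAt_eta (F := m.B.ty.fam) t.1.2 t.2.symm))

/-- the morphism of total spaces of a substitution -/
@[reducible] noncomputable def MapIn.totalHom :
    ArrowHom (arrowOf (sumMap (m.sub σ).f)) (arrowOf (sumMap m.f)) :=
  ((m.sub σ).totalIso s).inv.trans ((m.cfgHom s σ).total.trans (m.totalIso s).hom)

/-- the morphism of fibres of a substitution -/
@[reducible] noncomputable def MapIn.fibreHom :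
    ArrowHom (arrowOf (fibMap (m.sub σ).f)) (arrowOf (fibMap m.f)) :=
  ((m.sub σ).fibreIso s).inv.trans ((m.cfgHom s σ).fibre.trans (m.fibreIso s).hom)

/-! ## From total spaces to fibres -/

/-- the action of substitutions on equivalences of total spaces -/
@[reducible] def MapIn.actTotal (e : FamEquiv P (sumMap m.f)) : FamEquiv P (sumMap (m.sub σ).f) :=
  cast (congrArg (FamEquiv P) (sumMap_subst σ m.f)) (e.pull σ.map)

/-- the action of substitutions on equivalences of fibres -/
@[reducible] def MapIn.actFibre (e : FamEquiv P (fibMap m.f)) : FamEquiv P (fibMap (m.sub σ).f) :=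
  cast (congrArg (FamEquiv P) (fibMap_subst σ m.f)) (e.pull (m.A.ty.secsMap σ))

theorem MapIn.actTotal_rel (e : FamEquiv P (sumMap m.f)) :
    QInv.Rel (m.totalHom s σ) (toQInv (m.actTotal σ e)) (toQInv e) :=
  toQInv_pull_rel σ.map (sumMap_subst σ m.f) _ (fun _ => rfl) (fun _ => HEq.rfl) (fun _ => HEq.rfl) e

theorem MapIn.fibreHom_κ {X : C} (t : (arrowOf (fibMap (m.sub σ).f)).cod.obj X) :
    HEq ((m.fibreHom s σ).κ ⋄ t).2 t.2 :=
  famAt_heq _ ((m.cfgHom s σ).fibre.κ ⋄ ((m.sub σ).fibreIso s).inv.κ ⋄ t).2.symm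

theorem MapIn.actFibre_rel (e : FamEquiv P (fibMap m.f)) :
    QInv.Rel (m.fibreHom s σ) (toQInv (m.actFibre σ e)) (toQInv e) :=
  toQInv_pull_rel (m.A.ty.secsMap σ) (fibMap_subst σ m.f) _ (fun _ => rfl) (fun _ => HEq.rfl)
    (m.fibreHom_κ s σ) e

/-- the extension property of the base -/
noncomputable def MapIn.extBase (e : FamEquiv P (baseMap m.f)) : Ext P (m.cfg s).base :=
  (show QInv P (m.cfg s).base from toQInv e).toExt (m.cfg s).sA (m.cfg s).sB

/-- Total spaces are fibrant over the pairs `(ρ, ρ')` as composites of fibrations, which is what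
`QInv.toExt` requires. -/
noncomputable def MapIn.extTotal (e : FamEquiv P (sumMap m.f)) : Ext P (m.cfg s).total :=
  ((toQInv e).transport ((m.totalIso s).symm fun _ => rfl)).toExt ((m.cfg s).sA'.comp (m.cfg s).sA)
    ((m.cfg s).sB'.comp (m.cfg s).sB)

noncomputable def MapIn.extFibre (e : FamEquiv P (fibMap m.f)) : Ext P (m.cfg s).fibre :=
  ((toQInv e).transport ((m.fibreIso s).symm fun _ => rfl)).toExt (m.cfg s).sA'
    ((m.cfg s).sB'.pb (m.cfg s).f)

/-- The equivalences `e` and `E` enter only through the extension property that each provides. For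
this reason `E` is not required to lie over `e`, in accordance with the second assertion. -/
noncomputable def MapIn.toFibres (e : FamEquiv P (baseMap m.f)) (E : FamEquiv P (sumMap m.f)) :
    FamEquiv P (fibMap m.f) :=
  ofQInv (((m.cfg s).fibInv (m.extBase s e) (m.extTotal s E)).transport (m.fibreIso s))

/-- Here `e` is used twice: its extension property combines with that of the fibres, and its actual
inverses and homotopies prescribe the first components of the result. -/
noncomputable def MapIn.toTotals (e : FamEquiv P (baseMap m.f)) (E : FamEquiv P (fibMap m.f)) :
    FamEquiv P (sumMap m.f) :=
  ofQInv (((m.cfg s).sumInv (toQInv e) (Ext.sum (m.cfg s) (m.extBase s e)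
    (m.extFibre s E))).transport (m.totalIso s))

/-- the action of substitutions on equivalences of bases -/
@[reducible] def MapIn.actBase (e : FamEquiv P (baseMap m.f)) : FamEquiv P (baseMap (m.sub σ).f) :=
  cast (congrArg (FamEquiv P) (baseMap_subst σ m.f)) (e.pull σ.map)

theorem MapIn.actBase_rel (e : FamEquiv P (baseMap m.f)) :
    QInv.Rel (m.cfgHom s σ).base (toQInv (m.actBase σ e)) (toQInv e) :=
  toQInv_pull_rel σ.map (baseMap_subst σ m.f) _ (fun _ => rfl) (fun _ => HEq.rfl) (fun _ => HEq.rfl) e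

theorem MapIn.extBase_rel (e : FamEquiv P (baseMap m.f)) :
    Ext.Rel (m.cfgHom s σ).base ((m.sub σ).extBase s (m.actBase σ e)) (m.extBase s e) :=
  QInv.toExt_rel (m.actBase_rel s σ e) (m.cfgHom s σ).sA (m.cfgHom s σ).sB

theorem MapIn.extTotal_rel (e : FamEquiv P (sumMap m.f)) :
    Ext.Rel (m.cfgHom s σ).total ((m.sub σ).extTotal s (m.actTotal σ e)) (m.extTotal s e) :=
  QInv.toExt_rel (QInv.Rel.transport_symm _ _ (m.actTotal_rel s σ e))
    (FibrRel.comp (m.cfgHom s σ).qA_a' (m.cfgHom s σ).sA' (m.cfgHom s σ).sA)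
    (FibrRel.comp (m.cfgHom s σ).qB_b' (m.cfgHom s σ).sB' (m.cfgHom s σ).sB)

theorem MapIn.extFibre_rel (e : FamEquiv P (fibMap m.f)) :
    Ext.Rel (m.cfgHom s σ).fibre ((m.sub σ).extFibre s (m.actFibre σ e)) (m.extFibre s e) :=
  QInv.toExt_rel (QInv.Rel.transport_symm _ _ (m.actFibre_rel s σ e)) (m.cfgHom s σ).sA'
    (FibrRel.pb (m.cfgHom s σ).sB' (fun x => (m.cfgHom s σ).b_f x) _ (fun _ => rfl))

/-- The chain of relations from the inputs to `Cfg.fibInv` ends in a relation along a morphism that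
is the identity on fibres, and such a relation is an equation of families of equivalences. -/
theorem MapIn.toFibres_act (e : FamEquiv P (baseMap m.f)) (E : FamEquiv P (sumMap m.f)) :
    (m.sub σ).toFibres s (m.actBase σ e) (m.actTotal σ E) = m.actFibre σ (m.toFibres s e E) :=
  famEquiv_eq_pull (m.A.ty.secsMap σ) (fibMap_subst σ m.f) (m.fibreHom s σ) (fun _ => rfl)
    (fun _ => HEq.rfl) (m.fibreHom_κ s σ)
    (Cfg.fibInv_rel (m.cfgHom s σ) (m.extBase_rel s σ e) (m.extTotal_rel s σ E)).transport.ofQInv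

theorem MapIn.toTotals_act (e : FamEquiv P (baseMap m.f)) (E : FamEquiv P (fibMap m.f)) :
    (m.sub σ).toTotals s (m.actBase σ e) (m.actFibre σ E) = m.actTotal σ (m.toTotals s e E) :=
  famEquiv_eq_pull σ.map (sumMap_subst σ m.f) (m.totalHom s σ) (fun _ => rfl)
    (fun _ => HEq.rfl) (fun _ => HEq.rfl)
    (Cfg.sumInv_rel (m := m.cfgHom s σ) (m.actBase_rel s σ e)
      (Ext.sum_rel (m.extBase_rel s σ e) (m.extFibre_rel s σ E))).transport.ofQInv

/-! ### Equivalences of total spaces with prescribed first components. -/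

/-- An equivalence of total spaces lies over an equivalence of bases. -/
structure Over {A B : Ty Γ} {f : Tm (arrow F A B)} (E : FamEquiv P (sumMap f))
    (e : FamEquiv P (baseMap f)) : Prop where
  linv : ∀ {X : C} (g : Γ.2.pred.obj (op X)) (y : B.sumFam.obj g), (E.linv g y).1 = e.linv g y.1
  lhtpy : ∀ {X : C} (g : Γ.2.pred.obj (op X)) (x : A.sumFam.obj g) (i : P.I.obj (op X)),
    (E.lhtpy g x i).1 = e.lhtpy g x.1 i
  rinv : ∀ {X : C} (g : Γ.2.pred.obj (op X)) (y : B.sumFam.obj g), (E.rinv g y).1 = e.rinv g y.1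
  rhtpy : ∀ {X : C} (g : Γ.2.pred.obj (op X)) (y : B.sumFam.obj g) (i : P.I.obj (op X)),
    (E.rhtpy g y i).1 = e.rhtpy g y.1 i

/-- the projection of the total spaces to the bases -/
@[reducible] def sumProj {A B : Ty Γ} (f : Tm (arrow F A B)) :
    ArrowHom (arrowOf (sumMap f)) (arrowOf (baseMap f)) where
  τ := Map.id _
  δ := ⟨fun t => ⟨t.1, t.2.1⟩, fun _ _ => rfl⟩
  κ := ⟨fun t => ⟨t.1, t.2.1⟩, fun _ _ => rfl⟩
  πd_δ _ := rfl
  πc_κ _ := rfl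
  κ_fn _ := rfl

theorem Over.ofRel {A B : Ty Γ} {f : Tm (arrow F A B)} {E : FamEquiv P (sumMap f)}
    {e : FamEquiv P (baseMap f)} (R : QInv.Rel (sumProj f) (toQInv E) (toQInv e)) : Over E e where
  linv g y := eq_of_heq (Sigma.mk.inj_iff.1 (R.l ⟨g, y⟩)).2
  lhtpy g x i := eq_of_heq (Sigma.mk.inj_iff.1 (R.lh (⟨g, x⟩, i))).2
  rinv g y := eq_of_heq (Sigma.mk.inj_iff.1 (R.r ⟨g, y⟩)).2
  rhtpy g y i := eq_of_heq (Sigma.mk.inj_iff.1 (R.rh (⟨g, y⟩, i))).2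

theorem MapIn.toTotals_over (e : FamEquiv P (baseMap m.f)) (E : FamEquiv P (fibMap m.f)) :
    Over (m.toTotals s e E) e := by
  have R := (m.cfg s).sumInv_over (toQInv e) (Ext.sum (m.cfg s) (m.extBase s e) (m.extFibre s E))
  have Q := toQInv_ofQInv (((m.cfg s).sumInv (toQInv e) (Ext.sum (m.cfg s) (m.extBase s e)
    (m.extFibre s E))).transport (m.totalIso s))
  exact Over.ofRel ⟨fun y => (congrArg (sumProj m.f).δ.fn (Q.l y)).trans (R.l (m.B.ty.assocInv ⋄ y)),
    fun t => (congrArg (sumProj m.f).δ.fn (Q.lh t)).trans (R.lh (m.A.ty.assocInv ⋄ t.1, t.2)),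
    fun y => (congrArg (sumProj m.f).δ.fn (Q.r y)).trans (R.r (m.B.ty.assocInv ⋄ y)),
    fun t => (congrArg (sumProj m.f).κ.fn (Q.rh t)).trans (R.rh (m.B.ty.assocInv ⋄ t.1, t.2))⟩

end Scone
end Sconing

namespace Sconing
namespace TypeFormers
open Cwf
variable {C : Type u} [SmallCategory C] {P : CubeBase C} {K : Cwf.{u, w, w'} C}
  (F : TypeFormers P K) {Γ Δ : K.Ctx} {A B : K.TyAt Γ} {A' B' : K.TyAt Δ}

/-! ## The components of an element of `isEquiv f` -/

theorem sub_p_inst {D : K.TyAt Γ} (E : K.TyAt Γ) (a : K.Tm.obj D) :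
    sub (sub E (K.p D)) (inst a) = E := by
  rw [Cwf.sub_sub, inst_p]; exact res_id _ _

theorem map_p_inst {D E : K.TyAt Γ} {E' : K.TyAt (K.extend Γ D)} (a : K.Tm.obj D)
    (h : sub E (K.p D) = E') (h' : sub E' (inst a) = E) (x : K.Tm.obj E) :
    K.Tm.map (inst a) h' (K.Tm.map (K.p D) h x) = x := by
  rw [K.Tm.map_map]
  exact (K.Tm.map_eq (inst_p a) _ (res_id _ _) _).trans (K.Tm.map_id _ _)

theorem map_id_q_inst {D : K.TyAt Γ} {E : K.TyAt (K.extend Γ D)} (a : K.Tm.obj D)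
    (h : sub (sub D (K.p D)) (𝟙 _) = E) (h' : sub E (inst a) = D) :
    K.Tm.map (inst a) h' (K.Tm.map (𝟙 _) h (K.q D)) = a := by
  rw [K.Tm.map_map]
  exact (K.Tm.map_eq (Category.comp_id _) _ (sub_p_inst D a) _).trans (K.pair_q _ _ _ _)

variable (f : K.Tm.obj (F.arr A B)) {f' : K.Tm.obj (F.arr A' B')}

/-- Computes the type of the second component of a pair in `LInv f`: with `l` in place of the
variable it is the type of homotopies from `l ∘ f` to the identity. -/
theorem LInv_inst (l : K.Tm.obj (F.arr B A)) : sub (F.htpyId (F.comp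
    (K.Tm.map (𝟙 _) (by rw [res_id]; exact F.arr_sub _ rfl rfl) (K.q (F.arr B A)))
    (K.Tm.map (K.p (F.arr B A)) (F.arr_sub _ rfl rfl) f))) (inst l) = F.htpyId (F.comp l f) := by
  have hA := sub_p_inst A l
  have hB := sub_p_inst B l
  refine F.htpyId_sub _ hA _ (F.arr_sub _ hA hA) ?_
  rw [F.comp_sub _ hA hB hA _ _ _ (F.arr_sub _ hB hA) (F.arr_sub _ hA hB), map_p_inst,
    map_id_q_inst]

theorem RInv_inst (r : K.Tm.obj (F.arr B A)) : sub (F.htpyId (F.comp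
    (K.Tm.map (K.p (F.arr B A)) (F.arr_sub _ rfl rfl) f)
    (K.Tm.map (𝟙 _) (by rw [res_id]; exact F.arr_sub _ rfl rfl) (K.q (F.arr B A)))))
    (inst r) = F.htpyId (F.comp f r) := by
  have hA := sub_p_inst A r
  have hB := sub_p_inst B r
  refine F.htpyId_sub _ hB _ (F.arr_sub _ hB hB) ?_
  rw [F.comp_sub _ hB hA hB _ _ _ (F.arr_sub _ hA hB) (F.arr_sub _ hB hA), map_p_inst,
    map_id_q_inst]

variable {F f}

/-- the left inverse -/
def lfn (a : K.Tm.obj (F.LInv f)) : K.Tm.obj (F.arr B A) := (F.unpair a).1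

/-- the homotopy of the left inverse -/
def lhtpy (a : K.Tm.obj (F.LInv f)) : K.Tm.obj (F.htpyId (F.comp (lfn a) f)) :=
  -- Substitution along the identity serves as a cast between equal types.
  K.Tm.map (𝟙 Γ) ((res_id _ _).trans (F.LInv_inst f _)) (F.unpair a).2

/-- the right inverse -/
def rfn (a : K.Tm.obj (F.RInv f)) : K.Tm.obj (F.arr B A) := (F.unpair a).1

/-- the homotopy of the right inverse -/
def rhtpy (a : K.Tm.obj (F.RInv f)) : K.Tm.obj (F.htpyId (F.comp f (rfn a))) :=
  K.Tm.map (𝟙 Γ) ((res_id _ _).trans (F.RInv_inst f _)) (F.unpair a).2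

def linv (x : K.Tm.obj (F.isEquiv f)) : K.Tm.obj (F.LInv f) := (F.unpair x).1

def rinv (x : K.Tm.obj (F.isEquiv f)) : K.Tm.obj (F.RInv f) :=
  K.Tm.map (𝟙 Γ) ((res_id _ _).trans (sub_p_inst _ _)) (F.unpair x).2

theorem LInv_ext {a b : K.Tm.obj (F.LInv f)} (h : lfn a = lfn b) (h' : HEq (lhtpy a) (lhtpy b)) :
    a = b :=
  F.unpair.injective (Sigma.ext h ((K.Tm.map_id_heq _ _).symm.trans (h'.trans (K.Tm.map_id_heq _ _))))

theorem RInv_ext {a b : K.Tm.obj (F.RInv f)} (h : rfn a = rfn b) (h' : HEq (rhtpy a) (rhtpy b)) :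
    a = b :=
  F.unpair.injective (Sigma.ext h ((K.Tm.map_id_heq _ _).symm.trans (h'.trans (K.Tm.map_id_heq _ _))))

theorem isEquiv_ext {x y : K.Tm.obj (F.isEquiv f)} (hl : lfn (linv x) = lfn (linv y))
    (hlh : HEq (lhtpy (linv x)) (lhtpy (linv y))) (hr : rfn (rinv x) = rfn (rinv y))
    (hrh : HEq (rhtpy (rinv x)) (rhtpy (rinv y))) : x = y :=
  F.unpair.injective (Sigma.ext (LInv_ext hl hlh) ((K.Tm.map_id_heq _ _).symm.trans
    ((heq_of_eq (RInv_ext hr hrh)).trans (K.Tm.map_id_heq _ _))))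

/-- The equation for the homotopy is heterogeneous, because the type of `lhtpy a` mentions `lfn a`,
which is only propositionally `l`. -/
theorem LInv_exists (l : K.Tm.obj (F.arr B A)) (lh : K.Tm.obj (F.htpyId (F.comp l f))) :
    ∃ a : K.Tm.obj (F.LInv f), lfn a = l ∧ HEq (lhtpy a) lh := by
  have h := congrArg (fun T => K.Tm.obj T) (F.LInv_inst f l).symm
  have e := F.unpair.apply_symm_apply ⟨l, cast h lh⟩
  refine ⟨F.unpair.symm ⟨l, cast h lh⟩, congrArg Sigma.fst e, ?_⟩
  exact (K.Tm.map_id_heq _ _).trans ((Sigma.mk.inj_iff.1 e).2.trans (cast_heq _ _))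

theorem RInv_exists (r : K.Tm.obj (F.arr B A)) (rh : K.Tm.obj (F.htpyId (F.comp f r))) :
    ∃ a : K.Tm.obj (F.RInv f), rfn a = r ∧ HEq (rhtpy a) rh := by
  have h := congrArg (fun T => K.Tm.obj T) (F.RInv_inst f r).symm
  have e := F.unpair.apply_symm_apply ⟨r, cast h rh⟩
  refine ⟨F.unpair.symm ⟨r, cast h rh⟩, congrArg Sigma.fst e, ?_⟩
  exact (K.Tm.map_id_heq _ _).trans ((Sigma.mk.inj_iff.1 e).2.trans (cast_heq _ _))

theorem isEquiv_exists (a : K.Tm.obj (F.LInv f)) (b : K.Tm.obj (F.RInv f)) :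
    ∃ x : K.Tm.obj (F.isEquiv f), linv x = a ∧ rinv x = b := by
  have h := congrArg (fun T => K.Tm.obj T) (sub_p_inst (F.RInv f) a).symm
  have e := F.unpair.apply_symm_apply ⟨a, cast h b⟩
  refine ⟨F.unpair.symm ⟨a, cast h b⟩, congrArg Sigma.fst e, ?_⟩
  exact eq_of_heq ((K.Tm.map_id_heq _ _).trans ((Sigma.mk.inj_iff.1 e).2.trans (cast_heq _ _)))

/-! ### The components of an equivalence under substitution. -/

section
variable (σ : Δ ⟶ Γ) (hA : sub A σ = A') (hB : sub B σ = B') (e : sub (F.arr A B) σ = F.arr A' B')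
  (hf : K.Tm.map σ e f = f')
include hA hB hf

theorem lfn_sub (h : sub (F.LInv f) σ = F.LInv f') (a : K.Tm.obj (F.LInv f)) :
    lfn (K.Tm.map σ h a) = K.Tm.map σ (F.arr_sub σ hB hA) (lfn a) ∧
      HEq (lhtpy (K.Tm.map σ h a)) (K.Tm.map σ rfl (lhtpy a)) := by
  subst hf
  have hl := F.arr_sub σ hB hA
  have eA := arr_aux (A := F.arr B A) (B := A) σ hl hA
  have eB := arr_aux (A := F.arr B A) (B := B) σ hl hB
  -- The rule for projections needs the equation for the family of the sum, which holds for the same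
  -- reason as in `LInv_sub`: composition, the variable and weakening commute with the lifted
  -- substitution.
  have key := Scone.unpair_sub' F σ a hl (F.htpyId_sub _ eA _ (F.arr_sub _ eA eA) (by
    rw [F.comp_sub _ eA eB eA _ _ _ (F.arr_sub _ eB eA) (F.arr_sub _ eA eB)]
    congr 1
    · rw [K.Tm.map_map, ← lift_q σ hl (sub_eq (lift_p σ hl) rfl hl), K.Tm.map_map]
      exact K.Tm.map_eq (by simp) _ _ _
    · rw [K.Tm.map_map, K.Tm.map_map]
      exact K.Tm.map_eq (lift_p _ _) _ _ _)) h rfl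
  refine ⟨key.1, (K.Tm.map_id_heq _ _).trans (key.2.trans ?_)⟩
  exact K.Tm.map_heq rfl _ _ (F.LInv_inst f _) (K.Tm.map_id_heq _ _).symm

theorem rfn_sub (h : sub (F.RInv f) σ = F.RInv f') (a : K.Tm.obj (F.RInv f)) :
    rfn (K.Tm.map σ h a) = K.Tm.map σ (F.arr_sub σ hB hA) (rfn a) ∧
      HEq (rhtpy (K.Tm.map σ h a)) (K.Tm.map σ rfl (rhtpy a)) := by
  subst hf
  have hl := F.arr_sub σ hB hA
  have eA := arr_aux (A := F.arr B A) (B := A) σ hl hA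
  have eB := arr_aux (A := F.arr B A) (B := B) σ hl hB
  have key := Scone.unpair_sub' F σ a hl (F.htpyId_sub _ eB _ (F.arr_sub _ eB eB) (by
    rw [F.comp_sub _ eB eA eB _ _ _ (F.arr_sub _ eA eB) (F.arr_sub _ eB eA)]
    congr 1
    · rw [K.Tm.map_map, K.Tm.map_map]
      exact K.Tm.map_eq (lift_p _ _) _ _ _
    · rw [K.Tm.map_map, ← lift_q σ hl (sub_eq (lift_p σ hl) rfl hl), K.Tm.map_map]
      exact K.Tm.map_eq (by simp) _ _ _)) h rfl
  refine ⟨key.1, (K.Tm.map_id_heq _ _).trans (key.2.trans ?_)⟩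
  exact K.Tm.map_heq rfl _ _ (F.RInv_inst f _) (K.Tm.map_id_heq _ _).symm

theorem linv_sub (h : sub (F.isEquiv f) σ = F.isEquiv f') (x : K.Tm.obj (F.isEquiv f)) :
    linv (K.Tm.map σ h x) = K.Tm.map σ (F.LInv_sub σ hA hB f e hf) (linv x) ∧
      rinv (K.Tm.map σ h x) = K.Tm.map σ (F.RInv_sub σ hA hB f e hf) (rinv x) := by
  have key := Scone.unpair_sub' F σ x (F.LInv_sub σ hA hB f e hf)
    (sub_eq (lift_p _ _) rfl (F.RInv_sub σ hA hB f e hf)) h rfl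
  refine ⟨key.1, eq_of_heq ((K.Tm.map_id_heq _ _).trans (key.2.trans ?_))⟩
  exact K.Tm.map_heq rfl _ _ (sub_p_inst _ _) (K.Tm.map_id_heq _ _).symm

end

end TypeFormers
end Sconing

namespace Sconing
namespace Scone
open Cwf Kan
variable {C : Type u} [SmallCategory C] {P : CubeBase C} {K : Cwf.{u, w, w'} C} {Γ Δ : Ctx K}
  {F : TypeFormers P K}

/-! ## Functions and homotopies of `M` on closed elements -/

namespace Closed
variable (A B D : Closed Γ)

/-- the substitution `(ρ, a) : 1 ⟶ Γ.A` -/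
abbrev point {Y : C} (g : Γ.2.pred.obj (op Y)) (a : K.Tm.obj (A.cl g)) :
    K.unit Y ⟶ K.extend (under Γ) A.ty := K.pair (pr Γ g) (A.cl_eq g) a

variable {A}

theorem point_res {X Y : C} (k : Y ⟶ X) {g : Γ.2.pred.obj (op X)} {g' : Γ.2.pred.obj (op Y)}
    (h : res _ k g = g') {a : K.Tm.obj (A.cl g)} {a' : K.Tm.obj (A.cl g')}
    (ha : A.clFam.map k h a = a') : K.unitMap k ≫ A.point g a = A.point g' a' := by
  subst h ha
  exact (Cwf.comp_pair _ _ _ (A.cl_res k g) _).trans (Cwf.pair_congr (pr_res Γ k g).symm _ _ _)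

theorem point_sub (σ : Δ ⟶ Γ) {Y : C} (d : Δ.2.pred.obj (op Y)) (a : K.Tm.obj (A.cl (ap σ.map d))) :
    (A.pullback σ).point d a ≫ Cwf.lift σ.sub rfl = A.point (ap σ.map d) a :=
  (Cwf.pair_lift _ _ _ _ _).trans (Cwf.pair_congr (σ.comm d).symm _ _ _)

theorem sub_point {Y : C} (g : Γ.2.pred.obj (op Y)) (a : K.Tm.obj (A.cl g)) :
    Cwf.sub (Cwf.sub B.ty (K.p A.ty)) (A.point g a) = B.cl g :=
  (Cwf.sub_sub B.ty (K.p A.ty) _).trans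
    ((congrArg (Cwf.sub B.ty) (K.pair_p _ _ _)).trans (B.cl_eq g))

theorem map_point_q {Y : C} (g : Γ.2.pred.obj (op Y)) (a : K.Tm.obj (A.cl g)) :
    K.Tm.map (A.point g a) (Closed.sub_point A g a) (K.q A.ty) = a := K.pair_q _ _ _ _

end Closed

section
variable {A B D : Closed Γ}

/-- the function `|A| ρ → |B| ρ` of a function of `M` -/
def kfun (c : K.Tm.obj (F.arr A.ty B.ty)) {Y : C} (g : Γ.2.pred.obj (op Y)) (a : K.Tm.obj (A.cl g)) :
    K.Tm.obj (B.cl g) := K.Tm.map (A.point g a) (Closed.sub_point B g a) (F.unlam c)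

theorem kfun_res (c : K.Tm.obj (F.arr A.ty B.ty)) {X Y : C} (k : Y ⟶ X) {g : Γ.2.pred.obj (op X)}
    {g' : Γ.2.pred.obj (op Y)} (h : res _ k g = g') (a : K.Tm.obj (A.cl g)) :
    B.clFam.map k h (kfun c g a) = kfun c g' (A.clFam.map k h a) :=
  (K.Tm.map_map _ _ _).trans (K.Tm.map_eq (Closed.point_res k h rfl) _ _ _)

theorem kfun_comp (c : K.Tm.obj (F.arr B.ty D.ty)) (c' : K.Tm.obj (F.arr A.ty B.ty)) {Y : C}
    (g : Γ.2.pred.obj (op Y)) (a : K.Tm.obj (A.cl g)) :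
    kfun (A := A) (B := D) (F.comp c c') g a = kfun (A := B) c g (kfun c' g a) := by
  refine (congrArg (K.Tm.map (A.point g a) (Closed.sub_point D g a))
    ((F.unlam (A := A.ty) (B := Cwf.sub D.ty (K.p A.ty))).apply_symm_apply _)).trans ?_
  refine (K.Tm.map_map _ _ _).trans (K.Tm.map_eq ?_ _ _ _)
  exact (Cwf.comp_pair _ _ _ (Closed.sub_point B g a) _).trans (Cwf.pair_congr (K.pair_p _ _ _) _ _ _)

theorem kfun_sub (σ : Δ ⟶ Γ) (c : K.Tm.obj (F.arr A.ty B.ty))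
    (h : Cwf.sub (F.arr A.ty B.ty) σ.sub = F.arr (A.pullback σ).ty (B.pullback σ).ty) {Y : C}
    (d : Δ.2.pred.obj (op Y)) (a : K.Tm.obj (A.cl (ap σ.map d))) :
    kfun (A := A.pullback σ) (B := B.pullback σ) (K.Tm.map σ.sub h c) d a
      = kfun c (ap σ.map d) a := by
  refine (congrArg (K.Tm.map ((A.pullback σ).point d a) _)
    (F.unlam_arr_sub σ.sub (A := A.ty) (B := B.ty) rfl rfl h c)).trans ?_
  exact (K.Tm.map_map _ _ _).trans (K.Tm.map_eq (Closed.point_sub σ d a) _ _ _)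

variable {h : K.Tm.obj (F.arr A.ty A.ty)}

/-- The second end point is kept as an instance of the variable, although it equals `a`; the
equality is used only in `khtpy_one`, by `map_point_q`. -/
theorem sub_point_path (h : K.Tm.obj (F.arr A.ty A.ty)) {Y : C} (g : Γ.2.pred.obj (op Y))
    (a : K.Tm.obj (A.cl g)) :
    Cwf.sub (F.Path (Cwf.sub A.ty (K.p A.ty)) (F.unlam h) (K.q A.ty)) (A.point g a)
      = F.Path (A.cl g) (kfun h g a) (K.Tm.map (A.point g a) (Closed.sub_point A g a) (K.q A.ty)) :=
  F.Path_sub' _ (Closed.sub_point A g a) rfl rfl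

/-- the paths of a homotopy of `M`, at closed elements -/
def khtpy (c : K.Tm.obj (F.htpyId h)) {Y : C} (g : Γ.2.pred.obj (op Y)) (a : K.Tm.obj (A.cl g))
    (i : P.I.obj (op Y)) : K.Tm.obj (A.cl g) :=
  kpapp F (sub_point_path h g a) (K.Tm.map (A.point g a) rfl (F.unlam c)) i

theorem khtpy_zero (c : K.Tm.obj (F.htpyId h)) {Y : C} (g : Γ.2.pred.obj (op Y))
    (a : K.Tm.obj (A.cl g)) : khtpy c g a (P.pt false Y) = kfun h g a := F.papp_zero _

theorem khtpy_one (c : K.Tm.obj (F.htpyId h)) {Y : C} (g : Γ.2.pred.obj (op Y))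
    (a : K.Tm.obj (A.cl g)) : khtpy c g a (P.pt true Y) = a :=
  (F.papp_one _).trans (A.map_point_q g a)

theorem khtpy_res (c : K.Tm.obj (F.htpyId h)) {X Y : C} (k : Y ⟶ X) {g : Γ.2.pred.obj (op X)}
    {g' : Γ.2.pred.obj (op Y)} (e : res _ k g = g') (a : K.Tm.obj (A.cl g)) (i : P.I.obj (op X)) :
    A.clFam.map k e (khtpy c g a i) = khtpy c g' (A.clFam.map k e a) (res P.I k i) := by
  have hp := Closed.point_res (A := A) k e (a := a) rfl
  refine (kpapp_sub F (K.unitMap k) (sub_point_path h g a) _ i (sub_point_path h g' _)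
    ((Cwf.sub_sub _ _ _).trans (congrArg (Cwf.sub _) hp)) (A.cl_res_eq k e) (kfun_res h k e a) ?_).trans ?_
  · exact (K.Tm.map_map _ _ _).trans (K.Tm.map_eq hp _ _ _)
  · refine congrArg₂ (kpapp F (sub_point_path h g' _)) ((K.Tm.map_map _ _ _).trans
      (K.Tm.map_eq hp _ _ _)) (congrArg (fun f => res P.I f i) (K.base_unitMap k))

theorem khtpy_sub (σ : Δ ⟶ Γ) (c : K.Tm.obj (F.htpyId h))
    {h' : K.Tm.obj (F.arr (A.pullback σ).ty (A.pullback σ).ty)}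
    (e : Cwf.sub (F.arr A.ty A.ty) σ.sub = F.arr (A.pullback σ).ty (A.pullback σ).ty)
    (eh : K.Tm.map σ.sub e h = h')
    {c' : K.Tm.obj (F.htpyId h')} (hc : HEq c' (K.Tm.map σ.sub rfl c)) {Y : C}
    (d : Δ.2.pred.obj (op Y)) (a : K.Tm.obj (A.cl (ap σ.map d))) (i : P.I.obj (op Y)) :
    khtpy (A := A.pullback σ) c' d a i = khtpy c (ap σ.map d) a i := by
  subst eh
  obtain rfl : c' = K.Tm.map σ.sub (F.htpyId_sub σ.sub rfl h e rfl) c :=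
    eq_of_heq (hc.trans (K.Tm.map_heq'' _ _ _ _))
  have hB := F.Path_sub' (Cwf.lift σ.sub (A := A.ty) rfl) (TypeFormers.arr_aux σ.sub rfl rfl)
    (F.unlam_arr_sub σ.sub rfl rfl e h).symm (Cwf.lift_q σ.sub rfl
      (TypeFormers.arr_aux σ.sub rfl rfl))
  refine eq_of_heq (kpapp_heq F (sub_point_path (A := A.pullback σ) (K.Tm.map σ.sub e h) d a)
    (sub_point_path h (ap σ.map d) a) rfl
    (heq_of_eq (kfun_sub σ h e d a)) ?_ ?_ rfl)
  · exact heq_of_eq ((Closed.map_point_q (A := A.pullback σ) d a).trans (A.map_point_q _ a).symm)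
  · refine HEq.trans (heq_of_eq (congrArg (K.Tm.map ((A.pullback σ).point d a) rfl)
      (F.unlam_sub' σ.sub rfl hB (F.htpyId_sub σ.sub rfl h e rfl) c))) ?_
    refine (heq_of_eq (K.Tm.map_map _ _ _)).trans ?_
    exact K.Tm.map_heq (Closed.point_sub σ d a) _ _ rfl HEq.rfl

end

/-! ## Equivalences of `M` as equivalences of families -/

open TypeFormers

/-- The equivalences of families `|A| ρ → |B| ρ` of an element of `isEquiv f`. -/
@[reducible] def baseEquiv {A B : Ty Γ} (f : Tm (arrow F A B))
    (x : K.Tm.obj (F.isEquiv (A := A.ty) (B := B.ty) f.tm)) : FamEquiv P (baseMap f) where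
  linv g b := kfun (A := B.toClosed) (B := A.toClosed) (lfn (linv x)) g b
  linv_nat k _ _ h y := kfun_res (A := B.toClosed) (B := A.toClosed) _ k h y
  lhtpy g a i := khtpy (A := A.toClosed) (lhtpy (linv x)) g a i
  lhtpy_nat k _ _ h a i := khtpy_res (A := A.toClosed) _ k h a i
  lhtpy_zero g a := (khtpy_zero (A := A.toClosed) _ g a).trans
    (kfun_comp (A := A.toClosed) (B := B.toClosed) (D := A.toClosed) _ _ g a)
  lhtpy_one g a := khtpy_one (A := A.toClosed) _ g a
  rinv g b := kfun (A := B.toClosed) (B := A.toClosed) (rfn (rinv x)) g b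
  rinv_nat k _ _ h y := kfun_res (A := B.toClosed) (B := A.toClosed) _ k h y
  rhtpy g b i := khtpy (A := B.toClosed) (rhtpy (rinv x)) g b i
  rhtpy_nat k _ _ h b i := khtpy_res (A := B.toClosed) _ k h b i
  rhtpy_zero g b := (khtpy_zero (A := B.toClosed) _ g b).trans
    (kfun_comp (A := B.toClosed) (B := A.toClosed) (D := B.toClosed) _ _ g b)
  rhtpy_one g b := khtpy_one (A := B.toClosed) _ g b

end Scone
end Sconing

namespace Sconing
namespace Scone
open Cwf Kan TypeFormers
variable {C : Type u} [SmallCategory C] {P : CubeBase C} {K : Cwf.{u, w, w'} C} {Γ Δ : Ctx K}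
  {F : TypeFormers P K}

/-- The two functions and the two homotopies extracted from an element of `isEquiv f` commute with
substitution, and so do their values at closed elements. The filling `s` only serves to name the
morphism of arrows in `famEquiv_eq_pull`. -/
theorem baseEquiv_act (σ : Δ ⟶ Γ) (s : Filling P K) (m : MapIn P F Γ)
    (x : K.Tm.obj (F.isEquiv (A := m.A.ty.ty) (B := m.B.ty.ty) m.f.tm)) :
    baseEquiv (m.sub σ).f (baseAct σ m x) = m.actBase σ (baseEquiv m.f x) := by
  have hf := F.arr_sub σ.sub (A := m.A.ty.ty) (B := m.B.ty.ty) rfl rfl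
  obtain ⟨h₁, h₂⟩ := linv_sub σ.sub (A := m.A.ty.ty) (B := m.B.ty.ty) rfl rfl hf (f := m.f.tm)
    (f' := (m.sub σ).f.tm) rfl (F.isEquiv_sub σ.sub rfl rfl m.f.tm _ rfl) x
  obtain ⟨hl, hlh⟩ := lfn_sub σ.sub (A := m.A.ty.ty) (B := m.B.ty.ty) rfl rfl hf (f := m.f.tm)
    (f' := (m.sub σ).f.tm) rfl (F.LInv_sub σ.sub rfl rfl m.f.tm _ rfl) (TypeFormers.linv x)
  obtain ⟨hr, hrh⟩ := rfn_sub σ.sub (A := m.A.ty.ty) (B := m.B.ty.ty) rfl rfl hf (f := m.f.tm)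
    (f' := (m.sub σ).f.tm) rfl (F.RInv_sub σ.sub rfl rfl m.f.tm _ rfl) (TypeFormers.rinv x)
  rw [← h₁] at hl hlh
  rw [← h₂] at hr hrh
  -- The homotopies start at the composites `l ∘ f` and `f ∘ r`; comparing them after substitution
  -- requires the equations for these composites.
  have cl := F.comp_sub σ.sub (A := m.A.ty.ty) (B := m.B.ty.ty) (D := m.A.ty.ty) rfl rfl rfl
    (lfn (TypeFormers.linv x)) m.f.tm (F.arr_sub σ.sub rfl rfl) (F.arr_sub σ.sub rfl rfl) hf
  have cr := F.comp_sub σ.sub (A := m.B.ty.ty) (B := m.A.ty.ty) (D := m.B.ty.ty) rfl rfl rfl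
    m.f.tm (rfn (TypeFormers.rinv x)) (F.arr_sub σ.sub rfl rfl) hf (F.arr_sub σ.sub rfl rfl)
  replace cl := cl.trans (congrArg (fun l => F.comp (A := (m.sub σ).A.ty.ty)
    (B := (m.sub σ).B.ty.ty) l (m.sub σ).f.tm) hl.symm)
  replace cr := cr.trans (congrArg (F.comp (A := (m.sub σ).B.ty.ty) (B := (m.sub σ).A.ty.ty)
    (m.sub σ).f.tm) hr.symm)
  refine famEquiv_eq_pull σ.map (baseMap_subst σ m.f) (m.cfgHom s σ).base (fun _ => rfl)
    (fun _ => HEq.rfl) (fun _ => HEq.rfl) ⟨fun y => ?_, fun t => ?_, fun y => ?_, fun t => ?_⟩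
  · exact tot_ext rfl (heq_of_eq ((congrArg (fun c => kfun (A := (m.B.ty.pullback σ).toClosed)
      (B := (m.A.ty.pullback σ).toClosed) c y.1 y.2) hl).trans
      (kfun_sub (A := m.B.ty.toClosed) (B := m.A.ty.toClosed) σ _ _ y.1 y.2)))
  · exact tot_ext rfl (heq_of_eq (khtpy_sub (A := m.A.ty.toClosed) σ _ _ cl hlh t.1.1 t.1.2 t.2))
  · exact tot_ext rfl (heq_of_eq ((congrArg (fun c => kfun (A := (m.B.ty.pullback σ).toClosed)
      (B := (m.A.ty.pullback σ).toClosed) c y.1 y.2) hr).trans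
      (kfun_sub (A := m.B.ty.toClosed) (B := m.A.ty.toClosed) σ _ _ y.1 y.2)))
  · exact tot_ext rfl (heq_of_eq (khtpy_sub (A := m.B.ty.toClosed) σ _ _ cr hrh t.1.1 t.1.2 t.2))

/-! ## Values of paths of the sconing -/

section
variable {A B : Ty Γ} {e : Bool → Tm A}

/-- the value at `i` of the second component of a path -/
def pathAt (w : Tm (path F A e)) {Y : C} (g : Γ.2.pred.obj (op Y)) (i : P.I.obj (op Y)) :
    A.fam.obj (A.elem g (pathApp F A e (pathEv F A e w.tm g) i)) :=
  cast (congrArg (fun s : (pathClosed F A e).secs.obj (op Y) =>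
    A.fam.obj (A.elem s.1 (pathApp F A e s i))) (res_id _ (pathEv F A e w.tm g)))
    ((w.sec g).1 (𝟙 Y) i)

theorem pathAt_heq (w : Tm (path F A e)) {Y : C} (g : Γ.2.pred.obj (op Y)) (i : P.I.obj (op Y)) :
    HEq (pathAt w g i) ((w.sec g).1 (𝟙 Y) i) := cast_heq _ _

theorem pathAt_res (w : Tm (path F A e)) {X Y : C} (k : Y ⟶ X) {g : Γ.2.pred.obj (op X)}
    {g' : Γ.2.pred.obj (op Y)} (h : res _ k g = g') (i : P.I.obj (op X))
    (hp : res A.secs k (A.elem g (pathApp F A e (pathEv F A e w.tm g) i))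
      = A.elem g' (pathApp F A e (pathEv F A e w.tm g') (res P.I k i))) :
    A.fam.map k hp (pathAt w g i) = pathAt w g' (res P.I k i) := by
  refine eq_of_heq (HEq.trans (A.fam.map_heq rfl hp ((pathData F A e (pathEv F A e w.tm g)).hω (𝟙 X)
    k k (Category.comp_id k) i) ?_ (pathAt_heq w g i)) ?_)
  · exact congrArg (fun s : (pathClosed F A e).secs.obj (op X) =>
      A.elem s.1 (pathApp F A e s i)) (res_id _ (pathEv F A e w.tm g)).symm
  · exact (heq_of_eq ((w.sec g).2.1 (𝟙 X) k k (Category.comp_id k) i)).trans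
      ((path_sec_res F w k (𝟙 Y) g h (Category.id_comp k) rfl).symm.trans (pathAt_heq w g' _).symm)

theorem pathAt_pt (w : Tm (path F A e)) {Y : C} (g : Γ.2.pred.obj (op Y)) (b : Bool) :
    HEq (pathAt w g (P.pt b Y)) ((e b).sec g) :=
  (pathAt_heq w g _).trans ((heq_of_eq ((w.sec g).2.2 b (𝟙 Y))).trans
    ((pathEnd_heq F A e _ b).trans ((e b).sec_heq (res_id Γ.2.pred g))))

theorem pathAt_map (w : Tm (path F A e)) (σ : Δ ⟶ Γ) {B : Ty Δ} (hB : A.pullback σ = B)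
    {e' : Bool → Tm B} (he : ∀ b, (e b).map σ hB = e' b)
    (h : (path F A e).pullback σ = path F B e') {Y : C} (d : Δ.2.pred.obj (op Y))
    (i : P.I.obj (op Y)) :
    HEq (pathAt (w.map σ h) d i) (pathAt w (ap σ.map d) i) := by
  subst hB
  exact (pathAt_heq (A := A.pullback σ) _ d i).trans ((path_map_sec F w σ he h d (𝟙 Y) i).trans
    (pathAt_heq w _ i).symm)

/-- By naturality, the value of a path at a later stage `f` over `g` is its value at the identity
over the restriction of `g` along `f`. The values `pathAt` thus carry all the information. -/
theorem path_ext {w w' : Tm (path F A e)} (h : w.tm = w'.tm)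
    (h' : ∀ {Y : C} (g : Γ.2.pred.obj (op Y)) (i : P.I.obj (op Y)),
      HEq (pathAt w g i) (pathAt w' g i)) : w = w' := by
  refine Tm.ext h (fun {Y} g => PathFib.heq (D := pathData F A e (pathEv F A e w.tm g))
    (D' := pathData F A e (pathEv F A e w'.tm g)) (by rw [h]) (fun {Z} f i => ?_))
  have k := fun w : Tm (path F A e) => (pathAt_heq w (res _ f g) i).trans
    (path_sec_res F w f (𝟙 Z) g rfl (Category.id_comp f) rfl)
  exact (k w).symm.trans ((h' _ i).trans (k w'))

/-- The path of the sconing with given first component and given values. -/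
def pathMk (c : K.Tm.obj (F.Path A.ty (e false).tm (e true).tm))
    (y : ∀ {Y : C} (g : Γ.2.pred.obj (op Y)) (i : P.I.obj (op Y)),
      A.fam.obj (A.elem g (pathApp F A e (pathEv F A e c g) i)))
    (hy : ∀ {X Y : C} (k : Y ⟶ X) {g : Γ.2.pred.obj (op X)} {g' : Γ.2.pred.obj (op Y)}
      (_ : res _ k g = g') (i : P.I.obj (op X))
      (hp : res A.secs k (A.elem g (pathApp F A e (pathEv F A e c g) i))
        = A.elem g' (pathApp F A e (pathEv F A e c g') (res P.I k i))),
      A.fam.map k hp (y g i) = y g' (res P.I k i))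
    (hpt : ∀ (b : Bool) {Y : C} (g : Γ.2.pred.obj (op Y)), HEq (y g (P.pt b Y)) ((e b).sec g)) :
    Tm (path F A e) where
  tm := c
  sec {Y} g := ⟨fun f i => cast (congrArg (fun s : (pathClosed F A e).secs.obj (op _) =>
      A.fam.obj (A.elem s.1 (pathApp F A e s i))) (pathEv_res F c f g).symm) (y (res _ f g) i),
    fun {Z W} f k f' ef i => by
      have h : res _ k (res Γ.2.pred f g) = res Γ.2.pred f' g := by subst ef; exact res_res _ _ _ _
      refine eq_of_heq (HEq.trans (A.fam.map_heq rfl _ (pathApp_res F A e k _ _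
        ((pathEv_res F c k _).trans (congrArg (pathEv F A e c) h)) i) ?_ (cast_heq _ _))
        ((heq_of_eq (hy k h i _)).trans (cast_heq _ _).symm))
      exact congrArg (fun s : (pathClosed F A e).secs.obj (op Z) =>
        A.elem s.1 (pathApp F A e s i)) (pathEv_res F c f g),
    fun b {Z} f => eq_of_heq ((cast_heq _ _).trans ((hpt b _).trans
      (pathEnd_heq F A e (res _ f (pathEv F A e c g)) b).symm))⟩
  nat {X Y} k g := by
    refine eq_of_heq ((cast_heq _ _).trans ?_)
    refine PathFib.heq (pathData_res F A e k (pathEv_res F c k g)) (fun {Z} f i => ?_)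
    refine (cast_heq _ _).trans (HEq.trans ?_ (cast_heq _ _).symm)
    exact congr_arg_heq (fun g => y g i) (res_res Γ.2.pred k f g).symm

theorem pathAt_mk (c : K.Tm.obj (F.Path A.ty (e false).tm (e true).tm)) (y hy hpt) {Y : C}
    (g : Γ.2.pred.obj (op Y)) (i : P.I.obj (op Y)) :
    pathAt (pathMk (A := A) (e := e) c y hy hpt) g i = y g i :=
  eq_of_heq ((pathAt_heq _ g i).trans ((cast_heq _ _).trans
    (congr_arg_heq (fun g => y g i) (res_id Γ.2.pred g))))

end

/-! ## Functions of the sconing on total spaces -/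

section
variable {A B D : Ty Γ}

theorem arrow_ext {w w' : Tm (arrow F A B)} (h : w.tm = w'.tm)
    (h' : ∀ {X : C} (g : Γ.2.pred.obj (op X)) (t : A.sumFam.obj g),
      (sumMap w).fn g t = (sumMap w').fn g t) : w = w' := by
  refine (unlamEquiv F).injective (Tm.ext (congrArg F.unlam h) (fun {Y} t => ?_))
  exact (Sigma.mk.inj_iff.1 (h' t.1.1 ⟨t.1.2, t.2⟩)).2

/-- With `arrow_ext` this identifies functions of the sconing with a function `c` of `M` and a
natural map of total spaces strictly over `c`. The second components of that map are moved to the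
required fibres along `hc`. -/
theorem arrow_exists (c : K.Tm.obj (F.arr A.ty B.ty))
    (φ : ∀ {X : C} (g : Γ.2.pred.obj (op X)), A.sumFam.obj g → B.sumFam.obj g)
    (hn : ∀ {X Y : C} (k : Y ⟶ X) {g : Γ.2.pred.obj (op X)} {g' : Γ.2.pred.obj (op Y)}
      (h : res _ k g = g') (t : A.sumFam.obj g), B.sumFam.map k h (φ g t) = φ g' (A.sumFam.map k h t))
    (hc : ∀ {X : C} (g : Γ.2.pred.obj (op X)) (t : A.sumFam.obj g),
      (φ g t).1 = kfun (A := A.toClosed) (B := B.toClosed) c g t.1) :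
    ∃ w : Tm (arrow F A B), w.tm = c ∧ ∀ {X : C} (g : Γ.2.pred.obj (op X)) (t : A.sumFam.obj g),
      (sumMap w).fn g t = φ g t := by
  let v : Tm (B.pullback (p A)) := {
    tm := F.unlam c
    sec := fun {Y} t => cast (congrArg (fun b => B.fam.obj (B.elem t.1.1 b)) (hc t.1.1 ⟨t.1.2, t.2⟩))
      (φ t.1.1 ⟨t.1.2, t.2⟩).2
    nat := fun {X Y} k t => by
      refine eq_of_heq (HEq.trans (B.fam.map_heq rfl _ (B.res_elem k rfl rfl) ?_ (cast_heq _ _)) ?_)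
      · exact congrArg (B.elem t.1.1) (hc t.1.1 ⟨t.1.2, t.2⟩).symm
      · exact (Sigma.mk.inj_iff.1 (hn k rfl ⟨t.1.2, t.2⟩)).2.trans (cast_heq _ _).symm }
  have e : unlam F (lam F v) = v := (unlamEquiv F).right_inv v
  have ht : (lam F v).tm = c := F.unlam.symm_apply_apply c
  refine ⟨lam F v, ht, fun g t => Sigma.ext ?_ ?_⟩
  · exact (congrArg (fun c => kfun (A := A.toClosed) (B := B.toClosed) c g t.1) ht).trans (hc g t).symm
  · exact (Tm.sec_of_eq e (tot A g t.1 t.2)).trans (cast_heq _ _)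

theorem sumMap_comp (l : Tm (arrow F B D)) (f : Tm (arrow F A B)) {X : C}
    (g : Γ.2.pred.obj (op X)) (t : A.sumFam.obj g) :
    (sumMap (A := A) (B := D) ((formers F).comp (K := cwf K) (A := A) (B := B) (D := D) l f)).fn g t
      = (sumMap l).fn g ((sumMap f).fn g t) := by
  refine Sigma.ext (kfun_comp (A := A.toClosed) (B := B.toClosed) (D := D.toClosed) l.tm f.tm g t.1) ?_
  have e : unlam F (A := A) (B := D.pullback (p A))
      ((formers F).comp (K := cwf K) (A := A) (B := B) (D := D) l f)
      = (unlam F (A := B) (B := D.pullback (p B)) l).map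
        (pair (p A) rfl (unlam F (A := A) (B := B.pullback (p A)) f))
        (TypeFormers.comp_aux (K := cwf K) (A := A) (B := B) (D := D) _) :=
    (unlamEquiv F).apply_symm_apply _
  refine HEq.trans (Tm.sec_of_eq e (tot A g t.1 t.2)) ?_
  refine (Tm.map_sec _ _ _ _).trans ?_
  -- The substitution that pairs the projection with `f` sends `((ρ, a), a')` to its image under `f`
  -- by computation alone.
  refine Tm.sec_heq (unlam F (A := B) (B := D.pullback (p B)) l) ?_
  rfl

theorem sumMap_natural (w : Tm (arrow F A B)) (σ : Δ ⟶ Γ) {w' : Tm (arrow F (A.pullback σ) (B.pullback σ))}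
    (hw : w' = subst σ w) {X : C} (d : Δ.2.pred.obj (op X)) (t : A.sumFam.obj (ap σ.map d)) :
    (sumMap w').fn d t = (sumMap w).fn (ap σ.map d) t := by
  subst hw
  exact Sigma.ext (efun_subst σ w d t.1) (efun'_subst σ w d t.1 t.2)

end

/-! ## Homotopies of the sconing on total spaces -/

section
variable {A : Ty Γ} {h : Tm (arrow F A A)}

/-- the type of homotopies from `h` to the identity -/
abbrev htpy (h : Tm (arrow F A A)) : Ty Γ := TypeFormers.htpyId (formers F) (K := cwf K) (A := A) h

/-- the path of a homotopy over the extended context -/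
abbrev htpyPath (w : Tm (htpy h)) : Tm (path F (A.pullback (p A)) (ends
    (unlam F (A := A) (B := A.pullback (p A)) h) (q A))) := unlam F w

/-- the homotopy of total spaces of a homotopy of the sconing -/
def sumHtpy (w : Tm (htpy h)) {X : C} (g : Γ.2.pred.obj (op X)) (t : A.sumFam.obj g)
    (i : P.I.obj (op X)) : A.sumFam.obj g :=
  ⟨khtpy (A := A.toClosed) (F := F) (h := h.tm) w.tm g t.1 i, pathAt (htpyPath w) (tot A g t.1 t.2) i⟩

theorem sumHtpy_zero (w : Tm (htpy h)) {X : C} (g : Γ.2.pred.obj (op X)) (t : A.sumFam.obj g) :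
    sumHtpy w g t (P.pt false X) = (sumMap h).fn g t :=
  Sigma.ext (khtpy_zero (A := A.toClosed) (F := F) (h := h.tm) w.tm g t.1)
    (pathAt_pt (htpyPath w) (tot A g t.1 t.2) false)

theorem sumHtpy_one (w : Tm (htpy h)) {X : C} (g : Γ.2.pred.obj (op X)) (t : A.sumFam.obj g) :
    sumHtpy w g t (P.pt true X) = t :=
  Sigma.ext (khtpy_one (A := A.toClosed) (F := F) (h := h.tm) w.tm g t.1)
    ((pathAt_pt (htpyPath w) (tot A g t.1 t.2) true).trans (q_sec A _))

theorem sumHtpy_res (w : Tm (htpy h)) {X Y : C} (k : Y ⟶ X) {g : Γ.2.pred.obj (op X)}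
    {g' : Γ.2.pred.obj (op Y)} (e : res _ k g = g') (t : A.sumFam.obj g) (i : P.I.obj (op X)) :
    A.sumFam.map k e (sumHtpy w g t i) = sumHtpy w g' (A.sumFam.map k e t) (res P.I k i) := by
  refine Sigma.ext (khtpy_res (A := A.toClosed) (F := F) (h := h.tm) w.tm k e t.1 i) ?_
  refine (A.fam.map_heq'' _ _ _ _).trans (heq_of_eq (pathAt_res (htpyPath w) k
    (res_tot A k e rfl rfl) i (pathApp_res F _ _ k _ _ ((pathEv_res F _ k _).trans
      (congrArg (pathEv F _ _ (htpyPath w).tm) (res_tot A k e rfl rfl))) i)))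

theorem htpy_ext {w w' : Tm (htpy h)} (e : w.tm = w'.tm)
    (e' : ∀ {X : C} (g : Γ.2.pred.obj (op X)) (t : A.sumFam.obj g) (i : P.I.obj (op X)),
      sumHtpy w g t i = sumHtpy w' g t i) : w = w' := by
  refine (unlamEquiv F).injective (path_ext (A := A.pullback (p A)) (w := htpyPath w)
    (w' := htpyPath w') (congrArg F.unlam e) (fun {Y} t i => ?_))
  exact (Sigma.mk.inj_iff.1 (e' t.1.1 ⟨t.1.2, t.2⟩ i)).2

/-- Counterpart of `arrow_exists` for homotopies. The end points of the resulting path over the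
extended context are `h` applied to the variable and the variable itself, which is what `h0` and
`h1` supply. -/
theorem htpy_exists (c : K.Tm.obj (F.htpyId (A := A.ty) h.tm))
    (φ : ∀ {X : C} (g : Γ.2.pred.obj (op X)), A.sumFam.obj g → P.I.obj (op X) → A.sumFam.obj g)
    (hn : ∀ {X Y : C} (k : Y ⟶ X) {g : Γ.2.pred.obj (op X)} {g' : Γ.2.pred.obj (op Y)}
      (e : res _ k g = g') (t : A.sumFam.obj g) (i : P.I.obj (op X)),
      A.sumFam.map k e (φ g t i) = φ g' (A.sumFam.map k e t) (res P.I k i))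
    (h0 : ∀ {X : C} (g : Γ.2.pred.obj (op X)) (t : A.sumFam.obj g),
      φ g t (P.pt false X) = (sumMap h).fn g t)
    (h1 : ∀ {X : C} (g : Γ.2.pred.obj (op X)) (t : A.sumFam.obj g), φ g t (P.pt true X) = t)
    (hc : ∀ {X : C} (g : Γ.2.pred.obj (op X)) (t : A.sumFam.obj g) (i : P.I.obj (op X)),
      (φ g t i).1 = khtpy (A := A.toClosed) c g t.1 i) :
    ∃ w : Tm (htpy h), w.tm = c ∧ ∀ {X : C} (g : Γ.2.pred.obj (op X)) (t : A.sumFam.obj g)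
      (i : P.I.obj (op X)), sumHtpy w g t i = φ g t i := by
  let v : Tm (path F (A.pullback (p A)) (ends (unlam F (A := A) (B := A.pullback (p A)) h) (q A))) :=
    pathMk (A := A.pullback (p A)) (F.unlam c) (fun {Y} t i =>
      cast (congrArg (fun b => A.fam.obj (A.elem t.1.1 b)) (hc t.1.1 ⟨t.1.2, t.2⟩ i))
        (φ t.1.1 ⟨t.1.2, t.2⟩ i).2)
      (fun {X Y} k {t t'} et i hp => by
        subst et
        refine eq_of_heq (HEq.trans (A.fam.map_heq rfl _ (A.res_elem k rfl rfl) ?_ (cast_heq _ _)) ?_)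
        · exact congrArg (A.elem t.1.1) (hc t.1.1 ⟨t.1.2, t.2⟩ i).symm
        · exact (Sigma.mk.inj_iff.1 (hn k rfl ⟨t.1.2, t.2⟩ i)).2.trans (cast_heq _ _).symm)
      (fun b {Y} t => (cast_heq _ _).trans (match b with
        | false => (Sigma.mk.inj_iff.1 (h0 t.1.1 ⟨t.1.2, t.2⟩)).2
        | true => (Sigma.mk.inj_iff.1 (h1 t.1.1 ⟨t.1.2, t.2⟩)).2.trans (q_sec A t).symm))
  have e : unlam F (lam F v) = v := (unlamEquiv F).right_inv v
  have ht : (lam F v).tm = c := F.unlam.symm_apply_apply c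
  refine ⟨lam F v, ht, fun g t i => Sigma.ext ?_ ?_⟩
  · exact (congrArg (fun c => khtpy (A := A.toClosed) (F := F) (h := h.tm) c g t.1 i) ht).trans
      (hc g t i).symm
  · refine (congr_arg_heq (fun v => pathAt v (tot A g t.1 t.2) i) e).trans ?_
    exact (heq_of_eq (pathAt_mk (A := A.pullback (p A)) _ _ _ _ _ _)).trans (cast_heq _ _)

/-- The homotopy `w'` is compared with the substituted one heterogeneously: commutation of the type
of homotopies with `σ` is an equality but not a definitional one. -/
theorem sumHtpy_natural (w : Tm (htpy h)) (σ : Δ ⟶ Γ) {h' : Tm (arrow F (A.pullback σ) (A.pullback σ))}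
    (eh : subst σ h = h') {w' : Tm (htpy h')}
    (hw : HEq w' (w.map σ rfl)) {X : C} (d : Δ.2.pred.obj (op X)) (t : A.sumFam.obj (ap σ.map d))
    (i : P.I.obj (op X)) : sumHtpy w' d t i = sumHtpy w (ap σ.map d) t i := by
  subst eh
  have ha := (formers F).arr_sub (K := cwf K) (A := A) (B := A) σ rfl rfl
  have hs := (formers F).htpyId_sub (K := cwf K) (A := A) σ rfl h ha rfl
  have hB := (formers F).Path_sub' (K := cwf K) (Cwf.lift (K := cwf K) σ (A := A) rfl)
    (TypeFormers.arr_aux (K := cwf K) (A := A) (B := A) σ rfl rfl)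
    ((formers F).unlam_arr_sub (K := cwf K) (A := A) (B := A) σ rfl rfl ha h).symm
    (Cwf.lift_q (K := cwf K) (A := A) σ rfl (TypeFormers.arr_aux (K := cwf K) (A := A) (B := A) σ rfl rfl))
  obtain rfl : w' = w.map σ hs := eq_of_heq (hw.trans ((cwf K).Tm.map_heq'' σ rfl hs w))
  refine Sigma.ext (khtpy_sub (A := A.toClosed) (F := F) (h := h.tm) σ w.tm
    (F.arr_sub σ.sub rfl rfl) rfl (K.Tm.map_heq'' _ _ _ _) d t.1 i) ?_
  have e := (formers F).unlam_sub' (K := cwf K) σ rfl hB hs w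
  refine (congr_arg_heq (fun v => pathAt v (tot (A.pullback σ) d t.1 t.2) i) e).trans ?_
  refine (pathAt_map (htpyPath w) (Cwf.lift (K := cwf K) σ (A := A) rfl)
    (TypeFormers.arr_aux (K := cwf K) (A := A) (B := A) σ rfl rfl) (fun b => ?_) hB _ i).trans ?_
  · cases b
    · exact ((formers F).unlam_arr_sub (K := cwf K) (A := A) (B := A) σ rfl rfl ha h).symm
    · exact Cwf.lift_q (K := cwf K) (A := A) σ rfl (TypeFormers.arr_aux (K := cwf K) (A := A) (B := A) σ rfl rfl)
  · exact congr_arg_heq (fun τ : extend Δ (A.pullback σ) ⟶ extend Γ A =>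
      pathAt (htpyPath w) (ap τ.map (tot (A.pullback σ) d t.1 t.2)) i) (lift_eq σ A)

end
end Scone
end Sconing

namespace Sconing
namespace Scone
open Cwf Kan TypeFormers
variable {C : Type u} [SmallCategory C] {P : CubeBase C} {K : Cwf.{u, w, w'} C} {Γ Δ : Ctx K}
  {F : TypeFormers P K} {A B : Ty Γ}

/-! ## Equivalences of the sconing as equivalences of total spaces -/

/-- the type of proofs that `f` is an equivalence in the sconing -/
abbrev equivTy (f : Tm (arrow F A B)) : Ty Γ :=
  TypeFormers.isEquiv (formers F) (K := cwf K) (A := A) (B := B) f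

variable {f : Tm (arrow F A B)}

/-- the left inverse of an equivalence of the sconing -/
abbrev leftFn (x : Tm (equivTy f)) : Tm (arrow F B A) :=
  lfn (F := formers F) (K := cwf K) (A := A) (B := B) (f := f)
    (TypeFormers.linv (F := formers F) (K := cwf K) (A := A) (B := B) (f := f) x)

abbrev leftHtpy (x : Tm (equivTy f)) :
    Tm (htpy ((formers F).comp (K := cwf K) (A := A) (B := B) (D := A) (leftFn x) f)) :=
  lhtpy (F := formers F) (K := cwf K) (A := A) (B := B) (f := f)
    (TypeFormers.linv (F := formers F) (K := cwf K) (A := A) (B := B) (f := f) x)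

/-- the right inverse of an equivalence of the sconing -/
abbrev rightFn (x : Tm (equivTy f)) : Tm (arrow F B A) :=
  rfn (F := formers F) (K := cwf K) (A := A) (B := B) (f := f)
    (TypeFormers.rinv (F := formers F) (K := cwf K) (A := A) (B := B) (f := f) x)

abbrev rightHtpy (x : Tm (equivTy f)) :
    Tm (htpy ((formers F).comp (K := cwf K) (A := B) (B := A) (D := B) f (rightFn x))) :=
  rhtpy (F := formers F) (K := cwf K) (A := A) (B := B) (f := f)
    (TypeFormers.rinv (F := formers F) (K := cwf K) (A := A) (B := B) (f := f) x)

/-- The equivalences of total spaces of an equivalence of the sconing. -/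
@[reducible] def totEquiv (x : Tm (equivTy f)) : FamEquiv P (sumMap f) where
  linv g y := (sumMap (leftFn x)).fn g y
  linv_nat k _ _ h y := (sumMap (leftFn x)).nat k h y
  lhtpy g t i := sumHtpy (leftHtpy x) g t i
  lhtpy_nat k _ _ h t i := sumHtpy_res (leftHtpy x) k h t i
  lhtpy_zero g t := (sumHtpy_zero (leftHtpy x) g t).trans (sumMap_comp (leftFn x) f g t)
  lhtpy_one g t := sumHtpy_one (leftHtpy x) g t
  rinv g y := (sumMap (rightFn x)).fn g y
  rinv_nat k _ _ h y := (sumMap (rightFn x)).nat k h y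
  rhtpy g t i := sumHtpy (rightHtpy x) g t i
  rhtpy_nat k _ _ h t i := sumHtpy_res (rightHtpy x) k h t i
  rhtpy_zero g t := (sumHtpy_zero (rightHtpy x) g t).trans (sumMap_comp f (rightFn x) g t)
  rhtpy_one g t := sumHtpy_one (rightHtpy x) g t

theorem htpy_ext_heq {h h' : Tm (arrow F A A)} (e : h = h') {w : Tm (htpy h)} {w' : Tm (htpy h')}
    (hw : HEq w.tm w'.tm) (e' : ∀ {X : C} (g : Γ.2.pred.obj (op X)) (t : A.sumFam.obj g)
      (i : P.I.obj (op X)), sumHtpy w g t i = sumHtpy w' g t i) : HEq w w' := by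
  subst e
  exact heq_of_eq (htpy_ext (eq_of_heq hw) e')

/-- An equivalence of the sconing is determined by its first component and its equivalence of total
spaces. -/
theorem totEquiv_injective {x y : Tm (equivTy f)} (h : x.tm = y.tm) (h' : totEquiv x = totEquiv y) :
    x = y := by
  have hl : leftFn x = leftFn y := arrow_ext
    (congrArg (fun x : K.Tm.obj (F.isEquiv (A := A.ty) (B := B.ty) f.tm) => lfn (TypeFormers.linv x)) h)
    (fun g t => congrArg (fun E : FamEquiv P (sumMap f) => E.linv g t) h')
  have hr : rightFn x = rightFn y := arrow_ext
    (congrArg (fun x : K.Tm.obj (F.isEquiv (A := A.ty) (B := B.ty) f.tm) => rfn (TypeFormers.rinv x)) h)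
    (fun g t => congrArg (fun E : FamEquiv P (sumMap f) => E.rinv g t) h')
  refine isEquiv_ext (F := formers F) (K := cwf K) (A := A) (B := B) (f := f) hl ?_ hr ?_
  · exact htpy_ext_heq (congrArg (fun l => (formers F).comp (K := cwf K) (A := A) (B := B) (D := A) l f) hl)
      (congr_arg_heq (fun x : K.Tm.obj (F.isEquiv (A := A.ty) (B := B.ty) f.tm) =>
        lhtpy (TypeFormers.linv x)) h)
      (fun g t i => congrArg (fun E : FamEquiv P (sumMap f) => E.lhtpy g t i) h')
  · exact htpy_ext_heq (congrArg (fun r => (formers F).comp (K := cwf K) (A := B) (B := A) (D := B) f r) hr)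
      (congr_arg_heq (fun x : K.Tm.obj (F.isEquiv (A := A.ty) (B := B.ty) f.tm) =>
        rhtpy (TypeFormers.rinv x)) h)
      (fun g t i => congrArg (fun E : FamEquiv P (sumMap f) => E.rhtpy g t i) h')

/-- Together with `totEquiv_injective`: elements of `isEquiv*` correspond to pairs of an element `c`
of `isEquiv f` and an equivalence of total spaces strictly over the one of bases that `c` induces.
-/
theorem totEquiv_exists (c : K.Tm.obj (F.isEquiv (A := A.ty) (B := B.ty) f.tm))
    (E : FamEquiv P (sumMap f)) (o : Over E (baseEquiv f c)) :
    ∃ x : Tm (equivTy f), x.tm = c ∧ totEquiv x = E := by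
  obtain ⟨l, hl, hl'⟩ := arrow_exists (lfn (TypeFormers.linv c)) (fun g y => E.linv g y)
    (fun k _ _ h y => E.linv_nat k h y) o.linv
  obtain ⟨r, hr, hr'⟩ := arrow_exists (rfn (TypeFormers.rinv c)) (fun g y => E.rinv g y)
    (fun k _ _ h y => E.rinv_nat k h y) o.rinv
  -- The homotopies of `c` refer to the inverses of `c`, whereas those to be built refer to the
  -- first components of `l` and `r`. They are moved along the equality of these, without change of
  -- their values.
  have key : ∀ {D : Ty Γ} (h : Tm (arrow F D D)) {k : K.Tm.obj (F.arr D.ty D.ty)} (hk : h.tm = k)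
      (c : K.Tm.obj (F.htpyId k)), ∃ c' : K.Tm.obj (F.htpyId (A := D.ty) h.tm), HEq c' c ∧
        ∀ {X : C} (g : Γ.2.pred.obj (op X)) (a) (i), khtpy (A := D.toClosed) c' g a i
          = khtpy (A := D.toClosed) c g a i := by
    intro D h k hk c
    subst hk
    exact ⟨c, HEq.rfl, fun _ _ _ => rfl⟩
  obtain ⟨cl, hcl, hcl'⟩ := key ((formers F).comp (K := cwf K) (A := A) (B := B) (D := A) l f)
    (congrArg (fun l => F.comp l f.tm) hl) (lhtpy (TypeFormers.linv c))
  obtain ⟨cr, hcr, hcr'⟩ := key ((formers F).comp (K := cwf K) (A := B) (B := A) (D := B) f r)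
    (congrArg (fun r => F.comp f.tm r) hr) (rhtpy (TypeFormers.rinv c))
  obtain ⟨lh, hlh, hlh'⟩ := htpy_exists cl (fun g t i => E.lhtpy g t i)
    (fun k _ _ h t i => E.lhtpy_nat k h t i)
    (fun g t => (E.lhtpy_zero g t).trans ((hl' g _).symm.trans (sumMap_comp l f g t).symm))
    (fun g t => E.lhtpy_one g t) (fun g t i => (o.lhtpy g t i).trans (hcl' g t.1 i).symm)
  obtain ⟨rh, hrh, hrh'⟩ := htpy_exists cr (fun g t i => E.rhtpy g t i)
    (fun k _ _ h t i => E.rhtpy_nat k h t i)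
    (fun g t => (E.rhtpy_zero g t).trans ((congrArg _ (hr' g _).symm).trans (sumMap_comp f r g t).symm))
    (fun g t => E.rhtpy_one g t) (fun g t i => (o.rhtpy g t i).trans (hcr' g t.1 i).symm)
  obtain ⟨a, rfl, ha⟩ := LInv_exists (F := formers F) (K := cwf K) (A := A) (B := B) (f := f) l lh
  obtain ⟨b, rfl, hb⟩ := RInv_exists (F := formers F) (K := cwf K) (A := A) (B := B) (f := f) r rh
  obtain rfl := eq_of_heq ha
  obtain rfl := eq_of_heq hb
  obtain ⟨x, rfl, rfl⟩ := isEquiv_exists (F := formers F) (K := cwf K) (A := A) (B := B) (f := f) a b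
  refine ⟨x, ?_, FamEquiv.ext (fun g y => hl' g y) (fun g t i => hlh' g t i) (fun g y => hr' g y)
    (fun g t i => hrh' g t i)⟩
  exact isEquiv_ext hl ((heq_of_eq hlh).trans hcl) hr ((heq_of_eq hrh).trans hcr)

/-- The substitution rules for the components of an equivalence hold in any category with families;
here they are applied to the sconing instead of `M`. -/
theorem totEquiv_act (σ : Δ ⟶ Γ) (s : Filling P K) (m : MapIn P F Γ) (x : Tm (equivTy m.f)) :
    totEquiv (f := (m.sub σ).f) ((equivInSconing P F).act σ m x) = m.actTotal σ (totEquiv x) := by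
  have hf := (formers F).arr_sub (K := cwf K) (A := m.A.ty) (B := m.B.ty) σ rfl rfl
  obtain ⟨h₁, h₂⟩ := linv_sub (F := formers F) (K := cwf K) σ (A := m.A.ty) (B := m.B.ty) rfl rfl hf
    (f := m.f) (f' := (m.sub σ).f) rfl
    ((formers F).isEquiv_sub (K := cwf K) (A := m.A.ty) (B := m.B.ty) σ rfl rfl m.f hf rfl) x
  obtain ⟨hl, hlh⟩ := lfn_sub (F := formers F) (K := cwf K) σ (A := m.A.ty) (B := m.B.ty) rfl rfl hf
    (f := m.f) (f' := (m.sub σ).f) rfl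
    ((formers F).LInv_sub (K := cwf K) (A := m.A.ty) (B := m.B.ty) σ rfl rfl m.f hf rfl)
    (TypeFormers.linv (F := formers F) (K := cwf K) (A := m.A.ty) (B := m.B.ty) (f := m.f) x)
  obtain ⟨hr, hrh⟩ := rfn_sub (F := formers F) (K := cwf K) σ (A := m.A.ty) (B := m.B.ty) rfl rfl hf
    (f := m.f) (f' := (m.sub σ).f) rfl
    ((formers F).RInv_sub (K := cwf K) (A := m.A.ty) (B := m.B.ty) σ rfl rfl m.f hf rfl)
    (TypeFormers.rinv (F := formers F) (K := cwf K) (A := m.A.ty) (B := m.B.ty) (f := m.f) x)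
  rw [← h₁] at hl hlh
  rw [← h₂] at hr hrh
  have cl := (formers F).comp_sub (K := cwf K) σ (A := m.A.ty) (B := m.B.ty) (D := m.A.ty) rfl rfl rfl
    (leftFn x) m.f ((formers F).arr_sub (K := cwf K) (A := m.A.ty) (B := m.A.ty) σ rfl rfl)
    ((formers F).arr_sub (K := cwf K) (A := m.B.ty) (B := m.A.ty) σ rfl rfl) hf
  have cr := (formers F).comp_sub (K := cwf K) σ (A := m.B.ty) (B := m.A.ty) (D := m.B.ty) rfl rfl rfl
    m.f (rightFn x) ((formers F).arr_sub (K := cwf K) (A := m.B.ty) (B := m.B.ty) σ rfl rfl)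
    hf ((formers F).arr_sub (K := cwf K) (A := m.B.ty) (B := m.A.ty) σ rfl rfl)
  replace cl := cl.trans (congrArg (fun l => (formers F).comp (K := cwf K) (A := (m.sub σ).A.ty)
    (B := (m.sub σ).B.ty) (D := (m.sub σ).A.ty) l (m.sub σ).f) hl.symm)
  replace cr := cr.trans (congrArg ((formers F).comp (K := cwf K) (A := (m.sub σ).B.ty)
    (B := (m.sub σ).A.ty) (D := (m.sub σ).B.ty) (m.sub σ).f) hr.symm)
  refine famEquiv_eq_pull σ.map (sumMap_subst σ m.f) (m.totalHom s σ) (fun _ => rfl)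
    (fun _ => HEq.rfl) (fun _ => HEq.rfl) ⟨fun y => ?_, fun t => ?_, fun y => ?_, fun t => ?_⟩
  · exact tot_ext rfl (heq_of_eq (sumMap_natural (leftFn x) σ hl y.1 y.2))
  · exact tot_ext rfl (heq_of_eq (sumHtpy_natural (leftHtpy x) σ cl hlh t.1.1 t.1.2 t.2))
  · exact tot_ext rfl (heq_of_eq (sumMap_natural (rightFn x) σ hr y.1 y.2))
  · exact tot_ext rfl (heq_of_eq (sumHtpy_natural (rightHtpy x) σ cr hrh t.1.1 t.1.2 t.2))

end Scone
end Sconing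

namespace Sconing
namespace Scone
open Cwf Kan
variable {C : Type u} [SmallCategory C] {P : CubeBase C} {K : Cwf.{u, w, w'} C}
  {F : TypeFormers P K}

/-! ## The natural implications -/

theorem Assertion.NatImplies.trans {S T R : Assertion P F} (a : S.NatImplies T)
    (b : T.NatImplies R) : S.NatImplies R := by
  obtain ⟨s, hs⟩ := a
  obtain ⟨t, ht⟩ := b
  exact ⟨fun m x => t m (s m x), fun σ m x =>
    (congrArg (t (m.sub σ)) (hs σ m x)).trans (ht σ m (s m x))⟩

theorem equivInSconing_natImplies_equivOnTotals (s : Filling P K) :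
    (equivInSconing P F).NatImplies (equivOnTotals P F) :=
  ⟨fun {_} m (x : Tm (equivTy m.f)) => (x.tm, totEquiv x),
    fun {_ _} σ m x => Prod.ext rfl (totEquiv_act σ s m x)⟩

theorem equivOnTotals_natImplies_equivOnFibres (s : Filling P K) :
    (equivOnTotals P F).NatImplies (equivOnFibres P F) :=
  ⟨fun {_} m x => (x.1, m.toFibres s (baseEquiv m.f x.1) x.2), fun {_ _} σ m x => Prod.ext rfl
    ((congrArg (fun e => (m.sub σ).toFibres s e (m.actTotal σ x.2)) (baseEquiv_act σ s m x.1)).trans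
      (m.toFibres_act s σ (baseEquiv m.f x.1) x.2))⟩

/-- The witness is chosen from an existence statement, which does not endanger naturality: it is
determined by its first component and its equivalence of total spaces, and both of these are
natural. -/
theorem equivOnFibres_natImplies_equivInSconing (s : Filling P K) :
    (equivOnFibres P F).NatImplies (equivInSconing P F) := by
  have h : ∀ {Γ : Ctx K} (m : MapIn P F Γ) (x : (equivOnFibres P F).wit m),
      ∃ y : Tm (equivTy m.f), y.tm = x.1 ∧ totEquiv y = m.toTotals s (baseEquiv m.f x.1) x.2 :=
    fun m x => totEquiv_exists x.1 _ (m.toTotals_over s _ x.2)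
  refine ⟨fun {_} m x => (h m x).choose, fun {_ _} σ m x => ?_⟩
  obtain ⟨h₁, h₂⟩ := (h (m.sub σ) ((equivOnFibres P F).act σ m x)).choose_spec
  obtain ⟨k₁, k₂⟩ := (h m x).choose_spec
  -- The choice made after substitution and the substituted choice have the same first component,
  -- and the same total equivalence by `toTotals_act`.
  refine totEquiv_injective (f := (m.sub σ).f) (h₁.trans (congrArg (baseAct σ m) k₁).symm)
    (h₂.trans (Eq.trans ?_ (totEquiv_act σ s m _).symm))
  refine (congrArg (fun e => (m.sub σ).toTotals s e (m.actFibre σ x.2)) (baseEquiv_act σ s m x.1)).trans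
    ((m.toTotals_act s σ (baseEquiv m.f x.1) x.2).trans (congrArg (m.actTotal σ) k₂.symm))

end Scone
end Sconing

/-! ### The three equivalences, from a cycle of natural implications. -/

theorem mainTheorem4 {C : Type u} [SmallCategory C] (P : Sconing.CubeBase C)
    (M : Sconing.CubicalCwf.{u, w, w'} P) :
    (Sconing.Scone.equivInSconing P M.formers).NatIff (Sconing.Scone.equivOnTotals P M.formers) ∧
    (Sconing.Scone.equivOnTotals P M.formers).NatIff (Sconing.Scone.equivOnFibres P M.formers) ∧
    (Sconing.Scone.equivInSconing P M.formers).NatIff (Sconing.Scone.equivOnFibres P M.formers) := by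
  have h₁₂ := Sconing.Scone.equivInSconing_natImplies_equivOnTotals (F := M.formers) M.filling
  have h₂₃ := Sconing.Scone.equivOnTotals_natImplies_equivOnFibres (F := M.formers) M.filling
  have h₃₁ := Sconing.Scone.equivOnFibres_natImplies_equivInSconing (F := M.formers) M.filling
  exact ⟨⟨h₁₂, h₂₃.trans h₃₁⟩, ⟨h₂₃, h₃₁.trans h₁₂⟩, ⟨h₁₂.trans h₂₃, h₃₁⟩⟩
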